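/- **Definitions.** A permutation $\pi$ is a *pattern* of $\sigma$ if some subsequence of $\sigma$ is order isomorphic to $\pi$; $Av(B)$ is the set of permutations that have no pattern in $B$. A permutation of length $n$ is *simple* if it maps no interval onto an interval, except single points and the whole of $\{1,\dots,n\}$; $Av(B)$ is *wreath-closed* if its basis $B$ consists of simple permutations. A *pin sequence* is a sequence of points of $\mathbb Z^2$, no two in one row or column, in which each point $p_i$ after the first lies outside the bounding box of its predecessors and either separates $p_{i-1}$ from the earlier points by the vertical or horizontal line through $p_i$, or does not separate its predecessors into two nonempty sets. A *proper pin-permutation* is a permutation whose diagram is order isomorphic to a pin sequence in which every point from the third on separates its predecessor from all the points before that. If $(p_0,\dots,p_n)$ is a pin sequence such that $(p_1,\dots,p_n)$ is order isomorphic to the diagram of $\pi$, then $\pi$ is encoded by the *pin word* $w_1\cdots w_n$, where $w_i$ is $U$, $D$, $L$ or $R$ if $i\ge 2$ and $p_i$ separates $p_{i-1}$ from $\{p_0,\dots,p_{i-2}\}$, lying above, below, to the left or to the right of them all, and $w_i$ is $1$, $2$, $3$ or $4$ if $p_i$ lies in the up-right, up-left, bottom-left or bottom-right corner of the bounding box of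 $\{p_0,\dots,p_{i-1}\}$. For a numeral $q$ let $h_q\in\{L,R\}$ and $v_q\in\{U,D\}$ be the directions of that corner ($h_1=h_4=R$, $h_2=h_3=L$, $v_1=v_2=U$, $v_3=v_4=D$). For a word $s$ over $\{U,D,L,R\}$ put $\phi(qs)=\{h_qv_qs\}$ if $s$ begins with $L$ or $R$, $\phi(qs)=\{v_qh_qs\}$ if $s$ begins with $U$ or $D$, and $\phi(q)=\{h_qv_q,\,v_qh_q\}$. Let $M$ be the set of words of length at least $3$ over $\{U,D,L,R\}$ in which letters from $\{L,R\}$ and letters from $\{U,D\}$ alternate. Let $E(\pi)$ consist of the elements of $\phi(qs)$ for all pin words $qs$ of $\pi$ with $q$ a numeral and $s$ a nonempty word of directions, and of the words $xy\in M$ with $|x|=2$ and $y\in\phi(q's)$ for all pin words $qq's$ of $\pi$ with $q,q'$ numerals and $s$ a (possibly empty) word of directions. Let $$F(B)=\bigcup_{\pi\in B}E(\pi)\cup\{LL,LR,RR,RL,UU,UD,DD,DU\}.$$ The *Aho–Corasick automaton* of $F$ has as states the empty word (initial) and all prefixes of words of $F$; a state is final if it has a suffix in $F$, and final states are never left; from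 another state $p$ the letter $a$ leads to the longest suffix of $pa$ that is a state. **Statement.** There are a constant $C$ and four programs for a random access machine (registers and arrays of natural numbers; steps are copying, setting a constant, adding or subtracting $1$, reading or writing an array cell, and comparing two registers) such that for every finite list $B$ of simple permutations of length at least $2$, given in one-line notation, running the programs one after the other takes in total at most $C(n+1)$ steps, where $n=\sum_{\pi\in B}|\pi|$, and: 1. after the first program the memory holds a list of exactly the pin words of the permutations in $B$; 2. after the second it holds, up to numbering of the states, the complete deterministic Aho–Corasick automaton $\mathcal A$ of $F(B)$, and $\mathcal A$ recognizes the language of the words over $\{U,D,L,R\}$ that have a factor in $F(B)$; 3. after the third it holds the complement $\mathcal A^c$ (final and non-final states exchanged); 4. the last program outputs $1$ if and only if $\mathcal A^c$ contains no cycle that is accessible from the initial state and from which a final state can be reached. The output is $1$ if the wreath-closed class $Av(B)$ contains only finitely many proper pin-permutations, and $0$ if it contains infinitely many. -/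

import Mathlib

namespace PinPerm

/-! ### Permutations, patterns, classes -/

/-- A permutation of some length `n` (rows and columns are numbered from `0`). -/
abbrev Permutation := Σ n : ℕ, Equiv.Perm (Fin n)

/-- The length `|σ|`. -/
def Permutation.size (σ : Permutation) : ℕ := σ.1

/-- `π` is a pattern of `σ`: some subsequence of `σ` is order isomorphic to `π`. -/
def IsPattern (π σ : Permutation) : Prop :=
  ∃ f : Fin π.1 → Fin σ.1, StrictMono f ∧
    ∀ i j, π.2 i < π.2 j ↔ σ.2 (f i) < σ.2 (f j)

/-- `Av B`, the class of the permutations that avoid every element of `B`. -/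
def Av (B : Set Permutation) : Set Permutation := {σ | ∀ π ∈ B, ¬ IsPattern π σ}

/-- `σ` is simple: every block, that is every interval `{i, …, i + l}` of positions mapped onto an
interval `{j, …, j + l}` of values, is a single point or everything. -/
def IsSimplePerm (σ : Permutation) : Prop :=
  ∀ i j l : ℕ, i + l < σ.1 → j + l < σ.1 →
    (∀ k : Fin σ.1, (i ≤ k ∧ (k : ℕ) ≤ i + l) ↔ (j ≤ σ.2 k ∧ (σ.2 k : ℕ) ≤ j + l)) →
    l = 0 ∨ (i = 0 ∧ j = 0 ∧ l + 1 = σ.1)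

/-! ### Pins and pin sequences -/

/-- A pin: a point of the plane with integer coordinates. -/
abbrev Pin := ℤ × ℤ

/-- The vertical line through `p` separates `P` from `Q`. -/
def SeparatesVert (p : Pin) (P Q : Set Pin) : Prop :=
  ((∀ a ∈ P, a.1 < p.1) ∧ (∀ b ∈ Q, p.1 < b.1)) ∨
  ((∀ a ∈ P, p.1 < a.1) ∧ (∀ b ∈ Q, b.1 < p.1))

/-- The horizontal line through `p` separates `P` from `Q`. -/
def SeparatesHoriz (p : Pin) (P Q : Set Pin) : Prop :=
  ((∀ a ∈ P, a.2 < p.2) ∧ (∀ b ∈ Q, p.2 < b.2)) ∨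
  ((∀ a ∈ P, p.2 < a.2) ∧ (∀ b ∈ Q, b.2 < p.2))

/-- `p` separates `P` from `Q`, horizontally or vertically. -/
def Separates (p : Pin) (P Q : Set Pin) : Prop := SeparatesVert p P Q ∨ SeparatesHoriz p P Q

/-- `p` is independent from `S`: it does not separate `S` into two nonempty sets. -/
def IsIndependent (p : Pin) (S : Set Pin) : Prop :=
  ¬ ∃ P Q : Set Pin, P.Nonempty ∧ Q.Nonempty ∧ P ∪ Q = S ∧ Separates p P Q

/-- `p` lies above all points of `S`. -/
def Above (p : Pin) (S : Set Pin) : Prop := ∀ q ∈ S, q.2 < p.2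

/-- `p` lies below all points of `S`. -/
def Below (p : Pin) (S : Set Pin) : Prop := ∀ q ∈ S, p.2 < q.2

/-- `p` lies to the left of all points of `S`. -/
def LeftOf (p : Pin) (S : Set Pin) : Prop := ∀ q ∈ S, p.1 < q.1

/-- `p` lies to the right of all points of `S`. -/
def RightOf (p : Pin) (S : Set Pin) : Prop := ∀ q ∈ S, q.1 < p.1

/-- `p` (in no row or column of a point of `S`) lies outside the bounding box of `S`. -/
def OutsideBox (p : Pin) (S : Set Pin) : Prop :=
  Above p S ∨ Below p S ∨ LeftOf p S ∨ RightOf p S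

/-- The first `i` pins of a sequence. -/
def firstPins (p : ℕ → Pin) (i : ℕ) : Set Pin := p '' {k | k < i}

/-- `(p 0, …, p (m - 1))` is a pin sequence; only these `m` values of `p` matter. -/
def IsPinSeq (m : ℕ) (p : ℕ → Pin) : Prop :=
  (∀ i < m, ∀ j < m, i ≠ j → (p i).1 ≠ (p j).1 ∧ (p i).2 ≠ (p j).2) ∧
  ∀ i, i + 1 < m → OutsideBox (p (i + 1)) (firstPins p (i + 1)) ∧
    (Separates (p (i + 1)) {p i} (firstPins p i) ∨
      IsIndependent (p (i + 1)) (firstPins p (i + 1)))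

/-- Every pin from the third on separates its predecessor from the pins before that. -/
def IsProperSeq (m : ℕ) (p : ℕ → Pin) : Prop :=
  ∀ i, 1 ≤ i → i + 1 < m → Separates (p (i + 1)) {p i} (firstPins p i)

/-- `{p 0, …, p (|σ| - 1)}` is order isomorphic to the diagram of `σ`; the pin `p a` is sent to the
point of the diagram in column `e a`. -/
def Represents (p : ℕ → Pin) (σ : Permutation) : Prop :=
  ∃ e : Fin σ.1 ≃ Fin σ.1, ∀ a b : Fin σ.1,
    ((p a).1 < (p b).1 ↔ e a < e b) ∧ ((p a).2 < (p b).2 ↔ σ.2 (e a) < σ.2 (e b))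

/-- `σ` is a proper pin-permutation: it has a proper pin representation. -/
def IsProperPinPerm (σ : Permutation) : Prop :=
  ∃ p : ℕ → Pin, IsPinSeq σ.1 p ∧ IsProperSeq σ.1 p ∧ Represents p σ

/-! ### Pin words -/

/-- Directions: up, down, left, right. -/
inductive Dir
  | U | D | L | R
  deriving DecidableEq

/-- The quadrants `1` (up-right), `2` (up-left), `3` (bottom-left), `4` (bottom-right). -/
inductive Quad
  | one | two | three | four
  deriving DecidableEq

/-- The alphabet of pin words: numerals and directions. -/
inductive Letter
  | num (q : Quad)
  | dir (d : Dir)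
  deriving DecidableEq

/-- Is the direction left or right? -/
def Dir.isHoriz : Dir → Bool
  | .U => false
  | .D => false
  | .L => true
  | .R => true

/-- `x` lies in the corner with numeral `q` of the bounding box of `S` (so that it is independent
from `S`). -/
def InQuadrant (x : Pin) (S : Set Pin) : Quad → Prop
  | .one => RightOf x S ∧ Above x S
  | .two => LeftOf x S ∧ Above x S
  | .three => LeftOf x S ∧ Below x S
  | .four => RightOf x S ∧ Below x S

/-- `x`, lying outside the bounding box of `insert y S` on the side `d`, separates `y` from `S`. -/
def SeparatesFrom (x y : Pin) (S : Set Pin) : Dir → Prop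
  | .U => Above x (insert y S) ∧ SeparatesVert x {y} S
  | .D => Below x (insert y S) ∧ SeparatesVert x {y} S
  | .L => LeftOf x (insert y S) ∧ SeparatesHoriz x {y} S
  | .R => RightOf x (insert y S) ∧ SeparatesHoriz x {y} S

/-- The letter encodes the pin `p (i + 1)` of the pin sequence with origin `p 0`. A direction is
possible only when `{p 0, …, p (i - 1)}` is not empty. -/
def CodesPin (p : ℕ → Pin) (i : ℕ) : Letter → Prop
  | .num q => InQuadrant (p (i + 1)) (firstPins p (i + 1)) q
  | .dir d => 1 ≤ i ∧ SeparatesFrom (p (i + 1)) (p i) (firstPins p i) d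

/-- The set of the pin words that encode `π`: the encodings of the pin representations
`(p 1, …, p n)` of `π` with all possible origins `p 0`. (Dropping the origin of a pin sequence
always leaves a pin sequence.) -/
def pinWords (π : Permutation) : Set (List Letter) :=
  {w | w.length = π.1 ∧ ∃ p : ℕ → Pin, IsPinSeq (π.1 + 1) p ∧
    Represents (fun i => p (i + 1)) π ∧ ∀ (i : ℕ) (h : i < w.length), CodesPin p i w[i]}

/-! ### The forbidden factors -/

/-- The horizontal direction of a quadrant. -/
def Quad.h : Quad → Dir
  | .one => .R
  | .two => .L
  | .three => .L
  | .four => .R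

/-- The vertical direction of a quadrant. -/
def Quad.v : Quad → Dir
  | .one => .U
  | .two => .U
  | .three => .D
  | .four => .D

/-- The map `φ`, on the word that consists of the numeral `q` followed by the directions `ds`. It
replaces the numeral by the two directions of its quadrant, in the order that makes the result
alternate (`1R ↦ RUR`, `1U ↦ URU`, `3L ↦ LDL`, …). On a numeral alone it has two values. -/
def phi (q : Quad) : List Dir → Set (List Dir)
  | [] => {[q.h, q.v], [q.v, q.h]}
  | d :: ds => {if d.isHoriz then q.h :: q.v :: d :: ds else q.v :: q.h :: d :: ds}

/-- The set `M` of the words of length at least `3` over `{U, D, L, R}` in which horizontal and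
vertical directions alternate. -/
def altWords : Set (List Dir) :=
  {v | 3 ≤ v.length ∧ v.IsChain (fun a b => a.isHoriz ≠ b.isHoriz)}

/-- The word with first letter the numeral `q`, followed by the directions `ds`; it is a strict pin
word if `ds` is not empty. -/
def strictWord (q : Quad) (ds : List Dir) : List Letter := .num q :: ds.map .dir

/-- The quasi-strict word with first letters the numerals `q` and `q'`, followed by `ds`. -/
def quasiStrictWord (q q' : Quad) (ds : List Dir) : List Letter := .num q :: strictWord q' ds

/-- The set `E(π)`: the words `φ(u)` for the strict pin words `u` of `π`, and the words `x φ(u')`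
in `M` with `|x| = 2` for the quasi-strict pin words `u` of `π`, where `u'` is `u` without its first
letter. -/
def factorsOf (π : Permutation) : Set (List Dir) :=
  {v | ∃ q ds, ds ≠ [] ∧ strictWord q ds ∈ pinWords π ∧ v ∈ phi q ds} ∪
  {v | v ∈ altWords ∧ ∃ q q' ds x y, quasiStrictWord q q' ds ∈ pinWords π ∧
    x.length = 2 ∧ y ∈ phi q' ds ∧ v = x ++ y}

/-- All forbidden factors for the basis `B`: the sets `E(π)` for `π ∈ B`, and the eight words
`LL, LR, RR, RL, UU, UD, DD, DU`. -/
def forbidden (B : Set Permutation) : Set (List Dir) :=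
  (⋃ π ∈ B, factorsOf π) ∪ {v | ∃ a b : Dir, a.isHoriz = b.isHoriz ∧ v = [a, b]}

/-- The language of the words that have a factor in `F`. -/
def factorLanguage {α : Type*} (F : Set (List α)) : Language α := {w | ∃ f ∈ F, f <:+: w}

/-! ### Automata -/

/-- The states of the Aho–Corasick automaton of `F`: the empty word and all prefixes of words
of `F`. -/
abbrev ACState {α : Type*} (F : Set (List α)) : Type _ := {p : List α // p = [] ∨ ∃ f ∈ F, p <+: f}

open Classical in
/-- The longest suffix of a word that is a state. -/
noncomputable def longestState {α : Type*} (F : Set (List α)) : List α → ACState F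
  | [] => ⟨[], Or.inl rfl⟩
  | a :: l => if h : a :: l = [] ∨ ∃ f ∈ F, a :: l <+: f then ⟨a :: l, h⟩ else longestState F l

open Classical in
/-- The complete deterministic Aho–Corasick automaton of `F`, for the language of the words with a
factor in `F`: the final states are those that have a suffix in `F`, and they are never left; from
any other state `p`, the letter `a` leads to the longest suffix of `p a` that is a state. -/
noncomputable def ahoCorasick {α : Type*} (F : Set (List α)) : DFA α (ACState F) where
  step p a := if ∃ f ∈ F, f <:+ p.1 then p else longestState F (p.1 ++ [a])
  start := ⟨[], Or.inl rfl⟩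
  accept := {p | ∃ f ∈ F, f <:+ p.1}

/-- The automaton contains a cycle (through `q`, with nonempty label `w`) that is accessible from
the initial state and co-accessible, that is, from which a final state can be reached. -/
def HasUsefulCycle {α σ : Type*} (A : DFA α σ) : Prop :=
  ∃ (q : σ) (u w v : List α), A.eval u = q ∧ w ≠ [] ∧ A.evalFrom q w = q ∧
    A.evalFrom q v ∈ A.accept

/-! ### Machine model

Programs for a random access machine with registers and arrays of natural numbers. The only
arithmetic is adding and subtracting one, so a run of `t` steps adds at most `t` to the largest
number in memory: in linear time, all numbers are linear in the input size and have
logarithmically many bits. -/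

/-- The memory: registers `reg r`, and arrays with cells `arr k i`. -/
@[ext] structure Memory where
  reg : ℕ → ℕ
  arr : ℕ → ℕ → ℕ

/-- Write `x` into register `r`. -/
def Memory.setReg (s : Memory) (r x : ℕ) : Memory := { s with reg := Function.update s.reg r x }

/-- Write `x` into the cell `i` of array `k`. -/
def Memory.setArr (s : Memory) (k i x : ℕ) : Memory :=
  { s with arr := Function.update s.arr k (Function.update (s.arr k) i x) }

/-- Comparisons of two registers. -/
inductive Test
  | lt (r r' : ℕ)
  | eq (r r' : ℕ)

/-- The outcome of a comparison. -/
def Test.Holds : Test → Memory → Prop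
  | .lt r r', s => s.reg r < s.reg r'
  | .eq r r', s => s.reg r = s.reg r'

/-- Programs. The names of registers and arrays are fixed in the program text; only cells of arrays
are addressed indirectly. -/
inductive Program
  /-- `reg r := c` -/
  | const (r c : ℕ)
  /-- `reg r := reg r'` -/
  | copy (r r' : ℕ)
  /-- `reg r := reg r + 1` -/
  | inc (r : ℕ)
  /-- `reg r := reg r - 1`, where `0 - 1 = 0` -/
  | dec (r : ℕ)
  /-- `reg r := arr k (reg i)` -/
  | load (r k i : ℕ)
  /-- `arr k (reg i) := reg r` -/
  | store (k i r : ℕ)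
  /-- first `a`, then `b` -/
  | seq (a b : Program)
  /-- if `c` then `a` else `b` -/
  | ite (c : Test) (a b : Program)
  /-- while `c` do `a` -/
  | loop (c : Test) (a : Program)

/-- `Exec a s t s'`: started in memory `s`, the program `a` halts after exactly `t` steps with
memory `s'`. Every elementary instruction and every evaluation of a test is one step. -/
inductive Exec : Program → Memory → ℕ → Memory → Prop
  | const (r c : ℕ) (s : Memory) : Exec (.const r c) s 1 (s.setReg r c)
  | copy (r r' : ℕ) (s : Memory) : Exec (.copy r r') s 1 (s.setReg r (s.reg r'))
  | inc (r : ℕ) (s : Memory) : Exec (.inc r) s 1 (s.setReg r (s.reg r + 1))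
  | dec (r : ℕ) (s : Memory) : Exec (.dec r) s 1 (s.setReg r (s.reg r - 1))
  | load (r k i : ℕ) (s : Memory) : Exec (.load r k i) s 1 (s.setReg r (s.arr k (s.reg i)))
  | store (k i r : ℕ) (s : Memory) : Exec (.store k i r) s 1 (s.setArr k (s.reg i) (s.reg r))
  | seq {a b : Program} {s s' s'' : Memory} {t t' : ℕ} :
      Exec a s t s' → Exec b s' t' s'' → Exec (.seq a b) s (t + t') s''
  | iteTrue {c : Test} {a b : Program} {s s' : Memory} {t : ℕ} :
      c.Holds s → Exec a s t s' → Exec (.ite c a b) s (t + 1) s'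
  | iteFalse {c : Test} {a b : Program} {s s' : Memory} {t : ℕ} :
      ¬ c.Holds s → Exec b s t s' → Exec (.ite c a b) s (t + 1) s'
  | loopDone {c : Test} {a : Program} {s : Memory} :
      ¬ c.Holds s → Exec (.loop c a) s 1 s
  | loopStep {c : Test} {a : Program} {s s' s'' : Memory} {t t' : ℕ} :
      c.Holds s → Exec a s t s' → Exec (.loop c a) s' t' s'' →
      Exec (.loop c a) s (t + t' + 1) s''

/-- Runs are unique: programs are deterministic. -/
theorem Exec.unique {a : Program} {s s₁ s₂ : Memory} {t₁ t₂ : ℕ}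
    (h₁ : Exec a s t₁ s₁) (h₂ : Exec a s t₂ s₂) : t₁ = t₂ ∧ s₁ = s₂ := by
  induction h₁ generalizing t₂ s₂ with
  | seq _ _ i j =>
    cases h₂ with
    | seq x y => obtain ⟨rfl, rfl⟩ := i x; obtain ⟨rfl, rfl⟩ := j y; simp
  | iteTrue c _ i =>
    cases h₂ with
    | iteTrue _ x => obtain ⟨rfl, rfl⟩ := i x; simp
    | iteFalse d _ => exact absurd c d
  | iteFalse c _ i =>
    cases h₂ with
    | iteFalse _ x => obtain ⟨rfl, rfl⟩ := i x; simp
    | iteTrue d _ => exact absurd d c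
  | loopDone c =>
    cases h₂ with
    | loopDone => simp
    | loopStep d => exact absurd d c
  | loopStep c _ _ i j =>
    cases h₂ with
    | loopDone d => exact absurd c d
    | loopStep _ x y => obtain ⟨rfl, rfl⟩ := i x; obtain ⟨rfl, rfl⟩ := j y; simp
  | _ => cases h₂; simp

/-! ### Memory layout -/

/-- A list of words over `ℕ` as one sequence: every word is preceded by its length. -/
def flatCode (ws : List (List ℕ)) : List ℕ := ws.flatMap fun w => w.length :: w

/-- Register `k` holds the number of words, and array `k` begins with the words. -/
def HoldsWords (s : Memory) (k : ℕ) (ws : List (List ℕ)) : Prop :=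
  s.reg k = ws.length ∧ ∀ (i : ℕ) (h : i < (flatCode ws).length), s.arr k i = (flatCode ws)[i]

/-- The values `σ₁ σ₂ … σₙ` of a permutation, as numbers from `1` to `n`. -/
def Permutation.oneLine (σ : Permutation) : List ℕ := List.ofFn fun i => (σ.2 i : ℕ) + 1

/-- The initial memory for a list of permutations: register `0` and array `0` hold the one-line
notations, and everything else is `0`. -/
def inputMemory (B : List Permutation) : Memory where
  reg r := if r = 0 then B.length else 0
  arr k i := if k = 0 then (flatCode (B.map Permutation.oneLine)).getD i 0 else 0

/-- The number of a direction. -/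
def Dir.code : Dir → ℕ
  | .U => 0
  | .D => 1
  | .L => 2
  | .R => 3

/-- The number of a letter. -/
def Letter.code : Letter → ℕ
  | .num .one => 1
  | .num .two => 2
  | .num .three => 3
  | .num .four => 4
  | .dir d => 5 + d.code

/-- The memory holds the automaton `A` with states `0, …, N - 1`: register `2` holds `N`, register
`3` the initial state, the arrays `2, …, 5` the transitions by the four directions, and array `6`
says which states are final. -/
def HoldsAutomaton (s : Memory) {N : ℕ} (A : DFA Dir (Fin N)) : Prop :=
  s.reg 2 = N ∧ s.reg 3 = A.start ∧
  (∀ (q : Fin N) (d : Dir), s.arr (2 + d.code) q = A.step q d) ∧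
  ∀ q : Fin N, (q ∈ A.accept → s.arr 6 q = 1) ∧ (q ∉ A.accept → s.arr 6 q = 0)

end PinPerm

open PinPerm

set_option linter.unusedSimpArgs false

namespace PinPerm

/-! ### Directed coordinates -/

/-! Geometry is translated into words. An alternating word `v` of `n + 1` directions describes an
origin and `n` pins: relative to the origin and all pins except its predecessor, the pin number `i +
1` lies in the quadrant between the letters number `i` and `i + 1` (`quadrant_of_coded`). Every
alternating word of length at least two has such pins (`coded_wordPins`), the word determines their
order type (`Coded.order_iff`), and every proper pin-permutation of length at least two arises in
this way from a suitable origin (`IsProperPinPerm.exists_word`).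

Patterns become factors. If some of the pins are selected, a pin kept together with its predecessor
is still coded by its direction, and a pin kept without it is coded by the numeral of its quadrant
(`coded_subPins`). The pin word of a simple permutation has no numeral after the second letter,
because the pins before such a numeral would form a block (`Coded.isDir_of_simple`). So a simple
pattern occupies consecutive pins, except that its first pin may be detached from the others. The
two cases are the strict and the quasi-strict pin words; in the second one the place of the detached
pin is irrelevant, which explains the two free letters `x`. Therefore the permutation of `v` lies in
the class if and only if `v` has no forbidden factor (`mem_Av_iff`). The eight words of two parallel
directions exclude the words that do not alternate, and finiteness of the set of proper
pin-permutations becomes boundedness of the lengths of words without forbidden factors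
(`finite_properPin_iff`).

As long as no final state has been met, the state of the Aho–Corasick automaton is the longest
suffix of the input that is a state (`ahoCorasick_evalFrom`); this gives the language. By pumping,
the complement accepts arbitrarily long words if and only if it has a useful cycle. A cycle is
useful exactly if it avoids the final states of the automaton: these are never left, and a state on
a cycle outside of them is accessible by its own name (`ahoCorasick_eval_of_cycle`). Hence the last
program only has to test a subgraph for cycles.

Linear time rests on reading pin representations backwards. The direction of the last pin fixes this
pin as an extreme point. The line through a removed pin isolates its predecessor, which must
therefore be the extreme point next to that line. So four linear runs of the procedure `back` find
all proper representations (`back_complete`, `back_sound`). Each successful run yields twelve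
choices of the first two letters, so that a permutation has at most 48 pin words. The forbidden
factors of a pin word arise by putting one of at most 32 words of at most four letters in place of
its first two letters, so that the trie has linear size. Failure links are found by breadth first
search, and cycles by repeatedly removing states without predecessors. Loops of varying cost are
paid from a potential that counts the unread cells of the input. -/

/-- The coordinate that grows in the direction `d`. -/
def Dir.coord : Dir → Pin → ℤ
  | .U, x => x.2
  | .D, x => -x.2
  | .L, x => -x.1
  | .R, x => x.1

/-- The opposite direction. -/
def Dir.opp : Dir → Dir
  | .U => .D
  | .D => .U
  | .L => .R
  | .R => .L

@[simp] theorem Dir.isHoriz_opp (d : Dir) : d.opp.isHoriz = d.isHoriz := by cases d <;> rfl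

@[simp] theorem Dir.coord_opp (d : Dir) (x : Pin) : d.opp.coord x = -d.coord x := by
  cases d <;> simp [opp, coord]

theorem Dir.eq_or_eq_opp {d e : Dir} (h : d.isHoriz = e.isHoriz) : d = e ∨ d = e.opp := by
  cases d <;> cases e <;> simp_all [isHoriz, opp]

@[simp] theorem Quad.isHoriz_h (q : Quad) : q.h.isHoriz = true := by cases q <;> rfl

@[simp] theorem Quad.isHoriz_v (q : Quad) : q.v.isHoriz = false := by cases q <;> rfl

/-- The side of the quadrant along the axis of `d`. -/
def Quad.side (q : Quad) (d : Dir) : Dir := if d.isHoriz then q.h else q.v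

@[simp] theorem Quad.isHoriz_side (q : Quad) (d : Dir) : (q.side d).isHoriz = d.isHoriz := by
  cases q <;> cases d <;> rfl

theorem Quad.side_congr (q : Quad) {d e : Dir} (h : d.isHoriz = e.isHoriz) :
    q.side d = q.side e := by
  unfold Quad.side; rw [h]

/-- The quadrant between two perpendicular directions. -/
def quadOf : Dir → Dir → Quad
  | .R, .U => .one
  | .U, .R => .one
  | .L, .U => .two
  | .U, .L => .two
  | .L, .D => .three
  | .D, .L => .three
  | .R, .D => .four
  | .D, .R => .four
  -- An arbitrary value for parallel directions; the lemmas about the sides of `quadOf` assume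
  -- perpendicular ones.
  | _, _ => .one

theorem quadOf_side_left {d e : Dir} (h : d.isHoriz ≠ e.isHoriz) : (quadOf d e).side d = d := by
  cases d <;> cases e <;> simp_all [Dir.isHoriz, quadOf, Quad.side, Quad.h, Quad.v]

theorem quadOf_side_right {d e : Dir} (h : d.isHoriz ≠ e.isHoriz) : (quadOf d e).side e = e := by
  cases d <;> cases e <;> simp_all [Dir.isHoriz, quadOf, Quad.side, Quad.h, Quad.v]

theorem inQuadrant_iff {x : Pin} {S : Set Pin} {q : Quad} :
    InQuadrant x S q ↔ (∀ b ∈ S, q.h.coord b < q.h.coord x) ∧ ∀ b ∈ S, q.v.coord b < q.v.coord x := by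
  cases q <;>
    simp [InQuadrant, RightOf, LeftOf, Above, Below, Quad.h, Quad.v, Dir.coord]

/-- Since `q.side d` depends only on the axis of `d`, quantifying over all `d` treats both axes
uniformly and spares the split into four quadrants. -/
theorem inQuadrant_iff_side {x : Pin} {S : Set Pin} {q : Quad} :
    InQuadrant x S q ↔ ∀ d, ∀ b ∈ S, (q.side d).coord b < (q.side d).coord x := by
  rw [inQuadrant_iff]
  refine ⟨fun h d => ?_, fun h => ⟨h .L, h .U⟩⟩
  cases d <;> simp only [Quad.side, Dir.isHoriz, if_true, Bool.false_eq_true, if_false]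
  exacts [h.2, h.2, h.1, h.1]

/-- `e` points from `S` towards `y` across the axis of `d`: the new point is beyond `S` but short of
`y`. With signs absorbed into `e` and `d`, all cases become one formula. -/
theorem separatesFrom_iff {x y : Pin} {S : Set Pin} {d : Dir} :
    SeparatesFrom x y S d ↔ ∃ e : Dir, e.isHoriz ≠ d.isHoriz ∧
      (∀ b ∈ S, d.coord b < d.coord x) ∧ d.coord y < d.coord x ∧
      e.coord x < e.coord y ∧ ∀ b ∈ S, e.coord b < e.coord x := by
  have key : ∀ P : Dir → Prop, (∃ e, P e) ↔ P .U ∨ P .D ∨ P .L ∨ P .R := by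
    intro P
    constructor
    · rintro ⟨e, h⟩; cases e <;> simp [h]
    · rintro (h | h | h | h) <;> exact ⟨_, h⟩
  rw [key]
  cases d <;>
    simp [SeparatesFrom, SeparatesVert, SeparatesHoriz, LeftOf, RightOf, Above, Below, Dir.coord,
      Dir.isHoriz] <;> tauto

theorem forall_firstPins {p : ℕ → Pin} {i : ℕ} {P : Pin → Prop} :
    (∀ x ∈ firstPins p i, P x) ↔ ∀ j < i, P (p j) := by
  simp [firstPins]

theorem codesPin_num {p : ℕ → Pin} {i : ℕ} {q : Quad} :
    CodesPin p i (.num q) ↔ ∀ d, ∀ j ≤ i, (q.side d).coord (p j) < (q.side d).coord (p (i + 1)) := by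
  simp only [CodesPin, inQuadrant_iff_side, forall_firstPins, Nat.lt_succ_iff]

theorem codesPin_dir {p : ℕ → Pin} {i : ℕ} {d : Dir} :
    CodesPin p i (.dir d) ↔ 1 ≤ i ∧ ∃ e : Dir, e.isHoriz ≠ d.isHoriz ∧
      (∀ j ≤ i, d.coord (p j) < d.coord (p (i + 1))) ∧
      e.coord (p (i + 1)) < e.coord (p i) ∧ ∀ j < i, e.coord (p j) < e.coord (p (i + 1)) := by
  simp only [CodesPin, separatesFrom_iff, forall_firstPins]
  refine and_congr_right fun _ => exists_congr fun e => and_congr_right fun _ => ?_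
  rw [← and_assoc]
  refine and_congr_left fun _ => ⟨fun h j hj => ?_, fun h => ⟨fun j hj => h j hj.le, h i le_rfl⟩⟩
  rcases hj.lt_or_eq with hj | rfl
  exacts [h.1 j hj, h.2]

/-- All letters of the word encode the pins of the sequence. -/
def Coded (p : ℕ → Pin) (w : List Letter) : Prop := ∀ (i : ℕ) (h : i < w.length), CodesPin p i w[i]

theorem Dir.coord_ne_iff {d : Dir} {x y : Pin} :
    d.coord x ≠ d.coord y ↔ if d.isHoriz then x.1 ≠ y.1 else x.2 ≠ y.2 := by
  cases d <;> simp [coord, isHoriz]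

theorem ne_of_coord {d e : Dir} (hde : d.isHoriz ≠ e.isHoriz) {x y : Pin}
    (h₁ : d.coord x ≠ d.coord y) (h₂ : e.coord x ≠ e.coord y) : x.1 ≠ y.1 ∧ x.2 ≠ y.2 := by
  rw [Dir.coord_ne_iff] at h₁ h₂
  cases hd : d.isHoriz <;> cases he : e.isHoriz <;> simp_all

/-- A new pin can cut off nothing but its predecessor `p i`. For a direction `d`, the quadrant is
spanned by `d` and the direction `e` in which the predecessor is cut off. -/
theorem CodesPin.exists_quad {p : ℕ → Pin} {i : ℕ} {l : Letter} (h : CodesPin p i l) :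
    ∃ q : Quad, ∀ d, ∀ j < i, (q.side d).coord (p j) < (q.side d).coord (p (i + 1)) := by
  cases l with
  | num q => exact ⟨q, fun d j hj => codesPin_num.1 h d j hj.le⟩
  | dir d =>
    obtain ⟨_, e, he, h₁, h₂, h₃⟩ := codesPin_dir.1 h
    refine ⟨quadOf e d, fun d' j hj => ?_⟩
    by_cases hd : d'.isHoriz = d.isHoriz
    · have : (quadOf e d).side d' = d := by
        rw [Quad.side_congr _ hd, quadOf_side_right he]
      rw [this]; exact h₁ j hj.le
    · have hd' : d'.isHoriz = e.isHoriz := by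
        revert he hd; cases d'.isHoriz <;> cases e.isHoriz <;> cases d.isHoriz <;> simp
      have : (quadOf e d).side d' = e := by
        rw [Quad.side_congr _ hd', quadOf_side_left he]
      rw [this]; exact h₃ j hj

theorem CodesPin.ne {p : ℕ → Pin} {i : ℕ} {l : Letter} (h : CodesPin p i l) {j : ℕ} (hj : j ≤ i) :
    (p j).1 ≠ (p (i + 1)).1 ∧ (p j).2 ≠ (p (i + 1)).2 := by
  cases l with
  | num q =>
    have := codesPin_num.1 h
    exact ne_of_coord (d := q.h) (e := q.v) (by simp) (this .L j hj).ne (this .U j hj).ne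
  | dir d =>
    obtain ⟨_, e, he, h₁, h₂, h₃⟩ := codesPin_dir.1 h
    refine ne_of_coord he ?_ (h₁ j hj).ne
    rcases hj.lt_or_eq with hj | rfl
    exacts [(h₃ j hj).ne, h₂.ne']

theorem separates_of_coord {x y : Pin} {S : Set Pin} {e : Dir} (h₁ : e.coord x < e.coord y)
    (h₂ : ∀ b ∈ S, e.coord b < e.coord x) : Separates x {y} S := by
  cases e <;> simp_all [Separates, SeparatesVert, SeparatesHoriz, Dir.coord] <;> tauto

theorem Separates.exists_dir {x y : Pin} {S : Set Pin} (h : Separates x {y} S) :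
    ∃ e : Dir, e.coord x < e.coord y ∧ ∀ b ∈ S, e.coord b < e.coord x := by
  simp only [Separates, SeparatesVert, SeparatesHoriz, Set.mem_singleton_iff, forall_eq] at h
  rcases h with (⟨h₁, h₂⟩ | ⟨h₁, h₂⟩) | (⟨h₁, h₂⟩ | ⟨h₁, h₂⟩)
  · exact ⟨.L, by simpa [Dir.coord] using h₁, by simpa [Dir.coord] using h₂⟩
  · exact ⟨.R, by simpa [Dir.coord] using h₁, by simpa [Dir.coord] using h₂⟩
  · exact ⟨.D, by simpa [Dir.coord] using h₁, by simpa [Dir.coord] using h₂⟩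
  · exact ⟨.U, by simpa [Dir.coord] using h₁, by simpa [Dir.coord] using h₂⟩

theorem outsideBox_iff {x : Pin} {S : Set Pin} :
    OutsideBox x S ↔ ∃ d : Dir, ∀ b ∈ S, d.coord b < d.coord x := by
  constructor
  · rintro (h | h | h | h)
    · exact ⟨.U, h⟩
    · exact ⟨.D, fun b hb => neg_lt_neg (h b hb)⟩
    · exact ⟨.L, fun b hb => neg_lt_neg (h b hb)⟩
    · exact ⟨.R, h⟩
  · rintro ⟨d, h⟩
    cases d <;> simp_all [OutsideBox, Above, Below, LeftOf, RightOf, Dir.coord] <;> tauto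

theorem InQuadrant.isIndependent {x : Pin} {S : Set Pin} {q : Quad} (h : InQuadrant x S q) :
    IsIndependent x S := by
  rintro ⟨P, Q, ⟨a, ha⟩, ⟨b, hb⟩, rfl, hs⟩
  have h₁ := fun d => inQuadrant_iff_side.1 h d a (Or.inl ha)
  have h₂ := fun d => inQuadrant_iff_side.1 h d b (Or.inr hb)
  have h₁L := h₁ .L; have h₂L := h₂ .L; have h₁U := h₁ .U; have h₂U := h₂ .U
  rcases hs with (⟨k₁, k₂⟩ | ⟨k₁, k₂⟩) | (⟨k₁, k₂⟩ | ⟨k₁, k₂⟩) <;>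
    have k₁ := k₁ a ha <;> have k₂ := k₂ b hb <;> cases q <;>
    simp [Quad.side, Dir.isHoriz, Quad.h, Quad.v, Dir.coord] at h₁L h₂L h₁U h₂U <;> omega

/-- A coded sequence of points is a pin sequence. -/
theorem Coded.isPinSeq {p : ℕ → Pin} {w : List Letter} (h : Coded p w) :
    IsPinSeq (w.length + 1) p := by
  have key : ∀ i < w.length + 1, ∀ j < i, (p j).1 ≠ (p i).1 ∧ (p j).2 ≠ (p i).2 := by
    intro i hi j hj
    obtain ⟨i, rfl⟩ : ∃ k, i = k + 1 := ⟨i - 1, by omega⟩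
    exact (h i (by omega)).ne (by omega)
  refine ⟨fun i hi j hj hij => ?_, fun i hi => ?_⟩
  · rcases lt_or_gt_of_ne hij with h | h
    · exact key j hj i h
    · exact ⟨(key i hi j h).1.symm, (key i hi j h).2.symm⟩
  · have hc := h i (by omega)
    cases hl : w[i] with
    | num q =>
      rw [hl] at hc
      exact ⟨outsideBox_iff.2 ⟨q.side .L, inQuadrant_iff_side.1 hc .L⟩, Or.inr hc.isIndependent⟩
    | dir d =>
      rw [hl] at hc
      obtain ⟨_, e, he, h₁, h₂, h₃⟩ := codesPin_dir.1 hc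
      exact ⟨outsideBox_iff.2 ⟨d, forall_firstPins.2 fun j hj => h₁ j (by omega)⟩,
        Or.inl (separates_of_coord h₂ (forall_firstPins.2 h₃))⟩

/-- The requirement of a pin sequence may be dropped, because the letters already imply it by
`Coded.isPinSeq`. -/
theorem mem_pinWords {π : Permutation} {w : List Letter} :
    w ∈ pinWords π ↔ w.length = π.1 ∧ ∃ p : ℕ → Pin, Represents (fun i => p (i + 1)) π ∧ Coded p w := by
  constructor
  · rintro ⟨h, p, _, h₁, h₂⟩; exact ⟨h, p, h₁, h₂⟩
  · rintro ⟨h, p, h₁, h₂⟩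
    exact ⟨h, p, h ▸ Coded.isPinSeq h₂, h₁, h₂⟩

end PinPerm
namespace PinPerm

/-! ### Order types of coded sequences -/

theorem side_lt_iff {x y x' y' : Pin} {q : Quad}
    (h : ∀ d, (q.side d).coord x < (q.side d).coord y ∧ (q.side d).coord x' < (q.side d).coord y') :
    ((x.1 < y.1 ↔ x'.1 < y'.1) ∧ (x.2 < y.2 ↔ x'.2 < y'.2)) ∧
    ((y.1 < x.1 ↔ y'.1 < x'.1) ∧ (y.2 < x.2 ↔ y'.2 < x'.2)) := by
  have h₁ := h .L
  have h₂ := h .U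
  cases q <;>
    simp only [Quad.side, Dir.isHoriz, Quad.h, Quad.v, Dir.coord, if_true, Bool.false_eq_true,
      if_false] at h₁ h₂ <;> omega

/-- A quadrant is tested on one direction per axis. -/
theorem quad_of_perp {d e : Dir} (he : e.isHoriz ≠ d.isHoriz) (P : Dir → Prop) (hd : P d)
    (h : P e) : ∀ d', P ((quadOf e d).side d') := by
  intro d'
  by_cases hd' : d'.isHoriz = d.isHoriz
  · rwa [Quad.side_congr _ hd', quadOf_side_right he]
  · have : d'.isHoriz = e.isHoriz := by
      revert he hd'; cases d'.isHoriz <;> cases e.isHoriz <;> cases d.isHoriz <;> simp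
    rwa [Quad.side_congr _ this, quadOf_side_left he]

/-- The direction, perpendicular to its own, in which a separating pin stays behind its predecessor,
is determined by the letter of the predecessor. -/
theorem behind_unique {p : ℕ → Pin} {i : ℕ} {l : Letter} {d e : Dir} (hl : CodesPin p i l)
    (he : e.isHoriz ≠ d.isHoriz) (h₁ : e.coord (p (i + 1 + 1)) < e.coord (p (i + 1)))
    (h₂ : ∀ j < i + 1, e.coord (p j) < e.coord (p (i + 1 + 1))) :
    (∃ q, l = .num q ∧ e = q.side e) ∨ l = .dir e := by
  cases l with
  | num q =>
    refine Or.inl ⟨q, rfl, ?_⟩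
    have h := codesPin_num.1 hl e 0 (Nat.zero_le _)
    -- If `e` pointed away from the quadrant, `p 0` would be beyond `p (i + 1)` along `e`; but `p (i
    -- + 2)` is beyond `p 0` and behind `p (i + 1)`.
    rcases Dir.eq_or_eq_opp (Quad.isHoriz_side q e) with h' | h'
    · exact h'.symm
    · rw [h'] at h; simp only [Dir.coord_opp] at h
      have := h₂ 0 (Nat.succ_pos _)
      omega
  | dir d' =>
    right
    obtain ⟨hi, e', he', h₃, h₄, h₅⟩ := codesPin_dir.1 hl
    have hi' : i - 1 + 1 = i := by omega
    have h0 := h₂ 0 (by omega)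
    have hii := h₂ i (by omega)
    have h30 := h₃ 0 (by omega)
    have h50 := h₅ 0 (by omega)
    by_cases hd : d'.isHoriz = e.isHoriz
    · rcases Dir.eq_or_eq_opp hd with rfl | rfl
      · rfl
      · simp only [Dir.coord_opp] at h30; omega
    -- If `d'` is perpendicular to `e`, pin `i + 1` lies along `e` strictly between pin `i` and the
    -- pins before, so no line has it alone on one side.
    · exfalso
      have hee : e'.isHoriz = e.isHoriz := by
        revert hd he'; cases d'.isHoriz <;> cases e.isHoriz <;> cases e'.isHoriz <;> simp
      rcases Dir.eq_or_eq_opp hee with rfl | rfl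
      · omega
      · simp only [Dir.coord_opp] at h50 h₄; omega

/-- The letter of the later pin gives its quadrant, except that for a direction the side across it
is given by the letter before (`behind_unique`). The first letter only relates pin `1` to the
origin, so it matters for the other pins only if the second letter is a direction; hence the form of
`h₀`. -/
theorem exists_common_quad {p p' : ℕ → Pin} {w w' : List Letter} (h : Coded p w) (h' : Coded p' w')
    (h₁ : ∀ i, 1 ≤ i → w[i]? = w'[i]?) (h₀ : ∀ d, w[1]? = some (.dir d) → w[0]? = w'[0]?)
    {i j : ℕ} (hij : i < j) (hi : 1 ≤ i) (hj : j < w.length + 1) :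
    ∃ q : Quad, ∀ d, (q.side d).coord (p i) < (q.side d).coord (p j) ∧
      (q.side d).coord (p' i) < (q.side d).coord (p' j) := by
  obtain ⟨j, rfl⟩ : ∃ k, j = k + 1 := ⟨j - 1, by omega⟩
  have hjw : j < w.length := by omega
  have hjj := h₁ j (by omega)
  rw [List.getElem?_eq_getElem hjw] at hjj
  obtain ⟨hjw', hjj'⟩ := List.getElem?_eq_some_iff.1 hjj.symm
  have c := h j hjw
  have c' := h' j hjw'
  rw [hjj'] at c'
  cases hl : w[j] with
  | num q =>
    rw [hl] at c c'
    exact ⟨q, fun d => ⟨codesPin_num.1 c d i (by omega), codesPin_num.1 c' d i (by omega)⟩⟩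
  | dir d =>
    rw [hl] at c c'
    obtain ⟨_, e, he, a₁, a₂, a₃⟩ := codesPin_dir.1 c
    obtain ⟨_, e', he', a₁', a₂', a₃'⟩ := codesPin_dir.1 c'
    obtain ⟨j, rfl⟩ : ∃ k, j = k + 1 := ⟨j - 1, by omega⟩
    have hprev : w[j]? = w'[j]? := by
      rcases Nat.eq_zero_or_pos j with rfl | hpos
      · exact h₀ d (by rw [List.getElem?_eq_getElem hjw, hl])
      · exact h₁ j hpos
    rw [List.getElem?_eq_getElem (show j < w.length by omega)] at hprev
    obtain ⟨hjw2, hprev'⟩ := List.getElem?_eq_some_iff.1 hprev.symm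
    have b := behind_unique (h j (by omega)) he a₂ a₃
    have b' := behind_unique (h' j hjw2) he' a₂' a₃'
    have hee : e = e' := by
      rw [hprev'] at b'
      rcases b with ⟨q, hq, hqe⟩ | hq
      · rcases b' with ⟨q', hq', hqe'⟩ | hq'
        · rw [hq] at hq'; cases hq'
          rw [hqe, hqe']; apply Quad.side_congr
          revert he he'; cases d.isHoriz <;> cases e.isHoriz <;> cases e'.isHoriz <;> simp
        · rw [hq] at hq'; cases hq'
      · rcases b' with ⟨q', hq', hqe'⟩ | hq'
        · rw [hq] at hq'; cases hq'
        · rw [hq] at hq'; cases hq'; rfl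
    subst hee
    rcases (show i ≤ j + 1 by omega).lt_or_eq with hlt | rfl
    · exact ⟨quadOf e d, quad_of_perp he (fun d' => d'.coord (p i) < d'.coord (p (j + 1 + 1)) ∧
        d'.coord (p' i) < d'.coord (p' (j + 1 + 1))) ⟨a₁ i (by omega), a₁' i (by omega)⟩
        ⟨a₃ i hlt, a₃' i hlt⟩⟩
    -- The immediate predecessor is passed along `d`, but the new pin stays behind it along `e`.
    · refine ⟨quadOf e.opp d, quad_of_perp (by simpa using he)
        (fun d' => d'.coord (p (j + 1)) < d'.coord (p (j + 1 + 1)) ∧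
        d'.coord (p' (j + 1)) < d'.coord (p' (j + 1 + 1)))
        ⟨a₁ _ le_rfl, a₁' _ le_rfl⟩ ?_⟩
      simp only [Dir.coord_opp]; omega

/-- The order type of a coded sequence is determined by the word. -/
theorem Coded.order_iff {p p' : ℕ → Pin} {w w' : List Letter} (h : Coded p w) (h' : Coded p' w')
    (h₁ : ∀ i, 1 ≤ i → w[i]? = w'[i]?) (h₀ : ∀ d, w[1]? = some (.dir d) → w[0]? = w'[0]?)
    {i j : ℕ} (hi : i < w.length) (hj : j < w.length) :
    ((p (i + 1)).1 < (p (j + 1)).1 ↔ (p' (i + 1)).1 < (p' (j + 1)).1) ∧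
      ((p (i + 1)).2 < (p (j + 1)).2 ↔ (p' (i + 1)).2 < (p' (j + 1)).2) := by
  rcases lt_trichotomy i j with hij | rfl | hij
  · obtain ⟨q, hq⟩ := exists_common_quad h h' h₁ h₀ (i := i + 1) (j := j + 1) (by omega) (by omega)
      (by omega)
    exact (side_lt_iff hq).1
  · simp
  · obtain ⟨q, hq⟩ := exists_common_quad h h' h₁ h₀ (i := j + 1) (j := i + 1) (by omega) (by omega)
      (by omega)
    exact (side_lt_iff hq).2

/-! ### Representations and patterns -/

theorem Represents.isPattern {p p' : ℕ → Pin} {π σ : Permutation} (h : Represents p π)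
    (h' : Represents p' σ) (g : ℕ → ℕ) (hg : ∀ i < π.1, g i < σ.1)
    (ho : ∀ i < π.1, ∀ j < π.1, ((p i).1 < (p j).1 ↔ (p' (g i)).1 < (p' (g j)).1) ∧
      ((p i).2 < (p j).2 ↔ (p' (g i)).2 < (p' (g j)).2)) : IsPattern π σ := by
  obtain ⟨e, he⟩ := h
  obtain ⟨e', he'⟩ := h'
  refine ⟨fun i => e' ⟨g (e.symm i), hg _ (e.symm i).2⟩, fun i j hij => ?_, fun i j => ?_⟩
  · rw [← (he' _ _).1]
    have := (he (e.symm i) (e.symm j)).1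
    simp only [Equiv.apply_symm_apply] at this
    exact (ho _ (e.symm i).2 _ (e.symm j).2).1.1 (this.2 hij)
  · rw [← (he' _ _).2]
    have := (he (e.symm i) (e.symm j)).2
    simp only [Equiv.apply_symm_apply] at this
    rw [← this]
    exact (ho _ (e.symm i).2 _ (e.symm j).2).2

/-- The selected pins are listed in the order of the sequence, not of the columns: `g` has to be
increasing for the subsequence to be coded letter by letter. -/
theorem IsPattern.exists_represents {p : ℕ → Pin} {π σ : Permutation} (h : IsPattern π σ)
    (hp : Represents p σ) : ∃ g : ℕ → ℕ, (∀ i j, i < j → j < π.1 → g i < g j) ∧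
      (∀ i < π.1, g i < σ.1) ∧ Represents (fun i => p (g i)) π := by
  classical
  obtain ⟨f, hf, hf'⟩ := h
  obtain ⟨e, he⟩ := hp
  let I : Finset (Fin σ.1) := Finset.univ.image fun i => e.symm (f i)
  have hI : I.card = π.1 := by
    exact (Finset.card_image_of_injective _ (e.symm.injective.comp hf.injective)).trans (by simp)
  let G := I.orderEmbOfFin hI
  have hG : ∀ j, ∃ a, f a = e (G j) := by
    intro j
    obtain ⟨a, _, ha⟩ := Finset.mem_image.1 (I.orderEmbOfFin_mem hI j)
    exact ⟨a, by rw [← ha, Equiv.apply_symm_apply]⟩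
  choose k hk using hG
  have hkinj : Function.Injective k := fun i j hij => by
    have : e (G i) = e (G j) := by rw [← hk, ← hk, hij]
    exact G.injective (e.injective this)
  refine ⟨fun j => if h : j < π.1 then (G ⟨j, h⟩ : ℕ) else 0, fun i j hij hj => ?_, fun i hi => ?_,
    Equiv.ofBijective k ((Fintype.bijective_iff_injective_and_card k).2 ⟨hkinj, rfl⟩),
    fun a b => ?_⟩
  · simp only [hij.trans hj, hj, dif_pos]
    exact G.strictMono (show (⟨i, hij.trans hj⟩ : Fin π.1) < ⟨j, hj⟩ from hij)
  · simp only [hi, dif_pos]; exact (G _).2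
  · simp only [a.2, b.2, dif_pos, Equiv.ofBijective_apply]
    have := he (G a) (G b)
    rw [← hk, ← hk] at this
    exact ⟨this.1.trans hf.lt_iff_lt, this.2.trans (hf' _ _).symm⟩

theorem exists_represents {n : ℕ} {p : ℕ → Pin}
    (h : ∀ i < n, ∀ j < n, i ≠ j → (p i).1 ≠ (p j).1 ∧ (p i).2 ≠ (p j).2) :
    ∃ σ : Equiv.Perm (Fin n), Represents p ⟨n, σ⟩ := by
  have key : ∀ f : Fin n → ℤ, Function.Injective f → ∃ e : Fin n ≃ Fin n, ∀ a b,
      f a < f b ↔ e a < e b := by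
    intro f hf
    refine ⟨(Tuple.sort f).symm, fun a b => ?_⟩
    have hm : StrictMono (f ∘ Tuple.sort f) :=
      (Tuple.monotone_sort f).strictMono_of_injective (hf.comp (Equiv.injective _))
    rw [← hm.lt_iff_lt]; simp
  obtain ⟨e, he⟩ := key (fun a => (p a).1) fun a b hab => by
    by_contra hne
    exact (h a a.2 b b.2 (fun h => hne (Fin.ext h))).1 hab
  obtain ⟨e', he'⟩ := key (fun a => (p a).2) fun a b hab => by
    by_contra hne
    exact (h a a.2 b b.2 (fun h => hne (Fin.ext h))).2 hab
  exact ⟨e.symm.trans e', e, fun a b => ⟨he a b, by simpa using he' a b⟩⟩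

/-! ### Pin words of simple permutations -/

theorem exists_interval {n : ℕ} (S : Finset (Fin n)) (hS : S.Nonempty)
    (h : ∀ k ∉ S, (∀ a ∈ S, a < k) ∨ ∀ a ∈ S, k < a) :
    ∃ i : ℕ, i + (S.card - 1) < n ∧ ∀ k : Fin n, k ∈ S ↔ i ≤ k ∧ (k : ℕ) ≤ i + (S.card - 1) := by
  have hS' : S = Finset.Icc (S.min' hS) (S.max' hS) := by
    ext k
    rw [Finset.mem_Icc]
    refine ⟨fun hk => ⟨S.min'_le k hk, S.le_max' k hk⟩, fun ⟨h₁, h₂⟩ => ?_⟩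
    by_contra hk
    rcases h k hk with h | h
    · exact (h _ (S.max'_mem hS)).not_ge h₂
    · exact (h _ (S.min'_mem hS)).not_ge h₁
  have hc : S.card = (S.max' hS : ℕ) + 1 - S.min' hS := by
    conv_lhs => rw [hS']
    simp
  have hle : (S.min' hS : ℕ) ≤ S.max' hS := S.min'_le _ (S.max'_mem hS)
  have hlt := (S.max' hS).2
  refine ⟨S.min' hS, by omega, fun k => ?_⟩
  conv_lhs => rw [hS']
  rw [Finset.mem_Icc, Fin.le_def, Fin.le_def]
  omega

/-- A set of pins of a simple permutation that no other pin cuts is trivial. -/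
theorem IsSimplePerm.trivial_of_uncut {p : ℕ → Pin} {π : Permutation} (hs : IsSimplePerm π)
    (hp : Represents p π) {m : ℕ} (hm : 2 ≤ m) (hmn : m ≤ π.1)
    (h : ∀ k, m ≤ k → k < π.1 → ∃ q : Quad, ∀ d, ∀ j < m,
      (q.side d).coord (p j) < (q.side d).coord (p k)) : m = π.1 := by
  classical
  obtain ⟨e, he⟩ := hp
  let I : Finset (Fin π.1) := Finset.univ.filter fun a => (a : ℕ) < m
  have hI : I.card = m := by
    have : I = (Finset.range m).attachFin fun n hn => by
        have := Finset.mem_range.1 hn; omega := by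
      ext a; simp [I]
    rw [this]; simp
  let S := I.map e.toEmbedding
  let S' := S.map π.2.toEmbedding
  have hS : S.card = m := by simp [S, hI]
  have hS' : S'.card = m := by simp [S', hS]
  have hmem : ∀ a, e a ∈ S ↔ (a : ℕ) < m := by intro a; simp [S, I]
  have hmem' : ∀ a, π.2 a ∈ S' ↔ a ∈ S := by intro a; simp [S']
  obtain ⟨i, hi, hi'⟩ := exists_interval S (Finset.card_pos.1 (by omega)) (by
    intro k hk
    obtain ⟨k, rfl⟩ := e.surjective k
    rw [hmem, not_lt] at hk
    obtain ⟨q, hq⟩ := h k hk k.2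
    have hq := hq .L
    cases q <;> simp only [Quad.side, Dir.isHoriz, Quad.h, Dir.coord, if_true, neg_lt_neg_iff] at hq
    case one | four =>
      left; intro a ha; obtain ⟨a, rfl⟩ := e.surjective a
      exact (he a k).1.1 (hq a ((hmem a).1 ha))
    all_goals
      right; intro a ha; obtain ⟨a, rfl⟩ := e.surjective a
      exact (he k a).1.1 (hq a ((hmem a).1 ha)))
  obtain ⟨j, hj, hj'⟩ := exists_interval S' (Finset.card_pos.1 (by omega)) (by
    intro k hk
    obtain ⟨k, rfl⟩ := π.2.surjective k
    obtain ⟨k, rfl⟩ := e.surjective k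
    rw [hmem', hmem, not_lt] at hk
    obtain ⟨q, hq⟩ := h k hk k.2
    have hq := hq .U
    cases q <;> simp only [Quad.side, Dir.isHoriz, Quad.v, Dir.coord, if_false, Bool.false_eq_true,
      neg_lt_neg_iff] at hq
    case one | two =>
      left; intro a ha; obtain ⟨a, rfl⟩ := π.2.surjective a; obtain ⟨a, rfl⟩ := e.surjective a
      exact (he a k).2.1 (hq a ((hmem a).1 ((hmem' _).1 ha)))
    all_goals
      right; intro a ha; obtain ⟨a, rfl⟩ := π.2.surjective a; obtain ⟨a, rfl⟩ := e.surjective a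
      exact (he k a).2.1 (hq a ((hmem a).1 ((hmem' _).1 ha))))
  rw [hS] at hi hi'
  rw [hS'] at hj hj'
  rcases hs i j (m - 1) hi hj (fun k => by rw [← hi', ← hj', hmem']) with h0 | ⟨_, _, h0⟩
  · omega
  · omega

/-- If letter `i` were a numeral, no later pin would cut the first `i` pins: the next one by its
numeral, the others because they cut off at most their predecessors, which are not among the first
`i`. These pins would form a proper block. -/
theorem Coded.isDir_of_simple {p : ℕ → Pin} {w : List Letter} {π : Permutation} (hc : Coded p w)
    (hw : w.length = π.1) (hp : Represents (fun i => p (i + 1)) π) (hs : IsSimplePerm π) {i : ℕ}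
    (hi : 2 ≤ i) (hiw : i < w.length) : ∃ d, w[i] = .dir d := by
  cases hl : w[i] with
  | dir d => exact ⟨d, rfl⟩
  | num q =>
    exfalso
    have := hs.trivial_of_uncut hp hi (by omega) (fun k hik hk => by
      rcases hik.lt_or_eq with h | rfl
      · obtain ⟨q, hq⟩ := (hc k (by omega)).exists_quad
        exact ⟨q, fun d j hj => hq d (j + 1) (by omega)⟩
      · have := hc i hiw
        rw [hl] at this
        exact ⟨q, fun d j hj => codesPin_num.1 this d (j + 1) (by omega)⟩)
    omega

end PinPerm
namespace PinPerm

/-! ### Origins of pin representations -/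

/-- The sequence with origin `O`, followed by the pins of `p` on a finer grid. -/
def withOrigin (O : Pin) (p : ℕ → Pin) : ℕ → Pin
  | 0 => O
  -- Rows and columns become at least four apart, which leaves room for an origin at distance `1`
  -- from the row or column of a pin.
  | i + 1 => (4 * (p i).1, 4 * (p i).2)

theorem coord_withOrigin_succ (d : Dir) (O : Pin) (p : ℕ → Pin) (i : ℕ) :
    d.coord (withOrigin O p (i + 1)) = 4 * d.coord (p i) := by
  cases d <;> simp [withOrigin, Dir.coord]

theorem represents_withOrigin {O : Pin} {p : ℕ → Pin} {σ : Permutation} (h : Represents p σ) :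
    Represents (fun i => withOrigin O p (i + 1)) σ := by
  obtain ⟨e, he⟩ := h
  exact ⟨e, fun a b => by simpa [withOrigin] using he a b⟩

/-- All numerals. -/
def Quad.all : List Quad := [.one, .two, .three, .four]

theorem Quad.mem_all (q : Quad) : q ∈ Quad.all := by cases q <;> simp [Quad.all]

/-- The possible first two letters of a pin word, if the second pin lies in the quadrant `k` of the
first one and the third pin, on the left or right if and only if `b`, separates them. -/
def heads (k : Quad) (b : Bool) : List (Letter × Letter) :=
  Quad.all.map (fun q => (.num q, .num k)) ++
    (Quad.all.filter fun q => if b then q.h = k.h.opp else q.v = k.v.opp).map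
      fun q => (.num q, .dir (if b then k.v else k.h))

theorem mem_heads {k : Quad} {b : Bool} {x : Letter × Letter} :
    x ∈ heads k b ↔ ∃ q, x = (.num q, .num k) ∨ (if b then q.h = k.h.opp else q.v = k.v.opp) ∧
      x = (.num q, .dir (if b then k.v else k.h)) := by
  simp only [heads, List.mem_append, List.mem_map, List.mem_filter, Quad.mem_all, true_and,
    decide_eq_true_eq, exists_or]
  refine or_congr (exists_congr fun q => eq_comm) (exists_congr fun q => and_congr ?_ eq_comm)
  cases b <;> simp

/-- Along each `d` the origin exceeds the pin `p (c d)` by at most `1` on a grid of mesh `4`, so a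
pin that passes `p (c d)` passes the origin too. The third pin stays behind `p 1` across its own
direction and passes only `p 0` there; this forces `c e = 0` in `hs`. -/
theorem coded_withOrigin {p : ℕ → Pin} {O : Pin} {k : Quad} {s : List Dir} {l₁ l₂ : Letter}
    (hp : Coded p (strictWord k s)) (c : Dir → ℕ) (hc : ∀ d, c d ≤ 1)
    (hO : ∀ d : Dir, d.coord O ≤ 4 * d.coord (p (c d)) + 1)
    (hs : ∀ e : Dir, ∀ d ∈ s.head?, e.isHoriz ≠ d.isHoriz → c e = 0)
    (h₁ : CodesPin (withOrigin O p) 0 l₁) (h₂ : CodesPin (withOrigin O p) 1 l₂) :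
    Coded (withOrigin O p) (l₁ :: l₂ :: s.map .dir) := by
  rintro (_ | _ | i) hi
  · exact h₁
  · exact h₂
  · simp only [List.length_cons, List.length_map] at hi
    have hi' : i < s.length := by omega
    have h := hp (i + 1) (by simp [strictWord]; omega)
    simp only [strictWord, List.getElem_cons_succ, List.getElem_map] at h ⊢
    obtain ⟨_, e, he, a₁, a₂, a₃⟩ := codesPin_dir.1 h
    simp only [Nat.add_assoc, Nat.reduceAdd] at a₁ a₂ a₃
    refine codesPin_dir.2 ⟨by omega, e, he, ?_, ?_, ?_⟩
    · rintro (_ | j) hj <;> simp only [coord_withOrigin_succ]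
      · have := hO s[i]; have := a₁ (c s[i]) ((hc _).trans (by omega))
        simp only [withOrigin]; omega
      · have := a₁ j (by omega); omega
    · simp only [coord_withOrigin_succ]; omega
    · rintro (_ | j) hj <;> simp only [coord_withOrigin_succ]
      · have := hO e
        have := a₃ (c e) (by
          rcases Nat.eq_zero_or_pos i with rfl | h0
          · rw [hs e s[0] (by rw [List.head?_eq_getElem?, List.getElem?_eq_getElem hi']; rfl) he]
            omega
          · have := hc e; omega)
        simp only [withOrigin]; omega
      · have := a₃ j (by omega); omega

/-- A pin representation extends to all origins that the first letters may encode. -/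
theorem exists_origin {p : ℕ → Pin} {k : Quad} {b : Bool} {s : List Dir} {l₁ l₂ : Letter}
    (hp : Coded p (strictWord k s)) (hb : ∀ d ∈ s.head?, d.isHoriz = b)
    (h : (l₁, l₂) ∈ heads k b) : ∃ O, Coded (withOrigin O p) (l₁ :: l₂ :: s.map .dir) := by
  have h0 := codesPin_num.1 (hp 0 (by simp [strictWord]))
  rw [zero_add] at h0
  have h0L := h0 .L 0 le_rfl
  have h0U := h0 .U 0 le_rfl
  simp only [Quad.side, Dir.isHoriz, if_true, Bool.false_eq_true, if_false] at h0L h0U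
  obtain ⟨q, h | ⟨hq, h⟩⟩ := mem_heads.1 h
  · simp only [Prod.mk.injEq] at h
    obtain ⟨rfl, rfl⟩ := h
    -- The number `q.h.coord (1, 1)` is the sign of the direction. The origin is placed right before
    -- `p 0` as seen from the quadrant `q`.
    refine ⟨(4 * (p 0).1 - q.h.coord (1, 1), 4 * (p 0).2 - q.v.coord (1, 1)),
      coded_withOrigin hp (fun _ => 0) (by simp) ?_ (by simp) ?_ ?_⟩
    · intro d
      cases d <;> cases q <;> simp [Dir.coord, Quad.h, Quad.v] <;> omega
    · refine codesPin_num.2 fun d j hj => ?_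
      obtain rfl : j = 0 := by omega
      simp only [coord_withOrigin_succ, withOrigin]
      cases d <;> cases q <;> simp [Dir.coord, Quad.h, Quad.v, Quad.side, Dir.isHoriz]
    · refine codesPin_num.2 fun d j hj => ?_
      have h0d := h0 d 0 le_rfl
      obtain rfl | rfl : j = 0 ∨ j = 1 := by omega
      · simp only [coord_withOrigin_succ, withOrigin]
        revert h0d
        cases d <;> cases k <;> cases q <;>
          simp [Dir.coord, Quad.h, Quad.v, Quad.side, Dir.isHoriz] <;> omega
      · simp only [coord_withOrigin_succ]; omega
  · simp only [Prod.mk.injEq] at h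
    obtain ⟨rfl, rfl⟩ := h
    cases b with
    | true =>
      simp only [if_true] at hq ⊢
      -- The origin is placed horizontally just beyond `p 1` and vertically just before `p 0`, so
      -- that the vertical line through `p 1` runs between `p 0` and the origin.
      refine ⟨(4 * (p 1).1 + k.h.coord (1, 1), 4 * (p 0).2 - q.v.coord (1, 1)),
        coded_withOrigin hp (fun d => if d.isHoriz then 1 else 0) ?_ ?_ ?_ ?_ ?_⟩
      · intro d; cases d <;> simp [Dir.isHoriz]
      · intro d
        cases d <;> cases q <;> cases k <;>
          simp [Dir.coord, Quad.h, Quad.v, Dir.isHoriz] <;> omega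
      · intro e d hd; rw [hb d hd]; simp
      · refine codesPin_num.2 fun d j hj => ?_
        obtain rfl : j = 0 := by omega
        simp only [coord_withOrigin_succ, withOrigin]
        revert h0L hq
        cases d <;> cases q <;> cases k <;>
          simp [Dir.coord, Quad.h, Quad.v, Quad.side, Dir.isHoriz, Dir.opp] <;> omega
      · refine codesPin_dir.2 ⟨le_rfl, q.h, by simp, ?_, ?_, ?_⟩
        · intro j hj
          obtain rfl | rfl : j = 0 ∨ j = 1 := by omega
          all_goals
            simp only [coord_withOrigin_succ, withOrigin]
            revert h0U
            cases q <;> cases k <;> simp [Dir.coord, Quad.v] <;> omega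
        · rw [hq]
          simp only [coord_withOrigin_succ, Dir.coord_opp]; omega
        · intro j hj
          obtain rfl : j = 0 := by omega
          simp only [coord_withOrigin_succ, withOrigin]
          rw [hq]
          cases k <;> simp [Dir.coord, Quad.h, Dir.opp]
    | false =>
      simp only [if_false, Bool.false_eq_true] at hq ⊢
      refine ⟨(4 * (p 0).1 - q.h.coord (1, 1), 4 * (p 1).2 + k.v.coord (1, 1)),
        coded_withOrigin hp (fun d => if d.isHoriz then 0 else 1) ?_ ?_ ?_ ?_ ?_⟩
      · intro d; cases d <;> simp [Dir.isHoriz]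
      · intro d
        cases d <;> cases q <;> cases k <;>
          simp [Dir.coord, Quad.h, Quad.v, Dir.isHoriz] <;> omega
      · intro e d hd; rw [hb d hd]; simp
      · refine codesPin_num.2 fun d j hj => ?_
        obtain rfl : j = 0 := by omega
        simp only [coord_withOrigin_succ, withOrigin]
        revert h0U hq
        cases d <;> cases q <;> cases k <;>
          simp [Dir.coord, Quad.h, Quad.v, Quad.side, Dir.isHoriz, Dir.opp] <;> omega
      · refine codesPin_dir.2 ⟨le_rfl, q.v, by simp, ?_, ?_, ?_⟩
        · intro j hj
          obtain rfl | rfl : j = 0 ∨ j = 1 := by omega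
          all_goals
            simp only [coord_withOrigin_succ, withOrigin]
            revert h0L
            cases q <;> cases k <;> simp [Dir.coord, Quad.h] <;> omega
        · rw [hq]
          simp only [coord_withOrigin_succ, Dir.coord_opp]; omega
        · intro j hj
          obtain rfl : j = 0 := by omega
          simp only [coord_withOrigin_succ, withOrigin]
          rw [hq]
          cases k <;> simp [Dir.coord, Quad.v, Dir.opp]

theorem Coded.first_num {p : ℕ → Pin} {l : Letter} {w : List Letter} (h : Coded p (l :: w)) :
    ∃ q, l = .num q := by
  have := h 0 (by simp)
  cases l with
  | num q => exact ⟨q, rfl⟩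
  | dir d => exact absurd (codesPin_dir.1 this).1 (by simp)

/-- Consecutive directions of a pin word are perpendicular. -/
theorem Coded.perp {p : ℕ → Pin} {w : List Letter} (h : Coded p w) {i : ℕ} (hi : i + 1 < w.length)
    {d d' : Dir} (hd : w[i] = .dir d) (hd' : w[i + 1] = .dir d') : d.isHoriz ≠ d'.isHoriz := by
  have h₁ := h i (by omega)
  have h₂ := h (i + 1) hi
  rw [hd'] at h₂
  obtain ⟨_, e, he, a₁, a₂, a₃⟩ := codesPin_dir.1 h₂
  rcases behind_unique h₁ he a₂ a₃ with ⟨q, hq, _⟩ | hq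
  · rw [hd] at hq; cases hq
  · rw [hd] at hq; cases hq; exact he

/-- The first two letters of a pin word fit the pins without the origin. -/
theorem Coded.exists_heads {P : ℕ → Pin} {s : List Dir} {l₁ l₂ : Letter}
    (h : Coded P (l₁ :: l₂ :: s.map .dir)) : ∃ k b, Coded (fun i => P (i + 1)) (strictWord k s) ∧
      (∀ d ∈ s.head?, d.isHoriz = b) ∧ (l₁, l₂) ∈ heads k b := by
  have tail : ∀ k : Quad, (∀ d, (k.side d).coord (P 1) < (k.side d).coord (P 2)) →
      Coded (fun i => P (i + 1)) (strictWord k s) := by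
    rintro k hk (_ | i) hi
    · refine codesPin_num.2 fun d j hj => ?_
      obtain rfl : j = 0 := by omega
      exact hk d
    · have hi' : i < s.length := by simpa [strictWord] using hi
      have := h (i + 2) (by simpa using hi')
      simp only [strictWord, List.getElem_cons_succ, List.getElem_map] at this ⊢
      obtain ⟨_, e, he, a₁, a₂, a₃⟩ := codesPin_dir.1 this
      exact codesPin_dir.2 ⟨by omega, e, he, fun j hj => a₁ _ (by omega), a₂,
        fun j hj => a₃ _ (by omega)⟩
  obtain ⟨q, rfl⟩ := h.first_num
  have h₂ := h 1 (by simp)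
  simp only [List.getElem_cons_succ, List.getElem_cons_zero] at h₂
  cases l₂ with
  | num k =>
    -- A numeral as second letter is possible for both values of `b`, so the default for empty `s`
    -- is arbitrary.
    refine ⟨k, (s.head?.map Dir.isHoriz).getD true, tail k fun d => codesPin_num.1 h₂ d 1 le_rfl,
      ?_, mem_heads.2 ⟨q, Or.inl rfl⟩⟩
    intro d hd; rw [Option.mem_def.1 hd]; rfl
  | dir d =>
    obtain ⟨_, e, he, a₁, a₂, a₃⟩ := codesPin_dir.1 h₂
    have hq := behind_unique (h 0 (by simp)) he a₂ a₃
    simp only [List.getElem_cons_zero, Letter.num.injEq, reduceCtorEq, or_false] at hq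
    obtain ⟨_, rfl, hqe⟩ := hq
    -- Pin `2` is beyond pin `1` along `d` and behind it along `e`; the next direction is
    -- perpendicular to `d`.
    refine ⟨quadOf e.opp d, !d.isHoriz, tail _ fun d' => ?_, ?_, ?_⟩
    · exact quad_of_perp (by simpa using he) (fun d' => d'.coord (P 1) < d'.coord (P 2)) (a₁ 1 le_rfl)
        (by simpa using a₂) d'
    · intro d' hd'
      cases s with
      | nil => simp at hd'
      | cons a s =>
        simp only [List.head?_cons, Option.mem_def, Option.some.injEq] at hd'
        subst hd'
        have := h.perp (i := 1) (by simp) (d := d) (d' := a) rfl rfl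
        revert this; cases d.isHoriz <;> cases a.isHoriz <;> simp
    · refine mem_heads.2 ⟨q, Or.inr ?_⟩
      revert hqe he
      cases d <;> cases e <;> cases q <;> simp [Dir.isHoriz, Dir.opp, quadOf, Quad.h, Quad.v, Quad.side]

theorem exists_quadrant {x y : Pin} (h₁ : x.1 ≠ y.1) (h₂ : x.2 ≠ y.2) :
    ∃ k : Quad, InQuadrant x {y} k := by
  rcases lt_or_gt_of_ne h₁ with h₁ | h₁ <;> rcases lt_or_gt_of_ne h₂ with h₂ | h₂
  · exact ⟨.three, by simpa [InQuadrant, LeftOf, Below] using ⟨h₁, h₂⟩⟩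
  · exact ⟨.two, by simpa [InQuadrant, LeftOf, Above] using ⟨h₁, h₂⟩⟩
  · exact ⟨.four, by simpa [InQuadrant, RightOf, Below] using ⟨h₁, h₂⟩⟩
  · exact ⟨.one, by simpa [InQuadrant, RightOf, Above] using ⟨h₁, h₂⟩⟩

theorem firstPins_one (p : ℕ → Pin) : firstPins p 1 = {p 0} := by
  ext x; simp [firstPins, eq_comm]

/-- The first pin of a proper sequence serves as its origin: the second pin is coded by a numeral,
all others by directions. -/
theorem isProperPinPerm_iff {σ : Permutation} (hσ : 2 ≤ σ.1) :
    IsProperPinPerm σ ↔ ∃ p k s, s.length + 2 = σ.1 ∧ Coded p (strictWord k s) ∧ Represents p σ := by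
  constructor
  · rintro ⟨p, hp, hp', hr⟩
    have hd : ∀ i, ∃ d, 1 ≤ i → i + 1 < σ.1 → CodesPin p i (.dir d) := by
      intro i
      by_cases hi : 1 ≤ i ∧ i + 1 < σ.1
      · obtain ⟨e, he₁, he₂⟩ := (hp' i hi.1 hi.2).exists_dir
        obtain ⟨d, hd⟩ := outsideBox_iff.1 (hp.2 i hi.2).1
        rw [forall_firstPins] at hd he₂
        refine ⟨d, fun _ _ => codesPin_dir.2 ⟨hi.1, e, fun hed => ?_, fun j hj => hd j (by omega),
          he₁, he₂⟩⟩
        have a := hd i (by omega)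
        have b := hd 0 (by omega)
        have c := he₂ 0 (by omega)
        -- The side on which the pin leaves the bounding box is perpendicular to the side of the
        -- separation: along one axis it cannot be both beyond all pins and between some of them.
        rcases Dir.eq_or_eq_opp hed with rfl | rfl
        · omega
        · simp only [Dir.coord_opp] at c; omega
      · exact ⟨.U, fun h₁ h₂ => absurd ⟨h₁, h₂⟩ hi⟩
    choose d hd using hd
    have hne := hp.1 1 (by omega) 0 (by omega) (by omega)
    obtain ⟨k, hk⟩ := exists_quadrant hne.1 hne.2
    refine ⟨p, k, (List.range (σ.1 - 2)).map fun i => d (i + 1), by simp; omega, ?_, hr⟩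
    rintro (_ | i) hi
    · simpa [strictWord, CodesPin, firstPins_one] using hk
    · simp only [strictWord, List.length_cons, List.length_map, List.length_range] at hi
      simpa [strictWord] using hd (i + 1) (by omega) (by omega)
  · rintro ⟨p, k, s, hs, hp, hr⟩
    have hlen : (strictWord k s).length + 1 = σ.1 := by simp [strictWord]; omega
    refine ⟨p, hlen ▸ hp.isPinSeq, fun i hi hi' => ?_, hr⟩
    obtain ⟨i, rfl⟩ : ∃ j, i = j + 1 := ⟨i - 1, by omega⟩
    have := hp (i + 1) (by omega)
    simp only [strictWord, List.getElem_cons_succ, List.getElem_map] at this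
    obtain ⟨_, e, he, a₁, a₂, a₃⟩ := codesPin_dir.1 this
    exact separates_of_coord a₂ (forall_firstPins.2 a₃)

end PinPerm
namespace PinPerm

/-! ### Alternating words of directions -/

/-- The letter number `i` of a word of directions. -/
def letterAt (v : List Dir) (i : ℕ) : Dir := v.getD i .U

/-- Horizontal and vertical directions alternate. -/
abbrev Alternating (v : List Dir) : Prop := v.IsChain fun a b => a.isHoriz ≠ b.isHoriz

theorem letterAt_eq {v : List Dir} {i : ℕ} (h : i < v.length) : letterAt v i = v[i] := by
  simp [letterAt, List.getElem?_eq_getElem h]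

theorem Alternating.perp {v : List Dir} (h : Alternating v) {i : ℕ} (hi : i + 1 < v.length) :
    (letterAt v i).isHoriz ≠ (letterAt v (i + 1)).isHoriz := by
  rw [letterAt_eq hi, letterAt_eq (by omega)]
  exact List.isChain_iff_getElem.1 h i hi

/-- The strict pin word `u` with `φ(u) = v`. -/
def strictOf (v : List Dir) : List Letter :=
  strictWord (quadOf (letterAt v 0) (letterAt v 1)) (v.drop 2)

theorem length_strictOf {v : List Dir} (h : 2 ≤ v.length) : (strictOf v).length + 1 = v.length := by
  simp [strictOf, strictWord]; omega

theorem strictOf_getElem_succ {v : List Dir} {i : ℕ} (h : i + 1 < (strictOf v).length) :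
    (strictOf v)[i + 1] = .dir (letterAt v (i + 2)) := by
  have : i + 2 < v.length := by simp [strictOf, strictWord] at h; omega
  rw [letterAt_eq this]
  simp [strictOf, strictWord, Nat.add_comm]

/-- In a sequence of pins encoded by an alternating word, the quadrant of a pin is given by two
consecutive letters. -/
theorem quadrant_of_coded {p : ℕ → Pin} {v : List Dir} (hv : Alternating v) (h : Coded p (strictOf v))
    {i : ℕ} (hi : i + 1 < v.length) :
    (∀ d, ∀ j < i, ((quadOf (letterAt v i) (letterAt v (i + 1))).side d).coord (p j) <
      ((quadOf (letterAt v i) (letterAt v (i + 1))).side d).coord (p (i + 1))) ∧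
    (i = 0 → ∀ d, ((quadOf (letterAt v i) (letterAt v (i + 1))).side d).coord (p 0) <
      ((quadOf (letterAt v i) (letterAt v (i + 1))).side d).coord (p 1)) ∧
    (1 ≤ i → CodesPin p i (.dir (letterAt v (i + 1)))) := by
  have hl := length_strictOf (v := v) (by omega)
  rcases i with _ | i
  · refine ⟨by simp, fun _ d => ?_, by simp⟩
    have := h 0 (by omega)
    exact codesPin_num.1 (by simpa [strictOf, strictWord] using this) d 0 le_rfl
  · have hc := h (i + 1) (by omega)
    rw [strictOf_getElem_succ] at hc
    refine ⟨?_, by simp, fun _ => hc⟩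
    obtain ⟨_, e, he, a₁, a₂, a₃⟩ := codesPin_dir.1 hc
    have hperp := hv.perp hi
    have hee : e.isHoriz = (letterAt v (i + 1)).isHoriz := by
      revert he hperp
      cases e.isHoriz <;> cases (letterAt v (i + 1)).isHoriz <;>
        cases (letterAt v (i + 1 + 1)).isHoriz <;> simp
    -- The pin stays behind its predecessor in the direction in which the predecessor was placed,
    -- and that is the preceding letter.
    have : e = letterAt v (i + 1) := by
      have hb := behind_unique (h i (by omega)) he a₂ a₃
      rcases i with _ | i
      · simp only [strictOf, strictWord, List.getElem_cons_zero, Letter.num.injEq, reduceCtorEq,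
          or_false] at hb
        obtain ⟨q, rfl, hq⟩ := hb
        have hperp' := hv.perp (i := 0) (by omega)
        rw [hq, Quad.side_congr _ hee]
        exact quadOf_side_right hperp'
      · rw [strictOf_getElem_succ] at hb
        simpa [eq_comm] using hb
    subst this
    exact fun d j hj => quad_of_perp he (fun d' => d'.coord (p j) < d'.coord (p (i + 1 + 1)))
      (a₁ j hj.le) (a₃ j hj) d

/-! ### Subsequences of pins -/

/-- The origin followed by the pins number `g 0 + 1`, `g 1 + 1`, …. -/
def subPins (p : ℕ → Pin) (g : ℕ → ℕ) : ℕ → Pin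
  | 0 => p 0
  | j + 1 => p (g j + 1)

/-- The letter that encodes pin number `g j + 1` in the subsequence. -/
def subLetter (v : List Dir) (g : ℕ → ℕ) (j : ℕ) : Letter :=
  if j = 0 ∨ g j ≠ g (j - 1) + 1 then .num (quadOf (letterAt v (g j)) (letterAt v (g j + 1)))
  else .dir (letterAt v (g j + 1))

/-- A kept pin whose predecessor is omitted has all kept earlier pins on the same side of each of
its lines, hence a numeral. If the predecessor is kept, it is still separated from the rest, hence a
direction. The origin always stays. -/
theorem coded_subPins {p : ℕ → Pin} {v : List Dir} (hv : Alternating v) (h : Coded p (strictOf v))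
    {g : ℕ → ℕ} {m : ℕ} (hg : ∀ i j, i < j → j < m → g i < g j) (hgv : ∀ i < m, g i + 1 < v.length) :
    Coded (subPins p g) ((List.range m).map (subLetter v g)) := by
  intro j hj
  have hjm : j < m := by simpa using hj
  obtain ⟨q₁, q₂, q₃⟩ := quadrant_of_coded hv h (hgv j hjm)
  simp only [List.getElem_map, List.getElem_range, subLetter]
  split_ifs with hc
  · refine codesPin_num.2 fun d i hi => ?_
    rcases i with _ | i
    · rcases Nat.eq_zero_or_pos (g j) with h0 | h0
      · simpa [subPins, h0] using q₂ h0 d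
      · exact q₁ d 0 h0
    · refine q₁ d (g i + 1) ?_
      rcases hc with rfl | hc
      · omega
      · have h₁ := hg (j - 1) j (by omega) hjm
        have h₂ : g i ≤ g (j - 1) := by
          rcases (show i ≤ j - 1 by omega).lt_or_eq with h | h
          · exact (hg _ _ h (by omega)).le
          · rw [h]
        omega
  · obtain ⟨hj0, hc⟩ := not_or.1 hc
    rw [not_not] at hc
    obtain ⟨i, rfl⟩ : ∃ i, j = i + 1 := ⟨j - 1, by omega⟩
    obtain ⟨_, e, he, a₁, a₂, a₃⟩ := codesPin_dir.1 (q₃ (by omega))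
    simp only [Nat.add_sub_cancel] at hc
    refine codesPin_dir.2 ⟨by omega, e, he, ?_, ?_, ?_⟩
    · rintro (_ | j) hj
      · exact a₁ 0 (by omega)
      · refine a₁ _ ?_
        rcases (show j ≤ i by omega).lt_or_eq with h | h
        · have := hg _ _ h (by omega); omega
        · subst h; omega
    · simpa [subPins, hc] using a₂
    · rintro (_ | j) hj
      · exact a₃ 0 (by omega)
      · refine a₃ _ ?_
        have := hg j i (by omega) (by omega); omega

/-! ### The map `φ` -/

theorem mem_phi {q : Quad} {ds f : List Dir} (h : f ∈ phi q ds) (hf : Alternating f ∨ ds ≠ []) :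
    ∃ a b, f = a :: b :: ds ∧ q = quadOf a b := by
  cases ds with
  | nil =>
    simp only [phi, Set.mem_insert_iff, Set.mem_singleton_iff] at h
    rcases h with rfl | rfl
    · exact ⟨_, _, rfl, by cases q <;> rfl⟩
    · exact ⟨_, _, rfl, by cases q <;> rfl⟩
  | cons d ds =>
    simp only [phi, Set.mem_singleton_iff] at h
    split_ifs at h
    · exact ⟨_, _, h, by cases q <;> rfl⟩
    · exact ⟨_, _, h, by cases q <;> rfl⟩

theorem cons_cons_mem_phi {a b : Dir} {ds : List Dir} (h : Alternating (a :: b :: ds)) :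
    a :: b :: ds ∈ phi (quadOf a b) ds := by
  have hab : a.isHoriz ≠ b.isHoriz := by
    simp only [Alternating, List.isChain_cons_cons] at h; exact h.1
  cases ds with
  | nil =>
    simp only [phi, Set.mem_insert_iff, Set.mem_singleton_iff]
    revert hab; cases a <;> cases b <;> simp [Dir.isHoriz, quadOf, Quad.h, Quad.v]
  | cons d ds =>
    have hbd : b.isHoriz ≠ d.isHoriz := by
      simp only [Alternating, List.isChain_cons_cons] at h; exact h.2.1
    simp only [phi, Set.mem_singleton_iff]
    revert hab hbd
    cases a <;> cases b <;> cases d <;> simp [Dir.isHoriz, quadOf, Quad.h, Quad.v]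

theorem letterAt_append (A C : List Dir) (i : ℕ) : letterAt (A ++ C) (A.length + i) = letterAt C i := by
  simp [letterAt, List.getElem?_append_right]

theorem letterAt_append_left {A C : List Dir} {i : ℕ} (h : i < A.length) :
    letterAt (A ++ C) i = letterAt A i := by
  simp [letterAt, List.getElem?_append_left h]

/-- The tail of the pins of a word, from the pin number `k + 1` on, is encoded by a factor. -/
theorem map_subLetter_add {v f A C : List Dir} {a b : Dir} {ds : List Dir} (hv : v = A ++ f ++ C)
    (hf : f = a :: b :: ds) :
    (List.range (ds.length + 1)).map (subLetter v (A.length + ·)) = strictWord (quadOf a b) ds := by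
  subst hv hf
  have hl : ∀ i < ds.length + 2,
      letterAt (A ++ a :: b :: ds ++ C) (A.length + i) = letterAt (a :: b :: ds) i := by
    intro i hi
    rw [List.append_assoc, letterAt_append, letterAt_append_left (by simp; omega)]
  refine List.ext_getElem (by simp [strictWord]) fun i h₁ h₂ => ?_
  simp only [List.length_map, List.length_range] at h₁
  simp only [List.getElem_map, List.getElem_range, subLetter]
  rcases i with _ | i
  · simp only [true_or, if_true]
    rw [hl 0 (by omega), hl 1 (by omega)]; rfl
  · rw [if_neg (by simp; omega), Nat.add_assoc, hl (i + 1 + 1) (by omega), letterAt_eq (by simp; omega)]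
    simp [strictWord]

/-- The pin number `A.length + 2` is left out. The first kept pin takes its quadrant from `x`, the
second one from the first two letters of `y`; as they are not consecutive, the second letter is a
numeral. -/
theorem map_subLetter_skip {v x y A C : List Dir} {a b : Dir} {ds : List Dir}
    (hv : v = A ++ (x ++ y) ++ C) (hx : x.length = 2) (hy : y = a :: b :: ds) (q : Quad)
    (hq : q = quadOf (letterAt x 0) (letterAt x 1)) :
    (List.range (ds.length + 2)).map
      (subLetter v fun j => if j = 0 then A.length else A.length + 1 + j) =
      quasiStrictWord q (quadOf a b) ds := by
  subst hv hy
  have hl : ∀ i < ds.length + 4, letterAt (A ++ (x ++ a :: b :: ds) ++ C) (A.length + i) =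
      letterAt (x ++ a :: b :: ds) i := by
    intro i hi
    rw [List.append_assoc, letterAt_append, letterAt_append_left (by simp; omega)]
  have hl2 : ∀ i < ds.length + 2, letterAt (A ++ (x ++ a :: b :: ds) ++ C) (A.length + 2 + i) =
      letterAt (a :: b :: ds) i := by
    intro i hi
    rw [Nat.add_assoc, hl _ (by omega), ← hx, letterAt_append]
  refine List.ext_getElem (by simp [quasiStrictWord, strictWord]) fun i h₁ h₂ => ?_
  simp only [List.length_map, List.length_range] at h₁
  simp only [List.getElem_map, List.getElem_range, subLetter]
  rcases i with _ | _ | i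
  · simp only [true_or, if_true]
    have := hl 0 (by omega)
    rw [Nat.add_zero] at this
    rw [this, hl 1 (by omega), letterAt_append_left (by omega),
      letterAt_append_left (by omega), hq]; rfl
  · rw [if_pos (by simp)]
    have h0 := hl2 0 (by omega)
    have h1 := hl2 1 (by omega)
    simp only [Nat.add_zero, Nat.add_assoc, Nat.reduceAdd] at h0 h1
    simp only [Nat.add_assoc, zero_add, Nat.reduceAdd, one_ne_zero, if_false, h0, h1]
    rfl
  · rw [if_neg (by simp; omega)]
    have := hl2 (i + 2) (by omega)
    rw [show A.length + 2 + (i + 2) = A.length + 1 + (i + 1 + 1) + 1 by omega] at this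
    simp only [Nat.add_eq_zero_iff, one_ne_zero, and_false, if_false]
    rw [this, letterAt_eq (by simp; omega)]
    simp [quasiStrictWord, strictWord]

/-- A permutation given by an alternating word contains all permutations with a forbidden factor in
the word. -/
theorem isPattern_of_factor {p : ℕ → Pin} {v f : List Dir} {π σ : Permutation} (hv : Alternating v)
    (hvl : v.length = σ.1 + 1) (h : Coded p (strictOf v))
    (hσ : Represents (fun i => p (i + 1)) σ) (hf : f ∈ factorsOf π) (hfv : f <:+: v) :
    IsPattern π σ := by
  have hfa : Alternating f := List.IsChain.infix hv hfv
  obtain ⟨A, C, hv'⟩ := hfv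
  rcases hf with ⟨q, ds, hds, hw, hq⟩ | ⟨_, q, q', ds, x, y, hw, hx, hy, hxy⟩
  · obtain ⟨a, b, hab, rfl⟩ := mem_phi hq (Or.inl hfa)
    obtain ⟨hl, P, hP, hPc⟩ := mem_pinWords.1 hw
    have hl' : ds.length + 1 = π.1 := by simpa [strictWord] using hl
    have hlen : v.length = A.length + (ds.length + 2) + C.length := by rw [← hv', hab]; simp; omega
    have hc := coded_subPins hv h (g := (A.length + ·)) (m := ds.length + 1)
      (fun i j hij _ => by simpa using hij) (fun i hi => by omega)
    rw [map_subLetter_add hv'.symm hab] at hc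
    refine hP.isPattern hσ (A.length + ·) (fun i hi => by omega) fun i hi j hj => ?_
    exact hPc.order_iff hc (fun _ _ => rfl) (fun _ _ => rfl) (by omega) (by omega)
  · have hya : Alternating y := List.IsChain.infix hfa ⟨x, [], by simp [hxy]⟩
    obtain ⟨a, b, hab, rfl⟩ := mem_phi hy (Or.inl hya)
    obtain ⟨hl, P, hP, hPc⟩ := mem_pinWords.1 hw
    have hl' : ds.length + 2 = π.1 := by simpa [quasiStrictWord, strictWord] using hl
    have hlen : v.length = A.length + (ds.length + 4) + C.length := by
      rw [← hv', hxy, hab]; simp; omega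
    subst hxy
    have hc := coded_subPins hv h (g := fun j => if j = 0 then A.length else A.length + 1 + j)
      (m := ds.length + 2) (fun i j hij _ => by split_ifs <;> omega)
      (fun i hi => by split_ifs <;> omega)
    rw [map_subLetter_skip hv'.symm hx hab _ rfl] at hc
    refine hP.isPattern hσ (fun j => if j = 0 then A.length else A.length + 1 + j)
      (fun i hi => by split_ifs <;> omega) fun i hi j hj => ?_
    -- The first numerals of the two words may differ: since the second letter is a numeral, the
    -- first one does not affect the order type.
    refine hPc.order_iff hc (fun i hi => ?_) (fun d hd => ?_) (by omega) (by omega)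
    · obtain ⟨i, rfl⟩ : ∃ k, i = k + 1 := ⟨i - 1, by omega⟩
      simp [quasiStrictWord]
    · simp [quasiStrictWord, strictWord] at hd

theorem drop_eq_cons_letterAt {v : List Dir} {k : ℕ} (h : k < v.length) :
    v.drop k = letterAt v k :: v.drop (k + 1) := by
  rw [List.drop_eq_getElem_cons h, letterAt_eq h]

theorem exists_infix {v : List Dir} {k n : ℕ} (h : k + n + 2 ≤ v.length) :
    ∃ A C ds, v = A ++ letterAt v k :: letterAt v (k + 1) :: ds ++ C ∧ A.length = k ∧
      ds.length = n := by
  refine ⟨v.take k, v.drop (k + 2 + n), (v.drop (k + 2)).take n, ?_, by simp; omega, by simp; omega⟩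
  conv_lhs => rw [← List.take_append_drop k v, drop_eq_cons_letterAt (by omega),
    drop_eq_cons_letterAt (by omega), ← List.take_append_drop n (v.drop (k + 1 + 1)), List.drop_drop]
  simp [Nat.add_assoc]

/-- A simple pattern of a permutation given by an alternating word has a forbidden factor in the
word. -/
theorem exists_factor_of_isPattern {p : ℕ → Pin} {v : List Dir} {π σ : Permutation}
    (hv : Alternating v) (hvl : v.length = σ.1 + 1) (h : Coded p (strictOf v))
    (hσ : Represents (fun i => p (i + 1)) σ) (hπ : IsSimplePerm π) (hπ2 : 2 ≤ π.1)
    (hle : IsPattern π σ) : ∃ f ∈ factorsOf π, f <:+: v := by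
  obtain ⟨g, hg, hgσ, hr⟩ := hle.exists_represents hσ
  have hc := coded_subPins hv h hg (fun i hi => by have := hgσ i hi; omega)
  have hw : (List.range π.1).map (subLetter v g) ∈ pinWords π :=
    mem_pinWords.2 ⟨by simp, _, hr, hc⟩
  -- A gap before pin `j` would produce a numeral at position `j ≥ 2`, contrary to simplicity. So
  -- only the first pin can be detached.
  have hstep : ∀ j, 2 ≤ j → j < π.1 → g j = g (j - 1) + 1 := by
    intro j hj hjπ
    obtain ⟨d, hd⟩ := hc.isDir_of_simple (by simp) hr hπ hj (by simpa using hjπ)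
    simp only [List.getElem_map, List.getElem_range, subLetter] at hd
    split_ifs at hd with hcond
    push Not at hcond
    exact hcond.2
  have hrun : ∀ j, j + 1 < π.1 → g (j + 1) = g 1 + j := by
    intro j
    induction j with
    | zero => simp
    | succ j ih =>
      intro hj
      rw [hstep (j + 1 + 1) (by omega) hj, Nat.add_sub_cancel, ih (by omega)]; omega
  have h01 := hg 0 1 (by omega) (by omega)
  have hlast := hgσ (π.1 - 2 + 1) (by omega)
  rw [hrun _ (by omega)] at hlast
  -- Without a detached first pin the pin word is strict, otherwise it is quasi-strict.
  by_cases hcase : g 1 = g 0 + 1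
  · obtain ⟨A, C, ds, hvA, hA, hds⟩ := exists_infix (v := v) (k := g 0) (n := π.1 - 1) (by omega)
    refine ⟨_, ?_, A, C, hvA.symm⟩
    refine Or.inl ⟨quadOf (letterAt v (g 0)) (letterAt v (g 0 + 1)), ds, ?_, ?_,
      cons_cons_mem_phi (List.IsChain.infix hv ⟨A, C, hvA.symm⟩)⟩
    · rintro rfl; simp at hds; omega
    · rw [← map_subLetter_add hvA rfl]
      convert hw using 1
      rw [hds, show π.1 - 1 + 1 = π.1 by omega]
      refine List.map_congr_left fun j hj => ?_
      have hgj : ∀ i < π.1, g i = A.length + i := by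
        intro i hi
        rcases i with _ | i
        · omega
        · rw [hrun i hi]; omega
      rw [List.mem_range] at hj
      simp only [subLetter]
      rw [hgj j hj, hgj (j - 1) (by omega)]
  · obtain ⟨A, C, ds, hvA, hA, hds⟩ := exists_infix (v := v) (k := g 1) (n := π.1 - 2) (by omega)
    -- The two letters of `x` are taken right before position `g 1`, wherever the detached pin is;
    -- they exist because `g 1 ≥ g 0 + 2`.
    obtain ⟨A', x, hA', hx⟩ : ∃ A' x, A = A' ++ x ∧ x.length = 2 :=
      ⟨A.take (g 1 - 2), A.drop (g 1 - 2), by simp, by simp; omega⟩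
    have hvA' : v = A' ++ (x ++ letterAt v (g 1) :: letterAt v (g 1 + 1) :: ds) ++ C := by
      conv_lhs => rw [hvA, hA']
      simp
    have hfa : Alternating (x ++ letterAt v (g 1) :: letterAt v (g 1 + 1) :: ds) :=
      List.IsChain.infix hv ⟨A', C, hvA'.symm⟩
    refine ⟨_, Or.inr ⟨⟨by simp; omega, hfa⟩, quadOf (letterAt v (g 0)) (letterAt v (g 0 + 1)),
      quadOf (letterAt v (g 1)) (letterAt v (g 1 + 1)), ds, x, _, ?_, hx,
      cons_cons_mem_phi (List.IsChain.infix hfa ⟨x, [], by simp⟩), rfl⟩, A', C, hvA'.symm⟩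
    convert hw using 1
    have key := map_subLetter_skip hvA' hx rfl _ rfl
    rw [hds, show π.1 - 2 + 2 = π.1 by omega] at key
    have hlen : A'.length + 2 = g 1 := by rw [← hA, hA', List.length_append, hx]
    have hgj : ∀ i, 1 ≤ i → i < π.1 → g i = A'.length + 1 + i := by
      intro i hi hi'
      obtain ⟨i, rfl⟩ : ∃ k, i = k + 1 := ⟨i - 1, by omega⟩
      rw [hrun i hi']; omega
    refine List.ext_getElem (by simp [quasiStrictWord, strictWord]; omega) fun i h₁ h₂ => ?_
    have h₂' : i < π.1 := by simpa using h₂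
    rcases i with _ | i
    · simp [quasiStrictWord, subLetter]
    · have := congrArg (fun l => l[i + 1]?) key
      simp only [List.getElem?_map, List.getElem?_range h₂', Option.map_some] at this
      rw [show quasiStrictWord (quadOf (letterAt x 0) (letterAt x 1))
        (quadOf (letterAt v (g 1)) (letterAt v (g 1 + 1))) ds = .num (quadOf (letterAt x 0)
          (letterAt x 1)) :: strictWord (quadOf (letterAt v (g 1)) (letterAt v (g 1 + 1))) ds from rfl,
        List.getElem?_cons_succ] at this
      simp only [quasiStrictWord, List.getElem_cons_succ, List.getElem_map, List.getElem_range]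
      rw [← Option.some_inj, ← List.getElem?_eq_getElem, ← this]
      congr 1
      simp only [subLetter]
      rcases i with _ | i
      · rw [if_pos (by simp), if_pos (Or.inr hcase), zero_add]
        simp only [one_ne_zero, if_false]
        rw [hgj 1 le_rfl (by omega)]
      · simp only [Nat.add_eq_zero_iff, one_ne_zero, and_false, if_false, false_or,
          Nat.add_sub_cancel]
        rw [hgj (i + 1 + 1) (by omega) h₂', hgj (i + 1) (by omega) (by omega)]

end PinPerm
namespace PinPerm

/-! ### Pins of a given alternating word -/

/-- The unit vector in a direction. -/
def Dir.vec : Dir → Pin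
  | .U => (0, 1)
  | .D => (0, -1)
  | .L => (-1, 0)
  | .R => (1, 0)

/-- A pin sequence for the alternating word `v`. -/
def wordPins (v : List Dir) : ℕ → Pin
  | 0 => (0, 0)
  -- Pin `i + 1` has coordinate `2i + 4` along its own letter, beyond the bound `2j + 2` for all
  -- earlier pins `j`. Along the letter before it has `2i + 1`, which is beyond the pins `j < i` and
  -- short of the value `2i + 2` of pin `i` when `i ≥ 1`.
  | i + 1 => ((2 * i + 1) * (letterAt v i).vec.1 + (2 * i + 4) * (letterAt v (i + 1)).vec.1,
      (2 * i + 1) * (letterAt v i).vec.2 + (2 * i + 4) * (letterAt v (i + 1)).vec.2)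

theorem coord_comb (d a b : Dir) (m n : ℤ) :
    d.coord (m * a.vec.1 + n * b.vec.1, m * a.vec.2 + n * b.vec.2) =
      m * d.coord a.vec + n * d.coord b.vec := by
  cases d <;> simp [Dir.coord] <;> ring

theorem coord_vec_self (d : Dir) : d.coord d.vec = 1 := by cases d <;> rfl

theorem coord_vec_perp {d e : Dir} (h : d.isHoriz ≠ e.isHoriz) : d.coord e.vec = 0 := by
  cases d <;> cases e <;> simp_all [Dir.isHoriz, Dir.coord, Dir.vec]

theorem abs_coord_vec {d e : Dir} : -1 ≤ d.coord e.vec ∧ d.coord e.vec ≤ 1 := by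
  cases d <;> cases e <;> simp [Dir.coord, Dir.vec]

theorem coord_wordPins_le {v : List Dir} (hv : Alternating v) (d : Dir) {i : ℕ} (hi : i < v.length) :
    d.coord (wordPins v i) ≤ 2 * i + 2 := by
  rcases i with _ | i
  · cases d <;> simp [wordPins, Dir.coord]
  · rw [wordPins, coord_comb]
    have hp := hv.perp hi
    have h₁ := abs_coord_vec (d := d) (e := letterAt v i)
    have h₂ := abs_coord_vec (d := d) (e := letterAt v (i + 1))
    push_cast
    by_cases h : d.isHoriz = (letterAt v i).isHoriz
    · rw [coord_vec_perp (d := d) (e := letterAt v (i + 1)) (by rw [h]; exact hp)]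
      nlinarith
    · rw [coord_vec_perp (d := d) (e := letterAt v i) h]
      nlinarith

theorem coord_wordPins_last {v : List Dir} (hv : Alternating v) {i : ℕ} (hi : i + 1 < v.length) :
    (letterAt v (i + 1)).coord (wordPins v (i + 1)) = 2 * i + 4 := by
  rw [wordPins, coord_comb, coord_vec_self, coord_vec_perp (hv.perp hi).symm]; ring

theorem coord_wordPins_prev {v : List Dir} (hv : Alternating v) {i : ℕ} (hi : i + 1 < v.length) :
    (letterAt v i).coord (wordPins v (i + 1)) = 2 * i + 1 := by
  rw [wordPins, coord_comb, coord_vec_self, coord_vec_perp (hv.perp hi)]; ring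

theorem coded_wordPins {v : List Dir} (hv : Alternating v) (hl : 2 ≤ v.length) :
    Coded (wordPins v) (strictOf v) := by
  intro i hi
  have hlen := length_strictOf hl
  rcases i with _ | i
  · have hp := hv.perp (i := 0) (by omega)
    refine codesPin_num.2 fun d j hj => ?_
    obtain rfl : j = 0 := by omega
    refine quad_of_perp hp (fun d' => d'.coord (wordPins v 0) < d'.coord (wordPins v 1)) ?_ ?_ d
    all_goals
      have h0 : ∀ d : Dir, d.coord (wordPins v 0) = 0 := by
        intro d; cases d <;> simp [wordPins, Dir.coord]
      simp only [h0]
    · have := coord_wordPins_last hv (i := 0) (by omega); simp only [zero_add] at this ⊢; omega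
    · have := coord_wordPins_prev hv (i := 0) (by omega); simp only [zero_add] at this ⊢; omega
  · rw [strictOf_getElem_succ]
    have hi' : i + 1 + 1 < v.length := by omega
    refine codesPin_dir.2 ⟨by omega, letterAt v (i + 1), hv.perp hi', fun j hj => ?_, ?_,
      fun j hj => ?_⟩
    · have h := coord_wordPins_last hv hi'
      have h' := coord_wordPins_le hv (letterAt v (i + 2)) (i := j) (by omega)
      simp only [Nat.add_assoc, Nat.reduceAdd] at h h' ⊢
      rw [h]; push_cast; omega
    · rw [coord_wordPins_prev hv hi', coord_wordPins_last hv (by omega)]; push_cast; omega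
    · rw [coord_wordPins_prev hv hi']
      have h' := coord_wordPins_le hv (letterAt v (i + 1)) (i := j) (by omega)
      push_cast; omega

/-! ### Proper pin-permutations and alternating words -/

/-- Dropping the origin of the sequence leaves a proper sequence (`Coded.exists_heads`), with one
pin less than the word has letters. -/
theorem exists_proper_of_word {v : List Dir} (hv : Alternating v) (hl : 3 ≤ v.length) :
    ∃ (σ : Permutation) (p : ℕ → Pin), σ.1 + 1 = v.length ∧ IsProperPinPerm σ ∧
      Coded p (strictOf v) ∧ Represents (fun i => p (i + 1)) σ := by
  have hc := coded_wordPins hv (by omega)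
  have hlen := length_strictOf (v := v) (by omega)
  obtain ⟨σ, hσ⟩ := exists_represents (n := v.length - 1) (p := fun i => wordPins v (i + 1))
    fun i hi j hj hij => hc.isPinSeq.1 _ (by omega) _ (by omega) (by omega)
  refine ⟨⟨_, σ⟩, wordPins v, by simp only; omega, ?_, hc, hσ⟩
  rw [isProperPinPerm_iff (by simp only; omega)]
  obtain ⟨a, b, c, t, rfl⟩ : ∃ a b c t, v = a :: b :: c :: t := by
    match v, hl with
    | a :: b :: c :: t, _ => exact ⟨a, b, c, t, rfl⟩
  obtain ⟨k, _, hk, _⟩ := Coded.exists_heads (P := wordPins (a :: b :: c :: t))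
    (l₁ := .num (quadOf a b)) (l₂ := .dir c) (s := t) (by simpa [strictOf, strictWord, letterAt] using hc)
  exact ⟨_, k, t, by simp, hk, hσ⟩

/-- Among the possible origins there is one that makes the second letter a direction. The pin word
is then strict, and replacing its numeral by two directions gives the alternating word. -/
theorem IsProperPinPerm.exists_word {σ : Permutation} (hσ : IsProperPinPerm σ) (h2 : 2 ≤ σ.1) :
    ∃ (v : List Dir) (p : ℕ → Pin), σ.1 + 1 = v.length ∧ Alternating v ∧ Coded p (strictOf v) ∧
      Represents (fun i => p (i + 1)) σ := by
  obtain ⟨p, k, s, hs, hp, hr⟩ := (isProperPinPerm_iff h2).1 hσ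
  obtain ⟨b, hb⟩ : ∃ b, ∀ d ∈ s.head?, d.isHoriz = b := by
    cases s with
    | nil => exact ⟨true, by simp⟩
    | cons a s => exact ⟨a.isHoriz, by simp⟩
  obtain ⟨q, hq⟩ : ∃ q : Quad, if b then q.h = k.h.opp else q.v = k.v.opp := by
    cases b
    · cases k
      exacts [⟨.three, rfl⟩, ⟨.three, rfl⟩, ⟨.one, rfl⟩, ⟨.one, rfl⟩]
    · cases k
      exacts [⟨.three, rfl⟩, ⟨.one, rfl⟩, ⟨.one, rfl⟩, ⟨.three, rfl⟩]
  obtain ⟨O, hO⟩ := exists_origin hp hb (mem_heads.2 ⟨q, Or.inr ⟨hq, rfl⟩⟩)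
  set c : Dir := if b then k.v else k.h with hc
  have hperp : ∀ i (hi : i + 1 < (c :: s).length), (c :: s)[i].isHoriz ≠ (c :: s)[i + 1].isHoriz := by
    intro i hi
    refine hO.perp (i := i + 1) (by simpa using hi) ?_ ?_
    · have := List.getElem_map Letter.dir (l := c :: s) (i := i) (h := by simp only [List.length_map]; omega)
      exact this
    · have := List.getElem_map Letter.dir (l := c :: s) (i := i + 1) (h := by simpa using hi)
      simp
  -- The two directions of the numeral are ordered so that the second one is perpendicular to the
  -- next letter `c`.
  obtain ⟨x, y, hxy, hyc, rfl⟩ : ∃ x y : Dir, x.isHoriz ≠ y.isHoriz ∧ y.isHoriz ≠ c.isHoriz ∧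
      quadOf x y = q := by
    cases hcb : c.isHoriz
    · exact ⟨q.v, q.h, by simp, by simp, by cases q <;> rfl⟩
    · exact ⟨q.h, q.v, by simp, by simp, by cases q <;> rfl⟩
  refine ⟨x :: y :: c :: s, withOrigin O p, by simp; omega, ?_, ?_, represents_withOrigin hr⟩
  · simp only [Alternating, List.isChain_cons_cons]
    exact ⟨hxy, hyc, List.isChain_iff_getElem.2 hperp⟩
  · simpa [strictOf, strictWord, letterAt] using hO

/-- The permutations of a wreath-closed class that are given by words. -/
theorem mem_Av_iff {B : Set Permutation} (hB : ∀ π ∈ B, IsSimplePerm π ∧ 2 ≤ π.size) {σ : Permutation}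
    {p : ℕ → Pin} {v : List Dir} (hv : Alternating v) (hvl : σ.1 + 1 = v.length)
    (h : Coded p (strictOf v)) (hσ : Represents (fun i => p (i + 1)) σ) :
    σ ∈ Av B ↔ v ∉ factorLanguage (forbidden B) := by
  constructor
  · rintro hA ⟨f, hf | ⟨a, b, hab, rfl⟩, hfv⟩
    · simp only [Set.mem_iUnion] at hf
      obtain ⟨π, hπ, hf⟩ := hf
      exact hA π hπ (isPattern_of_factor hv hvl.symm h hσ hf hfv)
    · have := List.IsChain.infix hv hfv
      simp only [List.isChain_cons_cons] at this
      exact this.1 hab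
  · intro hf π hπ hle
    obtain ⟨f, hf', hfv⟩ := exists_factor_of_isPattern hv hvl.symm h hσ (hB π hπ).1 (hB π hπ).2 hle
    exact hf ⟨f, Or.inl (Set.mem_biUnion hπ hf'), hfv⟩

theorem alternating_of_not_mem {B : Set Permutation} {v : List Dir}
    (hv : v ∉ factorLanguage (forbidden B)) : Alternating v := by
  refine List.isChain_iff_getElem.2 fun i hi hab => hv ⟨[v[i], v[i + 1]], Or.inr ⟨_, _, hab, rfl⟩, ?_⟩
  refine ⟨v.take i, v.drop (i + 2), ?_⟩
  conv_rhs => rw [← List.take_append_drop i v, List.drop_eq_getElem_cons (by omega : i < v.length),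
    List.drop_eq_getElem_cons hi]
  simp

/-- The class contains finitely many proper pin-permutations if and only if the words without
forbidden factors have bounded length. -/
theorem finite_properPin_iff {B : Set Permutation} (hB : ∀ π ∈ B, IsSimplePerm π ∧ 2 ≤ π.size) :
    {σ | IsProperPinPerm σ ∧ σ ∈ Av B}.Finite ↔
      ∃ n, ∀ v, v ∉ factorLanguage (forbidden B) → v.length ≤ n := by
  constructor
  · intro hfin
    obtain ⟨n, hn⟩ := (hfin.image Sigma.fst).bddAbove
    -- A longer word has at least three letters, as `exists_proper_of_word` requires, and gives a
    -- permutation longer than `n`.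
    refine ⟨n + 3, fun v hv => ?_⟩
    by_contra hlen
    have ha := alternating_of_not_mem hv
    obtain ⟨σ, p, hσ, hp, hc, hr⟩ := exists_proper_of_word ha (by omega)
    have := hn ⟨σ, ⟨hp, (mem_Av_iff hB ha hσ hc hr).2 hv⟩, rfl⟩
    omega
  · rintro ⟨n, hn⟩
    -- There are finitely many permutations of bounded length; the longer ones have length at least
    -- two and are given by words.
    have : {σ : Permutation | σ.1 ≤ n + 1}.Finite := by
      have : {σ : Permutation | σ.1 ≤ n + 1} =
          ⋃ m ∈ Set.Iic (n + 1), Set.range fun σ : Equiv.Perm (Fin m) => (⟨m, σ⟩ : Permutation) := by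
        ext ⟨m, σ⟩
        simp only [Set.mem_ofPred_eq, Set.mem_iUnion, Set.mem_range, Set.mem_Iic]
        refine ⟨fun h => ⟨m, h, σ, rfl⟩, ?_⟩
        rintro ⟨m', h, σ', hs⟩
        cases hs; exact h
      rw [this]
      exact (Set.finite_Iic _).biUnion fun m _ => Set.finite_range _
    refine this.subset fun σ hσ => ?_
    by_contra hlen
    simp only [Set.mem_ofPred_eq, not_le] at hlen
    obtain ⟨v, p, hv, ha, hc, hr⟩ := hσ.1.exists_word (by omega)
    have := hn v ((mem_Av_iff hB ha hv hc hr).1 hσ.2)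
    omega

end PinPerm
namespace PinPerm

/-! ### The Aho–Corasick automaton -/

section AhoCorasick

variable {α : Type*} (F : Set (List α))

/-- The word is a state of the Aho–Corasick automaton. -/
def IsACState (l : List α) : Prop := l = [] ∨ ∃ f ∈ F, l <+: f

variable {F}

theorem IsACState.of_prefix {l l' : List α} (h : IsACState F l) (hl : l' <+: l) : IsACState F l' := by
  rcases h with rfl | ⟨f, hf, h⟩
  · exact Or.inl (List.prefix_nil.1 hl)
  · exact Or.inr ⟨f, hf, hl.trans h⟩

theorem isACState_of_mem {f : List α} (h : f ∈ F) : IsACState F f := Or.inr ⟨f, h, List.prefix_rfl⟩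

theorem longestState_suffix (l : List α) : (longestState F l).1 <:+ l := by
  induction l with
  | nil => exact List.suffix_rfl
  | cons a l ih =>
    rw [longestState]
    split_ifs with h
    · exact List.suffix_rfl
    · exact ih.trans (List.suffix_cons a l)

theorem suffix_longestState {l t : List α} (ht : IsACState F t) (h : t <:+ l) :
    t <:+ (longestState F l).1 := by
  induction l with
  | nil => exact h
  | cons a l ih =>
    rw [longestState]
    split_ifs with hc
    · exact h
    · rcases List.suffix_cons_iff.1 h with rfl | h
      · exact absurd ht hc
      · exact ih h

theorem eq_longestState {l t : List α} (ht : IsACState F t) (h : t <:+ l)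
    (h' : ∀ t', IsACState F t' → t' <:+ l → t' <:+ t) : t = (longestState F l).1 :=
  (suffix_longestState ht h).eq_of_length_le (h' _ (longestState F l).2 (longestState_suffix l)).length_le

theorem longestState_of_isACState {l : List α} (h : IsACState F l) : (longestState F l).1 = l :=
  (eq_longestState h List.suffix_rfl fun _ _ h => h).symm

/-- What precedes the longest state may be forgotten: a nonempty state that is a suffix of `l a` is
`t' a`, where `t'` is a prefix of a state, hence a state and a suffix of the longest state of `l`.
-/
theorem longestState_concat (l : List α) (a : α) :
    longestState F ((longestState F l).1 ++ [a]) = longestState F (l ++ [a]) := by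
  refine Subtype.ext (eq_longestState (longestState F _).2 ((longestState_suffix _).trans ?_) ?_)
  · exact List.suffix_concat_iff.2 (Or.inr ⟨_, rfl, longestState_suffix l⟩)
  · intro t ht h
    refine suffix_longestState ht ?_
    rcases List.suffix_concat_iff.1 h with rfl | ⟨t', rfl, h'⟩
    · exact List.nil_suffix
    · exact List.suffix_concat_iff.2 (Or.inr ⟨_, rfl,
        suffix_longestState (IsACState.of_prefix ht (List.prefix_append _ _)) h'⟩)

/-- This is the recursion behind failure links: if `b l a` is no state, the search continues from
the longest state that is a suffix of `l`. -/
theorem longestState_cons_concat (b a : α) (l : List α) (h : ¬ IsACState F (b :: l ++ [a])) :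
    longestState F (b :: l ++ [a]) = longestState F ((longestState F l).1 ++ [a]) := by
  rw [longestState_concat]
  show longestState F (b :: (l ++ [a])) = _
  rw [longestState]
  exact dif_neg h

theorem suffix_longestState_iff {f l : List α} (hf : f ∈ F) :
    f <:+ (longestState F l).1 ↔ f <:+ l :=
  ⟨fun h => h.trans (longestState_suffix l), suffix_longestState (isACState_of_mem hf)⟩

theorem ahoCorasick_step_of_mem {q : ACState F} (h : q ∈ (ahoCorasick F).accept) (a : α) :
    (ahoCorasick F).step q a = q := if_pos h

theorem ahoCorasick_step_of_not_mem {q : ACState F} (h : q ∉ (ahoCorasick F).accept) (a : α) :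
    (ahoCorasick F).step q a = longestState F (q.1 ++ [a]) := if_neg h

/-- A run ends in a final state when a word of `F` has been completed on the way; until then, the
state is the longest possible suffix. -/
theorem ahoCorasick_evalFrom (q : ACState F) (w : List α) :
    ((ahoCorasick F).evalFrom q w ∈ (ahoCorasick F).accept ↔
      ∃ u, u <+: w ∧ ∃ f ∈ F, f <:+ q.1 ++ u) ∧
    ((ahoCorasick F).evalFrom q w ∉ (ahoCorasick F).accept →
      (ahoCorasick F).evalFrom q w = longestState F (q.1 ++ w)) := by
  induction w using List.reverseRecOn with
  | nil =>
    rw [DFA.evalFrom_nil]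
    refine ⟨?_, fun _ => ?_⟩
    · simp only [List.prefix_nil, exists_eq_left, List.append_nil]; rfl
    · rw [List.append_nil]; exact Subtype.ext (longestState_of_isACState q.2).symm
  | append_singleton w a ih =>
    rw [DFA.evalFrom_append_singleton]
    by_cases h : (ahoCorasick F).evalFrom q w ∈ (ahoCorasick F).accept
    · rw [ahoCorasick_step_of_mem h]
      obtain ⟨u, hu, hf⟩ := ih.1.1 h
      exact ⟨iff_of_true h ⟨u, hu.trans (List.prefix_append _ _), hf⟩, fun h' => absurd h h'⟩
    · rw [ahoCorasick_step_of_not_mem h, ih.2 h, longestState_concat, ← List.append_assoc]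
      refine ⟨?_, fun _ => rfl⟩
      constructor
      · rintro ⟨f, hf, h'⟩
        exact ⟨w ++ [a], List.prefix_rfl, f, hf,
          by rw [← List.append_assoc]; exact (suffix_longestState_iff hf).1 h'⟩
      · rintro ⟨u, hu, f, hf, h'⟩
        rcases List.prefix_concat_iff.1 hu with rfl | hu
        · exact ⟨f, hf, (suffix_longestState_iff hf).2 (by rwa [← List.append_assoc] at h')⟩
        · exact absurd (ih.1.2 ⟨u, hu, f, hf, h'⟩) h

theorem ahoCorasick_accepts : (ahoCorasick F).accepts = factorLanguage F := by
  ext w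
  refine ((ahoCorasick_evalFrom (F := F) ⟨[], Or.inl rfl⟩ w).1).trans ?_
  constructor
  · rintro ⟨u, hu, f, hf, h⟩
    exact ⟨f, hf, List.IsInfix.trans h.isInfix hu.isInfix⟩
  · rintro ⟨f, hf, s, t, h⟩
    exact ⟨s ++ f, ⟨t, h⟩, f, hf, s, rfl⟩

theorem evalFrom_flatten_replicate {σ : Type*} (M : DFA α σ) {q : σ} {w : List α}
    (h : M.evalFrom q w = q) (k : ℕ) : M.evalFrom q (List.replicate k w).flatten = q := by
  induction k with
  | zero => simp
  | succ k ih => rw [List.replicate_succ, List.flatten_cons, DFA.evalFrom_of_append, h, ih]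

theorem length_flatten_replicate (k : ℕ) (w : List α) :
    (List.replicate k w).flatten.length = k * w.length := by
  simp

/-- There is a cycle through a state that is not final. -/
def HasCycleOutside {σ : Type*} (M : DFA α σ) : Prop :=
  ∃ q w, q ∉ M.accept ∧ w ≠ [] ∧ M.evalFrom q w = q

/-- States on cycles outside of the final states are accessible. -/
theorem ahoCorasick_eval_of_cycle {q : ACState F} {w : List α} (hq : q ∉ (ahoCorasick F).accept)
    (hw : w ≠ []) (h : (ahoCorasick F).evalFrom q w = q) : (ahoCorasick F).eval q.1 = q := by
  -- Going round the cycle this often reads a word `W` at least as long as the name of `q`.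
  set W := (List.replicate q.1.length w).flatten with hW
  have hWq : (ahoCorasick F).evalFrom q W = q := evalFrom_flatten_replicate _ h _
  have hrun := ahoCorasick_evalFrom q W
  rw [hWq] at hrun
  have hlen : q.1.length ≤ W.length := by
    have := List.length_pos_iff.2 hw
    rw [hW, length_flatten_replicate]; nlinarith
  -- The state after reading `W` from `q` is a suffix of `q W`; it is `q` again and not longer than
  -- `W`.
  have hsuf : q.1 <:+ W := by
    refine List.suffix_of_suffix_length_le ?_ (List.suffix_append q.1 W) hlen
    conv_lhs => rw [hrun.2 hq]
    exact longestState_suffix _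
  -- A forbidden factor met while reading the name of `q` would also be met inside `W`, and the run
  -- round the cycle would get stuck in a final state.
  have hfree : (ahoCorasick F).eval q.1 ∉ (ahoCorasick F).accept := by
    rw [DFA.eval, show (ahoCorasick F).start = ⟨[], Or.inl rfl⟩ from rfl, (ahoCorasick_evalFrom _ _).1]
    rintro ⟨u, hu, f, hf, hfu⟩
    obtain ⟨X, hX⟩ := hsuf
    exact hq (hrun.1.2 ⟨X ++ u, hX ▸ (List.prefix_append_right_inj X).2 hu, f, hf,
      hfu.trans ⟨q.1 ++ X, by simp⟩⟩)
  have := (ahoCorasick_evalFrom ⟨[], Or.inl rfl⟩ q.1).2 hfree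
  rw [List.nil_append] at this
  exact this.trans (Subtype.ext (longestState_of_isACState q.2))

theorem ahoCorasick_evalFrom_of_mem {q : ACState F} (hq : q ∈ (ahoCorasick F).accept) (w : List α) :
    (ahoCorasick F).evalFrom q w = q := by
  induction w with
  | nil => rfl
  | cons a w ih => rw [DFA.evalFrom_cons, ahoCorasick_step_of_mem hq, ih]

/-- Final states are never left, so from a cycle through one of them the complement reaches no final
state. A cycle through another state is accessible, and that state is final in the complement. -/
theorem hasUsefulCycle_compl_iff :
    HasUsefulCycle (ahoCorasick F)ᶜ ↔ HasCycleOutside (ahoCorasick F) := by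
  constructor
  · rintro ⟨q, u, w, v, _, hw, hqw, hv⟩
    refine ⟨q, w, fun hq => hv ?_, hw, hqw⟩
    rwa [show (ahoCorasick F)ᶜ.evalFrom q v = (ahoCorasick F).evalFrom q v from rfl,
      ahoCorasick_evalFrom_of_mem hq]
  · rintro ⟨q, w, hq, hw, h⟩
    exact ⟨q, q.1, w, [], ahoCorasick_eval_of_cycle hq hw h, hw, h, hq⟩

theorem hasCycleOutside_reindex {σ τ : Type*} (M : DFA α σ) (e : σ ≃ τ) :
    HasCycleOutside (DFA.reindex e M) ↔ HasCycleOutside M := by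
  constructor
  · rintro ⟨q, w, hq, hw, h⟩
    refine ⟨e.symm q, w, hq, hw, ?_⟩
    rw [DFA.evalFrom_reindex] at h
    rw [← e.apply_eq_iff_eq, h, e.apply_symm_apply]
  · rintro ⟨q, w, hq, hw, h⟩
    refine ⟨e q, w, ?_, hw, ?_⟩
    · simpa [DFA.reindex] using hq
    · rw [DFA.evalFrom_reindex, e.symm_apply_apply, h]

theorem hasUsefulCycle_reindex {σ τ : Type*} (M : DFA α σ) (e : σ ≃ τ) :
    HasUsefulCycle (DFA.reindex e M)ᶜ ↔ HasUsefulCycle Mᶜ := by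
  have h : ∀ q w, (DFA.reindex e M)ᶜ.evalFrom q w = e (Mᶜ.evalFrom (e.symm q) w) := fun q w =>
    DFA.evalFrom_reindex M e q w
  have h' : ∀ w, (DFA.reindex e M)ᶜ.eval w = e (Mᶜ.eval w) := fun w => DFA.eval_reindex M e w
  constructor
  · rintro ⟨q, u, w, v, hu, hw, hqw, hv⟩
    refine ⟨e.symm q, u, w, v, ?_, hw, ?_, ?_⟩
    · rw [← hu, h', e.symm_apply_apply]
    · rw [h] at hqw; rw [← e.apply_eq_iff_eq, hqw, e.apply_symm_apply]
    · rw [h] at hv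
      simpa [DFA.reindex, DFA.compl_def] using hv
  · rintro ⟨q, u, w, v, hu, hw, hqw, hv⟩
    refine ⟨e q, u, w, v, ?_, hw, ?_, ?_⟩
    · rw [← hu, h']
    · rw [h, e.symm_apply_apply, hqw]
    · rw [h, e.symm_apply_apply]
      simpa [DFA.reindex, DFA.compl_def] using hv

/-- The complement of the automaton has a useful cycle if and only if it accepts words of unbounded
length. -/
theorem hasUsefulCycle_compl_iff_unbounded [Finite (ACState F)] :
    HasUsefulCycle (ahoCorasick F)ᶜ ↔ ¬ ∃ n, ∀ w, w ∉ factorLanguage F → w.length ≤ n := by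
  have hacc : ∀ w, w ∉ factorLanguage F ↔ (ahoCorasick F).eval w ∉ (ahoCorasick F).accept := by
    intro w; rw [← ahoCorasick_accepts]; rfl
  constructor
  · rintro ⟨q, u, w, v, hu, hw, hqw, hv⟩ ⟨n, hn⟩
    -- Each of the `n + 1` rounds contributes at least one letter, so the accepted word is longer
    -- than `n`.
    have := hn (u ++ (List.replicate (n + 1) w).flatten ++ v) (by
      rw [hacc, DFA.eval, DFA.evalFrom_of_append, DFA.evalFrom_of_append]
      rw [show (ahoCorasick F).evalFrom (ahoCorasick F).start u = q from hu,
        evalFrom_flatten_replicate _ (show (ahoCorasick F).evalFrom q w = q from hqw)]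
      exact hv)
    have h1 := List.length_pos_iff.2 hw
    simp only [List.length_append, length_flatten_replicate] at this
    nlinarith
  · intro h
    have := Fintype.ofFinite (ACState F)
    push Not at h
    obtain ⟨w, hw, hlen⟩ := h (Fintype.card (ACState F))
    -- A word with more letters than there are states repeats a state; the repeated state lies on a
    -- cycle.
    obtain ⟨q, a, b, c, rfl, _, hb, ha, hq, hc⟩ :=
      (ahoCorasick F).evalFrom_split hlen.le rfl
    refine ⟨q, a, b, c, ha, hb, hq, ?_⟩
    rw [hacc] at hw
    exact fun h => hw (by rw [DFA.eval]; exact hc ▸ h)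

end AhoCorasick
end PinPerm
namespace PinPerm

/-! ### Removing the pins from the last one on -/

/-- The direction in which the first (`h`) or second coordinate grows. -/
def Dir.hi (h : Bool) : Dir := if h then .R else .U

/-- The direction in which the first (`h`) or second coordinate decreases. -/
def Dir.lo (h : Bool) : Dir := if h then .L else .D

@[simp] theorem Dir.isHoriz_hi (h : Bool) : (Dir.hi h).isHoriz = h := by cases h <;> rfl

@[simp] theorem Dir.isHoriz_lo (h : Bool) : (Dir.lo h).isHoriz = h := by cases h <;> rfl

@[simp] theorem Dir.coord_lo (h : Bool) (x : Pin) : (Dir.lo h).coord x = -(Dir.hi h).coord x := by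
  cases h <;> rfl

theorem Dir.eq_hi_or_lo {d : Dir} {h : Bool} (hd : d.isHoriz = h) : d = .hi h ∨ d = .lo h := by
  subst hd; cases d <;> simp [Dir.hi, Dir.lo, Dir.isHoriz]

/-- The quadrants in which a pair of points is increasing. -/
def Quad.inc : Quad → Bool
  | .one => true
  | .two => false
  | .three => true
  | .four => false

/-- The pins that are left have the coordinates `[a, b]` without `x` along the axis `h`, and `[c, d]`
across it, where `f` and `g` translate between the coordinates, and `x` is the coordinate of the pin
removed before. Only the pin next to `x` can be the last one that is left. The result consists of the
directions of the pins, whether the third pin is horizontal, and whether the first two increase. -/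
def back (f g : ℕ → ℕ) (h : Bool) (a b c d x : ℕ) (acc : List Dir) :
    ℕ → Option (List Dir × Bool × Bool)
  | 0 => none
  | n + 1 =>
    -- The line at `x` has the previous pin alone on one side, so that pin sits at `a` or at `b`.
    -- After its removal the axes exchange their roles: its coordinate across the axis is the new
    -- gap, and `a, a + 1` or `b - 1, b` are dropped from the interval.
    if x = a + 1 then
      -- Two pins are left. Their order is not determined, only whether they increase. The third pin
      -- is perpendicular to the axis `h`, along which it separates them.
      if b = a + 2 then some (acc, !h, decide (f a < f b))
      else back g f (!h) c d (a + 2) b (f a) (.lo h :: acc) n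
    else if x = b - 1 then back g f (!h) c d a (b - 2) (f b) (.hi h :: acc) n
    else none

/-- The first `m` pins fill the given coordinates. -/
structure Fits (f g : ℕ → ℕ) (h : Bool) (a b c d x m : ℕ) (p : ℕ → Pin) : Prop where
  along : ∀ j < m, ∃ u : ℕ, (Dir.hi h).coord (p j) = u ∧ a ≤ u ∧ u ≤ b ∧ u ≠ x ∧
    (Dir.hi !h).coord (p j) = f u ∧ c ≤ f u ∧ f u ≤ d ∧ g (f u) = u
  cover : ∀ u, a ≤ u → u ≤ b → u ≠ x → ∃ j < m, (Dir.hi h).coord (p j) = u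
  cover' : ∀ v, c ≤ v → v ≤ d → ∃ j < m, (Dir.hi !h).coord (p j) = v

theorem Coded.coord_ne {p : ℕ → Pin} {w : List Letter} (h : Coded p w) {i j : ℕ} (hi : i ≤ w.length)
    (hj : j ≤ w.length) (hij : i ≠ j) (d : Dir) : d.coord (p i) ≠ d.coord (p j) := by
  rw [Dir.coord_ne_iff]
  have := h.isPinSeq.1 i (by omega) j (by omega) hij
  split_ifs
  exacts [this.1, this.2]

theorem Coded.strict_dir {p : ℕ → Pin} {k : Quad} {s : List Dir} (hp : Coded p (strictWord k s))
    {i : ℕ} (hi : i < s.length) : CodesPin p (i + 1) (.dir s[i]) := by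
  have := hp (i + 1) (by simpa [strictWord] using hi)
  simpa [strictWord] using this

theorem Coded.strict_num {p : ℕ → Pin} {k : Quad} {s : List Dir} (hp : Coded p (strictWord k s))
    (d : Dir) : (k.side d).coord (p 0) < (k.side d).coord (p 1) :=
  codesPin_num.1 (hp 0 (by simp [strictWord])) d 0 le_rfl

theorem Quad.inc_iff {k : Quad} {x y : Pin} (h : ∀ d, (k.side d).coord x < (k.side d).coord y)
    (b : Bool) : k.inc = true ↔
      ((Dir.hi b).coord x < (Dir.hi b).coord y ↔ (Dir.hi !b).coord x < (Dir.hi !b).coord y) := by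
  have h₁ := h .L
  have h₂ := h .U
  revert h₁ h₂
  cases b <;> cases k <;> simp [inc, side, Dir.isHoriz, Quad.h, v, Dir.coord, Dir.hi] <;> omega

/-- It is unknown which of the two pins is the first one, but being increasing does not depend on
that. -/
theorem inc_of_fits {p : ℕ → Pin} {k : Quad} {s : List Dir} {f g : ℕ → ℕ} {h : Bool}
    {a b c d x : ℕ} (hp : Coded p (strictWord k s)) (fit : Fits f g h a b c d x 2 p) (hab : a < b)
    (hx : ∀ u, a ≤ u → u ≤ b → u ≠ x → u = a ∨ u = b) : k.inc = decide (f a < f b) := by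
  obtain ⟨u₀, h₀, b₁, b₂, b₃, b₄, -⟩ := fit.along 0 (by omega)
  obtain ⟨u₁, h₁, b₁', b₂', b₃', b₄', -⟩ := fit.along 1 (by omega)
  have hlen : (strictWord k s).length = s.length + 1 := by simp [strictWord]
  have hne := hp.coord_ne (i := 0) (j := 1) (by omega) (by omega) (by omega) (.hi h)
  have hne' := hp.coord_ne (i := 0) (j := 1) (by omega) (by omega) (by omega) (.hi !h)
  have hinc := Quad.inc_iff hp.strict_num h
  rw [h₀, h₁] at hne
  rw [b₄, b₄'] at hne'
  rw [h₀, h₁, b₄, b₄'] at hinc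
  have hne : u₀ ≠ u₁ := by exact_mod_cast hne
  have hne' : f u₀ ≠ f u₁ := by exact_mod_cast hne'
  simp only [Nat.cast_lt] at hinc
  rw [Bool.eq_iff_iff, decide_eq_true_iff, hinc]
  have hu : (u₀ = a ∧ u₁ = b) ∨ (u₀ = b ∧ u₁ = a) := by
    have := hx u₀ b₁ b₂ b₃
    have := hx u₁ b₁' b₂' b₃'
    omega
  rcases hu with ⟨rfl, rfl⟩ | ⟨rfl, rfl⟩ <;> omega

/-- The procedure is forced to retrace any given sequence: pin `m` lies at `x` and isolates pin `m -
1`, which is therefore an extreme point next to `x`, and the end at which it lies is its letter.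
`acc` collects the letters of the pins that are already removed. -/
theorem back_complete {p : ℕ → Pin} {k : Quad} {s : List Dir} (hp : Coded p (strictWord k s)) :
    ∀ (n m : ℕ) (f g : ℕ → ℕ) (h : Bool) (a b c d x : ℕ) (acc : List Dir), 2 ≤ m →
      (hm : m - 2 < s.length) → m ≤ n → Fits f g h a b c d x m p → b = a + m → d + 1 = c + m →
      (Dir.hi h).coord (p m) = x → s[m - 2].isHoriz ≠ h →
      back f g h a b c d x acc n =
        some (s.take (m - 2) ++ acc, (s.head?.map Dir.isHoriz).getD true, k.inc) := by
  intro n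
  induction n with
  | zero => intros; omega
  | succ n ih =>
    intro m f g h a b c d x acc hm2 hm hmn fit hb hd hx hs
    have hlen : (strictWord k s).length = s.length + 1 := by simp [strictWord]
    obtain ⟨_, e, he, a₁, a₂, a₃⟩ := codesPin_dir.1 (hp.strict_dir hm)
    rw [show m - 2 + 1 + 1 = m by omega] at a₁ a₂ a₃
    rw [show m - 2 + 1 = m - 1 by omega] at a₁ a₂ a₃
    have heh : e.isHoriz = h := by
      revert he hs; cases e.isHoriz <;> cases h <;> cases s[m - 2].isHoriz <;> simp
    obtain ⟨w, hw, haw, hwb, hwx, hfw, hcf, hfd, hgf⟩ := fit.along (m - 1) (by omega)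
    -- The first `m` pins fill `[a, b]` except `x`, and pin `m - 1` is alone on its side of `x`. So
    -- this side contains one coordinate, an end of the interval.
    have side : (w = a ∧ x = a + 1) ∨ (w = b ∧ x + 1 = b) := by
      rcases Dir.eq_hi_or_lo heh with rfl | rfl
      · right
        have hxw : x < w := by rw [hx, hw] at a₂; exact_mod_cast a₂
        have key : ∀ u, x < u → u ≤ b → u = w := by
          intro u hu hub
          have hxu : a ≤ u := by
            have := a₃ 0 (by omega)
            obtain ⟨u', hu', hau, _⟩ := fit.along 0 (by omega)
            rw [hu', hx] at this
            have : u' < x := by exact_mod_cast this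
            omega
          obtain ⟨j, hj, hju⟩ := fit.cover u hxu hub (by omega)
          rcases (show j ≤ m - 1 by omega).lt_or_eq with hlt | rfl
          · have := a₃ j hlt
            rw [hju, hx] at this
            have : u < x := by exact_mod_cast this
            omega
          · rw [hw] at hju; exact_mod_cast hju.symm
        have h1 := key b (by omega) le_rfl
        have h2 := key (x + 1) (by omega) (by omega)
        omega
      · left
        simp only [Dir.coord_lo, neg_lt_neg_iff] at a₂ a₃
        have hxw : w < x := by rw [hx, hw] at a₂; exact_mod_cast a₂
        have key : ∀ u, u < x → a ≤ u → u = w := by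
          intro u hu hub
          have hxu : u ≤ b := by
            have := a₃ 0 (by omega)
            obtain ⟨u', hu', _, hau, _⟩ := fit.along 0 (by omega)
            rw [hu', hx] at this
            have : x < u' := by exact_mod_cast this
            omega
          obtain ⟨j, hj, hju⟩ := fit.cover u hub hxu (by omega)
          rcases (show j ≤ m - 1 by omega).lt_or_eq with hlt | rfl
          · have := a₃ j hlt
            rw [hju, hx] at this
            have : x < u := by exact_mod_cast this
            omega
          · rw [hw] at hju; exact_mod_cast hju.symm
        have h1 := key a (by omega) le_rfl
        have h2 := key (x - 1) (by omega) (by omega)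
        omega
    rcases hm2.eq_or_lt with rfl | hm3
    · have hxa : x = a + 1 := by omega
      have hs0 : (s.head?.map Dir.isHoriz).getD true = !h := by
        rw [List.head?_eq_getElem?, List.getElem?_eq_getElem hm]
        revert hs; cases h <;> simp
      rw [back, if_pos hxa, if_pos hb, hs0]
      have := inc_of_fits hp fit (by omega) (fun u h₁ h₂ h₃ => by omega)
      simp [this]
    · have hlt : m - 1 - 2 < s.length := by omega
      obtain ⟨_, e', he', a₁', a₂', a₃'⟩ := codesPin_dir.1 (hp.strict_dir hlt)
      rw [show m - 1 - 2 + 1 + 1 = m - 1 by omega] at a₁' a₂' a₃'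
      rw [show m - 1 - 2 + 1 = m - 2 by omega] at a₁' a₂' a₃'
      -- A pin that is extreme in a direction along `h` has this direction as its letter; otherwise
      -- it would lie between its predecessor and the earlier pins along that axis.
      have hdir : ∀ d' : Dir, (∀ j < m - 1, d'.coord (p j) < d'.coord (p (m - 1))) →
          d'.isHoriz = h → s[m - 1 - 2] = d' := by
        intro d' hd' hdh
        have x₁ := hd' 0 (by omega)
        have x₂ := hd' (m - 2) (by omega)
        have x₃ := a₁' 0 (by omega)
        have x₄ := a₃' 0 (by omega)
        by_cases hpar : s[m - 1 - 2].isHoriz = d'.isHoriz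
        · rcases Dir.eq_or_eq_opp hpar with h' | h'
          · exact h'
          · rw [h'] at x₃; simp only [Dir.coord_opp] at x₃; omega
        · exfalso
          have : e'.isHoriz = d'.isHoriz := by
            revert hpar he'
            cases s[m - 1 - 2].isHoriz <;> cases e'.isHoriz <;> cases d'.isHoriz <;> simp
          rcases Dir.eq_or_eq_opp this with h' | h'
          · rw [h'] at a₂'; omega
          · rw [h'] at x₄; simp only [Dir.coord_opp] at x₄; omega
      have huniq : ∀ j < m, ∀ d : Dir, d.coord (p j) = d.coord (p (m - 1)) → j = m - 1 := by
        intro j hj d hjd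
        by_contra hne
        exact hp.coord_ne (by omega) (by omega) hne d hjd
      have htake : s.take (m - 2) = s.take (m - 1 - 2) ++ [s[m - 1 - 2]] := by
        rw [show m - 2 = m - 1 - 2 + 1 by omega, List.take_succ_eq_append_getElem hlt]
      have hnot : ∀ b' : Dir, b'.isHoriz = h → b'.isHoriz ≠ !h := by
        intro b' hb'; rw [hb']; cases h <;> simp
      -- Without pin `m - 1` the remaining pins fit again, with exchanged axes and the gap `f w`.
      have hfit : ∀ a' b', (∀ u, (a ≤ u ∧ u ≤ b ∧ u ≠ x ∧ u ≠ w) ↔ (a' ≤ u ∧ u ≤ b')) →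
          Fits g f (!h) c d a' b' (f w) (m - 1) p := by
        intro a' b' hab
        refine ⟨fun j hj => ?_, fun v hcv hvd hv => ?_, fun u hau hub => ?_⟩
        · obtain ⟨u, c₁, c₂, c₃, c₄, c₅, c₆, c₇, c₈⟩ := fit.along j (by omega)
          have huw : u ≠ w := by
            rintro rfl
            have := huniq j (by omega) _ (c₁.trans hw.symm)
            omega
          have := (hab u).1 ⟨c₂, c₃, c₄, huw⟩
          refine ⟨f u, c₅, c₆, c₇, fun h => ?_, ?_, ?_, ?_, ?_⟩
          · have := huniq j (by omega) _ (c₅.trans ((congrArg _ h).trans hfw.symm))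
            omega
          · rw [Bool.not_not, c₁, c₈]
          · rw [c₈]; exact this.1
          · rw [c₈]; exact this.2
          · rw [c₈]
        · obtain ⟨j, hj, hjv⟩ := fit.cover' v hcv hvd
          refine ⟨j, ?_, hjv⟩
          by_contra hc
          obtain rfl : j = m - 1 := by omega
          rw [hfw] at hjv
          exact hv (by exact_mod_cast hjv.symm)
        · have h4 := (hab u).2 ⟨hau, hub⟩
          obtain ⟨j, hj, hju⟩ := fit.cover u h4.1 h4.2.1 h4.2.2.1
          refine ⟨j, ?_, by rw [Bool.not_not]; exact hju⟩
          by_contra hc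
          obtain rfl : j = m - 1 := by omega
          rw [hw] at hju
          exact h4.2.2.2 (by exact_mod_cast hju.symm)
      rcases side with ⟨rfl, rfl⟩ | ⟨rfl, hxb⟩
      · have hlo := hdir (.lo h) (fun j hj => by
          obtain ⟨u, hu, c₁, c₂, c₃, -⟩ := fit.along j (by omega)
          simp only [Dir.coord_lo, neg_lt_neg_iff, hw, hu]
          have : u ≠ w := by
            rintro rfl
            have := huniq j (by omega) _ (hu.trans hw.symm)
            omega
          exact_mod_cast (show w < u by omega)) (by simp)
        rw [back, if_pos rfl, if_neg (by omega), htake, hlo, List.append_assoc]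
        refine ih (m - 1) g f (!h) c d (w + 2) b (f w) _ (by omega) hlt (by omega)
          (hfit _ _ fun u => by omega) (by omega) (by omega) hfw ?_
        rw [hlo]; exact hnot _ (by simp)
      · have hhi := hdir (.hi h) (fun j hj => by
          obtain ⟨u, hu, c₁, c₂, c₃, -⟩ := fit.along j (by omega)
          simp only [hw, hu]
          have : u ≠ w := by
            rintro rfl
            have := huniq j (by omega) _ (hu.trans hw.symm)
            omega
          exact_mod_cast (show u < w by omega)) (by simp)
        rw [back, if_neg (by omega), if_pos (by omega), htake, hhi, List.append_assoc]
        refine ih (m - 1) g f (!h) c d a (w - 2) (f w) _ (by omega) hlt (by omega)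
          (hfit _ _ fun u => by omega) (by omega) (by omega) hfw ?_
        rw [hhi]; exact hnot _ (by simp)

end PinPerm
namespace PinPerm

/-! ### Rebuilding pin sequences from successful removals -/

/-- The point with the given coordinates along and across the axis `h`. -/
def pt (h : Bool) (u v : ℤ) : Pin := if h then (u, v) else (v, u)

@[simp] theorem coord_hi_pt (h : Bool) (u v : ℤ) : (Dir.hi h).coord (pt h u v) = u := by
  cases h <;> rfl

@[simp] theorem coord_hi_not_pt (h : Bool) (u v : ℤ) : (Dir.hi !h).coord (pt h u v) = v := by
  cases h <;> rfl

/-- Coding depends only on the order of the coordinates, so pins may be moved to other coordinates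
in the same order. -/
theorem Coded.congr {p p' : ℕ → Pin} {w : List Letter} (h : Coded p w)
    (hp : ∀ i ≤ w.length, ∀ j ≤ w.length, ∀ d : Dir,
      d.coord (p i) < d.coord (p j) → d.coord (p' i) < d.coord (p' j)) : Coded p' w := by
  intro i hi
  have := h i hi
  cases hl : w[i] with
  | num q =>
    rw [hl] at this
    exact codesPin_num.2 fun d j hj => hp _ (by omega) _ (by omega) _ (codesPin_num.1 this d j hj)
  | dir d =>
    rw [hl] at this
    obtain ⟨h1, e, he, a₁, a₂, a₃⟩ := codesPin_dir.1 this
    exact codesPin_dir.2 ⟨h1, e, he, fun j hj => hp _ (by omega) _ (by omega) _ (a₁ j hj),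
      hp _ (by omega) _ (by omega) _ a₂, fun j hj => hp _ (by omega) _ (by omega) _ (a₃ j hj)⟩

theorem coded_extend {p : ℕ → Pin} {k : Quad} {s : List Dir} {m : ℕ} {d e : Dir} {z : Pin}
    (hp : Coded p (strictWord k s)) (hm : s.length + 2 = m) (hde : e.isHoriz ≠ d.isHoriz)
    (hz : ∀ j < m, d.coord (p j) < d.coord z) (h₁ : e.coord z < e.coord (p (m - 1)))
    (h₂ : ∀ j < m - 1, e.coord (p j) < e.coord z) :
    Coded (Function.update p m z) (strictWord k (s ++ [d])) := by
  intro i hi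
  have hl : (strictWord k s).length = s.length + 1 := by simp [strictWord]
  have hl' : (strictWord k (s ++ [d])).length = s.length + 2 := by simp [strictWord]
  have hs : strictWord k (s ++ [d]) = strictWord k s ++ [.dir d] := by simp [strictWord]
  simp only [hs]
  rcases (show i ≤ s.length + 1 by omega).lt_or_eq with h | rfl
  · rw [List.getElem_append_left (by omega)]
    have hc : Coded (Function.update p m z) (strictWord k s) := hp.congr fun i hi j hj d => by
      rw [Function.update_of_ne (by omega), Function.update_of_ne (by omega)]; exact id
    exact hc i (by omega)
  · rw [List.getElem_append_right (by omega)]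
    simp only [hl, Nat.sub_self, List.getElem_cons_zero]
    have hm' : s.length + 1 + 1 = m := by omega
    have hm1 : s.length + 1 = m - 1 := by omega
    refine codesPin_dir.2 ⟨by omega, e, hde, fun j hj => ?_, ?_, fun j hj => ?_⟩
    · rw [hm', Function.update_self, Function.update_of_ne (by omega)]; exact hz j (by omega)
    · rw [hm', Function.update_self, Function.update_of_ne (by omega), hm1]; exact h₁
    · rw [hm', Function.update_self, Function.update_of_ne (by omega)]; exact h₂ j (by omega)

/-- The given coordinates belong to the points of a permutation. -/
structure Graph (f g : ℕ → ℕ) (a b c d x : ℕ) : Prop where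
  fwd : ∀ u, a ≤ u → u ≤ b → u ≠ x → c ≤ f u ∧ f u ≤ d ∧ g (f u) = u
  bwd : ∀ v, c ≤ v → v ≤ d → a ≤ g v ∧ g v ≤ b ∧ g v ≠ x ∧ f (g v) = v

/-- Mirrors one removal: the axes are exchanged, and the value of the removed point becomes the gap.
-/
theorem Graph.erase {f g : ℕ → ℕ} {a b c d x w a' b' : ℕ} (hG : Graph f g a b c d x)
    (hw : a ≤ w ∧ w ≤ b ∧ w ≠ x)
    (hab : ∀ u, (a ≤ u ∧ u ≤ b ∧ u ≠ x ∧ u ≠ w) ↔ (a' ≤ u ∧ u ≤ b')) :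
    Graph g f c d a' b' (f w) := by
  refine ⟨fun v hc hd hv => ?_, fun u ha hb => ?_⟩
  · obtain ⟨h₁, h₂, h₃, h₄⟩ := hG.bwd v hc hd
    have := (hab (g v)).1 ⟨h₁, h₂, h₃, by rintro rfl; exact hv h₄.symm⟩
    exact ⟨this.1, this.2, h₄⟩
  · obtain ⟨h₁, h₂, h₃, h₄⟩ := (hab u).2 ⟨ha, hb⟩
    obtain ⟨k₁, k₂, k₃⟩ := hG.fwd u h₁ h₂ h₃
    refine ⟨k₁, k₂, fun h => h₄ ?_, k₃⟩
    rw [← k₃, h, (hG.fwd w hw.1 hw.2.1 hw.2.2).2.2]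

/-- There are pins with the given coordinates and directions, and the coordinate `x` separates the
last one from the others. -/
def HasPins (f g : ℕ → ℕ) (h : Bool) (a b c d x m : ℕ) (k : Quad) (s : List Dir) : Prop :=
  ∃ p, Coded p (strictWord k s) ∧ Fits f g h a b c d x m p ∧ ∃ e : Dir, e.isHoriz = h ∧
    ∀ z : Pin, (Dir.hi h).coord z = x → e.coord z < e.coord (p (m - 1)) ∧
      ∀ j < m - 1, e.coord (p j) < e.coord z

/-- The two points may be taken in either order, and this choice realizes both quadrants with the
right monotonicity. -/
theorem fits_two {f g : ℕ → ℕ} {h : Bool} {a b c d x : ℕ} (hG : Graph f g a b c d x) (hab : a < b)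
    (hxa : x ≠ a) (hxb : x ≠ b) (hx : ∀ u, a ≤ u → u ≤ b → u ≠ x → u = a ∨ u = b)
    {k : Quad} (hk : k.inc = decide (f a < f b)) :
    ∃ (p : ℕ → Pin) (u₀ u₁ : ℕ), Coded p (strictWord k []) ∧ Fits f g h a b c d x 2 p ∧
      (Dir.hi h).coord (p 0) = u₀ ∧ (Dir.hi h).coord (p 1) = u₁ ∧
      (u₀ = a ∧ u₁ = b ∨ u₀ = b ∧ u₁ = a) := by
  obtain ⟨a₁, a₂, a₃⟩ := hG.fwd a le_rfl (by omega) (by omega)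
  obtain ⟨b₁, b₂, b₃⟩ := hG.fwd b (by omega) le_rfl (by omega)
  have hne : f a ≠ f b := fun h => by rw [h, b₃] at a₃; omega
  have main : ∀ u₀ u₁, (u₀ = a ∧ u₁ = b ∨ u₀ = b ∧ u₁ = a) →
      (∀ d, (k.side d).coord (pt h u₀ (f u₀)) < (k.side d).coord (pt h u₁ (f u₁))) →
      ∃ (p : ℕ → Pin) (u₀ u₁ : ℕ), Coded p (strictWord k []) ∧ Fits f g h a b c d x 2 p ∧
      (Dir.hi h).coord (p 0) = u₀ ∧ (Dir.hi h).coord (p 1) = u₁ ∧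
      (u₀ = a ∧ u₁ = b ∨ u₀ = b ∧ u₁ = a) := by
    intro u₀ u₁ hu hq
    refine ⟨fun j => if j = 0 then pt h u₀ (f u₀) else pt h u₁ (f u₁), u₀, u₁, ?_, ⟨?_, ?_, ?_⟩,
      by simp, by simp, hu⟩
    · intro i hi
      obtain rfl : i = 0 := by simpa [strictWord] using hi
      refine codesPin_num.2 fun d j hj => ?_
      obtain rfl : j = 0 := by omega
      exact hq d
    · intro j hj
      refine ⟨if j = 0 then u₀ else u₁, ?_⟩
      split_ifs <;> rcases hu with ⟨rfl, rfl⟩ | ⟨rfl, rfl⟩ <;>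
        refine ⟨by simp, by omega, by omega, by omega, by simp, ?_, ?_, ?_⟩ <;> assumption
    · intro u h₁ h₂ h₃
      have := hx u h₁ h₂ h₃
      rcases (show u = u₀ ∨ u = u₁ by omega) with rfl | rfl
      · exact ⟨0, by omega, by simp⟩
      · exact ⟨1, by omega, by simp⟩
    · intro v h₁ h₂
      obtain ⟨k₁, k₂, k₃, k₄⟩ := hG.bwd v h₁ h₂
      have := hx _ k₁ k₂ k₃
      rcases (show g v = u₀ ∨ g v = u₁ by omega) with hv | hv
      · exact ⟨0, by omega, by simp [← hv, k₄]⟩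
      · exact ⟨1, by omega, by simp [← hv, k₄]⟩
  by_cases hs : k.side (.hi h) = .hi h
  · refine main a b (Or.inl ⟨rfl, rfl⟩) fun d => ?_
    revert hk hs
    cases d <;> cases k <;> cases h <;>
      simp [Quad.inc, Quad.side, Quad.h, Quad.v, Dir.hi, Dir.isHoriz, Dir.coord, pt] <;> omega
  · refine main b a (Or.inr ⟨rfl, rfl⟩) fun d => ?_
    revert hk hs
    cases d <;> cases k <;> cases h <;>
      simp [Quad.inc, Quad.side, Quad.h, Quad.v, Dir.hi, Dir.isHoriz, Dir.coord, pt] <;> omega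

theorem hasPins_two {f g : ℕ → ℕ} {h : Bool} {a c d : ℕ} (hG : Graph f g a (a + 2) c d (a + 1))
    {k : Quad} (hk : k.inc = decide (f a < f (a + 2))) :
    HasPins f g h a (a + 2) c d (a + 1) 2 k [] := by
  obtain ⟨p, u₀, u₁, hp, fit, h₀, h₁, hu⟩ := fits_two hG (by omega) (by omega) (by omega)
    (fun u _ _ _ => by omega) hk
  refine ⟨p, hp, fit, ?_⟩
  rcases hu with ⟨rfl, rfl⟩ | ⟨rfl, rfl⟩
  · refine ⟨.hi h, by simp, fun z hz => ⟨by simp [hz, h₁], fun j hj => ?_⟩⟩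
    obtain rfl : j = 0 := by omega
    simp [hz, h₀]
  · refine ⟨.lo h, by simp, fun z hz => ⟨by simp [hz, h₁], fun j hj => ?_⟩⟩
    obtain rfl : j = 0 := by omega
    simp [hz, h₀]

theorem Fits.extend {f g : ℕ → ℕ} {h : Bool} {a b c d x m w a' b' : ℕ} {p : ℕ → Pin}
    (hG : Graph f g a b c d x) (hw : a ≤ w ∧ w ≤ b ∧ w ≠ x)
    (hab : ∀ u, (a ≤ u ∧ u ≤ b ∧ u ≠ x ∧ u ≠ w) ↔ (a' ≤ u ∧ u ≤ b'))
    (fit : Fits g f (!h) c d a' b' (f w) m p) :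
    Fits f g h a b c d x (m + 1) (Function.update p m (pt h w (f w))) := by
  refine ⟨fun j hj => ?_, fun u h₁ h₂ h₃ => ?_, fun v h₁ h₂ => ?_⟩
  · rcases (show j ≤ m by omega).lt_or_eq with hlt | rfl
    · rw [Function.update_of_ne (by omega)]
      obtain ⟨v, c₁, c₂, c₃, c₄, c₅, c₆, c₇, c₈⟩ := fit.along j hlt
      rw [Bool.not_not] at c₅
      obtain ⟨k₁, k₂, k₃, -⟩ := (hab (g v)).2 ⟨c₆, c₇⟩
      exact ⟨g v, c₅, k₁, k₂, k₃, by rw [c₈, c₁], by rwa [c₈], by rwa [c₈], by rw [c₈]⟩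
    · rw [Function.update_self]
      obtain ⟨k₁, k₂, k₃⟩ := hG.fwd w hw.1 hw.2.1 hw.2.2
      exact ⟨w, by simp, hw.1, hw.2.1, hw.2.2, by simp, k₁, k₂, k₃⟩
  · by_cases huw : u = w
    · exact ⟨m, by omega, by simp [huw]⟩
    · obtain ⟨h₄, h₅⟩ := (hab u).1 ⟨h₁, h₂, h₃, huw⟩
      obtain ⟨j, hj, hju⟩ := fit.cover' u h₄ h₅
      rw [Bool.not_not] at hju
      exact ⟨j, by omega, by rwa [Function.update_of_ne (by omega)]⟩
  · by_cases hvw : v = f w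
    · exact ⟨m, by omega, by simp [hvw]⟩
    · obtain ⟨j, hj, hju⟩ := fit.cover v h₁ h₂ hvw
      exact ⟨j, by omega, by rwa [Function.update_of_ne (by omega)]⟩

/-- The removed pin at `w` is put back as the last one. By `hx` the coordinate `x` lies between it
and all the others, so it is in turn the pin that `x` isolates. -/
theorem HasPins.extend {f g : ℕ → ℕ} {h : Bool} {a b c d x m w a' b' : ℕ} {k : Quad} {s : List Dir}
    {dd : Dir} (hG : Graph f g a b c d x) (hw : a ≤ w ∧ w ≤ b ∧ w ≠ x)
    (hab : ∀ u, (a ≤ u ∧ u ≤ b ∧ u ≠ x ∧ u ≠ w) ↔ (a' ≤ u ∧ u ≤ b'))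
    (hdd : dd.isHoriz = h) (hx : ∀ z : Pin, (Dir.hi h).coord z = x → ∀ u : ℕ, a' ≤ u → u ≤ b' →
      ∀ v : ℤ, dd.coord (pt h u v) < dd.coord z ∧ dd.coord z < dd.coord (pt h w v))
    (hs : s.length + 2 = m) (H : HasPins g f (!h) c d a' b' (f w) m k s) :
    HasPins f g h a b c d x (m + 1) k (s ++ [dd]) := by
  obtain ⟨p, hp, fit, e, he, hsep⟩ := H
  have hpt : ∀ y z : Pin, (Dir.hi h).coord y = (Dir.hi h).coord z → dd.coord y = dd.coord z := by
    intro y z hyz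
    rcases Dir.eq_hi_or_lo hdd with rfl | rfl
    · exact hyz
    · simp [hyz]
  have hbeyond : ∀ z : Pin, (Dir.hi h).coord z = x → ∀ j < m, dd.coord (p j) < dd.coord z ∧
      dd.coord z < dd.coord (pt h w (f w)) := by
    intro z hz j hj
    obtain ⟨v, c₁, c₂, c₃, c₄, c₅, c₆, c₇, c₈⟩ := fit.along j hj
    rw [Bool.not_not] at c₅
    have := hx z hz (g v) c₆ c₇ (f w)
    rw [hpt (p j) (pt h (g v) (f w)) (by rw [c₅, coord_hi_pt])]
    exact this
  have hc := hsep (pt h w (f w)) (by simp)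
  refine ⟨Function.update p m (pt h w (f w)), ?_, fit.extend hG hw hab, dd, hdd, fun z hz => ?_⟩
  · refine coded_extend hp hs (by rw [he, hdd]; cases h <;> simp) (fun j hj => ?_) hc.1 hc.2
    have := hbeyond (pt h x 0) (by simp) j hj
    exact this.1.trans this.2
  · rw [Nat.add_sub_cancel, Function.update_self]
    refine ⟨(hbeyond z hz 0 (by omega)).2, fun j hj => ?_⟩
    rw [Function.update_of_ne (by omega)]
    exact (hbeyond z hz j hj).1

/-- Undoing the recursion puts the removed pins back one at a time with `HasPins.extend`; the two
pins of the base case account for all `k` with the same `inc`. The condition on `acc.head?` ensures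
that `hz` is the axis of the first direction. -/
theorem back_sound : ∀ (n m : ℕ) (f g : ℕ → ℕ) (h : Bool) (a b c d x : ℕ) (acc r : List Dir)
    (hz inc : Bool), back f g h a b c d x acc n = some (r, hz, inc) → Graph f g a b c d x → 2 ≤ m →
    b = a + m → d + 1 = c + m → ∃ s, r = s ++ acc ∧ s.length + 2 = m ∧
      ((∀ d ∈ acc.head?, d.isHoriz = !h) → ∀ d ∈ r.head?, d.isHoriz = hz) ∧
      ∀ k : Quad, k.inc = inc → HasPins f g h a b c d x m k s := by
  intro n
  induction n with
  | zero => intro m f g h a b c d x acc r hz inc hb; simp [back] at hb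
  | succ n ih =>
    intro m f g h a b c d x acc r hz inc hb hG hm hba hdc
    rw [back] at hb
    split_ifs at hb with h₁ h₂ h₂
    · simp only [Option.some.injEq, Prod.mk.injEq] at hb
      obtain ⟨rfl, rfl, rfl⟩ := hb
      subst h₁ h₂
      obtain rfl : m = 2 := by omega
      exact ⟨[], rfl, rfl, id, fun k hk => hasPins_two hG hk⟩
    · subst h₁
      have hab : ∀ u, (a ≤ u ∧ u ≤ b ∧ u ≠ a + 1 ∧ u ≠ a) ↔ (a + 2 ≤ u ∧ u ≤ b) := by
        intro u; omega
      have hw : a ≤ a ∧ a ≤ b ∧ a ≠ a + 1 := by omega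
      obtain ⟨s, rfl, hs, hh, hk⟩ := ih (m - 1) _ _ _ _ _ _ _ _ _ _ _ _ hb (hG.erase hw hab)
        (by omega) (by omega) (by omega)
      refine ⟨s ++ [.lo h], by simp, by simp; omega, fun _ => hh (by simp), fun k hki => ?_⟩
      have := (hk k hki).extend (dd := .lo h) hG hw hab (by simp) (fun z hz u hu hu' v => by
        simp only [Dir.coord_lo, coord_hi_pt, hz]; omega) hs
      rwa [show m - 1 + 1 = m by omega] at this
    · have hab : ∀ u, (a ≤ u ∧ u ≤ b ∧ u ≠ x ∧ u ≠ b) ↔ (a ≤ u ∧ u ≤ b - 2) := by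
        intro u; omega
      have hw : a ≤ b ∧ b ≤ b ∧ b ≠ x := by omega
      obtain ⟨s, rfl, hs, hh, hk⟩ := ih (m - 1) _ _ _ _ _ _ _ _ _ _ _ _ hb (hG.erase hw hab)
        (by omega) (by omega) (by omega)
      refine ⟨s ++ [.hi h], by simp, by simp; omega, fun _ => hh (by simp), fun k hki => ?_⟩
      have := (hk k hki).extend (dd := .hi h) hG hw hab (by simp) (fun z hz u hu hu' v => by
        simp only [coord_hi_pt, hz]; omega) hs
      rwa [show m - 1 + 1 = m by omega] at this

end PinPerm
namespace PinPerm

/-! ### The pin words of a simple permutation -/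

/-- By simplicity all letters after the second are directions, so the pins without the origin form a
proper sequence. Conversely each proper sequence admits an origin for every pair in `heads`. -/
theorem mem_pinWords_of_simple {σ : Permutation} (hσ : IsSimplePerm σ) (h2 : 2 ≤ σ.1)
    {w : List Letter} : w ∈ pinWords σ ↔ ∃ (k : Quad) (s : List Dir) (b : Bool) (p : ℕ → Pin),
      s.length + 2 = σ.1 ∧ (∀ d ∈ s.head?, d.isHoriz = b) ∧ Coded p (strictWord k s) ∧
      Represents p σ ∧ ∃ x ∈ heads k b, w = x.1 :: x.2 :: s.map .dir := by
  constructor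
  · intro hw
    obtain ⟨hl, P, hr, hP⟩ := mem_pinWords.1 hw
    obtain ⟨l₁, l₂, t, rfl⟩ : ∃ l₁ l₂ t, w = l₁ :: l₂ :: t := by
      match w, hl ▸ h2 with
      | l₁ :: l₂ :: t, _ => exact ⟨l₁, l₂, t, rfl⟩
    obtain ⟨s, rfl⟩ : ∃ s : List Dir, t = s.map .dir := by
      have : ∀ l ∈ t, ∃ d, Letter.dir d = l := by
        intro l hl'
        obtain ⟨i, hi, rfl⟩ := List.mem_iff_getElem.1 hl'
        obtain ⟨d, hd⟩ := hP.isDir_of_simple hl hr hσ (i := i + 2) (by omega) (by simpa using hi)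
        exact ⟨d, by simpa using hd.symm⟩
      have ht : t ∈ Set.range (List.map Letter.dir) := by rw [Set.range_list_map]; exact this
      exact ht.imp fun _ h => h.symm
    obtain ⟨k, b, hc, hb, hx⟩ := hP.exists_heads
    exact ⟨k, s, b, _, by simpa using hl, hb, hc, hr, _, hx, rfl⟩
  · rintro ⟨k, s, b, p, hs, hb, hp, hr, ⟨l₁, l₂⟩, hx, rfl⟩
    obtain ⟨O, hO⟩ := exists_origin hp hb hx
    exact mem_pinWords.2 ⟨by simpa using hs, _, represents_withOrigin hr, hO⟩

/-- The tables of the values of a permutation and of its inverse, from `1` on. -/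
def Tables (f g : ℕ → ℕ) (σ : Permutation) : Prop :=
  ∀ i : Fin σ.1, f (i + 1) = σ.2 i + 1 ∧ g (σ.2 i + 1) = i + 1

/-- The gap `0` lies outside `[1, n]`, so no coordinate is missing. -/
theorem Tables.graph {f g : ℕ → ℕ} {σ : Permutation} (h : Tables f g σ) :
    Graph f g 1 σ.1 1 σ.1 0 := by
  refine ⟨fun u h₁ h₂ _ => ?_, fun v h₁ h₂ => ?_⟩
  · obtain ⟨a, b⟩ := h ⟨u - 1, by omega⟩
    simp only [Nat.sub_add_cancel h₁] at a b
    have := (σ.2 ⟨u - 1, by omega⟩).2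
    rw [a]
    exact ⟨by omega, by omega, b⟩
  · obtain ⟨a, b⟩ := h (σ.2.symm ⟨v - 1, by omega⟩)
    simp only [Equiv.apply_symm_apply, Nat.sub_add_cancel h₁] at a b
    have := (σ.2.symm ⟨v - 1, by omega⟩).2
    rw [b]
    exact ⟨by omega, by omega, by omega, a⟩

theorem Graph.swap {f g : ℕ → ℕ} {n : ℕ} (h : Graph f g 1 n 1 n 0) : Graph g f 1 n 1 n 0 := by
  refine ⟨fun u h₁ h₂ _ => ?_, fun v h₁ h₂ => ?_⟩
  · obtain ⟨a, b, c, d⟩ := h.bwd u h₁ h₂; exact ⟨a, b, d⟩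
  · obtain ⟨a, b, c⟩ := h.fwd v h₁ h₂ (by omega); exact ⟨a, b, by omega, c⟩

theorem Fits.swap {f g : ℕ → ℕ} {h : Bool} {n m : ℕ} {p : ℕ → Pin} (hp : Fits f g h 1 n 1 n 0 m p) :
    Fits g f (!h) 1 n 1 n 0 m p := by
  refine ⟨fun j hj => ?_, fun v h₁ h₂ _ => hp.cover' v h₁ h₂, fun u h₁ h₂ => ?_⟩
  · obtain ⟨u, c₁, c₂, c₃, c₄, c₅, c₆, c₇, c₈⟩ := hp.along j hj
    exact ⟨f u, c₅, c₆, c₇, by omega, by rw [Bool.not_not, c₁, c₈], by omega, by omega, by rw [c₈]⟩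
  · rw [Bool.not_not]; exact hp.cover u h₁ h₂ (by omega)

/-- The coordinates are replaced by ranks counted from `1`; `Coded.congr` keeps the word. -/
theorem Represents.exists_fits {f g : ℕ → ℕ} {σ : Permutation} (ht : Tables f g σ) {p : ℕ → Pin}
    {w : List Letter} (hw : w.length + 1 = σ.1) (hp : Coded p w) (hr : Represents p σ) :
    ∃ P, Coded P w ∧ Fits f g true 1 σ.1 1 σ.1 0 σ.1 P := by
  obtain ⟨e, he⟩ := hr
  refine ⟨fun j => if h : j < σ.1 then ((e ⟨j, h⟩ : ℕ) + 1, (σ.2 (e ⟨j, h⟩) : ℕ) + 1) else (0, 0),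
    hp.congr fun i hi j hj d => ?_, ⟨fun j hj => ?_, fun u h₁ h₂ _ => ?_, fun v h₁ h₂ => ?_⟩⟩
  · have h₁ : i < σ.1 := by omega
    have h₂ : j < σ.1 := by omega
    have a : ((p i).1 < (p j).1 ↔ _) ∧ ((p i).2 < (p j).2 ↔ _) := he ⟨i, h₁⟩ ⟨j, h₂⟩
    have b : ((p j).1 < (p i).1 ↔ _) ∧ ((p j).2 < (p i).2 ↔ _) := he ⟨j, h₂⟩ ⟨i, h₁⟩
    simp only [h₁, h₂, dif_pos]
    cases d <;> simp only [Dir.coord] <;> intro h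
    · have := a.2.1 h; rw [Fin.lt_def] at this; omega
    · have := b.2.1 (by omega); rw [Fin.lt_def] at this; omega
    · have := b.1.1 (by omega); rw [Fin.lt_def] at this; omega
    · have := a.1.1 h; rw [Fin.lt_def] at this; omega
  · obtain ⟨a, b⟩ := ht (e ⟨j, hj⟩)
    have := (e ⟨j, hj⟩).2
    have := (σ.2 (e ⟨j, hj⟩)).2
    refine ⟨e ⟨j, hj⟩ + 1, ?_, by omega, by omega, by omega, ?_, by omega, by omega, ?_⟩
    · simp [hj, Dir.hi, Dir.coord]
    · simp [hj, Dir.hi, Dir.coord, a]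
    · rw [a, b]
  · refine ⟨e.symm ⟨u - 1, by omega⟩, (e.symm _).2, ?_⟩
    simp [Dir.hi, Dir.coord]; omega
  · refine ⟨e.symm (σ.2.symm ⟨v - 1, by omega⟩), (e.symm _).2, ?_⟩
    simp [Dir.hi, Dir.coord]; omega

theorem Fits.represents {f g : ℕ → ℕ} {σ : Permutation} (ht : Tables f g σ) {p : ℕ → Pin}
    {w : List Letter} (hw : w.length + 1 = σ.1) (hp : Coded p w)
    (fit : Fits f g true 1 σ.1 1 σ.1 0 σ.1 p) : Represents p σ := by
  choose u c₁ c₂ c₃ c₄ c₅ c₆ using fun j : Fin σ.1 => fit.along j j.2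
  let E : Fin σ.1 → Fin σ.1 := fun j => ⟨u j - 1, by have := c₂ j; have := c₃ j; omega⟩
  have hE : Function.Injective E := by
    intro i j hij
    by_contra hne
    refine hp.coord_ne (i := i) (j := j) (by omega) (by omega) (fun h => hne (Fin.ext h)) (.hi true) ?_
    rw [c₁, c₁]
    have : u i - 1 = u j - 1 := Fin.ext_iff.1 hij
    have := c₂ i
    have := c₂ j
    omega
  refine ⟨Equiv.ofBijective E ((Fintype.bijective_iff_injective_and_card E).2 ⟨hE, rfl⟩), fun a b => ?_⟩
  simp only [Equiv.ofBijective_apply]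
  have h₁ : ∀ j : Fin σ.1, (p j).1 = u j := c₁
  have h₂ : ∀ j : Fin σ.1, (p j).2 = f (u j) := c₅
  have hE1 : ∀ j, (E j : ℕ) + 1 = u j := fun j => by have := c₂ j; simp only [E]; omega
  rw [h₁, h₁, h₂, h₂, ← hE1, ← hE1, (ht (E a)).1, (ht (E b)).1, Fin.lt_def, Fin.lt_def]
  omega

/-- The removal of all pins, if the direction of the last one is given. -/
def start (f g : ℕ → ℕ) (n : ℕ) : Dir → Option (List Dir × Bool × Bool)
  -- If the last pin points up, it is in row `n` and column `g n`: that column is the gap, and the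
  -- rows up to `n - 1` remain.
  | .U => back f g true 1 n 1 (n - 1) (g n) [.U] n
  | .D => back f g true 1 n 2 n (g 1) [.D] n
  | .L => back g f false 1 n 2 n (f 1) [.L] n
  | .R => back g f false 1 n 1 (n - 1) (f n) [.R] n

/-- The last pin is extreme in its direction, so its coordinate there is `1` or `n`; `back_complete`
does the rest. -/
theorem start_eq_of_coded {f g : ℕ → ℕ} {n : ℕ} {p : ℕ → Pin} {k : Quad} {s : List Dir}
    (hs : s.length + 2 = n) (hn : 3 ≤ n) (hp : Coded p (strictWord k s))
    (fit : Fits f g true 1 n 1 n 0 n p) :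
    ∃ d, start f g n d = some (s, (s.head?.map Dir.isHoriz).getD true, k.inc) := by
  have hsl : n - 3 < s.length := by omega
  have hlen : (strictWord k s).length = s.length + 1 := by simp [strictWord]
  have key : ∀ (h : Bool) (F G : ℕ → ℕ), Fits F G h 1 n 1 n 0 n p → s[n - 3].isHoriz = h →
      (s[n - 3] = .hi h ∧ back G F (!h) 1 n 1 (n - 1) (F n) [.hi h] n =
        some (s, (s.head?.map Dir.isHoriz).getD true, k.inc)) ∨
      (s[n - 3] = .lo h ∧ back G F (!h) 1 n 2 n (F 1) [.lo h] n =
        some (s, (s.head?.map Dir.isHoriz).getD true, k.inc)) := by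
    intro h F G fit hh
    obtain ⟨_, e, he, a₁, a₂, a₃⟩ := codesPin_dir.1 (hp.strict_dir hsl)
    rw [show n - 3 + 1 + 1 = n - 1 by omega] at a₁ a₂ a₃
    rw [show n - 3 + 1 = n - 2 by omega] at a₁ a₂ a₃
    obtain ⟨w, c₁, c₂, c₃, c₄, c₅, c₆, c₇, c₈⟩ := fit.along (n - 1) (by omega)
    have huniq : ∀ j < n, ∀ d : Dir, d.coord (p j) = d.coord (p (n - 1)) → j = n - 1 := by
      intro j hj d hjd
      by_contra hne
      exact hp.coord_ne (by omega) (by omega) hne d hjd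
    have hfit : ∀ a' b', (∀ u, (1 ≤ u ∧ u ≤ n ∧ u ≠ w) ↔ (a' ≤ u ∧ u ≤ b')) →
        Fits G F (!h) 1 n a' b' (F w) (n - 1) p := by
      intro a' b' hab
      refine ⟨fun j hj => ?_, fun v hcv hvd hv => ?_, fun u hau hub => ?_⟩
      · obtain ⟨u, k₁, k₂, k₃, k₄, k₅, k₆, k₇, k₈⟩ := fit.along j (by omega)
        have := (hab u).1 ⟨k₂, k₃, by
          rintro rfl
          have := huniq j (by omega) _ (k₁.trans c₁.symm)
          omega⟩
        refine ⟨F u, k₅, k₆, k₇, fun h => ?_, by rw [Bool.not_not, k₁, k₈], ?_, ?_, by rw [k₈]⟩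
        · have := huniq j (by omega) _ (k₅.trans ((congrArg _ h).trans c₅.symm))
          omega
        · rw [k₈]; exact this.1
        · rw [k₈]; exact this.2
      · obtain ⟨j, hj, hjv⟩ := fit.cover' v hcv hvd
        refine ⟨j, ?_, hjv⟩
        by_contra hc
        obtain rfl : j = n - 1 := by omega
        rw [c₅] at hjv
        exact hv (by exact_mod_cast hjv.symm)
      · have h4 := (hab u).2 ⟨hau, hub⟩
        obtain ⟨j, hj, hju⟩ := fit.cover u h4.1 h4.2.1 (by omega)
        refine ⟨j, ?_, by rw [Bool.not_not]; exact hju⟩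
        by_contra hc
        obtain rfl : j = n - 1 := by omega
        rw [c₁] at hju
        exact h4.2.2 (by exact_mod_cast hju.symm)
    have htake : ∀ d, s[n - 3] = d → s.take (n - 1 - 2) ++ [d] = s := by
      rintro d rfl
      rw [show n - 1 - 2 = n - 3 by omega, ← List.take_succ_eq_append_getElem hsl,
        List.take_of_length_le (by omega)]
    have hidx : ∀ i (hi : i < s.length), i = n - 3 → s[i].isHoriz ≠ !h := by
      rintro i hi rfl; rw [hh]; cases h <;> simp
    rcases Dir.eq_hi_or_lo hh with h' | h'
    · left
      have hw : w = n := by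
        obtain ⟨j, hj, hju⟩ := fit.cover n (by omega) le_rfl (by omega)
        rcases (show j ≤ n - 1 by omega).lt_or_eq with hlt | rfl
        · have := a₁ j (by omega)
          rw [h', c₁, hju] at this
          have : n < w := by exact_mod_cast this
          omega
        · rw [c₁] at hju; exact_mod_cast hju
      subst hw
      refine ⟨h', ?_⟩
      have := back_complete hp w (w - 1) _ _ _ _ _ _ _ _ [.hi h] (by omega) (by omega) (by omega)
        (hfit 1 (w - 1) fun u => by omega) (by omega) (by omega) c₅ (hidx (w - 1 - 2) (by omega) (by omega))
      rwa [htake _ h'] at this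
    · right
      have hw : w = 1 := by
        obtain ⟨j, hj, hju⟩ := fit.cover 1 le_rfl (by omega) (by omega)
        rcases (show j ≤ n - 1 by omega).lt_or_eq with hlt | rfl
        · have := a₁ j (by omega)
          rw [h', Dir.coord_lo, Dir.coord_lo, c₁, hju] at this
          have : w < 1 := by omega
          omega
        · rw [c₁] at hju; exact_mod_cast hju
      subst hw
      refine ⟨h', ?_⟩
      have := back_complete hp n (n - 1) _ _ _ _ _ _ _ _ [.lo h] (by omega) (by omega) (by omega)
        (hfit 2 n fun u => by omega) (by omega) (by omega) c₅ (hidx (n - 1 - 2) (by omega) (by omega))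
      rwa [htake _ h'] at this
  cases hh : s[n - 3].isHoriz
  · rcases key false g f fit.swap hh with ⟨_, h⟩ | ⟨_, h⟩
    · exact ⟨.U, h⟩
    · exact ⟨.D, h⟩
  · rcases key true f g fit hh with ⟨_, h⟩ | ⟨_, h⟩
    · exact ⟨.R, h⟩
    · exact ⟨.L, h⟩

/-- `back_sound` rebuilds all pins but the last one, which is then appended at the border; the gap
it leaves across its direction isolates its predecessor. -/
theorem coded_of_start {f g : ℕ → ℕ} {n : ℕ} (hG : Graph f g 1 n 1 n 0) (hn : 3 ≤ n) {d : Dir}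
    {r : List Dir} {hz inc : Bool} (hr : start f g n d = some (r, hz, inc)) :
    r.length + 2 = n ∧ (∀ d ∈ r.head?, d.isHoriz = hz) ∧ ∀ k : Quad, k.inc = inc →
      ∃ p, Coded p (strictWord k r) ∧ Fits f g true 1 n 1 n 0 n p := by
  have key : ∀ (h : Bool) (F G : ℕ → ℕ) (w a' b' : ℕ) (dd : Dir), Graph F G 1 n 1 n 0 →
      1 ≤ w → w ≤ n → (∀ u, (1 ≤ u ∧ u ≤ n ∧ u ≠ 0 ∧ u ≠ w) ↔ (a' ≤ u ∧ u ≤ b')) → b' + 2 = a' + n →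
      dd.isHoriz = h → (∀ u : ℕ, a' ≤ u → u ≤ b' → ∀ v : ℤ,
        dd.coord (pt h u v) < dd.coord (pt h w (F w))) →
      back G F (!h) 1 n a' b' (F w) [dd] n = some (r, hz, inc) →
      r.length + 2 = n ∧ (∀ d ∈ r.head?, d.isHoriz = hz) ∧ ∀ k : Quad, k.inc = inc →
        ∃ p, Coded p (strictWord k r) ∧ Fits F G h 1 n 1 n 0 n p := by
    intro h F G w a' b' dd hG hw1 hwn hab hb' hdd hbey hb
    have hw : 1 ≤ w ∧ w ≤ n ∧ w ≠ 0 := by omega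
    obtain ⟨s, rfl, hs, hh, hk⟩ := back_sound _ (n - 1) _ _ _ _ _ _ _ _ _ _ _ _ hb (hG.erase hw hab)
      (by omega) (by omega) (by omega)
    refine ⟨by simp; omega, hh (by simp [hdd]), fun k hki => ?_⟩
    obtain ⟨p, hp, fit, e, he, hsep⟩ := hk k hki
    have hc := hsep (pt h w (F w)) (by simp)
    refine ⟨Function.update p (n - 1) (pt h w (F w)), ?_, ?_⟩
    · refine coded_extend hp hs (by rw [he, hdd]; cases h <;> simp) (fun j hj => ?_) hc.1 hc.2
      obtain ⟨v, c₁, c₂, c₃, c₄, c₅, c₆, c₇, c₈⟩ := fit.along j hj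
      rw [Bool.not_not] at c₅
      have := hbey (G v) c₆ c₇ 0
      rcases Dir.eq_hi_or_lo hdd with rfl | rfl
      · rw [c₅]; simpa using this
      · rw [Dir.coord_lo, c₅]; simpa using this
    · have := fit.extend hG hw hab
      rwa [show n - 1 + 1 = n by omega] at this
  cases d
  · obtain ⟨h₁, h₂, h₃⟩ := key false g f n 1 (n - 1) .U hG.swap (by omega) le_rfl
      (fun u => by omega) (by omega) rfl (fun u h₁ h₂ v => by simp [pt, Dir.coord]; omega) hr
    exact ⟨h₁, h₂, fun k hk => (h₃ k hk).imp fun p hp => ⟨hp.1, hp.2.swap⟩⟩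
  · obtain ⟨h₁, h₂, h₃⟩ := key false g f 1 2 n .D hG.swap le_rfl (by omega)
      (fun u => by omega) (by omega) rfl (fun u h₁ h₂ v => by simp [pt, Dir.coord]; omega) hr
    exact ⟨h₁, h₂, fun k hk => (h₃ k hk).imp fun p hp => ⟨hp.1, hp.2.swap⟩⟩
  · exact key true f g 1 2 n .L hG le_rfl (by omega)
      (fun u => by omega) (by omega) rfl (fun u h₁ h₂ v => by simp [pt, Dir.coord]; omega) hr
  · exact key true f g n 1 (n - 1) .R hG (by omega) le_rfl
      (fun u => by omega) (by omega) rfl (fun u h₁ h₂ v => by simp [pt, Dir.coord]; omega) hr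

/-- The words with the tail `r`, if the first two pins increase or not, and the third pin is
horizontal or not. -/
def wordsFrom (inc hz : Bool) (r : List Dir) : List (List Letter) :=
  ((Quad.all.filter fun k => k.inc = inc).flatMap fun k => heads k hz).map
    fun x => x.1 :: x.2 :: r.map .dir

/-- The words that a removal of all pins leads to. -/
def wordsOfRun : Option (List Dir × Bool × Bool) → List (List Letter)
  | none => []
  | some (r, hz, inc) => wordsFrom inc hz r

/-- The pin words of a simple permutation that is given by its tables. -/
def wordsOf (f g : ℕ → ℕ) (n : ℕ) : List (List Letter) :=
  -- With no third pin, both kinds of pairs in `heads` are possible.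
  if n = 2 then wordsFrom (decide (f 1 < f 2)) true [] ++ wordsFrom (decide (f 1 < f 2)) false []
  else [.U, .D, .L, .R].flatMap fun d => wordsOfRun (start f g n d)

theorem mem_wordsFrom {inc hz : Bool} {r : List Dir} {w : List Letter} :
    w ∈ wordsFrom inc hz r ↔ ∃ k : Quad, k.inc = inc ∧ ∃ x ∈ heads k hz,
      w = x.1 :: x.2 :: r.map .dir := by
  simp only [wordsFrom, List.mem_map, List.mem_flatMap, List.mem_filter, Quad.mem_all, true_and,
    decide_eq_true_eq]
  constructor
  · rintro ⟨x, ⟨k, hk, hx⟩, rfl⟩; exact ⟨k, hk, x, hx, rfl⟩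
  · rintro ⟨k, hk, x, hx, rfl⟩; exact ⟨x, ⟨k, hk, hx⟩, rfl⟩

/-- Soundness and completeness of the removal combine to show that four runs find all pin words. -/
theorem mem_wordsOf {f g : ℕ → ℕ} {σ : Permutation} (hσ : IsSimplePerm σ) (h2 : 2 ≤ σ.1)
    (ht : Tables f g σ) {w : List Letter} : w ∈ wordsOf f g σ.1 ↔ w ∈ pinWords σ := by
  have hlen : ∀ k s, (strictWord k s).length = s.length + 1 := by simp [strictWord]
  rw [mem_pinWords_of_simple hσ h2, wordsOf]
  split_ifs with hn
  · rw [List.mem_append, mem_wordsFrom, mem_wordsFrom]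
    have hx : ∀ u, 1 ≤ u → u ≤ σ.1 → u ≠ 0 → u = 1 ∨ u = σ.1 := by omega
    constructor
    · have : ∀ b : Bool, (∃ k : Quad, k.inc = decide (f 1 < f 2) ∧ ∃ x ∈ heads k b,
          w = x.1 :: x.2 :: ([] : List Dir).map .dir) → ∃ (k : Quad) (s : List Dir) (b : Bool)
          (p : ℕ → Pin), s.length + 2 = σ.1 ∧ (∀ d ∈ s.head?, d.isHoriz = b) ∧
          Coded p (strictWord k s) ∧ Represents p σ ∧ ∃ x ∈ heads k b,
          w = x.1 :: x.2 :: s.map .dir := by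
        rintro b ⟨k, hk, x, hx', rfl⟩
        obtain ⟨p, _, _, hp, fit, _⟩ := fits_two (h := true) ht.graph (by omega) (by omega) (by omega)
          hx (k := k) (by rw [hk, hn])
        exact ⟨k, [], b, p, by simp [hn], by simp, hp,
          Fits.represents ht (by simp [strictWord, hn]) hp (by rw [hn] at fit ⊢; exact fit), x, hx', rfl⟩
      rintro (h | h)
      exacts [this _ h, this _ h]
    · rintro ⟨k, s, b, p, hs, hb, hp, hr, x, hx', rfl⟩
      obtain rfl : s = [] := List.eq_nil_of_length_eq_zero (by omega)
      obtain ⟨P, hP, fit⟩ := hr.exists_fits ht (by rw [hlen]; omega) hp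
      have : k.inc = decide (f 1 < f 2) := by
        rw [hn] at fit hx
        exact inc_of_fits hP fit (by omega) hx
      cases b
      · exact Or.inr ⟨k, this, x, hx', rfl⟩
      · exact Or.inl ⟨k, this, x, hx', rfl⟩
  · simp only [List.mem_flatMap]
    constructor
    · rintro ⟨d, _, hw⟩
      cases hr : start f g σ.1 d with
      | none => rw [hr] at hw; simp [wordsOfRun] at hw
      | some x =>
        obtain ⟨r, hz, inc⟩ := x
        rw [hr] at hw
        obtain ⟨k, hk, x, hx, rfl⟩ := mem_wordsFrom.1 hw
        obtain ⟨h₁, h₂, h₃⟩ := coded_of_start ht.graph (by omega) hr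
        obtain ⟨p, hp, fit⟩ := h₃ k hk
        exact ⟨k, r, hz, p, h₁, h₂, hp, fit.represents ht (by rw [hlen]; omega) hp, x, hx, rfl⟩
    · rintro ⟨k, s, b, p, hs, hb, hp, hr, x, hx, rfl⟩
      obtain ⟨P, hP, fit⟩ := hr.exists_fits ht (by rw [hlen]; omega) hp
      obtain ⟨d, hd⟩ := start_eq_of_coded hs (by omega) hP fit
      refine ⟨d, by cases d <;> simp, ?_⟩
      rw [hd]
      refine mem_wordsFrom.2 ⟨k, rfl, x, ?_, rfl⟩
      have : b = (s.head?.map Dir.isHoriz).getD true := by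
        cases s with
        | nil => simp at hs; omega
        | cons a s => exact (hb a rfl).symm
      rwa [← this]

end PinPerm
namespace PinPerm

/-! ### Reasoning about programs -/

/-- Started in memory `s`, the program halts after at most `T` steps in a memory with `Q`. -/
def Runs (a : Program) (s : Memory) (T : ℕ) (Q : Memory → Prop) : Prop :=
  ∃ t s', Exec a s t s' ∧ t ≤ T ∧ Q s'

theorem Runs.mono {a : Program} {s : Memory} {T T' : ℕ} {Q Q' : Memory → Prop} (h : Runs a s T Q)
    (hT : T ≤ T') (hQ : ∀ s', Q s' → Q' s') : Runs a s T' Q' := by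
  obtain ⟨t, s', h₁, h₂, h₃⟩ := h
  exact ⟨t, s', h₁, h₂.trans hT, hQ s' h₃⟩

theorem Runs.seq {a b : Program} {s : Memory} {T₁ T₂ T : ℕ} {P Q : Memory → Prop}
    (ha : Runs a s T₁ P) (hb : ∀ s', P s' → Runs b s' T₂ Q) (hT : T₁ + T₂ ≤ T) :
    Runs (a.seq b) s T Q := by
  obtain ⟨t, s', h₁, h₂, h₃⟩ := ha
  obtain ⟨t', s'', k₁, k₂, k₃⟩ := hb s' h₃
  exact ⟨_, _, .seq h₁ k₁, by omega, k₃⟩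

theorem Runs.ite {c : Test} {a b : Program} {s : Memory} {T T' : ℕ} {Q : Memory → Prop}
    (ha : c.Holds s → Runs a s T Q) (hb : ¬ c.Holds s → Runs b s T Q) (hT : T + 1 ≤ T') :
    Runs (.ite c a b) s T' Q := by
  by_cases hc : c.Holds s
  · obtain ⟨t, s', h₁, h₂, h₃⟩ := ha hc
    exact ⟨_, _, .iteTrue hc h₁, by omega, h₃⟩
  · obtain ⟨t, s', h₁, h₂, h₃⟩ := hb hc
    exact ⟨_, _, .iteFalse hc h₁, by omega, h₃⟩

theorem Runs.loop_done {c : Test} {a : Program} {s : Memory} {T : ℕ} {Q : Memory → Prop}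
    (hc : ¬ c.Holds s) (hQ : Q s) (hT : 1 ≤ T) : Runs (.loop c a) s T Q :=
  ⟨_, _, .loopDone hc, hT, hQ⟩

theorem Runs.loop_step {c : Test} {a : Program} {s : Memory} {T₁ T₂ T : ℕ} {P Q : Memory → Prop}
    (hc : c.Holds s) (ha : Runs a s T₁ P) (hl : ∀ s', P s' → Runs (.loop c a) s' T₂ Q)
    (hT : T₁ + T₂ + 1 ≤ T) : Runs (.loop c a) s T Q := by
  obtain ⟨t, s', h₁, h₂, h₃⟩ := ha
  obtain ⟨t', s'', k₁, k₂, k₃⟩ := hl s' h₃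
  exact ⟨_, _, .loopStep hc h₁ k₁, by omega, k₃⟩

/-- A loop with `n` rounds of given cost. -/
theorem Runs.for {c : Test} {a : Program} (I : ℕ → Memory → Prop) (n : ℕ) (T : ℕ → ℕ)
    (step : ∀ i < n, ∀ s, I i s → c.Holds s ∧ Runs a s (T i) (I (i + 1)))
    (done : ∀ s, I n s → ¬ c.Holds s) {s : Memory} (h0 : I 0 s) :
    Runs (.loop c a) s ((∑ i ∈ Finset.range n, (T i + 1)) + 1) (I n) := by
  have : ∀ k ≤ n, ∀ s, I (n - k) s →
      Runs (.loop c a) s ((∑ i ∈ Finset.Ico (n - k) n, (T i + 1)) + 1) (I n) := by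
    intro k
    induction k with
    | zero => intro _ s h; exact .loop_done (done s h) h (by omega)
    | succ k ih =>
      intro hk s h
      obtain ⟨hc, hr⟩ := step _ (by omega) s h
      refine .loop_step hc hr (fun s' h' => ih (by omega) s' ?_) ?_
      · rwa [show n - (k + 1) + 1 = n - k by omega] at h'
      · rw [Finset.sum_eq_sum_Ico_succ_bot (by omega : n - (k + 1) < n),
          show n - (k + 1) + 1 = n - k by omega]
        omega
  have h := this n le_rfl s (by rwa [Nat.sub_self])
  rwa [Nat.sub_self, ← Finset.range_eq_Ico] at h

/-- A loop with rounds of constant cost that decrease a measure. -/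
theorem Runs.while {c : Test} {a : Program} (I : Memory → Prop) (Φ : Memory → ℕ) (T : ℕ)
    (step : ∀ s, I s → c.Holds s → Runs a s T fun s' => I s' ∧ Φ s' < Φ s) {s : Memory} (h0 : I s) :
    Runs (.loop c a) s (Φ s * (T + 1) + 1) fun s' => I s' ∧ ¬ c.Holds s' := by
  have : ∀ n s, I s → Φ s ≤ n → Runs (.loop c a) s (n * (T + 1) + 1) fun s' => I s' ∧ ¬ c.Holds s' := by
    intro n
    induction n with
    | zero =>
      intro s h hn
      by_cases hc : c.Holds s
      · obtain ⟨_, _, _, _, _, h'⟩ := step s h hc; omega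
      · exact .loop_done hc ⟨h, hc⟩ (by omega)
    | succ n ih =>
      intro s h hn
      by_cases hc : c.Holds s
      · exact .loop_step hc (step s h hc) (fun s' h' => ih s' h'.1 (by omega)) (by ring_nf; omega)
      · exact .loop_done hc ⟨h, hc⟩ (by omega)
  exact this _ s h0 le_rfl

/-! #### Programs without loops -/

/-- The weakest precondition of a program without loops. -/
def Program.wp : Program → (Memory → Prop) → Memory → Prop
  | .const r c, Q, s => Q (s.setReg r c)
  | .copy r r', Q, s => Q (s.setReg r (s.reg r'))
  | .inc r, Q, s => Q (s.setReg r (s.reg r + 1))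
  | .dec r, Q, s => Q (s.setReg r (s.reg r - 1))
  | .load r k i, Q, s => Q (s.setReg r (s.arr k (s.reg i)))
  | .store k i r, Q, s => Q (s.setArr k (s.reg i) (s.reg r))
  | .seq a b, Q, s => a.wp (b.wp Q) s
  | .ite c a b, Q, s => (c.Holds s → a.wp Q s) ∧ (¬ c.Holds s → b.wp Q s)
  | .loop _ _, _, _ => False

/-- A bound for the number of steps of a program without loops. -/
def Program.cost : Program → ℕ
  | .seq a b => a.cost + b.cost
  | .ite _ a b => max a.cost b.cost + 1
  | _ => 1

theorem runs_of_wp {a : Program} {s : Memory} {Q : Memory → Prop} (h : a.wp Q s) :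
    Runs a s a.cost Q := by
  induction a generalizing s Q with
  | const r c => exact ⟨_, _, .const r c s, le_rfl, h⟩
  | copy r r' => exact ⟨_, _, .copy r r' s, le_rfl, h⟩
  | inc r => exact ⟨_, _, .inc r s, le_rfl, h⟩
  | dec r => exact ⟨_, _, .dec r s, le_rfl, h⟩
  | load r k i => exact ⟨_, _, .load r k i s, le_rfl, h⟩
  | store k i r => exact ⟨_, _, .store k i r s, le_rfl, h⟩
  | seq a b iha ihb => exact (iha h).seq (fun s' h' => ihb h') le_rfl
  | ite c a b iha ihb =>
    exact .ite (fun hc => (iha (h.1 hc)).mono (le_max_left _ _) fun _ => id)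
      (fun hc => (ihb (h.2 hc)).mono (le_max_right _ _) fun _ => id) le_rfl
  | loop c a => exact h.elim

theorem Runs.of_wp {a : Program} {s : Memory} {Q : Memory → Prop} {T : ℕ} (h : a.wp Q s)
    (hT : a.cost ≤ T) : Runs a s T Q := (runs_of_wp h).mono hT fun _ => id

@[simp] theorem Memory.reg_setReg (s : Memory) (r x r' : ℕ) :
    (s.setReg r x).reg r' = if r' = r then x else s.reg r' := by
  simp [Memory.setReg, Function.update_apply]

@[simp] theorem Memory.arr_setReg (s : Memory) (r x k : ℕ) : (s.setReg r x).arr k = s.arr k := rfl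

@[simp] theorem Memory.reg_setArr (s : Memory) (k i x r : ℕ) : (s.setArr k i x).reg r = s.reg r := rfl

@[simp] theorem Memory.arr_setArr (s : Memory) (k i x k' : ℕ) :
    (s.setArr k i x).arr k' = if k' = k then Function.update (s.arr k) i x else s.arr k' := by
  simp only [Memory.setArr, Function.update_apply]

/-! #### Unchanged memory -/

/-- The registers outside `R` and the arrays outside `A` are the same. -/
def Frame (R A : List ℕ) (s s' : Memory) : Prop :=
  (∀ r, r ∉ R → s'.reg r = s.reg r) ∧ ∀ k, k ∉ A → s'.arr k = s.arr k

theorem Frame.refl (R A : List ℕ) (s : Memory) : Frame R A s s := ⟨fun _ _ => rfl, fun _ _ => rfl⟩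

theorem Frame.trans {R A : List ℕ} {s s' s'' : Memory} (h : Frame R A s s') (h' : Frame R A s' s'') :
    Frame R A s s'' :=
  ⟨fun r hr => (h'.1 r hr).trans (h.1 r hr), fun k hk => (h'.2 k hk).trans (h.2 k hk)⟩

theorem Frame.mono {R A R' A' : List ℕ} {s s' : Memory} (h : Frame R A s s') (hR : R ⊆ R')
    (hA : A ⊆ A') : Frame R' A' s s' :=
  ⟨fun r hr => h.1 r fun h => hr (hR h), fun k hk => h.2 k fun h => hk (hA h)⟩

/-- The program writes only the registers `R` and the arrays `A`. -/
def Program.Writes (R A : List ℕ) : Program → Prop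
  | .const r _ => r ∈ R
  | .copy r _ => r ∈ R
  | .inc r => r ∈ R
  | .dec r => r ∈ R
  | .load r _ _ => r ∈ R
  | .store k _ _ => k ∈ A
  | .seq a b => a.Writes R A ∧ b.Writes R A
  | .ite _ a b => a.Writes R A ∧ b.Writes R A
  | .loop _ a => a.Writes R A

theorem frame_setReg {R A : List ℕ} {r : ℕ} (hr : r ∈ R) (s : Memory) (x : ℕ) :
    Frame R A s (s.setReg r x) := by
  refine ⟨fun r' hr' => ?_, fun k _ => rfl⟩
  rw [Memory.reg_setReg, if_neg (by rintro rfl; exact hr' hr)]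

theorem Exec.frame {R A : List ℕ} {a : Program} {s s' : Memory} {t : ℕ} (h : Exec a s t s')
    (ha : a.Writes R A) : Frame R A s s' := by
  induction h with
  | const r c s => exact frame_setReg ha s _
  | copy r r' s => exact frame_setReg ha s _
  | inc r s => exact frame_setReg ha s _
  | dec r s => exact frame_setReg ha s _
  | load r k i s => exact frame_setReg ha s _
  | store k i r s =>
    refine ⟨fun _ _ => rfl, fun k' hk' => ?_⟩
    rw [Memory.arr_setArr, if_neg (by rintro rfl; exact hk' ha)]
  | seq _ _ i j => exact (i ha.1).trans (j ha.2)
  | iteTrue _ _ i => exact i ha.1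
  | iteFalse _ _ i => exact i ha.2
  | loopDone => exact .refl _ _ _
  | loopStep _ _ _ i j => exact (i ha).trans (j ha)

theorem Runs.frame {a : Program} {s : Memory} {T : ℕ} {Q : Memory → Prop} (h : Runs a s T Q)
    (R A : List ℕ) (ha : a.Writes R A) : Runs a s T fun s' => Q s' ∧ Frame R A s s' := by
  obtain ⟨t, s', h₁, h₂, h₃⟩ := h
  exact ⟨t, s', h₁, h₂, h₃, h₁.frame ha⟩

/-- Programs one after the other. -/
def block : List Program → Program
  | [] => .copy 0 0
  | [a] => a
  | a :: b :: l => .seq a (block (b :: l))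

/-- Runs the program `P (reg r)`, if the register is at most `n`; the register `t` is used for the
comparisons. -/
def switch (r t : ℕ) (P : ℕ → Program) : ℕ → Program
  | 0 => P 0
  | n + 1 => .seq (.const t (n + 1)) (.ite (.eq r t) (P (n + 1)) (switch r t P n))

/-- A value in memory selects among programs fixed in the text. Each of the at most `n` comparisons
costs two steps and changes only register `t`. -/
theorem Runs.switch {r t : ℕ} (hrt : r ≠ t) {P : ℕ → Program} {T : ℕ} {Q : Memory → Prop} :
    ∀ {n : ℕ} {s : Memory}, s.reg r ≤ n →
      (∀ s', Frame [t] [] s s' → Runs (P (s.reg r)) s' T Q) →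
      Runs (switch r t P n) s (2 * n + T) Q := by
  intro n
  induction n with
  | zero =>
    intro s h hP
    rw [Nat.le_zero.1 h] at hP
    exact (hP s (.refl _ _ _)).mono (by omega) fun _ => id
  | succ n ih =>
    intro s h hP
    refine Runs.seq (T₁ := 1) (P := fun s' => s' = s.setReg t (n + 1)) (Runs.of_wp rfl le_rfl) ?_
      (T₂ := 2 * n + T + 1) (by omega)
    rintro _ rfl
    have hf : Frame [t] [] s (s.setReg t (n + 1)) := frame_setReg (by simp) _ _
    have hr : (s.setReg t (n + 1)).reg r = s.reg r := by simp [hrt]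
    refine .ite (fun hc => ?_) (fun hc => ?_) le_rfl
    · simp only [Test.Holds, hr, Memory.reg_setReg, if_true] at hc
      rw [hc] at hP
      exact (hP _ hf).mono (by omega) fun _ => id
    · simp only [Test.Holds, hr, Memory.reg_setReg, if_true] at hc
      refine ih (by omega) fun s' hs' => ?_
      rw [hr]
      exact hP s' (hf.trans hs')

theorem writes_switch {R A : List ℕ} {r t : ℕ} {P : ℕ → Program} (ht : t ∈ R)
    (hP : ∀ i, (P i).Writes R A) : ∀ n, (switch r t P n).Writes R A
  | 0 => hP 0
  | n + 1 => ⟨ht, hP _, writes_switch ht hP n⟩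

end PinPerm
namespace PinPerm

/-! ### Complementing the automaton -/

/-- Exchanges the final and the other states. -/
def complementProgram : Program :=
  block [.const 9 0, .const 10 0, .loop (.lt 10 2) (block [.load 11 6 10,
    .ite (.eq 11 9) (.const 11 1) (.const 11 0), .store 6 10 11, .inc 10])]

theorem Runs.for_const {c : Test} {a : Program} (I : ℕ → Memory → Prop) (n T : ℕ)
    (step : ∀ i < n, ∀ s, I i s → c.Holds s ∧ Runs a s T (I (i + 1)))
    (done : ∀ s, I n s → ¬ c.Holds s) {s : Memory} (h0 : I 0 s) :
    Runs (.loop c a) s (n * (T + 1) + 1) (I n) := by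
  have := Runs.for I n (fun _ => T) step done h0
  simpa using this

theorem runs_complement {s : Memory} {N : ℕ} {A : DFA Dir (Fin N)} (h : HoldsAutomaton s A) :
    Runs complementProgram s (10 * N + 10) fun s' => HoldsAutomaton s' Aᶜ := by
  obtain ⟨h2, h3, hδ, hF⟩ := h
  let I : ℕ → Memory → Prop := fun i s' => s'.reg 9 = 0 ∧ s'.reg 10 = i ∧ s'.reg 2 = N ∧
    s'.reg 3 = A.start ∧ (∀ k, k ≠ 6 → s'.arr k = s.arr k) ∧
    ∀ q, s'.arr 6 q = if q < i then 1 - s.arr 6 q else s.arr 6 q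
  refine Runs.seq (T₁ := 1) (P := fun s' => s' = s.setReg 9 0) (.of_wp rfl le_rfl) ?_
    (T₂ := 10 * N + 9) (by omega)
  rintro _ rfl
  refine Runs.seq (T₁ := 1) (P := I 0) (.of_wp ?_ le_rfl) ?_ (T₂ := N * (7 + 1) + 1) (by omega)
  · simp [Program.wp, I, h2, h3]
  intro s' hs'
  refine (Runs.for_const I N 7 ?_ ?_ hs').mono (by omega) ?_
  · rintro i hi s' ⟨e9, e10, e2, e3, ea, e6⟩
    refine ⟨by simpa [Test.Holds, e10, e2] using hi, .of_wp ?_ (by decide)⟩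
    have key : ∀ x, x = 1 - s.arr 6 i → ∀ q, Function.update (s'.arr 6) i x q =
        if q ≤ i then 1 - s.arr 6 q else s.arr 6 q := by
      rintro _ rfl q
      rw [Function.update_apply, e6]
      split_ifs <;> first | omega | (subst_vars; rfl)
    have h6 : s'.arr 6 i = s.arr 6 i := by rw [e6, if_neg (lt_irrefl i)]
    simp only [block, Program.wp, Test.Holds, Memory.reg_setReg, Memory.arr_setReg,
      Memory.reg_setArr, Memory.arr_setArr, I, e10, e9, e2, e3, h6]
    refine ⟨fun hc => ?_, fun hc => ?_⟩ <;> simp at hc <;> simp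
    · exact ⟨fun k hk => by simp [hk, ea k hk], key 1 (by omega)⟩
    · exact ⟨fun k hk => by simp [hk, ea k hk], key 0 (by omega)⟩
  · rintro s' ⟨e9, e10, e2, -⟩
    simp [Test.Holds, e10, e2]
  · rintro s' ⟨e9, e10, e2, e3, ea, e6⟩
    refine ⟨e2, e3, fun q d => ?_, fun q => ?_⟩
    · rw [ea _ (by cases d <;> simp [Dir.code])]; exact hδ q d
    · rw [e6, if_pos q.2]
      obtain ⟨k₁, k₂⟩ := hF q
      refine ⟨fun h => ?_, fun h => ?_⟩
      · rw [k₂ h]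
      · rw [k₁ (by simpa [DFA.compl_def] using h)]

end PinPerm
namespace PinPerm

/-! ### Searching a cycle -/

/-- A step without effect. -/
def nop : Program := .copy 7 7

theorem setReg_self (s : Memory) (r : ℕ) : s.setReg r (s.reg r) = s := by
  ext1
  · funext r'; rw [Memory.reg_setReg]; split_ifs with h
    · rw [h]
    · rfl
  · rfl

@[simp] theorem wp_nop (Q : Memory → Prop) (s : Memory) : nop.wp Q s = Q s := by
  simp [nop, Program.wp, setReg_self]

/-- The programs of a list one after the other. -/
def chain : List Program → Program
  | [] => nop
  | a :: l => .seq a (chain l)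

/-- `J l` is the invariant while the programs for `l` are still to be run. -/
theorem Runs.chain {α : Type*} {f : α → Program} {T : ℕ} (J : List α → Memory → Prop) {l : List α}
    (step : ∀ x l s, J (x :: l) s → Runs (f x) s T (J l)) {s : Memory} (h : J l s) :
    Runs (chain (l.map f)) s (l.length * T + 1) (J []) := by
  induction l generalizing s with
  | nil => exact .of_wp (a := nop) (by simpa using h) (by simp [nop, Program.cost])
  | cons x l ih =>
    exact Runs.seq (step x l s h) (fun s' h' => ih h') (by simp only [List.length_cons]; ring_nf; omega)

theorem writes_chain {R A : List ℕ} {l : List Program} (h7 : 7 ∈ R) (h : ∀ a ∈ l, a.Writes R A) :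
    (chain l).Writes R A := by
  induction l with
  | nil => exact h7
  | cons a l ih => exact ⟨h a (by simp), ih fun x hx => h x (by simp [hx])⟩

/-- All directions. -/
def Dir.all : List Dir := [.U, .D, .L, .R]

/-- The program that subjects the target of the transition by `d` to a change of its number of
predecessors. -/
def countEdges (p : ℕ) (change : Program) (after : Program) : Program :=
  chain (Dir.all.map fun d => block [.load 12 (2 + d.code) p, .load 13 20 12, change, .store 20 12 13,
    after])

/-- Puts the state in register `r` into the queue. -/
def enqueue (r : ℕ) : Program := block [.store 21 14 r, .inc 14]

/-- Zero predecessors for all states. -/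
def clearDegrees : Program := .loop (.lt 10 2) (block [.store 20 10 9, .inc 10])

/-- Counts the edges from the states of the subgraph. -/
def countDegrees : Program :=
  .loop (.lt 10 2) (block [.load 11 6 10, .ite (.eq 11 8) (countEdges 10 (.inc 13) nop) nop, .inc 10])

/-- Counts the states of the subgraph and puts those without predecessors into the queue. -/
def initQueue : Program :=
  .loop (.lt 10 2) (block [.load 11 6 10, .ite (.eq 11 8) (block [.inc 15, .load 13 20 10,
    .ite (.eq 13 9) (enqueue 10) nop]) nop, .inc 10])

/-- Removes the states in the queue and puts the states without remaining predecessors into it. -/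
def removeStates : Program :=
  .loop (.lt 16 14) (block [.load 17 21 16, .inc 16, countEdges 17 (.dec 13)
    (.ite (.eq 13 9) (block [.load 11 6 12, .ite (.eq 11 8) (enqueue 12) nop]) nop)])

/-- Tests whether the subgraph of the final states is acyclic. -/
def cycleProgram : Program :=
  block [.const 9 0, .const 8 1, .const 10 0, clearDegrees, .const 10 0, countDegrees,
    .const 10 0, .const 14 0, .const 15 0, initQueue, .const 16 0, removeStates,
    .ite (.eq 14 15) (.const 4 1) (.const 4 0)]

section Kahn

variable (s₀ : Memory) (N : ℕ)

/-- The targets of the edges from `p`. -/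
def targets (ds : List Dir) (p : ℕ) : List ℕ := ds.map fun d => s₀.arr (2 + d.code) p

/-- The state belongs to the subgraph. -/
abbrev IsLive (p : ℕ) : Prop := s₀.arr 6 p = 1

/-- The number of edges to `q` from the states of the subgraph with the property `P`. -/
def edgeCount (P : ℕ → Prop) [DecidablePred P] (q : ℕ) : ℕ :=
  -- Edges are counted with multiplicity, since several letters may lead from `p` to the same state.
  ∑ p ∈ (Finset.range N).filter fun p => IsLive s₀ p ∧ P p, (targets s₀ Dir.all p).count q

/-- A set of states in the subgraph that have predecessors in the set. -/
def IsCyclic (C : Set ℕ) : Prop :=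
  ∀ q ∈ C, q < N ∧ IsLive s₀ q ∧ ∃ p ∈ C, q ∈ targets s₀ Dir.all p

/-- The memory still contains the automaton and the constants. -/
structure KahnBase (s : Memory) : Prop where
  reg2 : s.reg 2 = N
  reg8 : s.reg 8 = 1
  reg9 : s.reg 9 = 0
  arr_eq : ∀ k, k ≠ 20 → k ≠ 21 → s.arr k = s₀.arr k

/-- The queue contains the list. -/
structure HoldsQueue (Q : List ℕ) (s : Memory) : Prop where
  reg14 : s.reg 14 = Q.length
  arr21 : ∀ (i : ℕ) (h : i < Q.length), s.arr 21 i = Q[i]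
  nodup : Q.Nodup
  live : ∀ q ∈ Q, q < N ∧ IsLive s₀ q
  not_mem : ∀ C, IsCyclic s₀ N C → ∀ q ∈ Q, q ∉ C

variable {s₀ N}

theorem HoldsQueue.push {Q : List ℕ} {s s' : Memory} (h : HoldsQueue s₀ N Q s) {q : ℕ} (hq : q ∉ Q)
    (hqN : q < N) (hl : IsLive s₀ q) (hC : ∀ C, IsCyclic s₀ N C → q ∉ C)
    (h14 : s'.reg 14 = s.reg 14 + 1) (h21 : s'.arr 21 = Function.update (s.arr 21) (s.reg 14) q) :
    HoldsQueue s₀ N (Q ++ [q]) s' := by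
  refine ⟨by simp [h14, h.reg14], fun i hi => ?_, ?_, ?_, ?_⟩
  · rw [h21, h.reg14]
    rw [List.length_append, List.length_singleton] at hi
    rcases (show i ≤ Q.length by omega).lt_or_eq with hlt | rfl
    · rw [Function.update_of_ne hlt.ne, List.getElem_append_left hlt, h.arr21 i hlt]
    · simp
  · refine List.nodup_append.2 ⟨h.nodup, List.nodup_singleton q, fun a ha b hb hab => hq ?_⟩
    rw [List.mem_singleton] at hb
    rwa [← hb, ← hab]
  · simp only [List.mem_append, List.mem_singleton]
    rintro x (hx | rfl)
    exacts [h.live x hx, ⟨hqN, hl⟩]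
  · simp only [List.mem_append, List.mem_singleton]
    rintro C hCc x (hx | rfl)
    exacts [h.not_mem C hCc x hx, hC C hCc]

theorem HoldsQueue.congr {Q : List ℕ} {s s' : Memory} (h : HoldsQueue s₀ N Q s)
    (h14 : s'.reg 14 = s.reg 14) (h21 : s'.arr 21 = s.arr 21) : HoldsQueue s₀ N Q s' :=
  ⟨h14.trans h.reg14, fun i hi => by rw [h21, h.arr21 i hi], h.nodup, h.live, h.not_mem⟩

theorem HoldsQueue.length_le {Q : List ℕ} {s : Memory} (h : HoldsQueue s₀ N Q s) : Q.length ≤ N := by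
  rw [← List.toFinset_card_of_nodup h.nodup]
  refine (Finset.card_le_card (t := Finset.range N) fun q hq => ?_).trans (by simp)
  exact Finset.mem_range.2 (h.live q (List.mem_toFinset.1 hq)).1

theorem edgeCount_congr {P P' : ℕ → Prop} [DecidablePred P] [DecidablePred P'] (h : ∀ p < N, P p ↔ P' p)
    (q : ℕ) : edgeCount s₀ N P q = edgeCount s₀ N P' q := by
  simp only [edgeCount]
  refine Finset.sum_congr (Finset.filter_congr fun p hp => ?_) fun _ _ => rfl
  rw [h p (Finset.mem_range.1 hp)]

theorem edgeCount_eq_zero {P : ℕ → Prop} [DecidablePred P] {q : ℕ} (h : edgeCount s₀ N P q = 0) {p : ℕ}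
    (hp : p < N) (hl : IsLive s₀ p) (hP : P p) : q ∉ targets s₀ Dir.all p := by
  rw [edgeCount, Finset.sum_eq_zero_iff] at h
  exact List.count_eq_zero.1 (h p (Finset.mem_filter.2 ⟨Finset.mem_range.2 hp, hl, hP⟩))

/-- A state in a cyclic set has a predecessor in this set. If all its predecessors in the subgraph
have been removed, that one has too, although no state in the queue lies in a cyclic set. -/
theorem not_mem_of_edgeCount {Q : List ℕ} {s : Memory} (h : HoldsQueue s₀ N Q s) {P : List ℕ}
    (hP : P ⊆ Q) {q : ℕ} (hq : edgeCount s₀ N (· ∉ P) q = 0) {C : Set ℕ} (hC : IsCyclic s₀ N C) :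
    q ∉ C := by
  intro hqC
  obtain ⟨_, _, p, hp, hpq⟩ := hC q hqC
  obtain ⟨hpN, hpl, -⟩ := hC p hp
  by_cases hpP : p ∈ P
  · exact h.not_mem C hC p (hP hpP) hp
  · exact edgeCount_eq_zero hq hpN hpl hpP hpq

theorem runs_clearDegrees {s : Memory} (h : KahnBase s₀ N s) (h10 : s.reg 10 = 0) :
    Runs clearDegrees s (N * 3 + 1) fun s' => KahnBase s₀ N s' ∧ ∀ q < N, s'.arr 20 q = 0 := by
  refine (Runs.for_const (fun i s' => KahnBase s₀ N s' ∧ s'.reg 10 = i ∧ ∀ q < i, s'.arr 20 q = 0)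
    N 2 ?_ ?_ ⟨h, h10, by simp⟩).mono le_rfl fun s' h => ⟨h.1, h.2.2⟩
  · rintro i hi s' ⟨hb, h10, h20⟩
    refine ⟨by simpa [Test.Holds, h10, hb.reg2] using hi, .of_wp ?_ (by decide)⟩
    simp only [block, Program.wp]
    refine ⟨⟨by simp [hb.reg2], by simp [hb.reg8], by simp [hb.reg9], fun k h₁ h₂ => ?_⟩, by simp [h10],
      fun q hq => ?_⟩
    · simp [h₁, hb.arr_eq k h₁ h₂]
    · simp only [Memory.arr_setReg, Memory.arr_setArr, if_true, h10, hb.reg9, Function.update_apply]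
      split_ifs
      · rfl
      · exact h20 q (by omega)
  · rintro s' ⟨hb, h10, -⟩
    simp [Test.Holds, h10, hb.reg2]

theorem runs_countDegrees {s : Memory} (h : KahnBase s₀ N s) (h10 : s.reg 10 = 0)
    (h20 : ∀ q < N, s.arr 20 q = 0) :
    Runs countDegrees s (N * 25 + 1) fun s' => KahnBase s₀ N s' ∧
      ∀ q < N, s'.arr 20 q = edgeCount s₀ N (· ∉ ([] : List ℕ)) q := by
  let I : ℕ → Memory → Prop := fun i s' => KahnBase s₀ N s' ∧ s'.reg 10 = i ∧
    ∀ q < N, s'.arr 20 q = edgeCount s₀ N (· < i) q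
  have hsucc : ∀ i < N, ∀ q, edgeCount s₀ N (· ≤ i) q = edgeCount s₀ N (· < i) q +
      if IsLive s₀ i then (targets s₀ Dir.all i).count q else 0 := by
    intro i hi q
    simp only [edgeCount, Finset.sum_filter]
    rw [← Finset.sum_ite_eq_of_mem' (Finset.range N) i (fun i => if IsLive s₀ i then
      (targets s₀ Dir.all i).count q else 0) (Finset.mem_range.2 hi), ← Finset.sum_add_distrib]
    refine Finset.sum_congr rfl fun p _ => ?_
    split_ifs <;> omega
  have h0 : I 0 s := ⟨h, h10, fun q hq => by simp [h20 q hq, edgeCount]⟩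
  refine (Runs.for_const I N 24 ?_ ?_ h0).mono le_rfl fun s' h => ⟨h.1, fun q hq => ?_⟩
  · rintro i hi s' ⟨hb, h10, h20⟩
    refine ⟨by simpa [Test.Holds, h10, hb.reg2] using hi, ?_⟩
    refine Runs.seq (T₁ := 1) (T₂ := 23) (P := fun s'' => s'' = s'.setReg 11 (s₀.arr 6 i))
      (.of_wp (by simp [Program.wp, h10, hb.arr_eq]) le_rfl) ?_ le_rfl
    rintro _ rfl
    set s₁ := s'.setReg 11 (s₀.arr 6 i) with hs₁
    have hb₁ : KahnBase s₀ N s₁ := ⟨by simp [hs₁, hb.reg2], by simp [hs₁, hb.reg8], by simp [hs₁, hb.reg9],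
      hb.arr_eq⟩
    have h10₁ : s₁.reg 10 = i := by simp [hs₁, h10]
    let J : List Dir → Memory → Prop := fun ds s' => KahnBase s₀ N s' ∧ s'.reg 10 = i ∧
      ∀ q < N, s'.arr 20 q + (targets s₀ ds i).count q = edgeCount s₀ N (· ≤ i) q
    refine Runs.seq (T₁ := 22) (T₂ := 1) (P := J []) (.ite (fun hc => ?_) (fun hc => ?_)
      (show 21 + 1 ≤ 22 by omega)) ?_ le_rfl
    · have hl : IsLive s₀ i := by simpa [Test.Holds, hs₁, hb.reg8] using hc
      refine (Runs.chain J (T := 5) ?_ ?_).mono (by decide) fun _ => id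
      · rintro d ds t ⟨tb, t10, t20⟩
        refine .of_wp ?_ (by simp [block, Program.cost, nop])
        have hd : 2 + d.code ≠ 20 ∧ 2 + d.code ≠ 21 := by cases d <;> simp [Dir.code]
        simp only [block, Program.wp, wp_nop]
        refine ⟨⟨by simp [tb.reg2], by simp [tb.reg8], by simp [tb.reg9], fun k k₁ k₂ => ?_⟩,
          by simp [t10], fun q hq => ?_⟩
        · simp [k₁, tb.arr_eq k k₁ k₂]
        · have := t20 q hq
          simp only [targets, List.map_cons, List.count_cons, beq_iff_eq] at this
          simp only [Memory.arr_setArr, Memory.arr_setReg, Memory.reg_setReg, if_true, t10,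
            tb.arr_eq _ hd.1 hd.2, Function.update_apply, targets]
          norm_num
          split_ifs with hq'
          · rw [hq', if_pos rfl] at this; rw [hq']; omega
          · rw [if_neg (fun h => hq' h.symm)] at this; omega
      · exact ⟨hb₁, h10₁, fun q hq => by rw [hsucc i hi, if_pos hl, ← h20 q hq]; rfl⟩
    · have hl : ¬ IsLive s₀ i := by simpa [Test.Holds, hs₁, hb.reg8] using hc
      refine .of_wp (a := nop) ?_ (by decide)
      rw [wp_nop]
      exact ⟨hb₁, h10₁, fun q hq => by rw [hsucc i hi, if_neg hl, ← h20 q hq]; rfl⟩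
    · rintro t ⟨tb, t10, t20⟩
      refine .of_wp ?_ (by decide)
      refine ⟨⟨by simp [tb.reg2], by simp [tb.reg8], by simp [tb.reg9], tb.arr_eq⟩, by simp [t10],
        fun q hq => ?_⟩
      rw [edgeCount_congr (s₀ := s₀) (N := N) (P := (· < i + 1)) (P' := (· ≤ i)) (fun p _ => Nat.lt_succ_iff) q]
      simpa [targets] using t20 q hq
  · rintro s' ⟨hb, h10, -⟩
    simp [Test.Holds, h10, hb.reg2]
  · rw [h.2.2 q hq]
    exact edgeCount_congr (fun p hp => by simp [hp]) q

end Kahn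
end PinPerm
namespace PinPerm

section Kahn

variable {s₀ : Memory} {N : ℕ}

theorem runs_initQueue {s : Memory} (h : KahnBase s₀ N s) (h10 : s.reg 10 = 0) (h14 : s.reg 14 = 0)
    (h15 : s.reg 15 = 0) (h20 : ∀ q < N, s.arr 20 q = edgeCount s₀ N (· ∉ ([] : List ℕ)) q) :
    Runs initQueue s (N * 10 + 1) fun s' => KahnBase s₀ N s' ∧
      (∀ q < N, s'.arr 20 q = edgeCount s₀ N (· ∉ ([] : List ℕ)) q) ∧
      s'.reg 15 = ((Finset.range N).filter (IsLive s₀)).card ∧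
      ∃ Q, HoldsQueue s₀ N Q s' ∧ ∀ q < N, IsLive s₀ q → (q ∈ Q ↔ s'.arr 20 q = 0) := by
  let I : ℕ → Memory → Prop := fun i s' => KahnBase s₀ N s' ∧ s'.reg 10 = i ∧
    (∀ q < N, s'.arr 20 q = edgeCount s₀ N (· ∉ ([] : List ℕ)) q) ∧
    s'.reg 15 = ((Finset.range i).filter (IsLive s₀)).card ∧
    ∃ Q, HoldsQueue s₀ N Q s' ∧ ∀ q, q ∈ Q ↔ q < i ∧ IsLive s₀ q ∧ s'.arr 20 q = 0
  have h0 : I 0 s := ⟨h, h10, h20, by simp [h15], [], ⟨by simp [h14], by simp, by simp, by simp, by simp⟩,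
    by simp⟩
  refine (Runs.for_const I N 9 ?_ ?_ h0).mono le_rfl ?_
  · rintro i hi s' ⟨hb, h10, h20, h15, Q, hQ, hm⟩
    refine ⟨by simpa [Test.Holds, h10, hb.reg2] using hi, .of_wp ?_ (by decide)⟩
    have e6 : s'.arr 6 = s₀.arr 6 := hb.arr_eq 6 (by simp) (by simp)
    simp only [block, Program.wp, enqueue, wp_nop, Test.Holds, Memory.reg_setReg, Memory.arr_setReg,
      Memory.reg_setArr, Memory.arr_setArr, e6, h10]
    norm_num
    rw [hb.reg8, hb.reg9]
    have hcard : ((Finset.range (i + 1)).filter (IsLive s₀)).card =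
        ((Finset.range i).filter (IsLive s₀)).card + if IsLive s₀ i then 1 else 0 := by
      rw [Finset.range_add_one, Finset.filter_insert]
      split_ifs
      · rw [Finset.card_insert_of_notMem (by simp)]
      · rfl
    refine ⟨fun hl => ⟨fun hz => ?_, fun hz => ?_⟩, fun hl => ?_⟩
    · refine ⟨⟨by simp [hb.reg2], by simp [hb.reg8], by simp [hb.reg9], fun k k₁ k₂ => ?_⟩, by simp [h10],
        fun q hq => by simp [h20 q hq], by simp [h15, hcard, hl], Q ++ [i], ?_, fun q => ?_⟩
      · simp [k₂, hb.arr_eq k k₁ k₂]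
      · refine hQ.push (by simp [hm]) hi hl (fun C hC => ?_) (by simp) (by simp)
        exact not_mem_of_edgeCount hQ (P := []) (by simp) ((h20 i hi).symm.trans hz) hC
      · simp only [List.mem_append, hm, List.mem_singleton]
        simp only [Memory.arr_setArr, Memory.arr_setReg]
        norm_num
        constructor
        · rintro (⟨h₁, h₂, h₃⟩ | rfl)
          exacts [⟨by omega, h₂, h₃⟩, ⟨by omega, hl, hz⟩]
        · rintro ⟨h₁, h₂, h₃⟩
          rcases (show q ≤ i by omega).lt_or_eq with h | h
          exacts [.inl ⟨h, h₂, h₃⟩, .inr h]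
    · refine ⟨⟨by simp [hb.reg2], by simp [hb.reg8], by simp [hb.reg9], hb.arr_eq⟩, by simp [h10],
        fun q hq => by simp [h20 q hq], by simp [h15, hcard, hl], Q, hQ.congr (by simp) (by simp), fun q => ?_⟩
      rw [hm]
      simp only [Memory.arr_setReg]
      refine and_congr_left fun h => ⟨fun _ => by omega, fun _ => ?_⟩
      rcases (show q ≤ i by omega).lt_or_eq with h' | rfl
      exacts [h', absurd h.2 hz]
    · refine ⟨⟨by simp [hb.reg2], by simp [hb.reg8], by simp [hb.reg9], hb.arr_eq⟩, by simp [h10],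
        fun q hq => by simp [h20 q hq], by simp [h15, hcard, IsLive, hl], Q, hQ.congr (by simp) (by simp),
        fun q => ?_⟩
      rw [hm]
      simp only [Memory.arr_setReg]
      refine and_congr_left fun h => ⟨fun _ => by omega, fun _ => ?_⟩
      rcases (show q ≤ i by omega).lt_or_eq with h' | rfl
      exacts [h', absurd h.1 hl]
  · rintro s' ⟨hb, h10, -⟩
    simp [Test.Holds, h10, hb.reg2]
  · rintro s' ⟨hb, h10, h20, h15, Q, hQ, hm⟩
    exact ⟨hb, h20, h15, Q, hQ, fun q hq hl => by
      rw [hm]; exact ⟨fun h => h.2.2, fun h => ⟨hq, hl, h⟩⟩⟩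

theorem edgeCount_append {P : List ℕ} {p : ℕ} (hp : p ∉ P) (hpN : p < N) (hl : IsLive s₀ p) (q : ℕ) :
    edgeCount s₀ N (· ∉ P) q = edgeCount s₀ N (· ∉ P ++ [p]) q + (targets s₀ Dir.all p).count q := by
  simp only [edgeCount, Finset.sum_filter]
  rw [← Finset.sum_ite_eq_of_mem' (Finset.range N) p (fun i => (targets s₀ Dir.all i).count q)
    (Finset.mem_range.2 hpN), ← Finset.sum_add_distrib]
  refine Finset.sum_congr rfl fun x _ => ?_
  by_cases hx : x = p
  · subst hx; simp [hl, hp]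
  · simp [hx]

/-- The queue splits into the states `P` that are already processed and the waiting states `R`.
Array `20` counts the edges from states outside `P`, and a state of the subgraph is queued exactly
when its count is zero. Each round moves one state from `R` to `P`. -/
theorem runs_removeStates {s : Memory} {c : ℕ} {Q : List ℕ} (h : KahnBase s₀ N s) (h16 : s.reg 16 = 0)
    (h15 : s.reg 15 = c) (h20 : ∀ q < N, s.arr 20 q = edgeCount s₀ N (· ∉ ([] : List ℕ)) q)
    (hQ : HoldsQueue s₀ N Q s) (hm : ∀ q < N, IsLive s₀ q → (q ∈ Q ↔ s.arr 20 q = 0))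
    (hδ : ∀ p < N, ∀ d : Dir, s₀.arr (2 + d.code) p < N) :
    Runs removeStates s (N * 50 + 1) fun s' => s'.reg 15 = c ∧
      ∃ Q, HoldsQueue s₀ N Q s' ∧ ∀ q < N, IsLive s₀ q → (q ∈ Q ↔ edgeCount s₀ N (· ∉ Q) q = 0) := by
  let I : Memory → Prop := fun s' => KahnBase s₀ N s' ∧ s'.reg 15 = c ∧ ∃ P R, s'.reg 16 = P.length ∧
    HoldsQueue s₀ N (P ++ R) s' ∧ (∀ q < N, s'.arr 20 q = edgeCount s₀ N (· ∉ P) q) ∧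
    ∀ q < N, IsLive s₀ q → (q ∈ P ++ R ↔ s'.arr 20 q = 0)
  have h0 : I s := ⟨h, h15, [], Q, by simp [h16], hQ, h20, hm⟩
  refine (Runs.while I (fun s' => N - s'.reg 16) 49 ?_ h0).mono (by rw [h16]; simp) ?_
  · rintro s' ⟨hb, h15, P, R, h16, hQ, h20, hm⟩ hc
    simp only [Test.Holds, h16, hQ.reg14, List.length_append] at hc
    obtain ⟨p, R, rfl⟩ := List.exists_cons_of_length_pos (show 0 < R.length by omega)
    have hPN := hQ.length_le
    simp only [List.length_append, List.length_cons] at hPN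
    have hp21 : s'.arr 21 P.length = p := by
      rw [hQ.arr21 _ (by simp)]; simp
    rw [List.append_cons] at hQ hm
    obtain ⟨hpN, hpl⟩ := hQ.live p (by simp)
    have hpP : p ∉ P := by
      have := hQ.nodup
      simp only [List.append_assoc, List.nodup_append] at this
      exact fun hp => this.2.2 p hp p (by simp) rfl
    let P' := P ++ [p]
    -- While `p` is processed, its edges by the directions in `ds` are still counted.
    let J : List Dir → Memory → Prop := fun ds s' => KahnBase s₀ N s' ∧ s'.reg 15 = c ∧ s'.reg 17 = p ∧
      s'.reg 16 = P'.length ∧ ∃ R, HoldsQueue s₀ N (P' ++ R) s' ∧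
      (∀ q < N, s'.arr 20 q = edgeCount s₀ N (· ∉ P') q + (targets s₀ ds p).count q) ∧
      ∀ q < N, IsLive s₀ q → (q ∈ P' ++ R ↔ s'.arr 20 q = 0)
    refine Runs.seq (T₁ := 1) (T₂ := 48) (P := fun t => t = s'.setReg 17 p)
      (.of_wp (by simp [Program.wp, h16, hp21]) le_rfl) ?_ le_rfl
    rintro _ rfl
    refine Runs.seq (T₁ := 1) (T₂ := 47) (P := J Dir.all) (.of_wp ?_ le_rfl) ?_ le_rfl
    · simp only [Program.wp]
      refine ⟨⟨by simp [hb.reg2], by simp [hb.reg8], by simp [hb.reg9], hb.arr_eq⟩, by simp [h15],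
        by simp, by simp [h16, P'], R, hQ.congr (by simp) (by simp), fun q hq => ?_, hm⟩
      rw [← edgeCount_append hpP hpN hpl]
      exact h20 q hq
    intro t ht
    change Runs (countEdges _ _ _) t 47 _
    refine (Runs.chain J (T := 11) ?_ ht).mono (show _ ≤ 47 by decide) ?_
    · rintro d ds t ⟨tb, t15, t17, t16, R, tQ, t20, tm⟩
      refine .of_wp ?_ (by simp [block, Program.cost, nop, enqueue])
      have hd : 2 + d.code ≠ 20 ∧ 2 + d.code ≠ 21 := by cases d <;> simp [Dir.code]
      have e6 : t.arr 6 = s₀.arr 6 := tb.arr_eq 6 (by simp) (by simp)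
      have hq₀ := hδ p hpN d
      set q₀ := s₀.arr (2 + d.code) p with hq₀d
      have hcount : ∀ q, (targets s₀ (d :: ds) p).count q =
          (targets s₀ ds p).count q + if q = q₀ then 1 else 0 := by
        intro q
        simp only [targets, List.map_cons, List.count_cons, beq_iff_eq, ← hq₀d]
        simp only [eq_comm]
      have hpos : t.arr 20 q₀ = edgeCount s₀ N (· ∉ P') q₀ + (targets s₀ ds p).count q₀ + 1 := by
        rw [t20 q₀ hq₀, hcount, if_pos rfl]; rfl
      have hnew : ∀ q < N, Function.update (t.arr 20) q₀ (t.arr 20 q₀ - 1) q =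
          edgeCount s₀ N (· ∉ P') q + (targets s₀ ds p).count q := by
        intro q hq
        rw [Function.update_apply]
        split_ifs with h
        · rw [hpos, h]; omega
        · rw [t20 q hq, hcount, if_neg h]; omega
      simp only [block, Program.wp, enqueue, wp_nop, Test.Holds, Memory.reg_setReg, Memory.arr_setReg,
        Memory.reg_setArr, Memory.arr_setArr, e6, t17, tb.arr_eq _ hd.1 hd.2, ← hq₀d]
      norm_num
      rw [tb.reg8, tb.reg9]
      refine ⟨fun hz => ⟨fun hl => ?_, fun hl => ?_⟩, fun hz => ?_⟩
      · refine ⟨⟨by simp [tb.reg2], by simp [tb.reg8], by simp [tb.reg9], fun k k₁ k₂ => ?_⟩, by simp [t15],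
          by simp [t17], by simp [t16], R ++ [q₀], ?_, fun q hq => ?_, fun q hq hql => ?_⟩
        · simp [k₁, k₂, tb.arr_eq k k₁ k₂]
        · rw [← List.append_assoc]
          refine tQ.push ?_ hq₀ hl (fun C hC => ?_) (by simp) (by simp)
          · rw [tm q₀ hq₀ hl]; omega
          · exact not_mem_of_edgeCount tQ (P := P') (by simp) (by omega) hC
        · simpa using hnew q hq
        · rw [← List.append_assoc, List.mem_append, tm q hq hql, List.mem_singleton]
          simp only [Memory.arr_setArr, Memory.arr_setReg]
          norm_num
          rw [Function.update_apply]
          split_ifs with h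
          · simp [h, hz]
          · simp [h]
      · refine ⟨⟨by simp [tb.reg2], by simp [tb.reg8], by simp [tb.reg9], fun k k₁ k₂ => ?_⟩, by simp [t15],
          by simp [t17], by simp [t16], R, tQ.congr (by simp) (by simp), fun q hq => ?_, fun q hq hql => ?_⟩
        · simp [k₁, k₂, tb.arr_eq k k₁ k₂]
        · simpa using hnew q hq
        · rw [tm q hq hql]
          have : q ≠ q₀ := by rintro rfl; exact hl hql
          simp [Function.update_apply, this]
      · refine ⟨⟨by simp [tb.reg2], by simp [tb.reg8], by simp [tb.reg9], fun k k₁ k₂ => ?_⟩, by simp [t15],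
          by simp [t17], by simp [t16], R, tQ.congr (by simp) (by simp), fun q hq => ?_, fun q hq hql => ?_⟩
        · simp [k₁, k₂, tb.arr_eq k k₁ k₂]
        · simpa using hnew q hq
        · rw [tm q hq hql]
          simp only [Memory.arr_setArr, Memory.arr_setReg]
          norm_num
          rw [Function.update_apply]
          split_ifs with h
          · rw [h]; omega
          · rfl
    · rintro t ⟨tb, t15, t17, t16, R, tQ, t20, tm⟩
      refine ⟨⟨tb, t15, P', R, t16, tQ, fun q hq => by simpa [targets] using t20 q hq, tm⟩, ?_⟩
      simp only [t16, h16, P', List.length_append, List.length_singleton]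
      omega
  · rintro s' ⟨⟨hb, h15, P, R, h16, hQ, h20, hm⟩, hc⟩
    simp only [Test.Holds, h16, hQ.reg14, List.length_append] at hc
    obtain rfl := List.eq_nil_of_length_eq_zero (show R.length = 0 by omega)
    rw [List.append_nil] at hQ hm
    exact ⟨h15, P, hQ, fun q hq hl => by rw [hm q hq hl, h20 q hq]⟩

open Classical in
-- The queue never contains a state of a cyclic set, and the states that are never queued form such
-- a set. So all states of the subgraph get queued if and only if there is no nonempty cyclic set,
-- and comparing two counters decides this.
theorem runs_cycleProgram (h2 : s₀.reg 2 = N) (hδ : ∀ p < N, ∀ d : Dir, s₀.arr (2 + d.code) p < N) :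
    Runs cycleProgram s₀ (100 * N + 100) fun s' =>
      s'.reg 4 = if ∀ C, IsCyclic s₀ N C → C = ∅ then 1 else 0 := by
  have hset : ∀ {s : Memory} {r x : ℕ}, KahnBase s₀ N s → r ≠ 2 → r ≠ 8 → r ≠ 9 →
      KahnBase s₀ N (s.setReg r x) := fun hb h₁ h₂ h₃ =>
    ⟨by simp [hb.reg2, h₁.symm], by simp [hb.reg8, h₂.symm], by simp [hb.reg9, h₃.symm], hb.arr_eq⟩
  unfold cycleProgram block
  refine Runs.seq (T₁ := 1) (T₂ := 100 * N + 99) (P := fun s => s = s₀.setReg 9 0) (.of_wp rfl le_rfl) ?_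
    (by omega)
  rintro _ rfl
  refine Runs.seq (T₁ := 1) (T₂ := 100 * N + 98) (P := fun s => KahnBase s₀ N s)
    (.of_wp (by exact ⟨by simp [h2], by simp, by simp, fun _ _ _ => rfl⟩) le_rfl) ?_ (by omega)
  intro s hb
  refine Runs.seq (T₁ := 1) (T₂ := 100 * N + 97) (P := fun s => KahnBase s₀ N s ∧ s.reg 10 = 0)
    (.of_wp (by exact ⟨hset hb (by simp) (by simp) (by simp), by simp⟩) le_rfl) ?_ (by omega)
  rintro s ⟨hb, h10⟩
  refine Runs.seq (T₂ := 97 * N + 96) (runs_clearDegrees hb h10) ?_ (by omega)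
  rintro s ⟨hb, h20⟩
  refine Runs.seq (T₁ := 1) (T₂ := 97 * N + 95) (P := fun s => KahnBase s₀ N s ∧ s.reg 10 = 0 ∧
    ∀ q < N, s.arr 20 q = 0)
    (.of_wp (by exact ⟨hset hb (by simp) (by simp) (by simp), by simp, h20⟩) le_rfl) ?_ (by omega)
  rintro s ⟨hb, h10, h20⟩
  refine Runs.seq (T₂ := 72 * N + 94) (runs_countDegrees hb h10 h20) ?_ (by omega)
  rintro s ⟨hb, h20⟩
  refine Runs.seq (T₁ := 1) (T₂ := 72 * N + 93) (P := fun s => KahnBase s₀ N s ∧ s.reg 10 = 0 ∧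
    ∀ q < N, s.arr 20 q = edgeCount s₀ N (· ∉ ([] : List ℕ)) q)
    (.of_wp (by exact ⟨hset hb (by simp) (by simp) (by simp), by simp, h20⟩) le_rfl) ?_ (by omega)
  rintro s ⟨hb, h10, h20⟩
  refine Runs.seq (T₁ := 1) (T₂ := 72 * N + 92) (P := fun s => KahnBase s₀ N s ∧ s.reg 10 = 0 ∧
    s.reg 14 = 0 ∧ ∀ q < N, s.arr 20 q = edgeCount s₀ N (· ∉ ([] : List ℕ)) q)
    (.of_wp (by exact ⟨hset hb (by simp) (by simp) (by simp), by simp [h10], by simp, h20⟩) le_rfl) ?_ (by omega)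
  rintro s ⟨hb, h10, h14, h20⟩
  refine Runs.seq (T₁ := 1) (T₂ := 72 * N + 91) (P := fun s => KahnBase s₀ N s ∧ s.reg 10 = 0 ∧
    s.reg 14 = 0 ∧ s.reg 15 = 0 ∧ ∀ q < N, s.arr 20 q = edgeCount s₀ N (· ∉ ([] : List ℕ)) q)
    (.of_wp (by exact ⟨hset hb (by simp) (by simp) (by simp), by simp [h10], by simp [h14], by simp, h20⟩)
      le_rfl) ?_ (by omega)
  rintro s ⟨hb, h10, h14, h15, h20⟩
  refine Runs.seq (T₂ := 62 * N + 90) (runs_initQueue hb h10 h14 h15 h20) ?_ (by omega)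
  rintro s ⟨hb, h20, h15, Q, hQ, hm⟩
  refine Runs.seq (T₁ := 1) (T₂ := 62 * N + 89) (P := fun s' => s' = s.setReg 16 0) (.of_wp rfl le_rfl) ?_
    (by omega)
  rintro _ rfl
  refine Runs.seq (T₂ := 12 * N + 88) (runs_removeStates (hset hb (by simp) (by simp) (by simp)) (by simp)
    (by simpa using h15) h20 (hQ.congr (by simp) (by simp)) hm hδ) ?_ (by omega)
  rintro s ⟨h15, Q, hQ, hm⟩
  have hsub : Q.toFinset ⊆ (Finset.range N).filter (IsLive s₀) := fun q hq => by
    obtain ⟨h₁, h₂⟩ := hQ.live q (List.mem_toFinset.1 hq)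
    exact Finset.mem_filter.2 ⟨Finset.mem_range.2 h₁, h₂⟩
  have key : (∀ C, IsCyclic s₀ N C → C = ∅) ↔ s.reg 14 = s.reg 15 := by
    rw [hQ.reg14, h15, ← List.toFinset_card_of_nodup hQ.nodup]
    constructor
    · intro h
      refine congrArg _ (subset_antisymm hsub fun q hq => ?_)
      rw [Finset.mem_filter, Finset.mem_range] at hq
      by_contra hqQ
      -- A state that was not queued has a positive count, hence a predecessor that was not queued.
      have hC : IsCyclic s₀ N {q | q < N ∧ IsLive s₀ q ∧ q ∉ Q} := by
        rintro x ⟨hx, hl, hxQ⟩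
        refine ⟨hx, hl, ?_⟩
        rw [hm x hx hl, edgeCount, Finset.sum_eq_zero_iff] at hxQ
        push Not at hxQ
        obtain ⟨p, hp, hpx⟩ := hxQ
        rw [Finset.mem_filter, Finset.mem_range] at hp
        exact ⟨p, hp, by_contra fun h => hpx (List.count_eq_zero.2 h)⟩
      have := h _ hC
      exact (Set.mem_empty_iff_false q).1 (this ▸ ⟨hq.1, hq.2, by simpa using hqQ⟩)
    · intro h C hC
      have := Finset.eq_of_subset_of_card_le hsub h.ge
      refine Set.eq_empty_of_forall_notMem fun q hq => hQ.not_mem C hC q ?_ hq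
      have hq' : q ∈ (Finset.range N).filter (IsLive s₀) :=
        Finset.mem_filter.2 ⟨Finset.mem_range.2 (hC q hq).1, (hC q hq).2.1⟩
      rw [← this] at hq'
      exact List.mem_toFinset.1 hq'
  refine .of_wp ?_ (by simp only [block, Program.cost]; omega)
  simp only [key, block, Program.wp, Test.Holds]
  exact ⟨fun h => by simp [h], fun h => by simp [h]⟩

end Kahn
end PinPerm
namespace PinPerm

/-! ### From cyclic sets of states to cycles of the automaton -/

theorem HoldsAutomaton.arr_transition {s : Memory} {N : ℕ} {A : DFA Dir (Fin N)}
    (h : HoldsAutomaton s A) (q : Fin N) (d : Dir) : s.arr (2 + d.code) q = A.step q d := h.2.2.1 q d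

theorem isLive_compl_iff {s : Memory} {N : ℕ} {A : DFA Dir (Fin N)} (h : HoldsAutomaton s Aᶜ)
    (q : Fin N) : IsLive s q ↔ q ∉ A.accept := by
  obtain ⟨-, -, -, hF⟩ := h
  refine ⟨fun hl hq => ?_, fun hq => (hF q).1 (by simpa [DFA.compl_def] using hq)⟩
  have := (hF q).2 (by simpa [DFA.compl_def] using hq)
  rw [IsLive, this] at hl
  cases hl

theorem mem_targets_iff {s : Memory} {N : ℕ} {A : DFA Dir (Fin N)} (h : HoldsAutomaton s Aᶜ)
    {p q : Fin N} : (q : ℕ) ∈ targets s Dir.all p ↔ ∃ d, A.step p d = q := by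
  simp only [targets, List.mem_map, h.arr_transition, Fin.val_inj]
  constructor
  · rintro ⟨d, -, h⟩; exact ⟨d, h⟩
  · rintro ⟨d, h⟩; exact ⟨d, by cases d <;> simp [Dir.all], h⟩

/-- The final states are never left. -/
def IsAbsorbing {α σ : Type*} (A : DFA α σ) : Prop := ∀ q ∈ A.accept, ∀ a, A.step q a = q

theorem IsAbsorbing.evalFrom {α σ : Type*} {A : DFA α σ} (h : IsAbsorbing A) {q : σ} (hq : q ∈ A.accept)
    (w : List α) : A.evalFrom q w = q := by
  induction w with
  | nil => rfl
  | cons a w ih => rw [DFA.evalFrom_cons, h q hq, ih]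

/-- The subgraph of the states outside the final ones contains a cycle if and only if it contains a
nonempty set of states with predecessors in the set. -/
theorem exists_isCyclic_iff {s : Memory} {N : ℕ} {A : DFA Dir (Fin N)} (h : HoldsAutomaton s Aᶜ)
    (hA : IsAbsorbing A) : (∃ C, IsCyclic s N C ∧ C ≠ ∅) ↔ HasCycleOutside A := by
  constructor
  · rintro ⟨C, hC, hne⟩
    obtain ⟨q₀, hq₀⟩ := Set.nonempty_iff_ne_empty.2 hne
    have hpred : ∀ q : {q : Fin N // (q : ℕ) ∈ C}, ∃ p : {q : Fin N // (q : ℕ) ∈ C}, ∃ d,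
        A.step p.1 d = q.1 := by
      rintro ⟨q, hq⟩
      obtain ⟨-, -, p, hp, hpq⟩ := hC q hq
      exact ⟨⟨⟨p, (hC p hp).1⟩, hp⟩, (mem_targets_iff h).1 hpq⟩
    choose f hf using hpred
    have hpath : ∀ n q, ∃ w : List Dir, w.length = n ∧ A.evalFrom (f^[n] q).1 w = q.1 := by
      intro n
      induction n with
      | zero => exact fun q => ⟨[], rfl, rfl⟩
      | succ n ih =>
        intro q
        obtain ⟨w, hw, he⟩ := ih q
        obtain ⟨d, hd⟩ := hf (f^[n] q)
        refine ⟨d :: w, by simp [hw], ?_⟩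
        rw [Function.iterate_succ_apply', DFA.evalFrom_cons, hd, he]
    -- Following chosen predecessors backwards in a finite set repeats a state, and the path between
    -- the two visits is a cycle.
    obtain ⟨i, j, hij, he⟩ := Finite.exists_ne_map_eq_of_infinite
      fun n : ℕ => f^[n] ⟨⟨q₀, (hC q₀ hq₀).1⟩, hq₀⟩
    wlog hlt : i < j generalizing i j
    · exact this j i hij.symm he.symm (by omega)
    obtain ⟨w, hw, hwe⟩ := hpath (j - i) (f^[i] ⟨⟨q₀, (hC q₀ hq₀).1⟩, hq₀⟩)
    rw [← Function.iterate_add_apply, Nat.sub_add_cancel hlt.le, ← he] at hwe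
    set p := f^[i] ⟨⟨q₀, (hC q₀ hq₀).1⟩, hq₀⟩
    refine ⟨p.1, w, (isLive_compl_iff h _).1 (hC p.1 p.2).2.1, ?_, hwe⟩
    rintro rfl
    simp only [List.length_nil] at hw
    omega
  · rintro ⟨q, w, hq, hw, hqw⟩
    -- These states are reached from `q` by a nonempty word and lead back to `q`. The last letter of
    -- that word supplies a predecessor, which is in the set because its own word can be extended by
    -- a round of the cycle.
    refine ⟨{p | ∃ (x : Fin N) (u v : List Dir), (x : ℕ) = p ∧ u ≠ [] ∧ A.evalFrom q u = x ∧
      A.evalFrom x v = q}, ?_, Set.nonempty_iff_ne_empty.1 ⟨q, q, w, [], rfl, hw, hqw, rfl⟩⟩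
    rintro _ ⟨x, u, v, rfl, hu, hux, hxv⟩
    refine ⟨x.2, (isLive_compl_iff h _).2 fun hx => hq ?_, ?_⟩
    · rw [← hxv, hA.evalFrom hx]; exact hx
    · obtain ⟨u, a, rfl⟩ := List.eq_nil_or_concat'  u |>.resolve_left hu
      rw [DFA.evalFrom_append_singleton] at hux
      refine ⟨A.evalFrom q u, ⟨_, w ++ u, a :: v, rfl, by simp [hw], ?_, ?_⟩, (mem_targets_iff h).2 ⟨a, hux⟩⟩
      · rw [DFA.evalFrom_of_append, hqw]
      · rw [DFA.evalFrom_cons, hux, hxv]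

open Classical in
theorem runs_cycleSearch {s : Memory} {N : ℕ} {A : DFA Dir (Fin N)} (h : HoldsAutomaton s Aᶜ)
    (hA : IsAbsorbing A) : Runs cycleProgram s (100 * N + 100) fun s' =>
      s'.reg 4 = if HasCycleOutside A then 0 else 1 := by
  refine (runs_cycleProgram h.1 fun p hp d => ?_).mono le_rfl fun s' hs' => ?_
  · rw [h.arr_transition ⟨p, hp⟩ d]; exact Fin.is_lt _
  · rw [hs', ← exists_isCyclic_iff h hA]
    by_cases hc : ∀ C, IsCyclic s N C → C = ∅
    · rw [if_pos hc, if_neg]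
      rintro ⟨C, h₁, h₂⟩
      exact h₂ (hc C h₁)
    · rw [if_neg hc, if_pos]
      push Not at hc
      obtain ⟨C, h₁, h₂⟩ := hc
      exact ⟨C, h₁, h₂.ne_empty⟩

end PinPerm
namespace PinPerm

/-! ### The forbidden factors of a pin word -/

/-- The possible directions in place of the numeral `q`, if `l` is the next letter. -/
def orders (q : Quad) (l : Option Letter) : List (List Dir) :=
  match l with
  | some (.dir d) => if d.isHoriz then [[q.h, q.v]] else [[q.v, q.h]]
  | _ => [[q.h, q.v], [q.v, q.h]]

/-- The words of two directions. -/
def pairs : List (List Dir) := Dir.all.flatMap fun a => Dir.all.map fun b => [a, b]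

/-- The forbidden factors of a pin word arise by replacing the first two letters by one of these words;
`l` is the third letter. -/
def prefixes (l₁ l₂ l : Option Letter) : List (List Dir) :=
  match l₁, l₂ with
  | some (.num q), some (.dir d) => (orders q (some (.dir d))).map (· ++ [d])
  | some (.num _), some (.num q) =>
    (orders q l).flatMap fun o => (pairs.filter fun x => Alternating (x ++ o)).map (· ++ o)
  | _, _ => []

theorem length_of_mem_orders {q : Quad} {l : Option Letter} {o : List Dir} (h : o ∈ orders q l) :
    o.length = 2 := by
  rcases l with _ | _ | d
  · simp only [orders, List.mem_cons, List.not_mem_nil, or_false] at h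
    rcases h with rfl | rfl <;> rfl
  · simp only [orders, List.mem_cons, List.not_mem_nil, or_false] at h
    rcases h with rfl | rfl <;> rfl
  · simp only [orders] at h
    split_ifs at h <;> rw [List.mem_singleton.1 h] <;> rfl

theorem mem_phi_iff {q : Quad} {ds y : List Dir} :
    y ∈ phi q ds ↔ ∃ o ∈ orders q (ds.head?.map .dir), y = o ++ ds := by
  cases ds with
  | nil => simp [phi, orders]
  | cons d ds => simp only [phi, orders, List.head?_cons, Option.map_some]; split_ifs <;> simp

theorem mem_pairs {x : List Dir} : x ∈ pairs ↔ x.length = 2 := by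
  constructor
  · intro h
    simp only [pairs, List.mem_flatMap, List.mem_map] at h
    obtain ⟨a, _, b, _, rfl⟩ := h
    rfl
  · intro h
    obtain ⟨a, b, rfl⟩ := List.length_eq_two.1 h
    cases a <;> cases b <;> decide

theorem mem_prefixes_num {q q' : Quad} {l : Option Letter} {u : List Dir} :
    u ∈ prefixes (some (.num q)) (some (.num q')) l ↔
      ∃ x o, x.length = 2 ∧ o ∈ orders q' l ∧ Alternating (x ++ o) ∧ u = x ++ o := by
  simp only [prefixes, List.mem_flatMap, List.mem_map, List.mem_filter, mem_pairs, decide_eq_true_eq]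
  constructor
  · rintro ⟨o, ho, x, ⟨h₁, h₂⟩, rfl⟩; exact ⟨x, o, h₁, ho, h₂, rfl⟩
  · rintro ⟨x, o, h₁, ho, h₂, rfl⟩; exact ⟨o, ho, x, ⟨h₁, h₂⟩, rfl⟩

theorem exists_of_mem_pinWords {π : Permutation} (hπ : IsSimplePerm π) (h2 : 2 ≤ π.1) {w : List Letter}
    (hw : w ∈ pinWords π) : ∃ q l ds, w = .num q :: l :: ds.map .dir ∧ ds.length + 2 = π.1 ∧ Alternating ds := by
  obtain ⟨hl, P, hr, hP⟩ := mem_pinWords.1 hw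
  obtain ⟨l₁, l₂, t, rfl⟩ : ∃ l₁ l₂ t, w = l₁ :: l₂ :: t := by
    match w, hl ▸ h2 with
    | l₁ :: l₂ :: t, _ => exact ⟨l₁, l₂, t, rfl⟩
  obtain ⟨q, rfl⟩ := hP.first_num
  obtain ⟨ds, rfl⟩ : ∃ s : List Dir, t = s.map .dir := by
    have : ∀ l ∈ t, ∃ d, Letter.dir d = l := by
      intro l hl'
      obtain ⟨i, hi, rfl⟩ := List.getElem_of_mem hl'
      obtain ⟨d, hd⟩ := hP.isDir_of_simple hl hr hπ (i := i + 2) (by omega) (by simpa using hi)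
      exact ⟨d, by simpa using hd.symm⟩
    choose f hf using this
    exact ⟨t.attach.map fun l => f l.1 l.2, by
      rw [List.map_map]
      conv_lhs => rw [← List.attach_map_subtype_val t]
      exact List.map_congr_left fun l _ => (hf l.1 l.2).symm⟩
  refine ⟨q, l₂, ds, rfl, by simpa using hl, List.isChain_iff_getElem.2 fun i hi => ?_⟩
  refine hP.perp (i := i + 2) (by simp; omega) ?_ ?_ <;> simp

/-- The order of the two directions in `o` is chosen to fit the next letter, so only the short word
`x ++ o` has to be tested for alternation. -/
theorem alternating_append {x o ds : List Dir} {q : Quad} (ho : o ∈ orders q (ds.head?.map .dir))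
    (hx : Alternating (x ++ o)) (hds : Alternating ds) : Alternating (x ++ o ++ ds) := by
  refine List.IsChain.append hx hds fun a ha d hd => ?_
  cases ds with
  | nil => simp at hd
  | cons d' ds =>
    simp only [List.head?_cons, Option.mem_def, Option.some.injEq] at hd
    subst hd
    simp only [orders, List.head?_cons, Option.map_some] at ho
    split_ifs at ho with h <;> simp only [List.mem_singleton] at ho <;> subst ho <;> simp at ha <;>
      subst ha <;> cases q <;> simp [Quad.h, Quad.v, Dir.isHoriz] at * <;> simp [h]

/-- The forbidden factors in terms of the first two letters and the other letters of the pin words. -/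
theorem mem_forbidden_iff {B : Set Permutation} (hB : ∀ π ∈ B, IsSimplePerm π ∧ 2 ≤ π.size)
    {v : List Dir} : v ∈ forbidden B ↔
      (∃ π ∈ B, ∃ l₁ l₂ ds, l₁ :: l₂ :: ds.map .dir ∈ pinWords π ∧
        ∃ u ∈ prefixes (some l₁) (some l₂) (ds.head?.map .dir), v = u ++ ds) ∨
      ∃ a b : Dir, a.isHoriz = b.isHoriz ∧ v = [a, b] := by
  simp only [forbidden, Set.mem_union, Set.mem_iUnion, exists_prop, Set.mem_ofPred_eq, factorsOf]
  refine or_congr (exists_congr fun π => and_congr_right fun hπ => ?_) Iff.rfl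
  constructor
  · rintro (⟨q, ds, hne, hw, hv⟩ | ⟨⟨-, hv⟩, q, q', ds, x, y, hw, hx, hy, rfl⟩)
    · obtain ⟨d, ds, rfl⟩ := List.exists_cons_of_ne_nil hne
      obtain ⟨o, ho, rfl⟩ := mem_phi_iff.1 hv
      exact ⟨.num q, .dir d, ds, hw, o ++ [d], List.mem_map.2 ⟨o, ho, rfl⟩, by simp⟩
    · obtain ⟨o, ho, rfl⟩ := mem_phi_iff.1 hy
      refine ⟨.num q, .num q', ds, hw, x ++ o, mem_prefixes_num.2 ⟨x, o, hx, ho, ?_, rfl⟩, by simp⟩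
      exact List.IsChain.infix hv ⟨[], ds, by simp⟩
  · rintro ⟨l₁, l₂, ds, hw, u, hu, rfl⟩
    obtain ⟨q, l, ds', he, -, hds⟩ := exists_of_mem_pinWords (hB π hπ).1 (hB π hπ).2 hw
    simp only [List.cons.injEq] at he
    obtain ⟨rfl, rfl, he⟩ := he
    obtain rfl : ds = ds' := List.map_injective_iff.2 (fun a b h => by cases h; rfl) he
    cases l₂ with
    | dir d =>
      left
      obtain ⟨o, ho, rfl⟩ := List.mem_map.1 hu
      exact ⟨q, d :: ds, by simp, hw, mem_phi_iff.2 ⟨o, ho, by simp⟩⟩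
    | num q' =>
      right
      obtain ⟨x, o, hx, ho, hxo, rfl⟩ := mem_prefixes_num.1 hu
      refine ⟨⟨?_, alternating_append ho hxo hds⟩, q, q', ds, x, o ++ ds, hw, hx,
        mem_phi_iff.2 ⟨o, ho, rfl⟩, by simp⟩
      simp only [List.length_append, hx, length_of_mem_orders ho]
      omega

end PinPerm
namespace PinPerm

/-! ### Building the trie -/

/-- The number of a node, or `0`. -/
def nodeNum (V : List (List Dir)) (w : List Dir) : ℕ := if w ∈ V then V.idxOf w else 0

theorem nodeNum_of_mem {V : List (List Dir)} {w : List Dir} (h : w ∈ V) : nodeNum V w = V.idxOf w := if_pos h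

theorem nodeNum_of_not_mem {V : List (List Dir)} {w : List Dir} (h : w ∉ V) : nodeNum V w = 0 := if_neg h

theorem nodeNum_append_of_ne {V : List (List Dir)} {x y : List Dir} (h : y ≠ x) :
    nodeNum (V ++ [x]) y = nodeNum V y := by
  by_cases hy : y ∈ V
  · rw [nodeNum_of_mem hy, nodeNum_of_mem (by simp [hy]), List.idxOf_append_of_mem hy]
  · rw [nodeNum_of_not_mem hy, nodeNum_of_not_mem (by simp [hy, h])]

theorem nodeNum_append_self {V : List (List Dir)} {x : List Dir} (h : x ∉ V) :
    nodeNum (V ++ [x]) x = V.length := by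
  rw [nodeNum_of_mem (by simp), List.idxOf_append_of_notMem h]
  simp

theorem nodeNum_lt {V : List (List Dir)} {w : List Dir} (h : w ∈ V) : nodeNum V w < V.length := by
  rw [nodeNum_of_mem h]; exact List.idxOf_lt_length_of_mem h

theorem nodeNum_inj {V : List (List Dir)} {w w' : List Dir} (h : w ∈ V) (h' : w' ∈ V)
    (he : nodeNum V w = nodeNum V w') : w = w' := by
  rw [nodeNum_of_mem h, nodeNum_of_mem h'] at he
  exact (List.idxOf_inj h).1 he

theorem code_add_two_inj {d d' : Dir} : 2 + d'.code = 2 + d.code ↔ d' = d := by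
  cases d <;> cases d' <;> decide

/-- The memory contains the trie with nodes `V`, and the nodes in `M` are marked. -/
structure Trie (s : Memory) (V : List (List Dir)) (M : Set (List Dir)) : Prop where
  head : V.head? = some []
  nodup : V.Nodup
  closed : ∀ w d, w ++ [d] ∈ V → w ∈ V
  reg2 : s.reg 2 = V.length
  child : ∀ w ∈ V, ∀ d : Dir, s.arr (2 + d.code) (nodeNum V w) = nodeNum V (w ++ [d])
  fresh : ∀ (d : Dir) (i : ℕ), V.length ≤ i → s.arr (2 + d.code) i = 0
  mark : ∀ w ∈ V, (w ∈ M → s.arr 6 (nodeNum V w) = 1) ∧ (w ∉ M → s.arr 6 (nodeNum V w) = 0)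
  fresh_mark : ∀ i, V.length ≤ i → s.arr 6 i = 0
  sub : ∀ w ∈ M, w ∈ V

namespace Trie

variable {s s' : Memory} {V : List (List Dir)} {M : Set (List Dir)}

theorem nil_mem (h : Trie s V M) : [] ∈ V := List.mem_of_mem_head? (by rw [h.head]; simp)

theorem nodeNum_nil (h : Trie s V M) : nodeNum V [] = 0 := by
  obtain ⟨x, V', rfl⟩ := List.exists_cons_of_ne_nil (List.ne_nil_of_mem h.nil_mem)
  have := h.head
  simp only [List.head?_cons, Option.some.injEq] at this
  simp [nodeNum, this]

/-- The root has number `0` and is nobody's child, so `0` in a transition array can stand for a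
missing child. -/
theorem nodeNum_eq_zero (h : Trie s V M) {w : List Dir} (hw : w ∈ V) (h0 : nodeNum V w = 0) : w = [] :=
  nodeNum_inj hw h.nil_mem (by rw [h0, h.nodeNum_nil])

theorem congr (h : Trie s V M) (h2 : s'.reg 2 = s.reg 2) (ha : ∀ k, 2 ≤ k → k ≤ 6 → s'.arr k = s.arr k) :
    Trie s' V M where
  __ := h
  reg2 := h2.trans h.reg2
  child w hw d := by rw [ha _ (by omega) (by cases d <;> simp [Dir.code]), h.child w hw]
  fresh d i hi := by rw [ha _ (by omega) (by cases d <;> simp [Dir.code]), h.fresh d i hi]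
  mark w hw := by rw [ha _ (by omega) (by omega)]; exact h.mark w hw
  fresh_mark i hi := by rw [ha _ (by omega) (by omega), h.fresh_mark i hi]

theorem of_frame (h : Trie s V M) {R A : List ℕ} (hf : Frame R A s s') (hR : 2 ∉ R)
    (hA : ∀ k ∈ A, 6 < k) : Trie s' V M :=
  h.congr (hf.1 2 hR) fun k _ h₂ => hf.2 k fun hk => by have := hA k hk; omega

/-- The new node gets the next free number. The cells there are still zero, which is correct: as the
nodes are closed under prefixes, a word that was no node has no children and no mark. -/
theorem add (h : Trie s V M) {w : List Dir} {d : Dir} (hw : w ∈ V) (hx : w ++ [d] ∉ V)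
    (h2 : s'.reg 2 = V.length + 1) (h6 : s'.arr 6 = s.arr 6)
    (ha : ∀ d' : Dir, s'.arr (2 + d'.code) = if d' = d then
      Function.update (s.arr (2 + d.code)) (nodeNum V w) V.length else s.arr (2 + d'.code)) :
    Trie s' (V ++ [w ++ [d]]) M := by
  have hne : ∀ {y}, y ∈ V → y ≠ w ++ [d] := fun hy h => hx (h ▸ hy)
  have hnil := h.nil_mem
  have hs : ∀ (d' : Dir) (i : ℕ), V.length ≤ i → s'.arr (2 + d'.code) i = 0 := by
    intro d' i hi
    have := nodeNum_lt hw
    rw [ha]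
    split_ifs with hd
    · rw [Function.update_of_ne (by omega), h.fresh _ _ hi]
    · exact h.fresh _ _ hi
  refine ⟨?_, ?_, ?_, by simp [h2], ?_, ?_, ?_, ?_, ?_⟩
  · rw [List.head?_append, h.head]; rfl
  · refine List.nodup_append.2 ⟨h.nodup, List.nodup_singleton _, fun a ha b hb hab => ?_⟩
    rw [List.mem_singleton] at hb
    exact hne ha (hab.trans hb)
  · intro y d' hy
    simp only [List.mem_append, List.mem_singleton] at hy ⊢
    rcases hy with hy | hy
    · exact Or.inl (h.closed y d' hy)
    · rw [(List.append_inj' hy rfl).1]; exact Or.inl hw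
  · intro y hy d'
    simp only [List.mem_append, List.mem_singleton] at hy
    rcases hy with hy | rfl
    · rw [nodeNum_append_of_ne (hne hy), ha]
      by_cases hyd : y = w ∧ d' = d
      · obtain ⟨rfl, rfl⟩ := hyd
        rw [if_pos rfl, Function.update_self, nodeNum_append_self hx]
      · rw [nodeNum_append_of_ne, ← h.child y hy]
        · split_ifs with hd
          · subst hd
            rw [Function.update_of_ne]
            exact fun he => hyd ⟨nodeNum_inj hy hw he, rfl⟩
          · rfl
        · intro he
          obtain ⟨h₁, h₂⟩ := List.append_inj' he rfl
          exact hyd ⟨h₁, by simpa using h₂⟩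
    · rw [nodeNum_append_self hx, hs _ _ le_rfl, nodeNum_of_not_mem]
      simp only [List.mem_append, List.mem_singleton, not_or]
      exact ⟨fun h' => hx (h.closed _ _ h'), by simp⟩
  · intro d' i hi
    exact hs d' i (by simp at hi; omega)
  · intro y hy
    simp only [List.mem_append, List.mem_singleton] at hy
    rw [h6]
    rcases hy with hy | rfl
    · rw [nodeNum_append_of_ne (hne hy)]; exact h.mark y hy
    · rw [nodeNum_append_self hx, h.fresh_mark _ le_rfl]
      exact ⟨fun hM => absurd (h.sub _ hM) hx, fun _ => rfl⟩
  · intro i hi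
    rw [h6]
    exact h.fresh_mark i (by simp at hi; omega)
  · exact fun y hy => List.mem_append_left _ (h.sub y hy)

theorem insert_mark (h : Trie s V M) {w : List Dir} (hw : w ∈ V) (h2 : s'.reg 2 = s.reg 2)
    (ha : ∀ k, 2 ≤ k → k ≤ 5 → s'.arr k = s.arr k)
    (h6 : s'.arr 6 = Function.update (s.arr 6) (nodeNum V w) 1) : Trie s' V (insert w M) where
  __ := h
  reg2 := h2.trans h.reg2
  child w hw d := by rw [ha _ (by omega) (by cases d <;> simp [Dir.code]), h.child w hw]
  fresh d i hi := by rw [ha _ (by omega) (by cases d <;> simp [Dir.code]), h.fresh d i hi]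
  mark y hy := by
    rw [h6, Set.mem_insert_iff]
    by_cases hyw : y = w
    · subst hyw
      exact ⟨fun _ => by simp, fun h => absurd (Or.inl rfl) h⟩
    · rw [Function.update_of_ne fun h => hyw (nodeNum_inj hy hw h)]
      simpa [hyw] using h.mark y hy
  fresh_mark i hi := by
    have := nodeNum_lt hw
    rw [h6, Function.update_of_ne (by omega), h.fresh_mark i hi]
  sub y hy := by
    rcases hy with rfl | hy
    exacts [hw, h.sub y hy]

end Trie

/-- Goes from the node in register `20` to the child in direction `d`, which is added if necessary. -/
def gotoChild (d : Dir) : Program :=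
  block [.load 21 (2 + d.code) 20,
    .ite (.eq 21 9) (block [.store (2 + d.code) 20 2, .copy 21 2, .inc 2]) nop, .copy 20 21]

/-- The memory contains a trie and register `20` the number of the node `w`. -/
structure AtNode (s : Memory) (V : List (List Dir)) (M : Set (List Dir)) (w : List Dir) : Prop where
  trie : Trie s V M
  mem : w ∈ V
  reg20 : s.reg 20 = nodeNum V w
  reg9 : s.reg 9 = 0

theorem AtNode.of_frame {s s' : Memory} {V : List (List Dir)} {M : Set (List Dir)} {w : List Dir}
    (h : AtNode s V M w) {R A : List ℕ} (hf : Frame R A s s') (hR : 2 ∉ R ∧ 9 ∉ R ∧ 20 ∉ R)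
    (hA : ∀ k ∈ A, 6 < k) : AtNode s' V M w :=
  ⟨h.trie.of_frame hf hR.1 hA, h.mem, (hf.1 _ hR.2.2).trans h.reg20, (hf.1 _ hR.2.1).trans h.reg9⟩

theorem writes_gotoChild (d : Dir) : (gotoChild d).Writes [2, 20, 21, 7] [2, 3, 4, 5] := by
  cases d <;> simp [gotoChild, block, Program.Writes, nop, Dir.code]

theorem runs_gotoChild {s : Memory} {V : List (List Dir)} {M : Set (List Dir)} {w : List Dir}
    (h : AtNode s V M w) (d : Dir) : Runs (gotoChild d) s 6 fun s' => ∃ V', AtNode s' V' M (w ++ [d]) ∧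
      (∀ x, x ∈ V' ↔ x ∈ V ∨ x = w ++ [d]) ∧ V'.length ≤ V.length + 1 := by
  refine .of_wp ?_ (by simp [gotoChild, block, Program.cost, nop])
  have hc := h.trie.child w h.mem d
  have hd : 2 + d.code ≠ 6 := by cases d <;> simp [Dir.code]
  simp only [gotoChild, block, Program.wp, wp_nop, Test.Holds, Memory.reg_setReg, Memory.arr_setReg,
    h.reg20, hc]
  norm_num
  rw [h.reg9]
  refine ⟨fun hz => ?_, fun hz => ?_⟩
  · have hx : w ++ [d] ∉ V := fun hx => by simpa using h.trie.nodeNum_eq_zero hx hz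
    refine ⟨V ++ [w ++ [d]], ⟨h.trie.add h.mem hx ?_ ?_ ?_, by simp, ?_, ?_⟩, by simp, by simp⟩
    · simp [h.trie.reg2]
    · simp [hd.symm]
    · intro d'
      simp only [Memory.arr_setReg, Memory.arr_setArr, code_add_two_inj, h.trie.reg2]
    · simp [nodeNum_append_self hx, h.trie.reg2]
    · simp [h.reg9]
  · have hx : w ++ [d] ∈ V := by_contra fun hx => hz (nodeNum_of_not_mem hx)
    refine ⟨V, ⟨h.trie.congr (by simp) (by simp), hx, by simp, by simp [h.reg9]⟩, fun x => ?_, by simp⟩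
    exact ⟨Or.inl, by rintro (h | rfl); exacts [h, hx]⟩

/-- The direction with the given number as a letter. -/
def dirOfCode : ℕ → Dir
  | 5 => .U
  | 6 => .D
  | 7 => .L
  | _ => .R

theorem dirOfCode_code (d : Dir) : dirOfCode (5 + d.code) = d := by cases d <;> rfl

/-- Adds the word with the letters `u`, followed by the part of array `1` that begins at the cell with
number in register `10` and has the length in register `12`. -/
def insertWord (u : List Dir) : Program :=
  block [.const 20 0, chain (u.map gotoChild), .copy 22 10, .copy 23 12,
    .loop (.lt 9 23) (block [.load 24 1 22, switch 24 25 (fun c => gotoChild (dirOfCode c)) 8, .inc 22,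
      .dec 23]), .store 6 20 8]

/-- The registers used for the insertion of a word. -/
abbrev insertRegs : List ℕ := [2, 20, 21, 7, 22, 23, 24, 25]

theorem writes_insertWord (u : List Dir) : (insertWord u).Writes insertRegs [2, 3, 4, 5, 6] := by
  have hm : ∀ {a : Program}, a.Writes [2, 20, 21, 7] [2, 3, 4, 5] → a.Writes insertRegs [2, 3, 4, 5, 6] := by
    intro a
    induction a <;> simp only [Program.Writes] <;> first | tauto | (simp; try omega)
  refine ⟨by simp [Program.Writes], writes_chain (by simp) ?_, by simp [Program.Writes],
    by simp [Program.Writes], ⟨by simp [Program.Writes], writes_switch (by simp) (fun i => ?_) 8,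
      by simp [Program.Writes], by simp [block, Program.Writes]⟩, by simp [block, Program.Writes]⟩
  · simp only [List.mem_map]
    rintro _ ⟨d, -, rfl⟩
    exact hm (writes_gotoChild d)
  · exact hm (writes_gotoChild _)

theorem runs_insertWord {s : Memory} {V : List (List Dir)} {M : Set (List Dir)} {t : List Dir}
    (h : Trie s V M) (h8 : s.reg 8 = 1) (h9 : s.reg 9 = 0) (h12 : s.reg 12 = t.length)
    (ha : ∀ (i : ℕ) (hi : i < t.length), s.arr 1 (s.reg 10 + i) = 5 + t[i].code) (u : List Dir) :
    Runs (insertWord u) s (6 * u.length + 27 * t.length + 6) fun s' =>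
      ∃ V', Trie s' V' (insert (u ++ t) M) ∧ (∀ x, x ∈ V' ↔ x ∈ V ∨ x <+: u ++ t) ∧
        V'.length ≤ V.length + u.length + t.length := by
  unfold insertWord block
  have h0 : AtNode (s.setReg 20 0) V M [] :=
    ⟨h.congr (by simp) (by simp), h.nil_mem, by simp [h.nodeNum_nil], by simp [h9]⟩
  let fixed : Memory → Prop := fun s' => s'.reg 8 = 1 ∧ s'.reg 12 = t.length ∧ s'.reg 10 = s.reg 10 ∧
    s'.arr 1 = s.arr 1
  have hfix : ∀ {s₁ s₂ : Memory} {R A : List ℕ}, fixed s₁ → Frame R A s₁ s₂ →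
      (8 ∉ R ∧ 12 ∉ R ∧ 10 ∉ R ∧ 1 ∉ A) → fixed s₂ := by
    rintro s₁ s₂ R A ⟨e₁, e₂, e₃, e₄⟩ hf ⟨k₁, k₂, k₃, k₄⟩
    exact ⟨(hf.1 _ k₁).trans e₁, (hf.1 _ k₂).trans e₂, (hf.1 _ k₃).trans e₃, (hf.2 _ k₄).trans e₄⟩
  refine Runs.seq (T₁ := 1) (T₂ := 6 * u.length + 27 * t.length + 5)
    (P := fun s' => s' = s.setReg 20 0) (.of_wp rfl le_rfl) ?_ (by omega)
  rintro _ rfl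
  let J : List Dir → Memory → Prop := fun ds s' => fixed s' ∧ ∃ v V', v ++ ds = u ∧ AtNode s' V' M v ∧
    (∀ x, x ∈ V' ↔ x ∈ V ∨ x <+: v) ∧ V'.length ≤ V.length + v.length
  refine Runs.seq (T₁ := u.length * 6 + 1) (T₂ := 27 * t.length + 4) (P := J [])
    (Runs.chain J ?_ ?_) ?_ (by omega)
  · rintro d ds s' ⟨hx, v, V', rfl, hA, hV, hlen⟩
    refine ((runs_gotoChild hA d).frame _ _ (writes_gotoChild d)).mono le_rfl ?_
    rintro s'' ⟨⟨V'', hA', hV', hlen'⟩, hf⟩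
    refine ⟨hfix hx hf (by simp), v ++ [d], V'', by simp, hA', fun x => ?_, by simp; omega⟩
    rw [hV', hV, List.prefix_concat_iff]
    tauto
  · refine ⟨⟨by simp [h8], by simp [h12], by simp, by simp⟩, [], V, rfl, h0, fun x => ?_, by simp⟩
    rw [List.prefix_nil]
    exact ⟨Or.inl, by rintro (hx | rfl); exacts [hx, h.nil_mem]⟩
  rintro s₁ ⟨hx, v, V₁, hv, hA, hV, hlen⟩
  obtain rfl : v = u := by simpa using hv
  let I : ℕ → Memory → Prop := fun i s' => fixed s' ∧ s'.reg 22 = s.reg 10 + i ∧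
    s'.reg 23 = t.length - i ∧ ∃ V', AtNode s' V' M (v ++ t.take i) ∧
    (∀ x, x ∈ V' ↔ x ∈ V ∨ x <+: v ++ t.take i) ∧ V'.length ≤ V.length + v.length + i
  refine Runs.seq (T₁ := 1) (T₂ := 27 * t.length + 3)
    (P := fun s' => s' = s₁.setReg 22 (s.reg 10)) (.of_wp (by simp [Program.wp, hx.2.2.1]) le_rfl) ?_ (by omega)
  rintro _ rfl
  refine Runs.seq (T₁ := 1) (T₂ := 27 * t.length + 2) (P := I 0) (.of_wp ?_ le_rfl) ?_ (by omega)
  · refine ⟨⟨by simp [hx.1], by simp [hx.2.1], by simp [hx.2.2.1], by simp [hx.2.2.2]⟩, by simp, by simp [hx.2.1],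
      V₁, ?_, by simpa using hV, by simpa using hlen⟩
    rw [List.take_zero, List.append_nil]
    exact ⟨hA.trie.congr (by simp) (by simp), hA.mem, by simp [hA.reg20], by simp [hA.reg9]⟩
  intro s₂ hs₂
  refine Runs.seq (T₁ := t.length * (26 + 1) + 1) (T₂ := 1) (Runs.for_const I t.length 26 ?_ ?_ hs₂) ?_
    (by omega)
  · rintro i hi s' ⟨hx, h22, h23, V', hA', hV', hlen'⟩
    refine ⟨by simp only [Test.Holds, hA'.reg9, h23]; omega, ?_⟩
    have hc : s'.arr 1 (s.reg 10 + i) = 5 + t[i].code := by rw [hx.2.2.2, ha i hi]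
    refine Runs.seq (T₁ := 1) (T₂ := 25) (P := fun s'' => s'' = s'.setReg 24 (5 + t[i].code))
      (.of_wp (by simp [Program.wp, h22, hc]) le_rfl) ?_ (by omega)
    rintro _ rfl
    set s'' := s'.setReg 24 (5 + t[i].code) with hs''
    have hf₁ : Frame [24] [] s' s'' := frame_setReg (by simp) _ _
    refine Runs.seq (T₁ := 22) (T₂ := 2) (P := fun t' => Frame (24 :: [2, 20, 21, 7, 25]) [2, 3, 4, 5] s' t' ∧
      ∃ V'', AtNode t' V'' M (v ++ t.take i ++ [t[i]]) ∧
      (∀ x, x ∈ V'' ↔ x ∈ V' ∨ x = v ++ t.take i ++ [t[i]]) ∧ V''.length ≤ V'.length + 1) ?_ ?_ (by omega)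
    · refine (Runs.switch (T := 6) (by simp) ?_ fun s₃ hf₃ => ?_).mono (by omega) fun _ => id
      · simp [hs'']; cases t[i] <;> simp [Dir.code]
      · rw [show s''.reg 24 = 5 + t[i].code by simp [hs''], dirOfCode_code]
        have hA₃ := (hA'.of_frame hf₁ (by simp) (by simp)).of_frame hf₃ (by simp) (by simp)
        refine ((runs_gotoChild hA₃ t[i]).frame _ _ (writes_gotoChild _)).mono le_rfl ?_
        rintro s₄ ⟨hQ, hf₄⟩
        refine ⟨(hf₁.mono (by simp) (by simp)).trans ((hf₃.mono (by simp) (by simp)).trans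
          (hf₄.mono (by simp) (by simp))), hQ⟩
    · rintro s₃ ⟨hf, V'', hA'', hV'', hlen''⟩
      have hx₃ := hfix hx hf (by simp)
      refine .of_wp ?_ (by simp [block, Program.cost])
      simp only [block, Program.wp]
      refine ⟨⟨by simp [hx₃.1], by simp [hx₃.2.1], by simp [hx₃.2.2.1], by simp [hx₃.2.2.2]⟩, ?_, ?_, V'', ?_, ?_,
        by omega⟩
      · simp [hf.1 22 (by simp), h22]; omega
      · simp [hf.1 23 (by simp), h23]; omega
      · rw [List.take_succ_eq_append_getElem hi, ← List.append_assoc]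
        exact ⟨hA''.trie.congr (by simp) (by simp), hA''.mem, by simp [hA''.reg20], by simp [hA''.reg9]⟩
      · intro x
        rw [List.take_succ_eq_append_getElem hi, ← List.append_assoc, List.prefix_concat_iff, hV'', hV']
        tauto
  · rintro s' ⟨-, h22, h23, V', hA', -⟩
    simp [Test.Holds, hA'.reg9, h23]
  · rintro s' ⟨hx, h22, h23, V', hA', hV', hlen'⟩
    rw [List.take_length] at hA' hV'
    refine .of_wp ?_ (by simp [block, Program.cost])
    refine ⟨V', hA'.trie.insert_mark hA'.mem (by simp) (fun k _ hk => ?_) ?_, hV', hlen'⟩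
    · simp [show k ≠ 6 by omega]
    · simp [hA'.reg20, hx.1]

end PinPerm
namespace PinPerm

/-! ### Inserting the forbidden factors of all pin words -/

/-- A loop with rounds that are paid from a potential. -/
theorem Runs.loop_potential {c : Test} {a : Program} (I : Memory → Prop) (Φ : Memory → ℕ)
    (step : ∀ s, I s → c.Holds s → ∃ T, Runs a s T fun s' => I s' ∧ T + 1 + Φ s' ≤ Φ s) {s : Memory}
    (h0 : I s) : Runs (.loop c a) s (Φ s + 1) fun s' => I s' ∧ ¬ c.Holds s' := by
  have : ∀ n s, I s → Φ s ≤ n → Runs (.loop c a) s (Φ s + 1) fun s' => I s' ∧ ¬ c.Holds s' := by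
    intro n
    induction n with
    | zero =>
      intro s h hn
      by_cases hc : c.Holds s
      · obtain ⟨T, _, _, _, _, h'⟩ := step s h hc; omega
      · exact .loop_done hc ⟨h, hc⟩ (by omega)
    | succ n ih =>
      intro s h hn
      by_cases hc : c.Holds s
      · obtain ⟨T, t, s', h₁, h₂, h₃, h₄⟩ := step s h hc
        exact .loop_step (T₁ := T) (T₂ := Φ s' + 1) (P := fun x => x = s') hc ⟨t, s', h₁, h₂, rfl⟩
          (fun x hx => by subst hx; exact ih _ h₃ (by omega)) (by omega)
      · exact .loop_done hc ⟨h, hc⟩ (by omega)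
  exact this _ s h0 le_rfl

/-- The memory contains a trie for the words in `M`. -/
def TrieOf (s : Memory) (M : Set (List Dir)) : Prop := ∃ V, Trie s V M ∧ ∀ x, x ∈ V ↔ IsACState M x

theorem TrieOf.of_frame {s s' : Memory} {M : Set (List Dir)} (h : TrieOf s M) {R A : List ℕ}
    (hf : Frame R A s s') (hR : 2 ∉ R) (hA : ∀ k ∈ A, 6 < k) : TrieOf s' M := by
  obtain ⟨V, h₁, h₂⟩ := h
  exact ⟨V, h₁.of_frame hf hR hA, h₂⟩

theorem isACState_insert {α : Type*} {M : Set (List α)} {f x : List α} :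
    IsACState (insert f M) x ↔ IsACState M x ∨ x <+: f := by
  simp only [IsACState, Set.mem_insert_iff, exists_eq_or_imp]
  rw [or_assoc, or_comm (a := x <+: f)]

/-- Part of array `1` contains the directions. -/
structure HoldsTail (s : Memory) (t : List Dir) : Prop where
  reg8 : s.reg 8 = 1
  reg9 : s.reg 9 = 0
  reg12 : s.reg 12 = t.length
  arr : ∀ (i : ℕ) (hi : i < t.length), s.arr 1 (s.reg 10 + i) = 5 + t[i].code

theorem HoldsTail.of_frame {s s' : Memory} {t : List Dir} (h : HoldsTail s t) {R A : List ℕ}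
    (hf : Frame R A s s') (hR : 8 ∉ R ∧ 9 ∉ R ∧ 12 ∉ R ∧ 10 ∉ R) (hA : 1 ∉ A) : HoldsTail s' t :=
  ⟨(hf.1 _ hR.1).trans h.reg8, (hf.1 _ hR.2.1).trans h.reg9, (hf.1 _ hR.2.2.1).trans h.reg12,
    fun i hi => by rw [hf.2 _ hA, hf.1 _ hR.2.2.2, h.arr i hi]⟩

/-- Adds several words with the same end. -/
def insertWords (us : List (List Dir)) : Program := chain (us.map insertWord)

theorem writes_insertWords (us : List (List Dir)) : (insertWords us).Writes insertRegs [2, 3, 4, 5, 6] := by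
  refine writes_chain (by simp) ?_
  simp only [List.mem_map]
  rintro _ ⟨u, -, rfl⟩
  exact writes_insertWord u

theorem runs_insertWords {s : Memory} {M : Set (List Dir)} {t : List Dir} (h : TrieOf s M)
    (ht : HoldsTail s t) {us : List (List Dir)} (hus : ∀ u ∈ us, u.length ≤ 4) :
    Runs (insertWords us) s (us.length * (27 * t.length + 30) + 1) fun s' =>
      TrieOf s' (M ∪ {x | ∃ u ∈ us, x = u ++ t}) ∧ s'.reg 2 ≤ s.reg 2 + us.length * (t.length + 4) := by
  let J : List (List Dir) → Memory → Prop := fun l s' => HoldsTail s' t ∧ ∃ l', l' ++ l = us ∧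
    TrieOf s' (M ∪ {x | ∃ u ∈ l', x = u ++ t}) ∧ s'.reg 2 ≤ s.reg 2 + l'.length * (t.length + 4)
  refine (Runs.chain J (l := us) ?_ ?_).mono le_rfl ?_
  · rintro u l s' ⟨hs, l', rfl, ⟨V, hV, hm⟩, h2⟩
    have hu := hus u (by simp)
    refine ((runs_insertWord hV hs.reg8 hs.reg9 hs.reg12 hs.arr u).frame _ _ (writes_insertWord u)).mono
      (by omega) ?_
    rintro s'' ⟨⟨V', hV', hm', hl⟩, hf⟩
    refine ⟨hs.of_frame hf (by simp) (by simp), l' ++ [u], by simp, ⟨V', ?_, fun x => ?_⟩, ?_⟩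
    · convert hV' using 1
      ext x
      simp only [Set.mem_union, Set.mem_ofPred_eq, List.mem_append, List.mem_singleton, Set.mem_insert_iff]
      constructor
      · rintro (h | ⟨u', h | rfl, rfl⟩)
        exacts [Or.inr (Or.inl h), Or.inr (Or.inr ⟨u', h, rfl⟩), Or.inl rfl]
      · rintro (rfl | h | ⟨u', h, rfl⟩)
        exacts [Or.inr ⟨u, Or.inr rfl, rfl⟩, Or.inl h, Or.inr ⟨u', Or.inl h, rfl⟩]
    · rw [hm', hm, ← isACState_insert]
      refine iff_of_eq (congrArg₂ _ ?_ rfl)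
      ext x
      simp only [Set.mem_union, Set.mem_ofPred_eq, List.mem_append, List.mem_singleton, Set.mem_insert_iff]
      constructor
      · rintro (rfl | h | ⟨u', h, rfl⟩)
        exacts [Or.inr ⟨u, Or.inr rfl, rfl⟩, Or.inl h, Or.inr ⟨u', Or.inl h, rfl⟩]
      · rintro (h | ⟨u', h | rfl, rfl⟩)
        exacts [Or.inr (Or.inl h), Or.inr (Or.inr ⟨u', h, rfl⟩), Or.inl rfl]
    · rw [hV'.reg2]
      rw [hV.reg2] at h2
      rw [List.length_append, List.length_singleton, add_mul, one_mul]
      omega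
  · exact ⟨ht, [], rfl, by simpa using h, by simp⟩
  · rintro s' ⟨-, l', hl', h₁, h₂⟩
    rw [List.append_nil] at hl'
    subst hl'
    exact ⟨h₁, h₂⟩

/-- The letter with the given number. -/
def letterOfCode : ℕ → Option Letter
  | 1 => some (.num .one)
  | 2 => some (.num .two)
  | 3 => some (.num .three)
  | 4 => some (.num .four)
  | 5 => some (.dir .U)
  | 6 => some (.dir .D)
  | 7 => some (.dir .L)
  | 8 => some (.dir .R)
  | _ => none

theorem letterOfCode_code (l : Letter) : letterOfCode l.code = some l := by
  rcases l with (_ | _ | _ | _) | (_ | _ | _ | _) <;> rfl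

theorem Letter.code_le (l : Letter) : l.code ≤ 8 := by
  rcases l with (_ | _ | _ | _) | (_ | _ | _ | _) <;> decide

theorem length_orders_le (q : Quad) (l : Option Letter) : (orders q l).length ≤ 2 := by
  rcases l with _ | _ | d
  · simp [orders]
  · simp [orders]
  · simp only [orders]; split_ifs <;> simp

/-- At most two orders for the directions of the numeral, and sixteen pairs in front of each. -/
theorem length_prefixes_le (l₁ l₂ l : Option Letter) : (prefixes l₁ l₂ l).length ≤ 32 := by
  rcases l₁ with _ | _ | _ <;> rcases l₂ with _ | q | d <;> try simp [prefixes]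
  · have := List.sum_le_card_nsmul ((orders q l).map fun o =>
      ((pairs.filter fun x => Alternating (x ++ o)).map (· ++ o)).length) 16 (by
        simp only [List.mem_map]
        rintro _ ⟨o, -, rfl⟩
        rw [List.length_map]
        exact (List.length_filter_le _ _).trans (by decide))
    have h2 := length_orders_le q l
    simp only [List.length_map, smul_eq_mul] at this
    omega
  · have := length_orders_le ‹Quad› (some (.dir d))
    omega

theorem length_le_of_mem_prefixes {l₁ l₂ l : Option Letter} {u : List Dir} (h : u ∈ prefixes l₁ l₂ l) :
    u.length ≤ 4 := by
  rcases l₁ with _ | _ | _ <;> rcases l₂ with _ | q | d <;>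
    try exact absurd h List.not_mem_nil
  · obtain ⟨x, o, hx, ho, -, rfl⟩ := mem_prefixes_num.1 h
    simp [hx, length_of_mem_orders ho]
  · obtain ⟨o, ho, rfl⟩ := List.mem_map.1 h
    simp [length_of_mem_orders ho]

/-- Adds all forbidden factors for a pin word with first letters in the registers `13, 14, 15`. -/
def insertFactors : Program :=
  switch 13 17 (fun a => switch 14 17 (fun b => switch 15 17 (fun c =>
    insertWords (prefixes (letterOfCode a) (letterOfCode b) (letterOfCode c))) 8) 8) 8

theorem writes_insertFactors : insertFactors.Writes (17 :: insertRegs) [2, 3, 4, 5, 6] := by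
  refine writes_switch (by simp) (fun a => writes_switch (by simp) (fun b => writes_switch (by simp)
    (fun c => writes_chain (by simp) ?_) 8) 8) 8
  simp only [List.mem_map]
  rintro _ ⟨u, -, rfl⟩
  have : ∀ {a : Program}, a.Writes insertRegs [2, 3, 4, 5, 6] →
      a.Writes (17 :: insertRegs) [2, 3, 4, 5, 6] := by
    intro a
    induction a <;> simp only [Program.Writes] <;> tauto
  exact this (writes_insertWord u)

theorem runs_insertFactors {s : Memory} {M : Set (List Dir)} {t : List Dir} (h : TrieOf s M)
    (ht : HoldsTail s t) {l₁ l₂ : Letter} (h13 : s.reg 13 = l₁.code) (h14 : s.reg 14 = l₂.code)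
    (h15 : s.reg 15 ≤ 8) (h15' : letterOfCode (s.reg 15) = t.head?.map .dir) :
    Runs insertFactors s (1000 * (t.length + 2)) fun s' =>
      TrieOf s' (M ∪ {x | ∃ u ∈ prefixes (some l₁) (some l₂) (t.head?.map .dir), x = u ++ t}) ∧
      s'.reg 2 ≤ s.reg 2 + 32 * (t.length + 4) := by
  have hlen := length_prefixes_le (some l₁) (some l₂) (t.head?.map .dir)
  have hb := Nat.mul_le_mul_right (27 * t.length + 30) hlen
  have hb' := Nat.mul_le_mul_right (t.length + 4) hlen
  refine (Runs.switch (T := 1000 * t.length + 1984) (by simp) (h13 ▸ l₁.code_le) fun s₁ f₁ => ?_).mono (by omega)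
    fun _ => id
  have e14 : s₁.reg 14 = l₂.code := (f₁.1 _ (by simp)).trans h14
  refine (Runs.switch (T := 1000 * t.length + 1968) (by simp) (e14 ▸ l₂.code_le) fun s₂ f₂ => ?_).mono (by omega)
    fun _ => id
  have e15 : s₂.reg 15 = s.reg 15 := ((f₁.trans f₂).1 _ (by simp))
  refine (Runs.switch (T := 1000 * t.length + 1952) (by simp) (by omega) fun s₃ f₃ => ?_).mono (by omega)
    fun _ => id
  have hf := (f₁.trans f₂).trans f₃
  rw [h13, e14, e15, h15', letterOfCode_code, letterOfCode_code]
  refine (runs_insertWords (h.of_frame hf (by simp) (by simp)) (ht.of_frame hf (by simp) (by simp))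
    fun u hu => length_le_of_mem_prefixes hu).mono (by omega) ?_
  rintro s' ⟨h₁, h₂⟩
  rw [hf.1 2 (by simp)] at h₂
  exact ⟨h₁, by omega⟩

/-- Reads the next pin word and adds the forbidden factors. -/
def readWord : Program :=
  block [.load 12 1 10, .inc 10, .dec 12, .dec 12, .load 13 1 10, .inc 10, .load 14 1 10, .inc 10,
    .ite (.lt 9 12) (.load 15 1 10) (.const 15 0), insertFactors,
    .loop (.lt 9 12) (block [.inc 10, .dec 12]), .inc 11]

theorem runs_readWord {s : Memory} {M : Set (List Dir)} {l₁ l₂ : Letter} {t : List Dir} {p : ℕ}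
    (h : TrieOf s M) (h8 : s.reg 8 = 1) (h9 : s.reg 9 = 0) (h10 : s.reg 10 = p)
    (a₀ : s.arr 1 p = t.length + 2) (a₁ : s.arr 1 (p + 1) = l₁.code) (a₂ : s.arr 1 (p + 2) = l₂.code)
    (ha : ∀ (i : ℕ) (hi : i < t.length), s.arr 1 (p + 3 + i) = 5 + t[i].code) :
    Runs readWord s (1100 * (t.length + 3)) fun s' =>
      TrieOf s' (M ∪ {x | ∃ u ∈ prefixes (some l₁) (some l₂) (t.head?.map .dir), x = u ++ t}) ∧
      s'.reg 2 ≤ s.reg 2 + 32 * (t.length + 4) ∧ s'.reg 8 = 1 ∧ s'.reg 9 = 0 ∧ s'.reg 10 = p + 3 + t.length ∧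
      s'.reg 11 = s.reg 11 + 1 ∧ s'.reg 1 = s.reg 1 ∧ s'.arr 1 = s.arr 1 := by
  let P : Memory → Prop := fun s' => Frame [10, 12, 13, 14, 15] [] s s' ∧ s'.reg 12 = t.length ∧
    s'.reg 10 = p + 3 ∧ s'.reg 13 = l₁.code ∧ s'.reg 14 = l₂.code ∧ s'.reg 15 ≤ 8 ∧
    letterOfCode (s'.reg 15) = t.head?.map .dir
  have hP : Runs (block [.load 12 1 10, .inc 10, .dec 12, .dec 12, .load 13 1 10, .inc 10, .load 14 1 10,
      .inc 10, .ite (.lt 9 12) (.load 15 1 10) (.const 15 0)]) s 10 P := by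
    refine ((Runs.of_wp (Q := fun s' => s'.reg 12 = t.length ∧
      s'.reg 10 = p + 3 ∧ s'.reg 13 = l₁.code ∧ s'.reg 14 = l₂.code ∧ s'.reg 15 ≤ 8 ∧
      letterOfCode (s'.reg 15) = t.head?.map .dir) ?_ (by decide)).frame [10, 12, 13, 14, 15] []
      (by simp [block, Program.Writes])).mono le_rfl fun s' h => ⟨h.2, h.1⟩
    simp [block, Program.wp, Test.Holds, h9, h10, a₀, a₁, a₂]
    constructor
    · intro hpos
      have := ha 0 hpos
      rw [add_zero] at this
      rw [this]
      obtain ⟨d, t, rfl⟩ := List.exists_cons_of_length_pos hpos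
      have h₁ := letterOfCode_code (.dir d)
      have h₂ := Letter.code_le (.dir d)
      simp only [Letter.code] at h₁ h₂
      simpa [h₁] using h₂
    · rintro rfl
      rfl
  obtain ⟨τ, s₁, hx, hτ, hf, e12, e10, e13, e14, e15, e15'⟩ := hP
  suffices hrest : Runs (block [insertFactors, .loop (.lt 9 12) (block [.inc 10, .dec 12]), .inc 11]) s₁
      (1000 * (t.length + 2) + (t.length * 3 + 2)) _ by
    obtain ⟨τ', s₂, hx', hτ', hQ⟩ := hrest
    refine ⟨τ + τ', s₂, ?_, by omega, hQ⟩
    -- Blocks nest to the right, so the run of the initial instructions is taken apart and joined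
    -- with the run of the rest.
    simp only [readWord, block] at hx ⊢
    cases hx with
    | seq b₁ hx => cases hx with
    | seq b₂ hx => cases hx with
    | seq b₃ hx => cases hx with
    | seq b₄ hx => cases hx with
    | seq b₅ hx => cases hx with
    | seq b₆ hx => cases hx with
    | seq b₇ hx => cases hx with
    | seq b₈ hx =>
      simp only [add_assoc]
      exact .seq b₁ (.seq b₂ (.seq b₃ (.seq b₄ (.seq b₅ (.seq b₆ (.seq b₇ (.seq b₈ (.seq hx hx'))))))))
  have ht : HoldsTail s₁ t := ⟨(hf.1 _ (by simp)).trans h8, (hf.1 _ (by simp)).trans h9, e12,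
    fun i hi => by rw [hf.2 _ (by simp), e10, ha i hi]⟩
  refine Runs.seq (T₂ := t.length * 3 + 2) ((runs_insertFactors (h.of_frame hf (by simp) (by simp)) ht e13 e14
    e15 e15').frame _ _ writes_insertFactors) ?_ (by omega)
  rintro s₂ ⟨⟨hT, h2⟩, hf₂⟩
  have hf' := (hf.mono (R' := 11 :: 10 :: 12 :: 13 :: 14 :: 15 :: 17 :: insertRegs) (A' := [2, 3, 4, 5, 6])
    (by simp) (by simp)).trans (hf₂.mono (by simp) (by simp))
  let I : ℕ → Memory → Prop := fun i s' => Frame [10, 12] [] s₂ s' ∧ s'.reg 10 = p + 3 + i ∧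
    s'.reg 12 = t.length - i
  have h9₂ : s₂.reg 9 = 0 := (hf'.1 9 (by simp)).trans h9
  have h11 : s₂.reg 11 = s.reg 11 := (hf₂.1 11 (by simp)).trans (hf.1 11 (by simp))
  refine Runs.seq (T₂ := 1) (Runs.for_const I t.length 2 ?_ ?_ ?_) ?_ le_rfl
  · rintro i hi s' ⟨hf, h10, h12⟩
    have h9' := hf.1 9 (by simp)
    refine ⟨by simp only [Test.Holds, h9', h9₂, h12]; omega, ?_⟩
    refine ((Runs.of_wp (Q := fun s' => s'.reg 10 = p + 3 + (i + 1) ∧ s'.reg 12 = t.length - (i + 1)) ?_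
      (by decide)).frame [10, 12] [] (by simp [block, Program.Writes])).mono le_rfl
      fun s' h => ⟨hf.trans h.2, h.1⟩
    simp [block, Program.wp, h10, h12]
    omega
  · rintro s' ⟨hf, h10, h12⟩
    simp [Test.Holds, hf.1 9, h9₂, h12]
  · exact ⟨.refl _ _ _, by rw [hf₂.1 10 (by simp), e10], by rw [hf₂.1 12 (by simp), e12]; simp⟩
  · rintro s₃ ⟨hf₃, h10, -⟩
    refine .of_wp ?_ le_rfl
    have hfa : Frame [10, 11, 12] [] s₂ (s₃.setReg 11 (s₃.reg 11 + 1)) :=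
      (hf₃.mono (by simp) (by simp)).trans (frame_setReg (by simp) _ _)
    refine ⟨hT.of_frame hfa (by simp) (by simp), ?_, ?_, ?_, by simp [h10], ?_, ?_, ?_⟩
    · rw [hfa.1 2 (by simp), ← hf.1 2 (by simp)]; exact h2
    · rw [hfa.1 8 (by simp), hf'.1 8 (by simp), h8]
    · rw [hfa.1 9 (by simp), hf'.1 9 (by simp), h9]
    · simp [hf₃.1 11, h11]
    · rw [hfa.1 1 (by simp), hf'.1 1 (by simp)]
    · rw [hfa.2 1 (by simp), hf'.2 1 (by simp)]

end PinPerm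
namespace PinPerm

/-- The numbers of the letters of several words, in one sequence. -/
abbrev wordCode (W : List (List Letter)) : List ℕ := flatCode (W.map fun w => w.map Letter.code)

theorem wordCode_append (W W' : List (List Letter)) : wordCode (W ++ W') = wordCode W ++ wordCode W' := by
  simp [wordCode, flatCode]

theorem wordCode_cons (w : List Letter) (W : List (List Letter)) :
    wordCode (w :: W) = w.length :: w.map Letter.code ++ wordCode W := by
  simp [wordCode, flatCode]

/-- Two directions that are both horizontal or both vertical. -/
def parallelPairs : List (List Dir) := pairs.filter fun x => ¬ Alternating x

theorem mem_parallelPairs {x : List Dir} :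
    x ∈ parallelPairs ↔ ∃ a b : Dir, a.isHoriz = b.isHoriz ∧ x = [a, b] := by
  simp only [parallelPairs, List.mem_filter, mem_pairs, decide_eq_true_eq]
  constructor
  · rintro ⟨h, hx⟩
    obtain ⟨a, b, rfl⟩ := List.length_eq_two.1 h
    exact ⟨a, b, by simpa [Alternating] using hx, rfl⟩
  · rintro ⟨a, b, h, rfl⟩
    exact ⟨rfl, by simpa [Alternating] using h⟩

/-- Builds the trie of the forbidden factors. -/
def trieProgram : Program :=
  block [.const 8 1, .const 9 0, .const 2 1, .const 12 0, insertWords parallelPairs, .const 10 0, .const 11 0,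
    .loop (.lt 11 1) readWord]

/-- The forbidden factors of a list of pin words. -/
def factorSet (W : List (List Letter)) : Set (List Dir) :=
  {v | ∃ l₁ l₂, ∃ ds : List Dir, l₁ :: l₂ :: ds.map .dir ∈ W ∧
    ∃ u ∈ prefixes (some l₁) (some l₂) (ds.head?.map .dir), v = u ++ ds}

/-- A bounded number of words is inserted for each pin word, and each of them exceeds the rest of
the pin word by at most four letters. So time and number of nodes are linear in the total length of
the pin words. -/
theorem runs_trieProgram {s : Memory} {W : List (List Letter)}
    (hs : HoldsWords s 1 (W.map fun w => w.map Letter.code)) (h0 : ∀ k, 2 ≤ k → k ≤ 6 → ∀ i, s.arr k i = 0)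
    (hW : ∀ w ∈ W, ∃ l₁ l₂, ∃ ds : List Dir, w = l₁ :: l₂ :: ds.map .dir) :
    Runs trieProgram s (1101 * (wordCode W).length + 1000) fun s' =>
      TrieOf s' ({v | ∃ a b : Dir, a.isHoriz = b.isHoriz ∧ v = [a, b]} ∪ factorSet W) ∧
      s'.reg 2 ≤ 64 * (wordCode W).length + 64 ∧ s'.reg 8 = 1 ∧ s'.reg 9 = 0 := by
  have hcode : ∀ i x, (wordCode W)[i]? = some x → s.arr 1 i = x := by
    intro i x h
    obtain ⟨hi, rfl⟩ := List.getElem?_eq_some_iff.1 h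
    exact hs.2 i hi
  have h1 : s.reg 1 = W.length := by simpa using hs.1
  let s₁ := (((s.setReg 8 1).setReg 9 0).setReg 2 1).setReg 12 0
  refine Runs.seq (T₁ := 1) (T₂ := 1101 * (wordCode W).length + 999) (P := fun s' => s' = s.setReg 8 1)
    (.of_wp rfl le_rfl) ?_ (by omega)
  rintro _ rfl
  refine Runs.seq (T₁ := 1) (T₂ := 1101 * (wordCode W).length + 998)
    (P := fun s' => s' = (s.setReg 8 1).setReg 9 0) (.of_wp rfl le_rfl) ?_ (by omega)
  rintro _ rfl
  refine Runs.seq (T₁ := 1) (T₂ := 1101 * (wordCode W).length + 997)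
    (P := fun s' => s' = ((s.setReg 8 1).setReg 9 0).setReg 2 1) (.of_wp rfl le_rfl) ?_ (by omega)
  rintro _ rfl
  refine Runs.seq (T₁ := 1) (T₂ := 1101 * (wordCode W).length + 996) (P := fun s' => s' = s₁)
    (.of_wp rfl le_rfl) ?_ (by omega)
  rintro _ rfl
  -- The arrays are still zero and register `2` is one: this is the trie with only the root.
  have hempty : TrieOf s₁ ∅ := by
    refine ⟨[[]], ⟨rfl, by simp, by simp, by simp [s₁], ?_, ?_, ?_, ?_, by simp⟩, fun x => by simp [IsACState]⟩
    · intro w _ d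
      rw [nodeNum_of_not_mem (w := w ++ [d]) (by simp)]
      exact h0 _ (by omega) (by cases d <;> simp [Dir.code]) _
    · intro d i _
      exact h0 _ (by omega) (by cases d <;> simp [Dir.code]) _
    · exact fun w _ => ⟨fun h => h.elim, fun _ => h0 _ (by omega) (by omega) _⟩
    · exact fun i _ => h0 _ (by omega) (by omega) _
  have ht : HoldsTail s₁ [] := ⟨by simp [s₁], by simp [s₁], by simp [s₁], by simp⟩
  refine Runs.seq (T₁ := 500) (T₂ := 1101 * (wordCode W).length + 496)
    (((runs_insertWords hempty ht (us := parallelPairs) fun u hu => ?_).frame _ _ (writes_insertWords _)).mono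
      (by decide) fun _ => id) ?_ (by omega)
  · obtain ⟨a, b, -, rfl⟩ := mem_parallelPairs.1 hu
    simp
  rintro s₂ ⟨⟨hT, h2⟩, hf⟩
  have h2 : s₂.reg 2 ≤ 64 := by
    refine h2.trans ?_
    rw [show s₁.reg 2 = 1 by simp [s₁]]
    decide
  let base : Set (List Dir) := {v | ∃ a b : Dir, a.isHoriz = b.isHoriz ∧ v = [a, b]}
  have hbase : (∅ ∪ {x | ∃ u ∈ parallelPairs, x = u ++ []} : Set (List Dir)) = base := by
    ext v
    simp only [Set.empty_union, Set.mem_ofPred_eq, List.append_nil, exists_eq_right', mem_parallelPairs, base]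
  rw [hbase] at hT
  let I : Memory → Prop := fun s' => s'.reg 1 = W.length ∧ s'.arr 1 = s.arr 1 ∧ s'.reg 8 = 1 ∧ s'.reg 9 = 0 ∧
    ∃ W₁ W₂, W₁ ++ W₂ = W ∧ s'.reg 11 = W₁.length ∧ s'.reg 10 = (wordCode W₁).length ∧
    TrieOf s' (base ∪ factorSet W₁) ∧ s'.reg 2 ≤ 64 * (wordCode W₁).length + 64
  refine Runs.seq (T₁ := 1) (T₂ := 1101 * (wordCode W).length + 495) (P := fun s' => s' = s₂.setReg 10 0)
    (.of_wp rfl le_rfl) ?_ (by omega)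
  rintro _ rfl
  refine Runs.seq (T₁ := 1) (T₂ := 1101 * (wordCode W).length + 494) (P := fun s' => I s' ∧ s'.reg 10 = 0)
    (.of_wp ?_ le_rfl) ?_ (by omega)
  · have hf' : Frame [10, 11] [] s₂ ((s₂.setReg 10 0).setReg 11 0) :=
      (frame_setReg (by simp) _ _).trans (frame_setReg (by simp) _ _)
    refine ⟨⟨?_, ?_, ?_, ?_, [], W, rfl, by simp, by simp [flatCode], ?_, ?_⟩, by simp⟩
    · rw [hf'.1 1 (by simp), hf.1 1 (by simp)]; simp [s₁, h1]
    · rw [hf'.2 1 (by simp), hf.2 1 (by simp)]; rfl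
    · rw [hf'.1 8 (by simp), hf.1 8 (by simp)]; simp [s₁]
    · rw [hf'.1 9 (by simp), hf.1 9 (by simp)]; simp [s₁]
    · convert hT.of_frame hf' (by simp) (by simp) using 1
      simp [factorSet]
    · rw [hf'.1 2 (by simp)]; omega
  rintro s₃ ⟨hI, h10⟩
  -- A pin word with tail `t` occupies `t.length + 3` cells, its length included; `1100` steps per
  -- cell pay for its factors, and the remaining ones for the test of the loop.
  refine (Runs.loop_potential I (fun s' => 1101 * ((wordCode W).length - s'.reg 10)) ?_ hI).mono
    (by rw [h10]; omega) ?_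
  · rintro s' ⟨e1, ea, e8, e9, W₁, W₂, hWW, e11, e10, hT, h2⟩ hc
    simp only [Test.Holds, e11, e1, ← hWW, List.length_append] at hc
    obtain ⟨w, W₂, rfl⟩ := List.exists_cons_of_length_pos (show 0 < W₂.length by omega)
    obtain ⟨l₁, l₂, t, rfl⟩ := hW w (by simp [← hWW])
    have hflat : wordCode W = wordCode W₁ ++ ((t.length + 2) :: l₁.code :: l₂.code ::
        t.map fun d => 5 + d.code) ++ wordCode W₂ := by
      rw [← hWW, wordCode_append, wordCode_cons]
      simp [Letter.code, Function.comp_def]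
    have hget : ∀ i x, ((t.length + 2) :: l₁.code :: l₂.code :: t.map fun d => 5 + d.code)[i]? = some x →
        s'.arr 1 ((wordCode W₁).length + i) = x := by
      intro i x h
      rw [ea]
      refine hcode _ _ ?_
      obtain ⟨hi, -⟩ := List.getElem?_eq_some_iff.1 h
      rw [hflat, List.append_assoc, List.getElem?_append_right (by omega), Nat.add_sub_cancel_left,
        List.getElem?_append_left hi, h]
    refine ⟨_, (runs_readWord hT e8 e9 e10 (t := t) (l₁ := l₁) (l₂ := l₂) (hget 0 _ rfl) (hget 1 _ rfl)
      (hget 2 _ rfl) (fun i hi => ?_)).mono le_rfl ?_⟩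
    · rw [add_assoc]
      refine hget (3 + i) _ ?_
      rw [add_comm 3 i]
      simp [hi]
    · rintro s'' ⟨hT', h2', h8', h9', h10', h11', h1', ha'⟩
      have hl : (wordCode W).length = (wordCode W₁).length + (t.length + 3) + (wordCode W₂).length := by
        rw [hflat]; simp; omega
      have hl' : (wordCode (W₁ ++ [l₁ :: l₂ :: t.map .dir])).length = (wordCode W₁).length + (t.length + 3) := by
        rw [wordCode_append, wordCode_cons]; simp [flatCode]
      refine ⟨⟨h1'.trans e1, ha'.trans ea, h8', h9', W₁ ++ [l₁ :: l₂ :: t.map .dir], W₂, by simpa using hWW,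
        by simp [h11', e11], by rw [h10', hl']; omega, ?_, by rw [hl']; omega⟩, by rw [h10', e10, hl]; omega⟩
      convert hT' using 1
      rw [Set.union_assoc]
      congr 1
      ext v
      simp only [factorSet, Set.mem_union, Set.mem_ofPred_eq, List.mem_append, List.mem_singleton]
      constructor
      · rintro ⟨k₁, k₂, ds, h | h, hu⟩
        · exact Or.inl ⟨k₁, k₂, ds, h, hu⟩
        · simp only [List.cons.injEq] at h
          obtain ⟨rfl, rfl, h⟩ := h
          obtain rfl : ds = t := List.map_injective_iff.2 (fun a b h => by cases h; rfl) h
          exact Or.inr hu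
      · rintro (⟨k₁, k₂, ds, h, hu⟩ | hu)
        · exact ⟨k₁, k₂, ds, Or.inl h, hu⟩
        · exact ⟨l₁, l₂, t, Or.inr rfl, hu⟩
  · rintro s' ⟨⟨e1, ea, e8, e9, W₁, W₂, hWW, e11, e10, hT, h2⟩, hc⟩
    simp only [Test.Holds, e11, e1, ← hWW, List.length_append] at hc
    obtain rfl := List.eq_nil_of_length_eq_zero (show W₂.length = 0 by omega)
    rw [List.append_nil] at hWW
    subst hWW
    exact ⟨hT, h2, e8, e9⟩

end PinPerm
namespace PinPerm

/-! ### Failure links -/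

section Fail

variable {α : Type*} (M : Set (List α))

/-- The longest proper suffix of a state that is a state. -/
noncomputable def failState (q : List α) : List α := (longestState M q.tail).1

/-- The longest suffix of `q d` that is a state. -/
noncomputable def nextState (q : List α) (d : α) : List α := (longestState M (q ++ [d])).1

/-- The state has a suffix in `M`. -/
def IsFinalState (q : List α) : Prop := ∃ f ∈ M, f <:+ q

variable {M}

theorem isACState_failState (q : List α) : IsACState M (failState M q) := (longestState M _).2

theorem nextState_of_isACState {q : List α} {d : α} (h : IsACState M (q ++ [d])) :
    nextState M q d = q ++ [d] := longestState_of_isACState h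

/-- A transition without a child in the trie is inherited from the failure state. -/
theorem nextState_fail {q : List α} {d : α} (hq : q ≠ []) (h : ¬ IsACState M (q ++ [d])) :
    nextState M q d = nextState M (failState M q) d := by
  obtain ⟨b, l, rfl⟩ := List.exists_cons_of_ne_nil hq
  rw [nextState, longestState_cons_concat b d l h]
  rfl

theorem nextState_nil {d : α} (h : ¬ IsACState M [d]) : nextState M [] d = [] := by
  rw [nextState, List.nil_append, longestState, dif_neg (show ¬ ([d] = [] ∨ ∃ f ∈ M, [d] <+: f) from h)]
  rfl

/-- The failure link of a child is found by one transition from the failure link of its parent. -/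
theorem failState_append {q : List α} {d : α} (hq : q ≠ []) :
    failState M (q ++ [d]) = nextState M (failState M q) d := by
  obtain ⟨b, l, rfl⟩ := List.exists_cons_of_ne_nil hq
  simp only [failState, nextState, longestState_concat, List.cons_append, List.tail_cons]

theorem failState_singleton (d : α) : failState M [d] = [] := rfl

theorem failState_nil : failState M ([] : List α) = [] := rfl

theorem length_failState_append (q : List α) (d : α) : (failState M (q ++ [d])).length ≤ q.length := by
  refine (longestState_suffix _).length_le.trans ?_
  simp

theorem length_failState_lt {q : List α} (hq : q ≠ []) : (failState M q).length < q.length := by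
  obtain ⟨b, l, rfl⟩ := List.exists_cons_of_ne_nil hq
  exact Nat.lt_succ_of_le (longestState_suffix _).length_le

/-- A suffix in `M` is the whole state or a proper suffix; in the second case it is a state and thus
a suffix of the failure state. So marks propagate along failure links. -/
theorem isFinalState_iff (h0 : [] ∉ M) (q : List α) :
    IsFinalState M q ↔ q ∈ M ∨ IsFinalState M (failState M q) := by
  cases q with
  | nil =>
    simp only [IsFinalState, failState_nil]
    exact ⟨Or.inr, fun h => h.resolve_left h0⟩
  | cons b l =>
    constructor
    · rintro ⟨f, hf, h⟩
      rcases List.suffix_cons_iff.1 h with rfl | h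
      · exact Or.inl hf
      · exact Or.inr ⟨f, hf, (suffix_longestState_iff hf).2 h⟩
    · rintro (h | ⟨f, hf, h⟩)
      · exact ⟨_, h, List.suffix_rfl⟩
      · exact ⟨f, hf, ((suffix_longestState_iff hf).1 h).trans (List.suffix_cons _ _)⟩

end Fail

/-- Completes the transition by `d` from the state in register `28`, whose failure link is in register
`29`. -/
def processChild (d : Dir) : Program :=
  block [.load 30 (2 + d.code) 28, .ite (.eq 30 9)
    (block [.load 30 (2 + d.code) 29, .store (2 + d.code) 28 30])
    (block [.ite (.eq 28 9) (.const 31 0) (.load 31 (2 + d.code) 29), .store 22 30 31, .store 23 27 30,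
      .inc 27, .load 31 6 31, .ite (.eq 31 8) (.store 6 30 8) nop])]

/-- The state of the breadth first search: the transitions in `D` are complete, and the queue `Q` contains
the states that have been found. -/
structure Bfs (s : Memory) (V : List (List Dir)) (M : Set (List Dir)) (D : List Dir → Dir → Prop)
    (Q : List (List Dir)) : Prop where
  reg2 : s.reg 2 = V.length
  reg8 : s.reg 8 = 1
  reg9 : s.reg 9 = 0
  reg27 : s.reg 27 = Q.length
  order : ∀ (i : ℕ) (h : i < Q.length), s.arr 23 i = nodeNum V Q[i]
  nodup : Q.Nodup
  mem : ∀ x, x ∈ Q ↔ x ∈ V ∧ (x = [] ∨ ∃ w d, x = w ++ [d] ∧ D w d)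
  step : ∀ w ∈ V, ∀ d : Dir, (D w d → s.arr (2 + d.code) (nodeNum V w) = nodeNum V (nextState M w d)) ∧
    (¬ D w d → s.arr (2 + d.code) (nodeNum V w) = nodeNum V (w ++ [d]))
  fail : ∀ q ∈ Q, s.arr 22 (nodeNum V q) = nodeNum V (failState M q)
  mark : ∀ q ∈ Q, (IsFinalState M q → s.arr 6 (nodeNum V q) = 1) ∧
    (¬ IsFinalState M q → s.arr 6 (nodeNum V q) = 0)
  mark_trie : ∀ q ∈ V, q ∉ Q → (q ∈ M → s.arr 6 (nodeNum V q) = 1) ∧ (q ∉ M → s.arr 6 (nodeNum V q) = 0)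

section Bfs

variable {s : Memory} {V : List (List Dir)} {M : Set (List Dir)} {D : List Dir → Dir → Prop}
  {Q : List (List Dir)}

theorem Bfs.congr {s' : Memory} (h : Bfs s V M D Q) (h2 : s'.reg 2 = s.reg 2) (h8 : s'.reg 8 = s.reg 8)
    (h9 : s'.reg 9 = s.reg 9) (h27 : s'.reg 27 = s.reg 27) (ha : s'.arr = s.arr) : Bfs s' V M D Q :=
  ⟨h2.trans h.reg2, h8.trans h.reg8, h9.trans h.reg9, h27.trans h.reg27, ha ▸ h.order, h.nodup, h.mem,
    ha ▸ h.step, ha ▸ h.fail, ha ▸ h.mark, ha ▸ h.mark_trie⟩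

/-- `D` records the completed transitions; the other cells still contain the children in the trie.
The failure state of a nonempty `p` has its transition by `d` already (`hDf`), and the failure state
of a child of `p` is no longer than `p`, so it has been found and correctly marked (`hQ`). -/
theorem runs_processChild (hV : ∀ x, x ∈ V ↔ IsACState M x) (hM : [] ∉ M) (hz : nodeNum V [] = 0)
    (h : Bfs s V M D Q) {p : List Dir} (hp : p ∈ V) {d : Dir} (h28 : s.reg 28 = nodeNum V p)
    (h29 : s.reg 29 = nodeNum V (failState M p)) (hD : ¬ D p d) (hDf : p ≠ [] → D (failState M p) d)
    (hQ : ∀ y ∈ V, y.length ≤ p.length → y ∈ Q) :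
    Runs (processChild d) s 12 fun s' => ∃ Q', Bfs s' V M (fun w d' => D w d' ∨ (w = p ∧ d' = d)) Q' ∧
      (Q' = Q ∨ Q' = Q ++ [p ++ [d]]) ∧ s'.reg 26 = s.reg 26 ∧ s'.reg 28 = s.reg 28 ∧
      s'.reg 29 = s.reg 29 := by
  refine .of_wp ?_ (by cases d <;> decide)
  have hnil : [] ∈ V := (hV _).2 (Or.inl rfl)
  have hd : ∀ d : Dir, 2 + d.code ≠ 6 ∧ 2 + d.code ≠ 22 ∧ 2 + d.code ≠ 23 := by
    intro d; cases d <;> simp [Dir.code]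
  have hc := (h.step p hp d).2 hD
  have hfV : failState M p ∈ V := (hV _).2 (isACState_failState p)
  have hz' : ∀ w ∈ V, nodeNum V w = 0 ↔ w = [] := fun w hw =>
    ⟨fun h => nodeNum_inj hw hnil (h.trans hz.symm), fun h => h ▸ hz⟩
  simp only [processChild, block, Program.wp, wp_nop, Test.Holds, Memory.reg_setReg, Memory.arr_setReg,
    Memory.arr_setArr, Memory.reg_setArr, h28, hc]
  norm_num
  simp only [h.reg9, h.reg8, h29, h28, (hd d).1, (hd d).2.1, (hd d).2.2, (hd d).1.symm, if_false, hz' p hp]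
  refine ⟨fun h0 => ?_, fun h0 => ?_⟩
  -- Without a child, the transition of the failure state is copied. The root is its own failure
  -- state, and its cell already holds `0`, the number of the root.
  · have hx : p ++ [d] ∉ V := fun hx => by simpa using (hz' _ hx).1 h0
    have hnew : s.arr (2 + d.code) (nodeNum V (failState M p)) = nodeNum V (nextState M p d) := by
      by_cases hp0 : p = []
      · subst hp0
        rw [nextState_nil (fun h => hx ((hV _).2 h)), failState_nil, hc, h0, hz]
      · rw [(h.step _ hfV d).1 (hDf hp0), nextState_fail hp0 fun h => hx ((hV _).2 h)]
    rw [hnew]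
    refine ⟨Q, ⟨by simp [h.reg2], by simp [h.reg8], by simp [h.reg9], by simp [h.reg27], ?_, h.nodup, ?_, ?_, ?_,
      ?_, ?_⟩, Or.inl rfl⟩
    · simpa [(hd d).2.2.symm] using h.order
    · intro x
      rw [h.mem]
      refine and_congr_right fun hxV => or_congr_right (exists_congr fun w => exists_congr fun d' =>
        and_congr_right fun hxw => ⟨Or.inl, ?_⟩)
      rintro (h | ⟨rfl, rfl⟩)
      exacts [h, absurd (hxw ▸ hxV) hx]
    · intro w hw d'
      simp only [Memory.arr_setArr, Memory.arr_setReg, code_add_two_inj]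
      by_cases hwd : w = p ∧ d' = d
      · obtain ⟨rfl, rfl⟩ := hwd
        simp
      · have hold : (if d' = d then Function.update (s.arr (2 + d.code)) (nodeNum V p)
            (nodeNum V (nextState M p d)) else s.arr (2 + d'.code)) (nodeNum V w) =
            s.arr (2 + d'.code) (nodeNum V w) := by
          split_ifs with h
          · subst h
            rw [Function.update_of_ne fun he => hwd ⟨nodeNum_inj hw hp he, rfl⟩]
          · rfl
        rw [hold]
        simpa [hwd] using h.step w hw d'
    · simpa [(hd d).2.1.symm] using h.fail
    · simpa [(hd d).1.symm] using h.mark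
    · simpa [(hd d).1.symm] using h.mark_trie
  · have hx : p ++ [d] ∈ V := by_contra fun hx => h0 (nodeNum_of_not_mem hx)
    have hxQ : p ++ [d] ∉ Q := by
      rw [h.mem]
      rintro ⟨-, h | ⟨w, d', h₁, h₂⟩⟩
      · simp at h
      · obtain ⟨rfl, h₁⟩ := List.append_inj' h₁ rfl
        obtain rfl : d = d' := by simpa using h₁
        exact hD h₂
    have hfx : failState M (p ++ [d]) ∈ Q :=
      hQ _ ((hV _).2 (isACState_failState _)) (length_failState_append p d)
    have key : ∀ s' : Memory, s'.reg 2 = s.reg 2 → s'.reg 8 = s.reg 8 → s'.reg 9 = s.reg 9 →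
        s'.reg 27 = Q.length + 1 →
        s'.arr 23 = Function.update (s.arr 23) Q.length (nodeNum V (p ++ [d])) →
        s'.arr 22 = Function.update (s.arr 22) (nodeNum V (p ++ [d])) (nodeNum V (failState M (p ++ [d]))) →
        (∀ d' : Dir, s'.arr (2 + d'.code) = s.arr (2 + d'.code)) →
        (∀ q ∈ V, q ≠ p ++ [d] → s'.arr 6 (nodeNum V q) = s.arr 6 (nodeNum V q)) →
        ((IsFinalState M (p ++ [d]) → s'.arr 6 (nodeNum V (p ++ [d])) = 1) ∧
          (¬ IsFinalState M (p ++ [d]) → s'.arr 6 (nodeNum V (p ++ [d])) = 0)) →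
        Bfs s' V M (fun w d' => D w d' ∨ (w = p ∧ d' = d)) (Q ++ [p ++ [d]]) := by
      intro s' e2 e8 e9 e27 e23 e22 eδ e6 e6'
      have hQV : ∀ q ∈ Q, q ∈ V := fun q hq => ((h.mem q).1 hq).1
      have hQx : ∀ q ∈ Q, q ≠ p ++ [d] := fun q hq he => hxQ (he ▸ hq)
      refine ⟨e2.trans h.reg2, e8.trans h.reg8, e9.trans h.reg9, by simp [e27], fun i hi => ?_, ?_, fun x => ?_,
        fun w hw d' => ?_, fun q hq => ?_, fun q hq => ?_, fun q hq hqQ => ?_⟩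
      · rw [List.length_append, List.length_singleton] at hi
        rw [e23]
        rcases (show i ≤ Q.length by omega).lt_or_eq with hlt | rfl
        · rw [Function.update_of_ne hlt.ne, List.getElem_append_left hlt, h.order i hlt]
        · simp
      · refine List.nodup_append.2 ⟨h.nodup, List.nodup_singleton _, fun a ha b hb hab => ?_⟩
        rw [List.mem_singleton] at hb
        exact hQx a ha (hab.trans hb)
      · simp only [List.mem_append, List.mem_singleton, h.mem]
        constructor
        · rintro (⟨h₁, h₂ | ⟨w, d', h₂, h₃⟩⟩ | rfl)
          exacts [⟨h₁, Or.inl h₂⟩, ⟨h₁, Or.inr ⟨w, d', h₂, Or.inl h₃⟩⟩, ⟨hx, Or.inr ⟨p, d, rfl, Or.inr ⟨rfl, rfl⟩⟩⟩]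
        · rintro ⟨h₁, h₂ | ⟨w, d', h₂, h₃ | ⟨rfl, rfl⟩⟩⟩
          exacts [Or.inl ⟨h₁, Or.inl h₂⟩, Or.inl ⟨h₁, Or.inr ⟨w, d', h₂, h₃⟩⟩, Or.inr h₂]
      · rw [eδ]
        by_cases hwd : w = p ∧ d' = d
        · obtain ⟨rfl, rfl⟩ := hwd
          rw [hc, nextState_of_isACState ((hV _).1 hx)]
          simp
        · simpa [hwd] using h.step w hw d'
      · simp only [List.mem_append, List.mem_singleton] at hq
        rw [e22]
        rcases hq with hq | rfl
        · rw [Function.update_of_ne fun he => hQx q hq (nodeNum_inj (hQV q hq) hx he), h.fail q hq]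
        · simp
      · simp only [List.mem_append, List.mem_singleton] at hq
        rcases hq with hq | rfl
        · rw [e6 q (hQV q hq) (hQx q hq)]; exact h.mark q hq
        · exact e6'
      · simp only [List.mem_append, List.mem_singleton, not_or] at hqQ
        rw [e6 q hq hqQ.2]; exact h.mark_trie q hq hqQ.1
    have hm := h.mark_trie _ hx hxQ
    have hmf := h.mark _ hfx
    have hfin := isFinalState_iff hM (p ++ [d])
    have hval : ∀ y, y = nodeNum V (failState M (p ++ [d])) →
        (s.arr 6 y = 1 ↔ IsFinalState M (failState M (p ++ [d]))) := by
      rintro y rfl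
      refine ⟨fun h1 => by_contra fun h2 => ?_, hmf.1⟩
      rw [hmf.2 h2] at h1
      cases h1
    have hset : IsFinalState M (failState M (p ++ [d])) → ∀ f : ℕ → ℕ,
        f = Function.update (s.arr 6) (nodeNum V (p ++ [d])) 1 →
        (∀ q ∈ V, q ≠ p ++ [d] → f (nodeNum V q) = s.arr 6 (nodeNum V q)) ∧
        (IsFinalState M (p ++ [d]) → f (nodeNum V (p ++ [d])) = 1) ∧
          (¬ IsFinalState M (p ++ [d]) → f (nodeNum V (p ++ [d])) = 0) := by
      rintro hf f rfl
      refine ⟨fun q hq hne => Function.update_of_ne (fun he => hne (nodeNum_inj hq hx he)) _ _, fun _ => by simp,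
        fun h => absurd (hfin.2 (Or.inr hf)) h⟩
    have hkeep : ¬ IsFinalState M (failState M (p ++ [d])) → 
        (IsFinalState M (p ++ [d]) → s.arr 6 (nodeNum V (p ++ [d])) = 1) ∧
          (¬ IsFinalState M (p ++ [d]) → s.arr 6 (nodeNum V (p ++ [d])) = 0) := fun hf =>
      ⟨fun h => hm.1 ((hfin.1 h).resolve_right hf), fun h => hm.2 fun hxM => h (hfin.2 (Or.inl hxM))⟩
    -- Children of the root fail to the root; the transition from the root would lead to the child
    -- itself.
    have hfail : ∀ y, (p = [] ∧ y = 0 ∨ p ≠ [] ∧ y = s.arr (2 + d.code) (nodeNum V (failState M p))) →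
        y = nodeNum V (failState M (p ++ [d])) := by
      rintro y (⟨rfl, rfl⟩ | ⟨hp0, rfl⟩)
      · rw [List.nil_append, failState_singleton, hz]
      · rw [(h.step _ hfV d).1 (hDf hp0), failState_append hp0]
    refine ⟨fun hp0 => ?_, fun hp0 => ?_⟩
    · have hy := hfail 0 (Or.inl ⟨hp0, rfl⟩)
      rw [hval 0 hy, hy]
      refine ⟨fun hf => ⟨_, key _ (by simp) (by simp) (by simp) (by simp [h.reg27])
        (by simp [h.reg27]) (by simp) (fun d' => by simp [(hd d').1, (hd d').2.1, (hd d').2.2])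
        (hset hf _ (by simp)).1 (hset hf _ (by simp)).2, Or.inr rfl⟩,
        fun hf => ⟨_, key _ (by simp) (by simp) (by simp) (by simp [h.reg27])
        (by simp [h.reg27]) (by simp) (fun d' => by simp [(hd d').1, (hd d').2.1, (hd d').2.2])
        (fun q _ _ => by simp) (by simpa using hkeep hf), Or.inr rfl⟩⟩
    · have hy := hfail _ (Or.inr ⟨hp0, rfl⟩)
      rw [hval _ hy, hy]
      refine ⟨fun hf => ⟨_, key _ (by simp) (by simp) (by simp) (by simp [h.reg27])
        (by simp [h.reg27]) (by simp) (fun d' => by simp [(hd d').1, (hd d').2.1, (hd d').2.2])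
        (hset hf _ (by simp)).1 (hset hf _ (by simp)).2, Or.inr rfl⟩,
        fun hf => ⟨_, key _ (by simp) (by simp) (by simp) (by simp [h.reg27])
        (by simp [h.reg27]) (by simp) (fun d' => by simp [(hd d').1, (hd d').2.1, (hd d').2.2])
        (fun q _ _ => by simp) (by simpa using hkeep hf), Or.inr rfl⟩⟩

end Bfs
end PinPerm
namespace PinPerm

/-! ### Completing the automaton by breadth first search -/

/-- Computes the failure links, the final states and the transitions by breadth first search. -/
def failProgram : Program :=
  block [.const 26 0, .store 23 26 26, .store 22 26 26, .const 27 1, .loop (.lt 26 27)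
    (block [.load 28 23 26, .inc 26, .load 29 22 28, chain (Dir.all.map processChild)])]

/-- The queue consists of the processed states `P` and the waiting states `R`, in order of length.
This order guarantees that whatever a state needs from shorter states is ready. -/
theorem runs_failProgram {s : Memory} {V : List (List Dir)} {M : Set (List Dir)} (hT : Trie s V M)
    (hV : ∀ x, x ∈ V ↔ IsACState M x) (hM : [] ∉ M) (h8 : s.reg 8 = 1) (h9 : s.reg 9 = 0) :
    Runs failProgram s (60 * V.length + 10) fun s' => s'.reg 2 = V.length ∧ s'.reg 8 = 1 ∧
      (∀ w ∈ V, ∀ d : Dir, s'.arr (2 + d.code) (nodeNum V w) = nodeNum V (nextState M w d)) ∧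
      ∀ w ∈ V, (IsFinalState M w → s'.arr 6 (nodeNum V w) = 1) ∧
        (¬ IsFinalState M w → s'.arr 6 (nodeNum V w) = 0) := by
  have hnil := hT.nil_mem
  have hz := hT.nodeNum_nil
  have hlen : ∀ {D s' Q}, Bfs s' V M D Q → Q.length ≤ V.length := fun h =>
    (h.nodup.subperm fun q hq => ((h.mem q).1 hq).1).length_le
  let I : Memory → Prop := fun s' => ∃ P R, s'.reg 26 = P.length ∧ Bfs s' V M (fun w _ => w ∈ P) (P ++ R) ∧
    (P ++ R).Pairwise fun x y => x.length ≤ y.length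
  have hI : Runs (block [.const 26 0, .store 23 26 26, .store 22 26 26, .const 27 1]) s 4 I := by
    refine .of_wp ?_ (by decide)
    simp only [block, Program.wp]
    refine ⟨[], [[]], by simp, ⟨by simp [hT.reg2], by simp [h8], by simp [h9], by simp, ?_, by simp, ?_, ?_, ?_,
      ?_, ?_⟩, by simp⟩
    · intro i hi
      obtain rfl : i = 0 := by simpa using hi
      simp [hz]
    · intro x
      simp only [List.nil_append, List.mem_singleton, List.not_mem_nil, and_false, exists_false, or_false]
      exact ⟨fun h => ⟨h ▸ hnil, h⟩, fun h => h.2⟩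
    · intro w hw d
      have hd : 2 + d.code ≠ 22 ∧ 2 + d.code ≠ 23 := by cases d <;> simp [Dir.code]
      simpa [hd.1, hd.2] using hT.child w hw d
    · simp [failState_nil, hz]
    · intro q hq
      obtain rfl : q = [] := by simpa using hq
      have hf : ¬ IsFinalState M [] := by
        rintro ⟨f, hf, h⟩
        rw [List.suffix_nil.1 h] at hf
        exact hM hf
      exact ⟨fun h => absurd h hf, fun _ => by simpa using (hT.mark [] hnil).2 hM⟩
    · intro q hq _
      simpa using hT.mark q hq
  obtain ⟨τ, s₁, hx, hτ, hI⟩ := hI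
  suffices hrest : Runs (.loop (.lt 26 27)
      (block [.load 28 23 26, .inc 26, .load 29 22 28, chain (Dir.all.map processChild)])) s₁
      ((V.length - s₁.reg 26) * (52 + 1) + 1) _ by
    obtain ⟨τ', s₂, hx', hτ', hQ⟩ := hrest
    have : (V.length - s₁.reg 26) * (52 + 1) ≤ V.length * 53 := Nat.mul_le_mul_right _ (Nat.sub_le _ _)
    refine ⟨τ + τ', s₂, ?_, by omega, hQ⟩
    simp only [failProgram, block] at hx ⊢
    cases hx with
    | seq b₁ hx => cases hx with
    | seq b₂ hx => cases hx with
    | seq b₃ hx =>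
      simp only [add_assoc]
      exact .seq b₁ (.seq b₂ (.seq b₃ (.seq hx hx')))
  refine (Runs.while I (fun s' => V.length - s'.reg 26) 52 ?_ hI).mono le_rfl ?_
  · rintro s' ⟨P, R, h26, hB, hs⟩ hc
    simp only [Test.Holds, h26, hB.reg27, List.length_append] at hc
    obtain ⟨p, R, rfl⟩ := List.exists_cons_of_length_pos (show 0 < R.length by omega)
    have hl := hlen hB
    simp only [List.length_append, List.length_cons] at hl
    have hpQ : p ∈ P ++ p :: R := by simp
    have hpV : p ∈ V := ((hB.mem p).1 hpQ).1
    have hpP : p ∉ P := by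
      have := hB.nodup
      rw [List.nodup_append] at this
      exact fun hp => this.2.2 p hp p (by simp) rfl
    have hPp : ∀ x ∈ P, x.length ≤ p.length := fun x hx => (List.pairwise_append.1 hs).2.2 x hx p (by simp)
    have hpR : ∀ x ∈ p :: R, p.length ≤ x.length := by
      have := (List.pairwise_append.1 hs).2.1
      intro x hx
      rcases List.mem_cons.1 hx with rfl | hx
      · exact le_rfl
      · exact (List.pairwise_cons.1 this).1 x hx
    -- By induction on the name, the parent of a shorter state has been processed, so the state is
    -- in the queue, and by its length it comes before `p`.
    have hshort : ∀ y ∈ V, y.length < p.length → y ∈ P := by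
      intro y
      induction y using List.reverseRecOn with
      | nil =>
        intro hy hlt
        rcases List.mem_append.1 ((hB.mem []).2 ⟨hy, Or.inl rfl⟩) with h | h
        · exact h
        · have := hpR _ h; omega
      | append_singleton y d ih =>
        intro hy hlt
        have hyP := ih (hT.closed y d hy) (by simp at hlt; omega)
        rcases List.mem_append.1 ((hB.mem _).2 ⟨hy, Or.inr ⟨y, d, rfl, hyP⟩⟩) with h | h
        · exact h
        · have := hpR _ h; omega
    have hstart : Runs (block [.load 28 23 26, .inc 26, .load 29 22 28]) s' 3 fun s'' =>
        s'' = ((s'.setReg 28 (nodeNum V p)).setReg 26 (P.length + 1)).setReg 29 (nodeNum V (failState M p)) := by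
      refine .of_wp ?_ (by decide)
      have h₁ : s'.arr 23 P.length = nodeNum V p := by
        rw [hB.order _ (by simp)]; simp
      simp [block, Program.wp, h26, h₁, hB.fail p hpQ]
    obtain ⟨τ, s₂, hx, hτ, rfl⟩ := hstart
    set s₂ := ((s'.setReg 28 (nodeNum V p)).setReg 26 (P.length + 1)).setReg 29 (nodeNum V (failState M p))
      with hs₂
    have hB₂ : Bfs s₂ V M (fun w _ => w ∈ P) (P ++ p :: R) :=
      hB.congr (by simp [hs₂]) (by simp [hs₂]) (by simp [hs₂]) (by simp [hs₂]) rfl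
    -- While `p` is processed, exactly its transitions by the directions in `ds` are incomplete.
    let J : List Dir → Memory → Prop := fun ds s'' => ds.Nodup ∧ s''.reg 26 = P.length + 1 ∧
      s''.reg 28 = nodeNum V p ∧ s''.reg 29 = nodeNum V (failState M p) ∧
      ∃ R, Bfs s'' V M (fun w d => w ∈ P ∨ (w = p ∧ d ∉ ds)) (P ++ [p] ++ R) ∧
        (P ++ [p] ++ R).Pairwise fun x y => x.length ≤ y.length
    suffices hch : Runs (chain (Dir.all.map processChild)) s₂ 49
        (fun s' => I s' ∧ V.length - s'.reg 26 < V.length - P.length) by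
      obtain ⟨τ', s₃, hx', hτ', hQ⟩ := hch
      refine ⟨τ + τ', s₃, ?_, by omega, by rw [h26]; exact hQ⟩
      simp only [block] at hx ⊢
      cases hx with
      | seq b₁ hx => cases hx with
      | seq b₂ hx =>
        simp only [add_assoc]
        exact .seq b₁ (.seq b₂ (.seq hx hx'))
    refine (Runs.chain J (T := 12) ?_ ?_).mono (by decide) ?_
    · rintro d ds t ⟨hnd, t26, t28, t29, R, tB, ts⟩
      rw [List.nodup_cons] at hnd
      have hPQ : ∀ y ∈ V, y.length ≤ p.length → y ∈ P ++ [p] ++ R := by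
        intro y hy hyl
        refine (tB.mem y).2 ⟨hy, ?_⟩
        rcases List.eq_nil_or_concat' y with rfl | ⟨y, d', rfl⟩
        · exact Or.inl rfl
        · exact Or.inr ⟨y, d', rfl, Or.inl (hshort y (hT.closed y d' hy) (by simp at hyl; omega))⟩
      refine (runs_processChild hV hM hz tB hpV t28 t29 ?_ (fun hp0 => Or.inl ?_) hPQ).mono le_rfl ?_
      · rintro (h | ⟨-, h⟩)
        exacts [hpP h, h (by simp)]
      · exact hshort _ ((hV _).2 (isACState_failState p)) (length_failState_lt hp0)
      · rintro t' ⟨Q', hB', hQ', t26', t28', t29'⟩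
        have hD : (fun w d' => (w ∈ P ∨ (w = p ∧ d' ∉ d :: ds)) ∨ (w = p ∧ d' = d)) =
            fun (w : List Dir) d' => w ∈ P ∨ (w = p ∧ d' ∉ ds) := by
          funext w d'
          refine propext ⟨?_, ?_⟩
          · rintro ((h | ⟨h₁, h₂⟩) | ⟨rfl, rfl⟩)
            exacts [Or.inl h, Or.inr ⟨h₁, fun h => h₂ (by simp [h])⟩, Or.inr ⟨rfl, hnd.1⟩]
          · rintro (h | ⟨h₁, h₂⟩)
            · exact Or.inl (Or.inl h)
            · by_cases hd : d' = d
              · exact Or.inr ⟨h₁, hd⟩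
              · exact Or.inl (Or.inr ⟨h₁, by simp [hd, h₂]⟩)
        rw [hD] at hB'
        refine ⟨hnd.2, t26'.trans t26, t28'.trans t28, t29'.trans t29, ?_⟩
        rcases hQ' with rfl | rfl
        · exact ⟨R, hB', ts⟩
        · refine ⟨R ++ [p ++ [d]], by rwa [← List.append_assoc], ?_⟩
          rw [← List.append_assoc]
          refine List.pairwise_append.2 ⟨ts, by simp, fun x hx y hy => ?_⟩
          rw [List.mem_singleton.1 hy, List.length_append, List.length_singleton]
          rcases ((tB.mem x).1 hx).2 with rfl | ⟨w, d', rfl, h | ⟨rfl, -⟩⟩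
          · simp
          · have := hPp w h; simp; omega
          · simp
    · refine ⟨by decide, by simp [hs₂], by simp [hs₂], by simp [hs₂], R, ?_, by simpa using hs⟩
      have hD : (fun w d => w ∈ P ∨ (w = p ∧ d ∉ Dir.all)) = fun (w : List Dir) (_ : Dir) => w ∈ P := by
        funext w d
        have : d ∈ Dir.all := by cases d <;> decide
        simp [this]
      rw [hD]
      simpa using hB₂
    · rintro t ⟨-, t26, -, -, R, tB, ts⟩
      refine ⟨⟨P ++ [p], R, by simp [t26], ?_, ts⟩, by rw [t26]; omega⟩
      have hD : (fun w d => w ∈ P ∨ (w = p ∧ d ∉ ([] : List Dir))) = fun w (_ : Dir) => w ∈ P ++ [p] := by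
        funext w d; simp
      rwa [hD] at tB
  · rintro s' ⟨⟨P, R, h26, hB, -⟩, hc⟩
    simp only [Test.Holds, h26, hB.reg27, List.length_append] at hc
    obtain rfl := List.eq_nil_of_length_eq_zero (show R.length = 0 by omega)
    rw [List.append_nil] at hB
    have hall : ∀ x ∈ V, x ∈ P := by
      intro x
      induction x using List.reverseRecOn with
      | nil => exact fun hx => (hB.mem _).2 ⟨hx, Or.inl rfl⟩
      | append_singleton x d ih =>
        exact fun hx => (hB.mem _).2 ⟨hx, Or.inr ⟨x, d, rfl, ih (hT.closed x d hx)⟩⟩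
    exact ⟨hB.reg2, hB.reg8, fun w hw d => (hB.step w hw d).1 (hall w hw), fun w hw => hB.mark w (hall w hw)⟩

/-- Makes the final states absorbing. -/
def absorbProgram : Program :=
  block [.const 3 0, .const 10 0, .loop (.lt 10 2) (block [.load 11 6 10, .ite (.eq 11 8)
    (block [.store 2 10 10, .store 3 10 10, .store 4 10 10, .store 5 10 10]) nop, .inc 10])]

/-- The search computes `nextState` for final states too; since `ahoCorasick` never leaves them,
their transitions are overwritten by loops. -/
theorem runs_absorbProgram {s : Memory} {N : ℕ} (h2 : s.reg 2 = N) (h8 : s.reg 8 = 1) :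
    Runs absorbProgram s (8 * N + 10) fun s' => s'.reg 2 = N ∧ s'.reg 3 = 0 ∧ s'.arr 6 = s.arr 6 ∧
      ∀ i < N, ∀ d : Dir, s'.arr (2 + d.code) i = if s.arr 6 i = 1 then i else s.arr (2 + d.code) i := by
  let I : ℕ → Memory → Prop := fun i s' => s'.reg 2 = N ∧ s'.reg 3 = 0 ∧ s'.reg 8 = 1 ∧ s'.reg 10 = i ∧
    s'.arr 6 = s.arr 6 ∧ ∀ j, ∀ d : Dir, s'.arr (2 + d.code) j =
      if j < i ∧ s.arr 6 j = 1 then j else s.arr (2 + d.code) j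
  refine Runs.seq (T₁ := 1) (T₂ := 8 * N + 9) (P := fun s' => s' = s.setReg 3 0) (.of_wp rfl le_rfl) ?_ (by omega)
  rintro _ rfl
  refine Runs.seq (T₁ := 1) (T₂ := N * (7 + 1) + 1) (P := I 0) (.of_wp ?_ le_rfl) ?_ (by omega)
  · simp [Program.wp, I, h2, h8]
  intro s₁ hs₁
  refine (Runs.for_const I N 7 ?_ ?_ hs₁).mono (by omega) ?_
  · rintro i hi s' ⟨e2, e3, e8, e10, e6, eδ⟩
    refine ⟨by simpa [Test.Holds, e10, e2] using hi, .of_wp ?_ (by decide)⟩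
    simp only [block, Program.wp, wp_nop, Test.Holds, Memory.reg_setReg, Memory.arr_setReg,
      Memory.reg_setArr, Memory.arr_setArr, e10]
    norm_num
    rw [e8, e6]
    refine ⟨fun hl => ?_, fun hl => ?_⟩
    · refine ⟨by simp [e2], by simp [e3], by simp [e8], by simp [e10], by simp [e6], fun j d => ?_⟩
      have := eδ j d
      have key : Function.update (s'.arr (2 + d.code)) i i j =
          if j < i + 1 ∧ s.arr 6 j = 1 then j else s.arr (2 + d.code) j := by
        rw [Function.update_apply]
        split_ifs with h₁ h₂ h₂
        · exact h₁.symm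
        · exact absurd ⟨by omega, h₁ ▸ hl⟩ h₂
        · rw [this, if_pos ⟨by omega, h₂.2⟩]
        · rw [this, if_neg fun h => h₂ ⟨by omega, h.2⟩]
      rw [← key]
      cases d <;> simp [Dir.code]
    · refine ⟨by simp [e2], by simp [e3], by simp [e8], by simp [e10], by simp [e6], fun j d => ?_⟩
      simp only [Memory.arr_setReg]
      rw [eδ]
      refine if_congr (and_congr_left fun h => ⟨fun _ => by omega, fun _ => ?_⟩) rfl rfl
      rcases (show j ≤ i by omega).lt_or_eq with h' | rfl
      exacts [h', absurd h hl]
  · rintro s' ⟨e2, -, -, e10, -⟩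
    simp [Test.Holds, e10, e2]
  · rintro s' ⟨e2, e3, e8, e10, e6, eδ⟩
    exact ⟨e2, e3, e6, fun i hi d => by rw [eδ]; simp [hi]⟩

/-- Builds the Aho–Corasick automaton. -/
def automatonProgram : Program := block [trieProgram, failProgram, absorbProgram]

/-- The numbering `e` is the position in the list of nodes of the trie. The empty word is excluded
from `F`, so the root is not final. -/
theorem runs_automatonProgram {s : Memory} {W : List (List Letter)} {F : Set (List Dir)}
    (hs : HoldsWords s 1 (W.map fun w => w.map Letter.code)) (h0 : ∀ k, 2 ≤ k → k ≤ 6 → ∀ i, s.arr k i = 0)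
    (hW : ∀ w ∈ W, ∃ l₁ l₂, ∃ ds : List Dir, w = l₁ :: l₂ :: ds.map .dir)
    (hF : F = {v | ∃ a b : Dir, a.isHoriz = b.isHoriz ∧ v = [a, b]} ∪ factorSet W) (hF0 : [] ∉ F) :
    Runs automatonProgram s (6000 * (wordCode W).length + 6000) fun s' =>
      ∃ (N : ℕ) (e : ACState F ≃ Fin N), HoldsAutomaton s' (DFA.reindex e (ahoCorasick F)) ∧
        N ≤ 64 * (wordCode W).length + 64 := by
  refine Runs.seq (T₂ := 4899 * (wordCode W).length + 5000) (runs_trieProgram hs h0 hW) ?_ (by omega)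
  rw [← hF]
  rintro s₁ ⟨⟨V, hT, hV⟩, h2, h8, h9⟩
  rw [hT.reg2] at h2
  refine Runs.seq (T₂ := 8 * V.length + 10) (runs_failProgram hT hV hF0 h8 h9) ?_ (by omega)
  rintro s₂ ⟨h2', h8', hδ, hm⟩
  refine (runs_absorbProgram h2' h8').mono le_rfl ?_
  rintro s₃ ⟨e2, e3, e6, eδ⟩
  have hget : ∀ i : Fin V.length, nodeNum V V[i] = i := fun i => by
    rw [nodeNum_of_mem (w := V[i]) (List.getElem_mem i.2)]
    exact hT.nodup.idxOf_getElem i i.2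
  let e : ACState F ≃ Fin V.length :=
    { toFun := fun x => ⟨nodeNum V x.1, nodeNum_lt ((hV _).2 x.2)⟩
      invFun := fun i => ⟨V[i], (hV _).1 (List.getElem_mem _)⟩
      left_inv := fun x => Subtype.ext (nodeNum_inj (List.getElem_mem _) ((hV _).2 x.2) (hget ⟨_, _⟩))
      right_inv := fun i => Fin.ext (hget i) }
  have hacc : ∀ x : ACState F, (x ∈ (ahoCorasick F).accept → s₂.arr 6 (nodeNum V x.1) = 1) ∧
      (x ∉ (ahoCorasick F).accept → s₂.arr 6 (nodeNum V x.1) = 0) := fun x => hm x.1 ((hV _).2 x.2)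
  have hnum : ∀ q : Fin V.length, (q : ℕ) = nodeNum V (e.symm q).1 := fun q => (hget q).symm
  refine ⟨V.length, e, ⟨e2, e3.trans hT.nodeNum_nil.symm, fun q d => ?_, fun q => ?_⟩, h2⟩
  · rw [eδ q q.2, hnum q]
    show _ = nodeNum V ((ahoCorasick F).step (e.symm q) d).1
    by_cases hq : e.symm q ∈ (ahoCorasick F).accept
    · rw [if_pos ((hacc _).1 hq), ahoCorasick_step_of_mem hq]
    · rw [if_neg (by rw [(hacc _).2 hq]; simp), ahoCorasick_step_of_not_mem hq,
        hδ _ ((hV _).2 (e.symm q).2)]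
      rfl
  · rw [e6, hnum q]
    exact hacc (e.symm q)

end PinPerm
namespace PinPerm

/-! ### Writing pin words -/

/-- The cells of array `1` before the position in register `32` contain the list. -/
structure Out (s : Memory) (l : List ℕ) : Prop where
  reg32 : s.reg 32 = l.length
  arr : ∀ (i : ℕ) (h : i < l.length), s.arr 1 i = l[i]

theorem Out.push {s s' : Memory} {l : List ℕ} (h : Out s l) {x : ℕ} (h32 : s'.reg 32 = s.reg 32 + 1)
    (h1 : s'.arr 1 = Function.update (s.arr 1) (s.reg 32) x) : Out s' (l ++ [x]) := by
  refine ⟨by simp [h32, h.reg32], fun i hi => ?_⟩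
  rw [List.length_append, List.length_singleton] at hi
  rw [h1, h.reg32]
  rcases (show i ≤ l.length by omega).lt_or_eq with hlt | rfl
  · rw [Function.update_of_ne hlt.ne, List.getElem_append_left hlt, h.arr i hlt]
  · simp

theorem Out.of_frame {s s' : Memory} {l : List ℕ} (h : Out s l) {R A : List ℕ} (hf : Frame R A s s')
    (hR : 32 ∉ R) (hA : 1 ∉ A) : Out s' l :=
  ⟨(hf.1 _ hR).trans h.reg32, fun i hi => by rw [hf.2 _ hA, h.arr i hi]⟩

/-- The stack in array `9` contains the directions, the first one on top. -/
structure Stack (s : Memory) (r : List Dir) : Prop where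
  reg45 : s.reg 45 = r.length
  arr : ∀ (i : ℕ) (h : i < r.length), s.arr 9 (r.length - 1 - i) = 5 + r[i].code

theorem Stack.of_frame {s s' : Memory} {r : List Dir} (h : Stack s r) {R A : List ℕ} (hf : Frame R A s s')
    (hR : 45 ∉ R) (hA : 9 ∉ A) : Stack s' r :=
  ⟨(hf.1 _ hR).trans h.reg45, fun i hi => by rw [hf.2 _ hA, h.arr i hi]⟩

theorem Stack.push {s s' : Memory} {r : List Dir} (h : Stack s r) {d : Dir} (h45 : s'.reg 45 = s.reg 45 + 1)
    (h9 : s'.arr 9 = Function.update (s.arr 9) (s.reg 45) (5 + d.code)) : Stack s' (d :: r) := by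
  refine ⟨by simp [h45, h.reg45], fun i hi => ?_⟩
  rw [h9, h.reg45, List.length_cons, Nat.add_sub_cancel]
  cases i with
  | zero => simp
  | succ i =>
    simp only [List.length_cons] at hi
    rw [Function.update_of_ne (by omega), List.getElem_cons_succ, ← h.arr i (by omega)]
    congr 1
    omega

/-- Writes a constant. -/
def putConst (c : ℕ) : Program := block [.const 51 c, .store 1 32 51, .inc 32]

/-- Writes the pin word with the given first letters and the directions on the stack. -/
def emit (x : Letter × Letter) : Program :=
  block [block [.copy 51 45, .inc 51, .inc 51, .store 1 32 51, .inc 32], putConst x.1.code, putConst x.2.code,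
    .copy 50 45, .loop (.lt 9 50) (block [.dec 50, .load 51 9 50, .store 1 32 51, .inc 32]), .inc 1]

/-- The memory contains the output words. -/
structure OutWords (s : Memory) (W : List (List Letter)) : Prop where
  out : Out s (wordCode W)
  reg1 : s.reg 1 = W.length

theorem OutWords.of_frame {s s' : Memory} {W : List (List Letter)} (h : OutWords s W) {R A : List ℕ}
    (hf : Frame R A s s') (hR : 32 ∉ R ∧ 1 ∉ R) (hA : 1 ∉ A) : OutWords s' W :=
  ⟨h.out.of_frame hf hR.1 hA, (hf.1 _ hR.2).trans h.reg1⟩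

theorem runs_putConst {s : Memory} {l : List ℕ} (h : Out s l) (c : ℕ) :
    Runs (putConst c) s 3 fun s' => Out s' (l ++ [c]) :=
  .of_wp (h.push (by simp) (by simp)) (by simp [putConst, block, Program.cost])

theorem writes_emit (x : Letter × Letter) : (emit x).Writes [1, 32, 50, 51] [1] := by
  simp [emit, putConst, block, Program.Writes]

/-- The removal finds the last direction first, so the top of the stack is the first direction of
the word. The stack is read without being emptied, to serve several choices of the first letters. -/
theorem runs_emit {s : Memory} {W : List (List Letter)} {r : List Dir} (h : OutWords s W) (hr : Stack s r)
    (h9 : s.reg 9 = 0) (x : Letter × Letter) :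
    Runs (emit x) s (5 * r.length + 14) fun s' => OutWords s' (W ++ [x.1 :: x.2 :: r.map .dir]) := by
  have hfirst : Runs (block [.copy 51 45, .inc 51, .inc 51, .store 1 32 51, .inc 32]) s 5
      fun s' => Out s' (wordCode W ++ [r.length + 2]) := by
    refine .of_wp ?_ (by decide)
    simp only [block, Program.wp]
    exact h.out.push (by simp) (by simp [hr.reg45])
  refine Runs.seq (T₂ := 5 * r.length + 9) (hfirst.frame [51, 32] [1] (by simp [block, Program.Writes])) ?_
    (by omega)
  rintro s₁ ⟨h₁, f₁⟩
  refine Runs.seq (T₂ := 5 * r.length + 6) ((runs_putConst h₁ x.1.code).frame [51, 32] [1]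
    (by simp [putConst, block, Program.Writes])) ?_ (by omega)
  rintro s₂ ⟨h₂, f₂⟩
  refine Runs.seq (T₂ := 5 * r.length + 3) ((runs_putConst h₂ x.2.code).frame [51, 32] [1]
    (by simp [putConst, block, Program.Writes])) ?_ (by omega)
  rintro s₃ ⟨h₃, f₃⟩
  have f := (f₁.trans f₂).trans f₃
  have hr₃ : Stack s₃ r := hr.of_frame f (by simp) (by simp)
  let I : ℕ → Memory → Prop := fun i s' => Frame [50, 51, 32] [1] s₃ s' ∧ s'.reg 50 = r.length - i ∧
    Out s' (wordCode W ++ [r.length + 2] ++ [x.1.code] ++ [x.2.code] ++ (r.take i).map fun d => 5 + d.code)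
  refine Runs.seq (T₁ := 1) (T₂ := 5 * r.length + 2) (P := I 0) (.of_wp ?_ le_rfl) ?_ (by omega)
  · have h₃' := h₃.of_frame (frame_setReg (R := [50]) (A := []) (r := 50) (by simp) s₃ (s₃.reg 45)) (by simp) (by simp)
    exact ⟨frame_setReg (by simp) _ _, by simp [hr₃.reg45], by simpa using h₃'⟩
  intro s₄ h₄
  refine Runs.seq (T₂ := 1) (Runs.for_const I r.length 4 ?_ ?_ h₄) ?_ (by omega)
  · rintro i hi s' ⟨f', h50, ho⟩
    have e9 : s'.reg 9 = 0 := by rw [f'.1 9 (by simp), f.1 9 (by simp), h9]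
    refine ⟨by simp only [Test.Holds, e9, h50]; omega, ?_⟩
    have ha : s'.arr 9 (r.length - i - 1) = 5 + r[i].code := by
      rw [f'.2 9 (by simp), ← hr₃.arr i hi]; congr 1; omega
    refine ((Runs.of_wp (Q := fun s' => s'.reg 50 = r.length - (i + 1) ∧ Out s' (wordCode W ++ [r.length + 2] ++
      [x.1.code] ++ [x.2.code] ++ (r.take (i + 1)).map fun d => 5 + d.code)) ?_ (by decide)).frame [50, 51, 32] [1]
      (by simp [block, Program.Writes])).mono le_rfl fun s'' h => ⟨f'.trans h.2, h.1⟩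
    simp only [block, Program.wp]
    refine ⟨by simp [h50]; omega, ?_⟩
    rw [List.take_succ_eq_append_getElem hi, List.map_append, ← List.append_assoc]
    exact ho.push (by simp) (by simp [h50, ha])
  · rintro s' ⟨f', h50, -⟩
    simp [Test.Holds, f'.1 9, f.1 9, h9, h50]
  · rintro s' ⟨f', h50, ho⟩
    refine .of_wp ?_ le_rfl
    simp only [block, Program.wp]
    refine ⟨?_, ?_⟩
    · rw [wordCode_append, wordCode_cons]
      have := ho.of_frame (frame_setReg (R := [1]) (A := []) (r := 1) (by simp) s' (s'.reg 1 + 1)) (by simp) (by simp)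
      simpa [flatCode, Letter.code, Function.comp_def] using this
    · simp [f'.1 1, f.1 1, h.reg1]

/-- Writes several pin words with the same directions. -/
def emitAll (l : List (Letter × Letter)) : Program := chain (l.map emit)

theorem writes_emitAll (l : List (Letter × Letter)) : (emitAll l).Writes [1, 7, 32, 50, 51] [1] := by
  refine writes_chain (by simp) ?_
  simp only [List.mem_map]
  rintro _ ⟨x, -, rfl⟩
  simp [emit, putConst, block, Program.Writes]

theorem runs_emitAll {s : Memory} {W : List (List Letter)} {r : List Dir} (h : OutWords s W) (hr : Stack s r)
    (h9 : s.reg 9 = 0) (l : List (Letter × Letter)) :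
    Runs (emitAll l) s (l.length * (5 * r.length + 14) + 1) fun s' =>
      OutWords s' (W ++ l.map fun x => x.1 :: x.2 :: r.map .dir) := by
  let J : List (Letter × Letter) → Memory → Prop := fun l₂ s' => Stack s' r ∧ s'.reg 9 = 0 ∧
    ∃ l₁, l₁ ++ l₂ = l ∧ OutWords s' (W ++ l₁.map fun x => x.1 :: x.2 :: r.map .dir)
  refine (Runs.chain J (l := l) ?_ ⟨hr, h9, [], rfl, by simpa using h⟩).mono le_rfl ?_
  · rintro x l₂ s' ⟨hr, h9, l₁, rfl, ho⟩
    refine ((runs_emit ho hr h9 x).frame _ _ (writes_emit x)).mono le_rfl ?_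
    rintro s'' ⟨h', f⟩
    exact ⟨hr.of_frame f (by simp) (by simp), (f.1 9 (by simp)).trans h9, l₁ ++ [x], by simp,
      by simpa using h'⟩
  · rintro s' ⟨-, -, l₁, hl, ho⟩
    rw [List.append_nil] at hl
    exact hl ▸ ho

/-- The possible first letters of the pin words. -/
def headsFrom (inc hz : Bool) : List (Letter × Letter) :=
  (Quad.all.filter fun k => k.inc = inc).flatMap fun k => heads k hz

/-- Two quadrants have the given monotonicity; each allows four first numerals before a numeral and
two before a direction. -/
theorem length_headsFrom (inc hz : Bool) : (headsFrom inc hz).length = 12 := by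
  cases inc <;> cases hz <;> decide

theorem length_wordCode_wordsFrom (inc hz : Bool) (r : List Dir) :
    (wordCode (wordsFrom inc hz r)).length = 12 * (r.length + 3) := by
  have : ∀ l : List (Letter × Letter), (wordCode (l.map fun x => x.1 :: x.2 :: r.map .dir)).length =
      l.length * (r.length + 3) := by
    intro l
    induction l with
    | nil => simp [wordCode, flatCode]
    | cons x l ih =>
      rw [List.map_cons, wordCode_cons, List.length_append, ih]
      simp
      ring
  rw [← length_headsFrom inc hz]
  exact this _

/-- Writes the pin words, depending on the registers `48` and `49`. -/
def emitWords : Program :=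
  .ite (.eq 48 8) (.ite (.eq 49 8) (emitAll (headsFrom true true)) (emitAll (headsFrom true false)))
    (.ite (.eq 49 8) (emitAll (headsFrom false true)) (emitAll (headsFrom false false)))

theorem runs_emitWords {s : Memory} {W : List (List Letter)} {r : List Dir} {inc hz : Bool} (h : OutWords s W)
    (hr : Stack s r) (h8 : s.reg 8 = 1) (h9 : s.reg 9 = 0) (h48 : s.reg 48 = inc.toNat)
    (h49 : s.reg 49 = hz.toNat) : Runs emitWords s (60 * r.length + 171) fun s' =>
      OutWords s' (W ++ wordsFrom inc hz r) := by
  have key : ∀ inc' hz', inc' = inc → hz' = hz → Runs (emitAll (headsFrom inc' hz')) s (60 * r.length + 169)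
      fun s' => OutWords s' (W ++ wordsFrom inc hz r) := by
    rintro _ _ rfl rfl
    refine (runs_emitAll h hr h9 _).mono ?_ fun _ => id
    rw [length_headsFrom]
    omega
  refine .ite (T := 60 * r.length + 170) (fun h₁ => ?_) (fun h₁ => ?_) le_rfl <;>
    refine .ite (T := 60 * r.length + 169) (fun h₂ => key _ _ ?_ ?_) (fun h₂ => key _ _ ?_ ?_) le_rfl <;>
    simp only [Test.Holds, h48, h49, h8] at h₁ h₂ <;> cases inc <;> cases hz <;> simp_all

end PinPerm
namespace PinPerm

/-! ### Finding the pin words -/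

/-- The number of the table that is used along the axis `h`. -/
def tableNum (h : Bool) : ℕ := if h then 7 else 8

/-- Removes one pin; the other pins lie along the axis `h`. -/
def removePin (h : Bool) : Program :=
  block [.copy 50 40, .inc 50, .ite (.eq 44 50)
    (block [.inc 50, .ite (.eq 41 50)
      (block [.const 49 (!h).toNat, .load 51 (tableNum h) 40, .load 52 (tableNum h) 41,
        .ite (.lt 51 52) (.const 48 1) (.const 48 0), .const 47 1])
      (block [.load 44 (tableNum h) 40, .copy 51 41, .copy 40 42, .copy 41 43, .copy 42 50, .copy 43 51,
        .const 51 (5 + (Dir.lo h).code), .store 9 45 51, .inc 45, .const 46 (!h).toNat])])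
    (block [.copy 50 41, .dec 50, .ite (.eq 44 50)
      (block [.dec 50, .load 44 (tableNum h) 41, .copy 51 40, .copy 40 42, .copy 41 43, .copy 42 51, .copy 43 50,
        .const 51 (5 + (Dir.hi h).code), .store 9 45 51, .inc 45, .const 46 (!h).toNat])
      (.const 47 2)])]

/-- Removes the pins one by one. -/
def removePins : Program :=
  .loop (.eq 47 9) (.ite (.eq 54 9) (.const 47 2)
    (.seq (.dec 54) (.ite (.eq 46 8) (removePin true) (removePin false))))

/-- The memory contains the arguments of `back`. -/
structure BackState (s : Memory) (f g : ℕ → ℕ) (h : Bool) (a b c d x : ℕ) (acc : List Dir) (n : ℕ) :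
    Prop where
  reg8 : s.reg 8 = 1
  reg9 : s.reg 9 = 0
  reg40 : s.reg 40 = a
  reg41 : s.reg 41 = b
  reg42 : s.reg 42 = c
  reg43 : s.reg 43 = d
  reg44 : s.reg 44 = x
  reg46 : s.reg 46 = h.toNat
  reg47 : s.reg 47 = 0
  reg54 : s.reg 54 = n
  arr7 : s.arr 7 = f
  arr8 : s.arr 8 = g
  stack : Stack s acc

/-- The memory contains the result of `back`. -/
def BackResult (s : Memory) : Option (List Dir × Bool × Bool) → Prop
  | none => s.reg 47 = 2
  | some (r, hz, inc) => s.reg 47 = 1 ∧ s.reg 48 = inc.toNat ∧ s.reg 49 = hz.toNat ∧ Stack s r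

theorem BackResult.ne_zero {s : Memory} {o : Option (List Dir × Bool × Bool)} (h : BackResult s o) :
    s.reg 47 ≠ 0 := by
  rcases o with _ | ⟨r, hz, inc⟩
  · rw [show s.reg 47 = 2 from h]; simp
  · rw [h.1]; simp

/-- The table along the axis `h`. -/
def table (f g : ℕ → ℕ) (h : Bool) : ℕ → ℕ := if h then f else g

theorem Stack.congr {s s' : Memory} {r : List Dir} (h : Stack s r) (h45 : s'.reg 45 = s.reg 45)
    (h9 : s'.arr 9 = s.arr 9) : Stack s' r :=
  ⟨h45.trans h.reg45, fun i hi => by rw [h9, h.arr i hi]⟩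

/-- A round leads to the result of `back`, or to the arguments of its recursive call. -/
def BackStep (s : Memory) (f g : ℕ → ℕ) (n : ℕ) (o : Option (List Dir × Bool × Bool)) : Prop :=
  BackResult s o ∨ ∃ h a b c d x acc, BackState s f g h a b c d x acc n ∧
    back (table f g h) (table f g !h) h a b c d x acc n = o

/-- One round performs one level of the recursion of `back`. The tables stay in place: exchanging
the axes only flips the flag in register `46`, which selects the version of the program. -/
theorem runs_removePin {s : Memory} {f g : ℕ → ℕ} {h : Bool} {a b c d x : ℕ} {acc : List Dir} {n : ℕ}
    (hs : BackState s f g h a b c d x acc n) : Runs (removePin h) s 20 fun s' =>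
      s'.reg 9 = 0 ∧ BackStep s' f g n (back (table f g h) (table f g !h) h a b c d x acc (n + 1)) := by
  refine .of_wp ?_ (by cases h <;> decide)
  have htab : s.arr (tableNum h) = table f g h := by
    cases h
    exacts [hs.arr8, hs.arr7]
  have hst := hs.stack
  simp only [removePin, block, Program.wp, Test.Holds, Memory.reg_setReg, Memory.arr_setReg,
    Memory.reg_setArr, Memory.arr_setArr, hs.reg40, hs.reg41, hs.reg44, htab]
  norm_num
  simp only [hs.reg40, hs.reg41, hs.reg44, hs.reg9]
  rw [back]
  refine ⟨fun h₁ => ⟨fun h₂ => ?_, fun h₂ => ?_⟩, fun h₁ => ⟨fun h₂ => ?_, fun h₂ => ?_⟩⟩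
  · rw [if_pos h₁, if_pos h₂]
    constructor
    · intro h₃
      refine ⟨trivial, Or.inl ⟨by simp, by simp [h₃], by simp, hst.congr (by simp) (by simp)⟩⟩
    · intro h₃
      refine ⟨trivial, Or.inl ⟨by simp, by simp [Nat.not_lt.2 h₃], by simp, hst.congr (by simp) (by simp)⟩⟩
  · rw [if_pos h₁, if_neg h₂]
    refine ⟨trivial, Or.inr ⟨!h, c, d, a + 2, b, table f g h a, .lo h :: acc, ⟨by simp [hs.reg8], by simp [hs.reg9],
      by simp [hs.reg42], by simp [hs.reg43], by simp, by simp, by simp, by simp, by simp [hs.reg47],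
      by simp [hs.reg54], by simp [hs.arr7], by simp [hs.arr8], hst.push (by simp) (by simp)⟩, ?_⟩⟩
    rw [Bool.not_not]
  · rw [if_neg h₁, if_pos h₂]
    refine ⟨trivial, Or.inr ⟨!h, c, d, a, b - 2, table f g h b, .hi h :: acc, ⟨by simp [hs.reg8], by simp [hs.reg9],
      by simp [hs.reg42], by simp [hs.reg43], by simp, by simp; try omega, by simp, by simp, by simp [hs.reg47],
      by simp [hs.reg54], by simp [hs.arr7], by simp [hs.arr8], hst.push (by simp) (by simp)⟩, ?_⟩⟩
    rw [Bool.not_not]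
  · rw [if_neg h₁, if_neg h₂]
    exact ⟨trivial, Or.inl (by simp [BackResult])⟩

theorem runs_removePins {f g : ℕ → ℕ} {n : ℕ} : ∀ {s : Memory} {h : Bool} {a b c d x : ℕ} {acc : List Dir},
    BackState s f g h a b c d x acc n → Runs removePins s (30 * n + 30) fun s' =>
      BackResult s' (back (table f g h) (table f g !h) h a b c d x acc n) := by
  induction n with
  | zero =>
    intro s h a b c d x acc hs
    refine .loop_step (T₁ := 2) (T₂ := 1) (P := fun s' => s' = s.setReg 47 2)
      (by simp [Test.Holds, hs.reg47, hs.reg9]) (.ite (T := 1) (fun _ => .of_wp rfl le_rfl)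
        (fun hc => absurd (by simp [Test.Holds, hs.reg54, hs.reg9]) hc) le_rfl) ?_ (by omega)
    · rintro _ rfl
      refine .loop_done (by simp [Test.Holds, hs.reg9]) ?_ le_rfl
      simp [back, BackResult]
  | succ n ih =>
    intro s h a b c d x acc hs
    refine .loop_step (T₁ := 23) (T₂ := 30 * n + 30) (P := fun s' => s'.reg 9 = 0 ∧
      BackStep s' f g n (back (table f g h) (table f g !h) h a b c d x acc (n + 1)))
      (by simp [Test.Holds, hs.reg47, hs.reg9]) ?_ ?_ (by omega)
    · refine .ite (T := 22) (fun hc => ?_) (fun _ => ?_) le_rfl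
      · simp [Test.Holds, hs.reg54, hs.reg9] at hc
      · refine Runs.seq (T₁ := 1) (T₂ := 21) (P := fun s' => s' = s.setReg 54 n)
          (.of_wp (by simp [Program.wp, hs.reg54]) le_rfl) ?_ (by omega)
        rintro _ rfl
        have hs' : BackState (s.setReg 54 n) f g h a b c d x acc n :=
          ⟨by simp [hs.reg8], by simp [hs.reg9], by simp [hs.reg40], by simp [hs.reg41], by simp [hs.reg42],
            by simp [hs.reg43], by simp [hs.reg44], by simp [hs.reg46], by simp [hs.reg47], by simp, hs.arr7,
            hs.arr8, hs.stack.congr (by simp) (by simp)⟩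
        refine .ite (T := 20) (fun hc => ?_) (fun hc => ?_) le_rfl
        · obtain rfl : h = true := by
            simp only [Test.Holds, hs'.reg46, hs'.reg8] at hc; cases h <;> simp_all
          exact runs_removePin hs'
        · obtain rfl : h = false := by
            simp only [Test.Holds, hs'.reg46, hs'.reg8] at hc; cases h <;> simp_all
          exact runs_removePin hs'
    · rintro s' ⟨h9, hr | ⟨h, a, b, c, d, x, acc, hs', he⟩⟩
      · exact .loop_done (by simpa [Test.Holds, h9] using hr.ne_zero) hr (by omega)
      · rw [← he]
        exact ih hs'

/-- The arguments of `back`, if the last pin has the direction `d`. -/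
def prepare (d : Dir) : Program :=
  .seq (match d with
    | .U => block [.load 44 8 35, .copy 43 35, .dec 43, .const 42 1, .const 46 1]
    | .D => block [.const 44 1, .load 44 8 44, .copy 43 35, .const 42 2, .const 46 1]
    | .L => block [.const 44 1, .load 44 7 44, .copy 43 35, .const 42 2, .const 46 0]
    | .R => block [.load 44 7 35, .copy 43 35, .dec 43, .const 42 1, .const 46 0])
  (block [.const 40 1, .copy 41 35, .const 47 0, .copy 54 35, .const 45 0, .const 51 (5 + d.code), .store 9 45 51,
    .inc 45])

/-- Removes the pins and writes the pin words, if the last pin has the direction `d`. -/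
def searchFrom (d : Dir) : Program := block [prepare d, removePins, .ite (.eq 47 8) emitWords nop]

theorem length_back_le {n : ℕ} : ∀ {f g : ℕ → ℕ} {h : Bool} {a b c d x : ℕ} {acc r : List Dir} {hz inc : Bool},
    back f g h a b c d x acc n = some (r, hz, inc) → r.length ≤ acc.length + n := by
  induction n with
  | zero => intro f g h a b c d x acc r hz inc he; simp [back] at he
  | succ n ih =>
    intro f g h a b c d x acc r hz inc he
    rw [back] at he
    split_ifs at he
    · simp only [Option.some.injEq, Prod.mk.injEq] at he
      rw [← he.1]; omega
    · have := ih he; simp at this; omega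
    · have := ih he; simp at this; omega

theorem runs_prepare {s : Memory} {f g : ℕ → ℕ} {n : ℕ} (h8 : s.reg 8 = 1) (h9 : s.reg 9 = 0)
    (h35 : s.reg 35 = n) (h7 : s.arr 7 = f) (hg : s.arr 8 = g) (d : Dir) :
    Runs (prepare d) s 13 fun s' => ∃ h a b c e x, BackState s' f g h a b c e x [d] n ∧
      back (table f g h) (table f g !h) h a b c e x [d] n = start f g n d := by
  refine .of_wp ?_ (by cases d <;> decide)
  have hstack : ∀ s' : Memory, s'.reg 45 = 1 → s'.arr 9 0 = 5 + d.code → Stack s' [d] := by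
    refine fun s' h₁ h₂ => ⟨h₁, fun i hi => ?_⟩
    obtain rfl : i = 0 := by simpa using hi
    exact h₂
  cases d
  · exact ⟨true, 1, n, 1, n - 1, g n, ⟨by simp [h8], by simp [h9], by simp, by simp [h35], by simp, by simp [h35],
      by simp [h35, hg], by simp, by simp, by simp [h35], by simp [h7], by simp [hg],
      hstack _ (by simp) (by simp)⟩, rfl⟩
  · exact ⟨true, 1, n, 2, n, g 1, ⟨by simp [h8], by simp [h9], by simp, by simp [h35], by simp, by simp [h35],
      by simp [h35, hg], by simp, by simp, by simp [h35], by simp [h7], by simp [hg],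
      hstack _ (by simp) (by simp)⟩, rfl⟩
  · exact ⟨false, 1, n, 2, n, f 1, ⟨by simp [h8], by simp [h9], by simp, by simp [h35], by simp, by simp [h35],
      by simp [h35, h7], by simp, by simp, by simp [h35], by simp [h7], by simp [hg],
      hstack _ (by simp) (by simp)⟩, rfl⟩
  · exact ⟨false, 1, n, 1, n - 1, f n, ⟨by simp [h8], by simp [h9], by simp, by simp [h35], by simp, by simp [h35],
      by simp [h35, h7], by simp, by simp, by simp [h35], by simp [h7], by simp [hg],
      hstack _ (by simp) (by simp)⟩, rfl⟩

theorem Program.Writes.mono {R A R' A' : List ℕ} (hR : R ⊆ R') (hA : A ⊆ A') {a : Program}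
    (h : a.Writes R A) : a.Writes R' A' := by
  induction a with
  | seq a b iha ihb => exact ⟨iha h.1, ihb h.2⟩
  | ite c a b iha ihb => exact ⟨iha h.1, ihb h.2⟩
  | loop c a iha => exact iha h
  | store k i r => exact hA h
  | _ => exact hR h

/-- The registers that are used by the search for pin words of one permutation. -/
abbrev searchRegs : List ℕ := [1, 7, 32, 40, 41, 42, 43, 44, 45, 46, 47, 48, 49, 50, 51, 52, 54]

theorem writes_prepare_removePins (d : Dir) :
    (Program.seq (prepare d) removePins).Writes [40, 41, 42, 43, 44, 45, 46, 47, 48, 49, 50, 51, 52, 54] [9] := by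
  cases d <;> simp [prepare, removePins, removePin, block, Program.Writes]

theorem writes_emitWords : emitWords.Writes searchRegs [1, 9] := by
  have := fun l => (writes_emitAll l).mono (R' := searchRegs) (A' := [1, 9]) (by simp) (by simp)
  exact ⟨⟨this _, this _⟩, ⟨this _, this _⟩⟩

theorem writes_searchFrom (d : Dir) : (searchFrom d).Writes searchRegs [1, 9] := by
  have h := (writes_prepare_removePins d).mono (R' := searchRegs) (A' := [1, 9]) (by simp) (by simp)
  exact ⟨h.1, h.2, writes_emitWords, by simp [nop, Program.Writes]⟩

theorem length_wordCode_wordsOfRun_le (f g : ℕ → ℕ) (n : ℕ) (d : Dir) :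
    (wordCode (wordsOfRun (start f g n d))).length ≤ 12 * (n + 4) := by
  rcases hr : start f g n d with _ | ⟨r, hz, inc⟩
  · simp [wordsOfRun, wordCode, flatCode]
  · rw [wordsOfRun, length_wordCode_wordsFrom]
    have : r.length ≤ 1 + n := by
      cases d <;> exact length_back_le hr
    omega

theorem runs_searchFrom {s : Memory} {f g : ℕ → ℕ} {n : ℕ} {W : List (List Letter)} (ho : OutWords s W)
    (h8 : s.reg 8 = 1) (h9 : s.reg 9 = 0) (h35 : s.reg 35 = n) (h7 : s.arr 7 = f) (hg : s.arr 8 = g) (d : Dir) :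
    Runs (searchFrom d) s (300 * (n + 1)) fun s' => OutWords s' (W ++ wordsOfRun (start f g n d)) := by
  have hrun : Runs (.seq (prepare d) removePins) s (30 * n + 43) fun s' => BackResult s' (start f g n d) := by
    refine Runs.seq (runs_prepare h8 h9 h35 h7 hg d) ?_ (T₂ := 30 * n + 30) (by omega)
    rintro s' ⟨h, a, b, c, e, x, hs, he⟩
    rw [← he]
    exact runs_removePins hs
  obtain ⟨τ, s₁, hx, hτ, hr, hf⟩ := hrun.frame _ _ (writes_prepare_removePins d)
  suffices hrest : Runs (.ite (.eq 47 8) emitWords nop) s₁ (60 * n + 232)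
      fun s' => OutWords s' (W ++ wordsOfRun (start f g n d)) by
    obtain ⟨τ', s₂, hx', hτ', hQ⟩ := hrest
    refine ⟨τ + τ', s₂, ?_, by omega, hQ⟩
    cases hx with
    | seq b₁ hx =>
      simp only [add_assoc]
      exact .seq b₁ (.seq hx hx')
  have ho₁ := ho.of_frame hf (by simp) (by simp)
  have e8 : s₁.reg 8 = 1 := (hf.1 8 (by simp)).trans h8
  have e9 : s₁.reg 9 = 0 := (hf.1 9 (by simp)).trans h9
  refine .ite (T := 60 * n + 231) (fun hc => ?_) (fun hc => ?_) le_rfl <;>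
    simp only [Test.Holds, e8] at hc <;> rcases hs : start f g n d with _ | ⟨r, hz, inc⟩ <;> rw [hs] at hr
  · rw [show s₁.reg 47 = 2 from hr] at hc; simp at hc
  · have : r.length ≤ 1 + n := by
      cases d <;> exact length_back_le hs
    exact (runs_emitWords ho₁ hr.2.2.2 e8 e9 hr.2.1 hr.2.2.1).mono (by omega) fun _ => id
  · refine .of_wp (a := nop) ?_ (by simp [nop, Program.cost])
    rw [wp_nop]
    simpa [wordsOfRun] using ho₁
  · exact absurd hr.1 hc

end PinPerm
namespace PinPerm

/-! ### Reading the basis and writing all its pin words -/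

/-- Reads the next permutation. -/
def readTables : Program :=
  block [.load 35 0 33, .inc 33, .const 36 1, .copy 37 35, .loop (.lt 9 37) (block [.load 38 0 33, .store 7 36 38,
    .store 8 38 36, .inc 36, .inc 33, .dec 37])]

theorem writes_readTables : readTables.Writes [33, 35, 36, 37, 38] [7, 8] := by
  simp [readTables, block, Program.Writes]

theorem runs_readTables {s : Memory} {σ : Permutation} {p : ℕ} (h9 : s.reg 9 = 0) (h33 : s.reg 33 = p)
    (hn : s.arr 0 p = σ.1) (hσ : ∀ i : Fin σ.1, s.arr 0 (p + 1 + i) = σ.2 i + 1) :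
    Runs readTables s (7 * σ.1 + 5) fun s' => s'.reg 35 = σ.1 ∧ s'.reg 33 = p + 1 + σ.1 ∧
      Tables (s'.arr 7) (s'.arr 8) σ := by
  let I : ℕ → Memory → Prop := fun i s' => s'.reg 9 = 0 ∧ s'.reg 35 = σ.1 ∧ s'.reg 33 = p + 1 + i ∧
    s'.reg 36 = i + 1 ∧ s'.reg 37 = σ.1 - i ∧ s'.arr 0 = s.arr 0 ∧
    ∀ j : Fin σ.1, (j : ℕ) < i → s'.arr 7 (j + 1) = σ.2 j + 1 ∧ s'.arr 8 (σ.2 j + 1) = j + 1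
  have hI : Runs (block [.load 35 0 33, .inc 33, .const 36 1, .copy 37 35]) s 4 (I 0) :=
    .of_wp (by simp [block, Program.wp, I, h9, h33, hn]) (by decide)
  obtain ⟨τ, s₁, hx, hτ, hI⟩ := hI
  suffices hrest : Runs (.loop (.lt 9 37) (block [.load 38 0 33, .store 7 36 38,
      .store 8 38 36, .inc 36, .inc 33, .dec 37])) s₁ (σ.1 * (6 + 1) + 1) _ by
    obtain ⟨τ', s₂, hx', hτ', hQ⟩ := hrest
    refine ⟨τ + τ', s₂, ?_, by omega, hQ⟩
    simp only [readTables, block] at hx ⊢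
    cases hx with
    | seq b₁ hx => cases hx with
    | seq b₂ hx => cases hx with
    | seq b₃ hx =>
      simp only [add_assoc]
      exact .seq b₁ (.seq b₂ (.seq b₃ (.seq hx hx')))
  refine (Runs.for_const I σ.1 6 ?_ ?_ hI).mono le_rfl ?_
  · rintro i hi s' ⟨e9, e35, e33, e36, e37, ea, hj⟩
    refine ⟨by simp only [Test.Holds, e9, e37]; omega, .of_wp ?_ (by decide)⟩
    have hv : s'.arr 0 (p + 1 + i) = σ.2 ⟨i, hi⟩ + 1 := by rw [ea]; exact hσ ⟨i, hi⟩
    simp only [block, Program.wp]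
    refine ⟨by simp [e9], by simp [e35], by simp [e33]; omega, by simp [e36], by simp [e37]; omega, by simp [ea],
      fun j hji => ?_⟩
    simp only [Memory.reg_setReg, Memory.arr_setReg, Memory.reg_setArr, Memory.arr_setArr, e33, e36, hv]
    norm_num
    rcases (show (j : ℕ) ≤ i by omega).lt_or_eq with hlt | heq
    -- The new entry of the inverse table overwrites no earlier one, because the values are
    -- distinct.
    · have hne : (σ.2 j : ℕ) ≠ σ.2 ⟨i, hi⟩ := fun h => by
        have := σ.2.injective (Fin.ext h)
        rw [this] at hlt
        exact lt_irrefl _ hlt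
      rw [Function.update_of_ne (by omega), Function.update_of_ne (by omega)]
      exact hj j hlt
    · obtain rfl : j = ⟨i, hi⟩ := Fin.ext heq
      simp
  · rintro s' ⟨e9, e35, e33, e36, e37, ea, hj⟩
    simp [Test.Holds, e9, e37]
  · rintro s' ⟨e9, e35, e33, e36, e37, ea, hj⟩
    exact ⟨e35, e33, fun j => hj j j.2⟩

/-- Writes the pin words of a permutation of length two. -/
def searchTwo : Program :=
  .seq (block [.const 45 0, .const 50 1, .load 51 7 50, .const 50 2, .load 52 7 50,
    .ite (.lt 51 52) (.const 48 1) (.const 48 0), .const 49 1]) (block [emitWords, .const 49 0, emitWords])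

/-- Writes the pin words of the permutation in the tables. -/
def searchPerm : Program :=
  block [.const 50 2, .ite (.eq 35 50) searchTwo (chain (Dir.all.map searchFrom))]

theorem writes_searchPerm : searchPerm.Writes searchRegs [1, 9] := by
  refine ⟨by simp [Program.Writes], ⟨?_, writes_emitWords, by simp [Program.Writes], writes_emitWords⟩,
    writes_chain (by simp) ?_⟩
  · simp [block, Program.Writes]
  · simp only [List.mem_map]
    rintro _ ⟨d, -, rfl⟩
    exact writes_searchFrom d

theorem runs_searchTwo {s : Memory} {f g : ℕ → ℕ} {W : List (List Letter)} (ho : OutWords s W)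
    (h8 : s.reg 8 = 1) (h9 : s.reg 9 = 0) (h7 : s.arr 7 = f) :
    Runs searchTwo s 400 fun s' => OutWords s' (W ++ wordsOf f g 2) := by
  have h₁ : Runs (block [.const 45 0, .const 50 1, .load 51 7 50, .const 50 2, .load 52 7 50,
      .ite (.lt 51 52) (.const 48 1) (.const 48 0), .const 49 1]) s 8 fun s' =>
      s'.reg 45 = 0 ∧ s'.reg 48 = (decide (f 1 < f 2)).toNat ∧ s'.reg 49 = 1 := by
    refine .of_wp ?_ (by decide)
    simp [block, Program.wp, Test.Holds, h7]
    exact ⟨fun h => by simp [h], fun h => by simp [Nat.not_lt.2 h]⟩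
  refine Runs.seq (T₂ := 392) (h₁.frame [45, 48, 49, 50, 51, 52] [] (by simp [block, Program.Writes])) ?_ (by omega)
  rintro s₁ ⟨⟨e45, e48, e49⟩, f₁⟩
  have hst : Stack s₁ [] := ⟨e45, by simp⟩
  refine Runs.seq (T₁ := 171) (T₂ := 221) ((runs_emitWords (inc := decide (f 1 < f 2)) (hz := true)
    (ho.of_frame f₁ (by simp) (by simp)) hst
    ((f₁.1 8 (by simp)).trans h8) ((f₁.1 9 (by simp)).trans h9) e48 e49).frame [1, 7, 32, 50, 51] [1] ?_) ?_ (by omega)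
  · exact ⟨⟨writes_emitAll _, writes_emitAll _⟩, writes_emitAll _, writes_emitAll _⟩
  rintro s₂ ⟨ho₂, f₂⟩
  refine Runs.seq (T₁ := 1) (T₂ := 220) (P := fun s' => s' = s₂.setReg 49 0) (.of_wp rfl le_rfl) ?_ (by omega)
  rintro _ rfl
  have f₃ : Frame [45, 48, 49, 50, 51, 52, 1, 7, 32] [1] s (s₂.setReg 49 0) :=
    ((f₁.mono (by simp) (by simp)).trans (f₂.mono (by simp) (by simp))).trans (frame_setReg (by simp) _ _)
  have f₄ : Frame [49, 50, 51, 1, 7, 32] [1] s₁ (s₂.setReg 49 0) :=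
    (f₂.mono (by simp) (by simp)).trans (frame_setReg (by simp) _ _)
  refine (runs_emitWords (inc := decide (f 1 < f 2)) (hz := false)
    (ho₂.of_frame (frame_setReg (R := [49]) (A := []) (r := 49) (by simp) s₂ 0) (by simp) (by simp))
    (hst.of_frame f₄ (by simp) (by simp)) ((f₃.1 8 (by simp)).trans h8) ((f₃.1 9 (by simp)).trans h9)
    ((f₄.1 48 (by simp)).trans e48) (by simp)).mono (by simp) ?_
  intro s' h
  simpa [wordsOf] using h

theorem runs_searchPerm {s : Memory} {f g : ℕ → ℕ} {n : ℕ} {W : List (List Letter)} (ho : OutWords s W)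
    (h8 : s.reg 8 = 1) (h9 : s.reg 9 = 0) (h35 : s.reg 35 = n) (h7 : s.arr 7 = f) (hg : s.arr 8 = g) :
    Runs searchPerm s (1200 * (n + 1) + 403) fun s' => OutWords s' (W ++ wordsOf f g n) := by
  refine Runs.seq (T₁ := 1) (T₂ := 1200 * (n + 1) + 402) (P := fun s' => s' = s.setReg 50 2) (.of_wp rfl le_rfl) ?_
    (by omega)
  rintro _ rfl
  have hf : Frame [50] [] s (s.setReg 50 2) := frame_setReg (by simp) _ _
  have ho' := ho.of_frame hf (by simp) (by simp)
  refine .ite (T := 1200 * (n + 1) + 401) (fun hc => ?_) (fun hc => ?_) le_rfl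
  · obtain rfl : n = 2 := by simpa [Test.Holds, h35] using hc
    exact (runs_searchTwo ho' (by simp [h8]) (by simp [h9]) h7).mono (by omega) fun _ => id
  · have hn : n ≠ 2 := by simpa [Test.Holds, h35] using hc
    let J : List Dir → Memory → Prop := fun ds s' => Frame searchRegs [1, 9] s s' ∧ ∃ ds', ds' ++ ds = Dir.all ∧
      OutWords s' (W ++ ds'.flatMap fun d => wordsOfRun (start f g n d))
    refine (Runs.chain J (l := Dir.all) (T := 300 * (n + 1)) ?_
      ⟨hf.mono (by simp) (by simp), [], rfl, by simpa using ho'⟩).mono ?_ ?_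
    · rintro d ds s' ⟨f', ds', hds, ho'⟩
      refine ((runs_searchFrom ho' ((f'.1 8 (by simp)).trans h8) ((f'.1 9 (by simp)).trans h9)
        ((f'.1 35 (by simp)).trans h35) ((f'.2 7 (by simp)).trans h7) ((f'.2 8 (by simp)).trans hg) d).frame _ _
        (writes_searchFrom d)).mono le_rfl ?_
      rintro s'' ⟨ho'', f''⟩
      exact ⟨f'.trans f'', ds' ++ [d], by simpa using hds, by simpa using ho''⟩
    · rw [show Dir.all.length = 4 from rfl]; omega
    · rintro s' ⟨-, ds', hds, ho'⟩
      rw [List.append_nil] at hds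
      subst hds
      simpa [wordsOf, hn, Dir.all] using ho'

theorem length_wordCode_wordsOf_le (f g : ℕ → ℕ) (n : ℕ) : (wordCode (wordsOf f g n)).length ≤ 48 * (n + 4) := by
  rw [wordsOf]
  split_ifs
  · rw [wordCode_append, List.length_append, length_wordCode_wordsFrom, length_wordCode_wordsFrom, List.length_nil]
    omega
  · have := length_wordCode_wordsOfRun_le f g n
    have h₁ := this .U
    have h₂ := this .D
    have h₃ := this .L
    have h₄ := this .R
    simp only [List.flatMap_cons, List.flatMap_nil, wordCode_append, List.length_append, List.append_nil]
    omega

/-- Computes the pin words of the input. -/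
def pinWordsProgram : Program :=
  .seq (block [.const 8 1, .const 9 0, .const 1 0, .const 32 0, .const 33 0, .const 34 0])
    (.loop (.lt 34 0) (block [readTables, searchPerm, .inc 34]))

theorem writes_pinWordsProgram :
    pinWordsProgram.Writes (8 :: 9 :: 33 :: 34 :: 35 :: 36 :: 37 :: 38 :: searchRegs) [1, 7, 8, 9] := by
  refine ⟨by simp [block, Program.Writes], writes_readTables.mono (by simp) (by simp),
    writes_searchPerm.mono ?_ (by simp), by simp [block, Program.Writes]⟩
  intro x hx
  simp only [List.mem_cons] at hx ⊢
  tauto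

/-- The input as one sequence. -/
abbrev inputCode (B : List Permutation) : List ℕ := flatCode (B.map Permutation.oneLine)

theorem inputCode_append (B B' : List Permutation) : inputCode (B ++ B') = inputCode B ++ inputCode B' := by
  simp [inputCode, flatCode]

theorem inputCode_cons (σ : Permutation) (B : List Permutation) :
    inputCode (σ :: B) = σ.1 :: σ.oneLine ++ inputCode B := by
  simp [inputCode, flatCode, Permutation.oneLine]

/-- Each permutation costs time linear in its length, and the total length of its pin words is
linear as well, so both bounds add up over the basis. -/
theorem runs_pinWordsProgram {B : List Permutation} (hB : ∀ π ∈ B, IsSimplePerm π ∧ 2 ≤ π.size) :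
    Runs pinWordsProgram (inputMemory B) (1700 * (inputCode B).length + 7) fun s' =>
      ∃ W, OutWords s' W ∧ (∀ w, w ∈ W ↔ ∃ π ∈ B, w ∈ pinWords π) ∧
        (wordCode W).length ≤ 240 * (inputCode B).length := by
  let I : Memory → Prop := fun s' => s'.reg 8 = 1 ∧ s'.reg 9 = 0 ∧ s'.reg 0 = B.length ∧
    s'.arr 0 = (inputMemory B).arr 0 ∧ ∃ B₁ B₂, B₁ ++ B₂ = B ∧ s'.reg 34 = B₁.length ∧
    s'.reg 33 = (inputCode B₁).length ∧ ∃ W, OutWords s' W ∧ (∀ w, w ∈ W ↔ ∃ π ∈ B₁, w ∈ pinWords π) ∧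
      (wordCode W).length ≤ 240 * (inputCode B₁).length
  have hI : Runs (block [.const 8 1, .const 9 0, .const 1 0, .const 32 0, .const 33 0, .const 34 0])
      (inputMemory B) 6 fun s' => I s' ∧ s'.reg 33 = 0 := by
    refine .of_wp ?_ (by decide)
    simp only [block, Program.wp]
    exact ⟨⟨by simp, by simp, by simp [inputMemory], by simp, [], B, rfl, by simp, by simp [flatCode], [],
      ⟨⟨by simp [flatCode], by simp [flatCode]⟩, by simp⟩, by simp, by simp [flatCode]⟩, by simp⟩
  refine Runs.seq (T₂ := 1700 * (inputCode B).length + 1) hI ?_ (by omega)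
  rintro s₁ ⟨hI, h33⟩
  -- A permutation of length `n` occupies `n + 1` cells; `1700` per cell covers `1210 * (n + 1) +
  -- 451` because `n ≥ 2`.
  refine (Runs.loop_potential I (fun s' => 1700 * ((inputCode B).length - s'.reg 33)) ?_ hI).mono
    (by rw [h33]; omega) ?_
  · rintro s ⟨e8, e9, e0, ea, B₁, B₂, hBB, e34, e33, W, ho, hW, hlen⟩ hc
    simp only [Test.Holds, e34, e0, ← hBB, List.length_append] at hc
    obtain ⟨σ, B₂, rfl⟩ := List.exists_cons_of_length_pos (show 0 < B₂.length by omega)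
    obtain ⟨hσ, hσ2⟩ := hB σ (by simp [← hBB])
    have hflat : inputCode B = inputCode B₁ ++ (σ.1 :: σ.oneLine) ++ inputCode B₂ := by
      rw [← hBB, inputCode_append, inputCode_cons]
      simp
    have hget : ∀ i x, (σ.1 :: σ.oneLine)[i]? = some x → s.arr 0 ((inputCode B₁).length + i) = x := by
      intro i x h
      obtain ⟨hi, -⟩ := List.getElem?_eq_some_iff.1 h
      rw [ea]
      show (inputCode B).getD _ 0 = x
      rw [List.getD_eq_getElem?_getD, hflat, List.append_assoc, List.getElem?_append_right (by omega),
        Nat.add_sub_cancel_left, List.getElem?_append_left hi, h]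
      rfl
    have hlσ : σ.oneLine.length = σ.1 := by simp [Permutation.oneLine]
    refine ⟨1210 * (σ.1 + 1) + 450, Runs.seq (T₂ := 1200 * (σ.1 + 1) + 404) ((runs_readTables e9 e33 (hget 0 _ rfl)
      fun i => ?_).frame _ _ writes_readTables) ?_ (by omega)⟩
    · rw [add_assoc]
      refine hget (1 + i) _ ?_
      rw [add_comm 1]
      simp [Permutation.oneLine]
    rintro s' ⟨⟨f35, f33, ht⟩, f⟩
    refine Runs.seq (T₂ := 1) ((runs_searchPerm (ho.of_frame f (by simp) (by simp)) ((f.1 8 (by simp)).trans e8)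
      ((f.1 9 (by simp)).trans e9) f35 rfl rfl).frame _ _ writes_searchPerm) ?_ (by omega)
    rintro s'' ⟨ho'', f''⟩
    have hσlen : (inputCode (B₁ ++ [σ])).length = (inputCode B₁).length + (σ.1 + 1) := by
      rw [inputCode_append, inputCode_cons]
      simp [hlσ, flatCode]
    have hlB : (inputCode B).length = (inputCode B₁).length + (σ.1 + 1) + (inputCode B₂).length := by
      rw [hflat]; simp [hlσ]; omega
    refine .of_wp ?_ le_rfl
    have hf₃ : Frame [34] [] s'' (s''.setReg 34 (s''.reg 34 + 1)) := frame_setReg (by simp) _ _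
    simp only [block, Program.wp]
    refine ⟨⟨?_, ?_, ?_, ?_, B₁ ++ [σ], B₂, by simpa using hBB, ?_, ?_, W ++ wordsOf (s'.arr 7) (s'.arr 8) σ.1,
      ho''.of_frame hf₃ (by simp) (by simp), fun w => ?_, ?_⟩, ?_⟩
    · rw [hf₃.1 8 (by simp), f''.1 8 (by simp), f.1 8 (by simp), e8]
    · rw [hf₃.1 9 (by simp), f''.1 9 (by simp), f.1 9 (by simp), e9]
    · rw [hf₃.1 0 (by simp), f''.1 0 (by simp), f.1 0 (by simp), e0]
    · rw [hf₃.2 0 (by simp), f''.2 0 (by simp), f.2 0 (by simp), ea]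
    · simp [f''.1 34, f.1 34, e34]
    · rw [hf₃.1 33 (by simp), f''.1 33 (by simp), f33, hσlen]; omega
    · rw [List.mem_append, hW, mem_wordsOf hσ hσ2 ht]
      simp only [List.mem_append, List.mem_singleton]
      constructor
      · rintro (⟨π, h₁, h₂⟩ | h)
        exacts [⟨π, Or.inl h₁, h₂⟩, ⟨σ, Or.inr rfl, h⟩]
      · rintro ⟨π, h₁ | rfl, h₂⟩
        exacts [Or.inl ⟨π, h₁, h₂⟩, Or.inr h₂]
    · have := length_wordCode_wordsOf_le (s'.arr 7) (s'.arr 8) σ.1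
      rw [wordCode_append, List.length_append, hσlen]
      omega
    · rw [hf₃.1 33 (by simp), f''.1 33 (by simp), f33, e33, hlB]
      have : 2 ≤ σ.1 := hσ2
      omega
  · rintro s ⟨⟨e8, e9, e0, ea, B₁, B₂, hBB, e34, e33, W, ho, hW, hlen⟩, hc⟩
    simp only [Test.Holds, e34, e0, ← hBB, List.length_append] at hc
    obtain rfl := List.eq_nil_of_length_eq_zero (show B₂.length = 0 by omega)
    rw [List.append_nil] at hBB
    subst hBB
    exact ⟨W, ho, hW, hlen⟩

theorem length_inputCode_le {B : List Permutation} (hB : ∀ π ∈ B, 2 ≤ π.size) :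
    (inputCode B).length ≤ 2 * (B.map Permutation.size).sum := by
  induction B with
  | nil => simp [inputCode, flatCode]
  | cons σ B ih =>
    have h₁ := ih fun π hπ => hB π (by simp [hπ])
    have h₂ : 2 ≤ σ.1 := hB σ (by simp)
    rw [inputCode_cons]
    simp only [List.cons_append, List.length_cons, List.length_append, List.map_cons, List.sum_cons,
      Permutation.oneLine, List.length_ofFn, Permutation.size] at h₁ ⊢
    omega

end PinPerm
namespace PinPerm

/-! ### All stages -/

theorem nil_not_mem_prefixes {l₁ l₂ l : Option Letter} : [] ∉ prefixes l₁ l₂ l := by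
  intro h
  rcases l₁ with _ | _ | _ <;> rcases l₂ with _ | q | d <;> try exact absurd h List.not_mem_nil
  · obtain ⟨x, o, hx, -, -, h⟩ := mem_prefixes_num.1 h
    rw [(List.append_eq_nil_iff.1 h.symm).1] at hx
    cases hx
  · obtain ⟨o, -, h⟩ := List.mem_map.1 h
    simp at h

/-- The four programs run one after the other in linear time, with the specified results. -/
theorem runs_stages {B : List Permutation} (hB : ∀ π ∈ B, IsSimplePerm π ∧ 2 ≤ π.size) :
    ∃ (s₁ s₂ s₃ s₄ : Memory) (t₁ t₂ t₃ t₄ : ℕ) (W : List (List Letter)) (N : ℕ)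
      (e : ACState (forbidden {π | π ∈ B}) ≃ Fin N),
      Exec pinWordsProgram (inputMemory B) t₁ s₁ ∧ Exec automatonProgram s₁ t₂ s₂ ∧
      Exec complementProgram s₂ t₃ s₃ ∧ Exec cycleProgram s₃ t₄ s₄ ∧
      t₁ + t₂ + t₃ + t₄ ≤ 10000000 * ((B.map Permutation.size).sum + 1) ∧
      HoldsWords s₁ 1 (W.map fun w => w.map Letter.code) ∧ (∀ w, w ∈ W ↔ ∃ π ∈ B, w ∈ pinWords π) ∧
      HoldsAutomaton s₂ (DFA.reindex e (ahoCorasick (forbidden {π | π ∈ B}))) ∧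
      HoldsAutomaton s₃ (DFA.reindex e (ahoCorasick (forbidden {π | π ∈ B})))ᶜ ∧
      (s₄.reg 4 = 0 ∨ s₄.reg 4 = 1) ∧
      (s₄.reg 4 = 1 ↔ ¬ HasCycleOutside (DFA.reindex e (ahoCorasick (forbidden {π | π ∈ B})))) := by
  classical
  obtain ⟨t₁, s₁, hx₁, ht₁, ⟨W, ho, hW, hlen⟩, hf⟩ := (runs_pinWordsProgram hB).frame _ _ writes_pinWordsProgram
  have hlen' := length_inputCode_le fun π hπ => (hB π hπ).2
  have hs : HoldsWords s₁ 1 (W.map fun w => w.map Letter.code) :=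
    ⟨by rw [ho.reg1, List.length_map], ho.out.arr⟩
  have hform : ∀ w ∈ W, ∃ l₁ l₂, ∃ ds : List Dir, w = l₁ :: l₂ :: ds.map .dir := by
    intro w hw
    obtain ⟨π, hπ, hw⟩ := (hW w).1 hw
    obtain ⟨q, l, ds, rfl, -⟩ := exists_of_mem_pinWords (hB π hπ).1 (hB π hπ).2 hw
    exact ⟨_, _, _, rfl⟩
  have hF : forbidden {π | π ∈ B} = {v | ∃ a b : Dir, a.isHoriz = b.isHoriz ∧ v = [a, b]} ∪ factorSet W := by
    ext v
    rw [mem_forbidden_iff (B := {π | π ∈ B}) hB, Set.mem_union, or_comm]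
    refine or_congr Iff.rfl ?_
    simp only [factorSet, Set.mem_ofPred_eq, hW]
    constructor
    · rintro ⟨π, hπ, l₁, l₂, ds, hw, hu⟩; exact ⟨l₁, l₂, ds, ⟨π, hπ, hw⟩, hu⟩
    · rintro ⟨l₁, l₂, ds, ⟨π, hπ, hw⟩, hu⟩; exact ⟨π, hπ, l₁, l₂, ds, hw, hu⟩
  have hF0 : [] ∉ forbidden {π | π ∈ B} := by
    rw [mem_forbidden_iff (B := {π | π ∈ B}) hB]
    rintro (⟨π, -, l₁, l₂, ds, -, u, hu, h⟩ | ⟨a, b, -, h⟩)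
    · rw [(List.append_eq_nil_iff.1 h.symm).1] at hu
      exact nil_not_mem_prefixes hu
    · cases h
  -- The trie needs zeros in the arrays `2` to `6`; the first program writes only the arrays `1`,
  -- `7`, `8` and `9`.
  obtain ⟨t₂, s₂, hx₂, ht₂, N, e, hA, hN⟩ := runs_automatonProgram hs (fun k h₁ h₂ i => by
    rw [hf.2 k (by simp; omega)]; simp [inputMemory]; omega) hform hF hF0
  obtain ⟨t₃, s₃, hx₃, ht₃, hAc⟩ := runs_complement hA
  have habs : IsAbsorbing (DFA.reindex e (ahoCorasick (forbidden {π | π ∈ B}))) := fun q hq a => by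
    show e ((ahoCorasick _).step (e.symm q) a) = q
    rw [ahoCorasick_step_of_mem hq, Equiv.apply_symm_apply]
  obtain ⟨t₄, s₄, hx₄, ht₄, h4⟩ := runs_cycleSearch hAc habs
  -- With `n` the total length of the basis, the pin words take at most `480 n` cells. So the
  -- automaton costs about `2.9` million steps per unit of `n` and has about `31000 n` states, at
  -- `110` steps each for the last two programs; ten million is a generous bound.
  refine ⟨s₁, s₂, s₃, s₄, t₁, t₂, t₃, t₄, W, N, e, hx₁, hx₂, hx₃, hx₄, by omega, hs, hW, hA, hAc, ?_, ?_⟩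
  · rw [h4]; split_ifs <;> simp
  · rw [h4]; split_ifs with h <;> simp [h]

end PinPerm

theorem mainTheorem4 :
    ∃ (pinWordsStage automatonStage complementStage cycleStage : Program) (C : ℕ),
      ∀ B : List Permutation, (∀ π ∈ B, IsSimplePerm π ∧ 2 ≤ π.size) →
      ∃ (s₁ s₂ s₃ s₄ : Memory) (t₁ t₂ t₃ t₄ : ℕ)
        (W : List (List Letter)) (N : ℕ) (A : DFA Dir (Fin N))
        (e : ACState (forbidden {π | π ∈ B}) ≃ Fin N),
        -- the four stages run one after the other, in linear total time
        Exec pinWordsStage (inputMemory B) t₁ s₁ ∧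
        Exec automatonStage s₁ t₂ s₂ ∧
        Exec complementStage s₂ t₃ s₃ ∧
        Exec cycleStage s₃ t₄ s₄ ∧
        t₁ + t₂ + t₃ + t₄ ≤ C * ((B.map Permutation.size).sum + 1) ∧
        -- the first stage computes the pin words of the basis
        HoldsWords s₁ 1 (W.map fun w => w.map Letter.code) ∧
        (∀ w, w ∈ W ↔ ∃ π ∈ B, w ∈ pinWords π) ∧
        -- the second stage builds the Aho–Corasick automaton of the forbidden factors
        A = DFA.reindex e (ahoCorasick (forbidden {π | π ∈ B})) ∧
        A.accepts = factorLanguage (forbidden {π | π ∈ B}) ∧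
        HoldsAutomaton s₂ A ∧
        -- the third stage complements it
        HoldsAutomaton s₃ Aᶜ ∧
        -- the fourth stage tests for an accessible and co-accessible cycle in the complement
        (s₄.reg 4 = 1 ↔ ¬ HasUsefulCycle Aᶜ) ∧
        -- the output is correct
        (s₄.reg 4 = 1 ↔ {σ | IsProperPinPerm σ ∧ σ ∈ Av {π | π ∈ B}}.Finite) ∧
        (s₄.reg 4 = 0 ↔ ¬ {σ | IsProperPinPerm σ ∧ σ ∈ Av {π | π ∈ B}}.Finite) := by
  refine ⟨pinWordsProgram, automatonProgram, complementProgram, cycleProgram, 10000000, fun B hB => ?_⟩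
  obtain ⟨s₁, s₂, s₃, s₄, t₁, t₂, t₃, t₄, W, N, e, h₁, h₂, h₃, h₄, ht, hs, hW, hA, hAc, h01, h4⟩ :=
    runs_stages hB
  -- Pumping needs finitely many states; the numbering provides this.
  have : Finite (ACState (forbidden {π | π ∈ B})) := .of_equiv _ e.symm
  -- The program has tested for cycles outside the final states, which is equivalent to the absence
  -- or presence of useful cycles by `hasUsefulCycle_compl_iff`.
  have hcycle : s₄.reg 4 = 1 ↔
      ¬ HasUsefulCycle (DFA.reindex e (ahoCorasick (forbidden {π | π ∈ B})))ᶜ := by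
    rw [h4, hasUsefulCycle_reindex, hasUsefulCycle_compl_iff, hasCycleOutside_reindex]
  have hfin : s₄.reg 4 = 1 ↔ {σ | IsProperPinPerm σ ∧ σ ∈ Av {π | π ∈ B}}.Finite := by
    rw [hcycle, hasUsefulCycle_reindex, hasUsefulCycle_compl_iff_unbounded, not_not,
      finite_properPin_iff (B := {π | π ∈ B}) hB]
  refine ⟨s₁, s₂, s₃, s₄, t₁, t₂, t₃, t₄, W, N, _, e, h₁, h₂, h₃, h₄, ht, hs, hW, rfl, ?_, hA, hAc, hcycle, hfin, ?_⟩
  · rw [DFA.accepts_reindex, ahoCorasick_accepts]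
  · rw [← hfin]; omega
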